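/- Let $\beta\in\{1,2,4\}$. A $\beta$-sine process is a simple point process on $\mathbb{R}$ (a random locally finite set of distinct points $\{a_i\}$) whose $k$-point correlation functions $\rho_k$, i.e. the functions with $$\mathbb{E}\sum_{i_1,\dots,i_k\ \text{pairwise distinct}}F(a_{i_1},\dots,a_{i_k})=\int_{\mathbb{R}^k}F\,\rho_k\,dx_1\cdots dx_k\qquad(F\ge 0\text{ Borel}),$$ are, for all $k$, $$\rho_k(x_1,\dots,x_k)=\det\bigl(K^{(2)}(x_i,x_j)\bigr)_{i,j\le k}\ \ (\beta=2),\qquad \rho_k(x_1,\dots,x_k)=\mathrm{qdet}\bigl(K^{(\beta)}(x_i,x_j)\bigr)_{i,j\le k}\ \ (\beta=1,4),$$ where $$K^{(2)}(x,y)=\frac{\sin\pi(x-y)}{\pi(x-y)},$$ $$K^{(1)}(x,y)=\begin{pmatrix}\frac{\sin\pi(x-y)}{\pi(x-y)}&\frac{\partial}{\partial x}\frac{\sin\pi(x-y)}{\pi(x-y)}\\ \frac1\pi\int_0^{\pi(x-y)}\frac{\sin t}{t}\,dt-\frac12\,\mathrm{sgn}(x-y)&\frac{\sin\pi(x-y)}{\pi(x-y)}\end{pmatrix},$$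 $$K^{(4)}(x,y)=\begin{pmatrix}\frac{\sin2\pi(x-y)}{2\pi(x-y)}&\frac{\partial}{\partial x}\frac{\sin2\pi(x-y)}{2\pi(x-y)}\\ \frac1{2\pi}\int_0^{2\pi(x-y)}\frac{\sin t}{t}\,dt&\frac{\sin2\pi(x-y)}{2\pi(x-y)}\end{pmatrix}$$ (values at $x=y$ by continuity, $\mathrm{sgn}(0)=0$), and the quaternion determinant of a $k\times k$ array $(q_{ij})$ of $2\times2$ matrices is $$\mathrm{qdet}(q_{ij})=\sum_{\sigma\in \mathbf{S}_k}\mathrm{sgn}(\sigma)\prod_{\text{cycles }(i_1\to i_2\to\cdots\to i_\ell\to i_1)\text{ of }\sigma}\tfrac12\,\mathrm{Tr}\bigl(q_{i_1i_2}q_{i_2i_3}\cdots q_{i_\ell i_1}\bigr),$$ fixed points counting as cycles. For real $N>0$ put $$\mathcal{W}_N=-\frac1N\sum_{i\ne j,\ a_i,a_j\in[0,N]}\log\left|2\sin\frac{\pi(a_i-a_j)}{N}\right|+\log N .$$ **Theorem.** For every $\beta$-sine process with $\beta\in\{1,2,4\}$, the random variable $\mathcal{W}_N$ is square integrable for every $N>0$,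 and $$\lim_{N\to\infty}\mathrm{Var}(\mathcal{W}_N)=0 .$$ -/

import Mathlib

open MeasureTheory ProbabilityTheory Filter Topology Set

noncomputable section

namespace SineBeta

/-! ### Simple point processes and their correlation functions -/

/-- A simple point process on the real line: a random locally finite set of (distinct) points,
measurable in the sense that the number of points in every Borel set is a random variable. -/
structure IsSimplePointProcess {Ω : Type*} [MeasurableSpace Ω] (X : Ω → Set ℝ) : Prop where
  locallyFinite : ∀ (ω : Ω) (a b : ℝ), (X ω ∩ Icc a b).Finite
  measurable_count : ∀ B : Set ℝ, MeasurableSet B →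
    Measurable fun ω => (X ω ∩ B).encard

/-- The sum of `F` over all `k`-tuples of pairwise distinct points of `A`. -/
def distinctSum (A : Set ℝ) (k : ℕ) (F : (Fin k → ℝ) → ENNReal) : ENNReal :=
  ∑' x : {x : Fin k → ℝ // Function.Injective x ∧ ∀ i, x i ∈ A}, F x.1

/-- `ρ k` is the `k`-point correlation function of the point process `X`, for every `k`:
the expected sum of a test function over the `k`-tuples of pairwise distinct points is the
integral of the test function against `ρ k`. -/
def HasCorrelationFunctions {Ω : Type*} [MeasurableSpace Ω] (P : Measure Ω) (X : Ω → Set ℝ)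
    (ρ : (k : ℕ) → (Fin k → ℝ) → ℝ) : Prop :=
  ∀ (k : ℕ) (F : (Fin k → ℝ) → ENNReal), Measurable F →
    ∫⁻ ω, distinctSum (X ω) k F ∂P = ∫⁻ x, F x * ENNReal.ofReal (ρ k x)

/-! ### Quaternion determinants

Quaternions are represented by `2 × 2` matrices; the scalar part of `q` is `Tr q / 2`. -/

/-- The scalar part of the product `q_{i, σ i} q_{σ i, σ² i} ⋯ q_{σ⁻¹ i, i}` along the cycle of
`σ` through `i`. -/
def cycleScalar {n : ℕ} (Q : Fin n → Fin n → Matrix (Fin 2) (Fin 2) ℝ)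
    (σ : Equiv.Perm (Fin n)) (i : Fin n) : ℝ :=
  (1 / 2) * Matrix.trace (((List.range (Function.minimalPeriod σ i)).map
    fun j => Q ((σ ^ j) i) ((σ ^ (j + 1)) i)).prod)

open Classical in
/-- The quaternion determinant of a self-dual matrix of quaternions: the sum over permutations
of the sign times the product, over all the cycles (fixed points included), of the scalar parts of
the products along the cycles. Each cycle is represented by its smallest element. -/
def qdet {n : ℕ} (Q : Fin n → Fin n → Matrix (Fin 2) (Fin 2) ℝ) : ℝ :=
  ∑ σ : Equiv.Perm (Fin n), ((Equiv.Perm.sign σ : ℤ) : ℝ) *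
    ∏ i ∈ Finset.univ.filter (fun i : Fin n => ∀ j : ℕ, i ≤ (σ ^ j) i), cycleScalar Q σ i

/-! ### The sine kernels (`Real.sinc u = sin u / u`, with `Real.sinc 0 = 1`) -/

/-- The sine kernel for `β = 2`. -/
def kernelTwo (x y : ℝ) : ℝ := Real.sinc (Real.pi * (x - y))

/-- The matrix sine kernel for `β = 1`. -/
def kernelOne (x y : ℝ) : Matrix (Fin 2) (Fin 2) ℝ :=
  !![Real.sinc (Real.pi * (x - y)), deriv (fun u => Real.sinc (Real.pi * (u - y))) x;
    (1 / Real.pi) * (∫ t in (0 : ℝ)..(Real.pi * (x - y)), Real.sinc t)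
      - (1 / 2) * Real.sign (x - y),
    Real.sinc (Real.pi * (x - y))]

/-- The matrix sine kernel for `β = 4`. -/
def kernelFour (x y : ℝ) : Matrix (Fin 2) (Fin 2) ℝ :=
  !![Real.sinc (2 * Real.pi * (x - y)), deriv (fun u => Real.sinc (2 * Real.pi * (u - y))) x;
    (1 / (2 * Real.pi)) * (∫ t in (0 : ℝ)..(2 * Real.pi * (x - y)), Real.sinc t),
    Real.sinc (2 * Real.pi * (x - y))]

/-- The `k`-point correlation function of the `β`-sine process, for `β = 1, 2, 4`
(the value for any other `β` is irrelevant). -/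
def sineCorrelation (β k : ℕ) (x : Fin k → ℝ) : ℝ :=
  if β = 1 then qdet fun i j => kernelOne (x i) (x j)
  else if β = 2 then Matrix.det (Matrix.of fun i j => kernelTwo (x i) (x j))
  else if β = 4 then qdet fun i j => kernelFour (x i) (x j)
  else 0

/-- `X`, a random set of points defined on the probability space `(Ω, P)`, is a `β`-sine process
(`β = 1, 2, 4`). -/
structure IsSineProcess {Ω : Type*} [MeasurableSpace Ω] (P : Measure Ω) (β : ℕ)
    (X : Ω → Set ℝ) : Prop where
  simple : IsSimplePointProcess X
  correlation : HasCorrelationFunctions P X (sineCorrelation β)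

/-! ### The renormalized energy -/

/-- The renormalized energy in the window `[0, N]` of a locally finite set `A` of points:
`-(1/N) ∑_{a ≠ b} log |2 sin (π (a - b) / N)| + log N`, the sum running over the ordered pairs of
distinct points of `A` in `[0, N]`. -/
def renormalizedEnergy (N : ℝ) (A : Set ℝ) : ℝ :=
  -(1 / N) * (∑ᶠ p ∈ (A ∩ Icc 0 N).offDiag,
    Real.log |2 * Real.sin (Real.pi * (p.1 - p.2) / N)|) + Real.log N

end SineBeta

end

namespace SineBeta

/-- The scalar part of a quaternion represented by a `2 × 2` matrix. -/
noncomputable def scal (q : Matrix (Fin 2) (Fin 2) ℝ) : ℝ := (1 / 2) * Matrix.trace q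

section qdet

variable {n : ℕ} (Q : Fin n → Fin n → Matrix (Fin 2) (Fin 2) ℝ) (σ : Equiv.Perm (Fin n)) (i : Fin n)

/-- The scalar part along a cycle of length at most four. -/
noncomputable def shortCycleScalar : ℝ :=
  if σ i = i then scal (Q i i)
  else if σ (σ i) = i then scal (Q i (σ i) * Q (σ i) i)
  else if σ (σ (σ i)) = i then scal (Q i (σ i) * Q (σ i) (σ (σ i)) * Q (σ (σ i)) i)
  else scal (Q i (σ i) * Q (σ i) (σ (σ i)) * Q (σ (σ i)) (σ (σ (σ i))) * Q (σ (σ (σ i))) i)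

lemma cycleScalar_eq_shortCycleScalar (h4 : σ (σ (σ (σ i))) = i ∨ σ (σ (σ i)) = i) :
    cycleScalar Q σ i = shortCycleScalar Q σ i := by
  unfold cycleScalar shortCycleScalar scal
  split_ifs with h1 h2 h3
  · have : Function.minimalPeriod σ i = 1 :=
      Function.minimalPeriod_eq_one_iff_isFixedPt.2 h1
    simp [this, h1]
  · have : Function.minimalPeriod σ i = 2 :=
      Function.minimalPeriod_eq_prime (hp := ⟨Nat.prime_two⟩) h2 h1
    simp [this, h2, List.range_succ, pow_succ]
  · have : Function.minimalPeriod σ i = 3 :=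
      Function.minimalPeriod_eq_prime (hp := ⟨Nat.prime_three⟩) h3 h1
    simp [this, h3, List.range_succ, pow_succ, mul_assoc]
  · have : Function.minimalPeriod σ i = 2 ^ (1 + 1) :=
      Function.minimalPeriod_eq_prime_pow (hp := ⟨Nat.prime_two⟩) (k := 1) h2
        (h4.resolve_right h3)
    simp [this, List.range_succ, pow_succ, mul_assoc, h4.resolve_right h3]

lemma forall_pow_iff (h : σ (σ (σ (σ i))) = i ∨ σ (σ (σ i)) = i) :
    (∀ j : ℕ, i ≤ (σ ^ j) i) ↔ i ≤ σ i ∧ i ≤ σ (σ i) ∧ i ≤ σ (σ (σ i)) := by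
  constructor
  · intro H
    exact ⟨by simpa using H 1, by simpa [pow_succ] using H 2, by simpa [pow_succ] using H 3⟩
  · rintro ⟨h1, h2, h3⟩ j
    have key : ∀ j : ℕ, (σ ^ j) i = i ∨ (σ ^ j) i = σ i ∨ (σ ^ j) i = σ (σ i) ∨
        (σ ^ j) i = σ (σ (σ i)) := by
      intro j
      induction j with
      | zero => simp
      | succ j ih =>
        rw [pow_succ', Equiv.Perm.mul_apply]
        rcases ih with h' | h' | h' | h' <;> rw [h']
        · simp
        · simp
        · simp
        · rcases h with h | h <;> simp [h]
    rcases key j with h | h | h | h <;> rw [h] <;> first | exact le_rfl | assumption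

lemma qdet_eq (h : ∀ (σ : Equiv.Perm (Fin n)) i, σ (σ (σ (σ i))) = i ∨ σ (σ (σ i)) = i) :
    qdet Q = ∑ σ : Equiv.Perm (Fin n), ((Equiv.Perm.sign σ : ℤ) : ℝ) *
      ∏ i, if i ≤ σ i ∧ i ≤ σ (σ i) ∧ i ≤ σ (σ (σ i)) then shortCycleScalar Q σ i else 1 := by
  classical
  unfold qdet
  refine Finset.sum_congr rfl fun σ _ => ?_
  rw [Finset.prod_filter]
  congr 1
  refine Finset.prod_congr rfl fun i _ => ?_
  rw [cycleScalar_eq_shortCycleScalar Q σ i (h σ i)]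
  exact if_congr (forall_pow_iff σ i (h σ i)) rfl rfl

end qdet

open Equiv in
lemma univ_perm_two : (Finset.univ : Finset (Perm (Fin 2))) =
    {1, swap 0 1} := by
  decide

open Equiv in
lemma univ_perm_three : (Finset.univ : Finset (Perm (Fin 3))) =
    {1, swap 0 1, swap 0 2, swap 1 2, swap 0 1 * swap 1 2, swap 0 2 * swap 2 1} := by
  decide

open Equiv in
set_option maxRecDepth 100000 in
lemma univ_perm_four : (Finset.univ : Finset (Perm (Fin 4))) =
    {1, swap 0 1, swap 0 2, swap 0 3, swap 1 2, swap 1 3, swap 2 3, swap 0 1 * swap 2 3, swap 0 2 * swap 1 3, swap 0 3 * swap 1 2, swap 0 1 * swap 1 2, swap 0 2 * swap 2 1, swap 0 1 * swap 1 3, swap 0 3 * swap 3 1, swap 0 2 * swap 2 3, swap 0 3 * swap 3 2, swap 1 2 * swap 2 3, swap 1 3 * swap 3 2, swap 0 1 * swap 1 2 * swap 2 3, swap 0 1 * swap 1 3 * swap 3 2, swap 0 2 * swap 2 1 * swap 1 3, swap 0 2 * swap 2 3 * swap 3 1, swap 0 3 * swap 3 1 * swap 1 2, swap 0 3 * swap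 3 2 * swap 2 1} := by
  decide +kernel

lemma qdet_two (Q : Fin 2 → Fin 2 → Matrix (Fin 2) (Fin 2) ℝ) :
    qdet Q = scal (Q 0 0) * scal (Q 1 1) - scal (Q 0 1 * Q 1 0) := by
  rw [qdet_eq Q (by decide), univ_perm_two]
  repeat rw [Finset.sum_insert (by decide)]
  rw [Finset.sum_singleton]
  simp +decide [Fin.prod_univ_succ, shortCycleScalar, Equiv.swap_apply_def, Equiv.Perm.sign_swap']
  ring

lemma qdet_three (Q : Fin 3 → Fin 3 → Matrix (Fin 2) (Fin 2) ℝ) :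
    qdet Q = scal (Q 0 0) * scal (Q 1 1) * scal (Q 2 2) - scal (Q 0 1 * Q 1 0) * scal (Q 2 2)
      - scal (Q 0 2 * Q 2 0) * scal (Q 1 1) - scal (Q 1 2 * Q 2 1) * scal (Q 0 0)
      + scal (Q 0 1 * Q 1 2 * Q 2 0) + scal (Q 0 2 * Q 2 1 * Q 1 0) := by
  rw [qdet_eq Q (by decide), univ_perm_three]
  repeat rw [Finset.sum_insert (by decide)]
  rw [Finset.sum_singleton]
  simp +decide [Fin.prod_univ_succ, shortCycleScalar, Equiv.swap_apply_def, Equiv.Perm.sign_swap']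
  ring

set_option maxRecDepth 100000 in
lemma qdet_four (Q : Fin 4 → Fin 4 → Matrix (Fin 2) (Fin 2) ℝ) :
    qdet Q = scal (Q 0 0) * scal (Q 1 1) * scal (Q 2 2) * scal (Q 3 3)
      - scal (Q 0 1 * Q 1 0) * scal (Q 2 2) * scal (Q 3 3)
      - scal (Q 0 2 * Q 2 0) * scal (Q 1 1) * scal (Q 3 3)
      - scal (Q 0 3 * Q 3 0) * scal (Q 1 1) * scal (Q 2 2)
      - scal (Q 1 2 * Q 2 1) * scal (Q 0 0) * scal (Q 3 3)
      - scal (Q 1 3 * Q 3 1) * scal (Q 0 0) * scal (Q 2 2)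
      - scal (Q 2 3 * Q 3 2) * scal (Q 0 0) * scal (Q 1 1)
      + scal (Q 0 1 * Q 1 0) * scal (Q 2 3 * Q 3 2)
      + scal (Q 0 2 * Q 2 0) * scal (Q 1 3 * Q 3 1)
      + scal (Q 0 3 * Q 3 0) * scal (Q 1 2 * Q 2 1)
      + scal (Q 0 1 * Q 1 2 * Q 2 0) * scal (Q 3 3)
      + scal (Q 0 2 * Q 2 1 * Q 1 0) * scal (Q 3 3)
      + scal (Q 0 1 * Q 1 3 * Q 3 0) * scal (Q 2 2)
      + scal (Q 0 3 * Q 3 1 * Q 1 0) * scal (Q 2 2)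
      + scal (Q 0 2 * Q 2 3 * Q 3 0) * scal (Q 1 1)
      + scal (Q 0 3 * Q 3 2 * Q 2 0) * scal (Q 1 1)
      + scal (Q 1 2 * Q 2 3 * Q 3 1) * scal (Q 0 0)
      + scal (Q 1 3 * Q 3 2 * Q 2 1) * scal (Q 0 0) - scal (Q 0 1 * Q 1 2 * Q 2 3 * Q 3 0)
      - scal (Q 0 1 * Q 1 3 * Q 3 2 * Q 2 0) - scal (Q 0 2 * Q 2 1 * Q 1 3 * Q 3 0)
      - scal (Q 0 2 * Q 2 3 * Q 3 1 * Q 1 0) - scal (Q 0 3 * Q 3 1 * Q 1 2 * Q 2 0)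
      - scal (Q 0 3 * Q 3 2 * Q 2 1 * Q 1 0) := by
  rw [qdet_eq Q (by decide), univ_perm_four]
  repeat rw [Finset.sum_insert (by decide)]
  rw [Finset.sum_singleton]
  simp +decide [Fin.prod_univ_succ, shortCycleScalar, Equiv.swap_apply_def, Equiv.Perm.sign_swap']
  ring

/-- A translation invariant self-dual quaternion kernel `[[s, d], [e, s]]` of unit density. -/
structure PairKernel where
  /-- The diagonal entry. -/
  s : ℝ → ℝ
  /-- The upper right entry. -/
  d : ℝ → ℝ
  /-- The lower left entry. -/
  e : ℝ → ℝ
  s_neg : ∀ u, s (-u) = s u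
  d_neg : ∀ u, d (-u) = -d u
  e_neg : ∀ u, e (-u) = -e u
  s_zero : s 0 = 1

namespace PairKernel

variable (K : PairKernel)

/-- The matrix of the kernel at the difference `u`. -/
def mat (u : ℝ) : Matrix (Fin 2) (Fin 2) ℝ := !![K.s u, K.d u; K.e u, K.s u]

/-- The truncated two-point function. -/
def T (u : ℝ) : ℝ := K.s u ^ 2 - K.d u * K.e u

/-- The scalar part along a cycle of length three. -/
noncomputable def R3 (x y z : ℝ) : ℝ := scal (K.mat (x - y) * K.mat (y - z) * K.mat (z - x))

/-- The scalar part along a cycle of length four. -/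
noncomputable def R4 (x y z w : ℝ) : ℝ :=
  scal (K.mat (x - y) * K.mat (y - z) * K.mat (z - w) * K.mat (w - x))

/-- The two-point correlation function. -/
def r2 (x y : ℝ) : ℝ := 1 - K.T (x - y)

/-- The three-point correlation function. -/
noncomputable def r3 (x y z : ℝ) : ℝ :=
  1 - K.T (x - y) - K.T (x - z) - K.T (y - z) + 2 * K.R3 x y z

/-- The four-point correlation function. -/
noncomputable def r4 (x y z w : ℝ) : ℝ :=
  1 - K.T (x - y) - K.T (x - z) - K.T (x - w) - K.T (y - z) - K.T (y - w) - K.T (z - w)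
    + K.T (x - y) * K.T (z - w) + K.T (x - z) * K.T (y - w) + K.T (x - w) * K.T (y - z)
    + 2 * (K.R3 x y z + K.R3 x y w + K.R3 x z w + K.R3 y z w)
    - 2 * (K.R4 x y z w + K.R4 x y w z + K.R4 x z y w)

lemma s_sub_comm (x y : ℝ) : K.s (x - y) = K.s (y - x) := by rw [← K.s_neg, neg_sub]
lemma d_sub_comm (x y : ℝ) : K.d (x - y) = -K.d (y - x) := by rw [← K.d_neg, neg_sub]
lemma e_sub_comm (x y : ℝ) : K.e (x - y) = -K.e (y - x) := by rw [← K.e_neg, neg_sub]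

lemma T_neg (u : ℝ) : K.T (-u) = K.T u := by
  simp [T, K.s_neg, K.d_neg, K.e_neg]

lemma T_sub_comm (x y : ℝ) : K.T (x - y) = K.T (y - x) := by rw [← K.T_neg, neg_sub]

lemma d_zero : K.d 0 = 0 := by have := K.d_neg 0; simp at this; linarith
lemma e_zero : K.e 0 = 0 := by have := K.e_neg 0; simp at this; linarith

lemma scal_mat_zero (x : ℝ) : scal (K.mat (x - x)) = 1 := by
  simp [scal, mat, Matrix.trace_fin_two, K.s_zero]; norm_num

lemma scal_mat_mul (x y : ℝ) : scal (K.mat (x - y) * K.mat (y - x)) = K.T (x - y) := by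
  simp [scal, mat, T, Matrix.trace_fin_two, K.s_sub_comm y x, K.d_sub_comm y x, K.e_sub_comm y x]
  ring

lemma R3_eq (x y z : ℝ) : K.R3 x y z = K.s (x - y) * K.s (y - z) * K.s (z - x)
    + (1 / 2) * (K.s (x - y) * (K.d (y - z) * K.e (z - x) + K.e (y - z) * K.d (z - x))
      + K.s (y - z) * (K.d (x - y) * K.e (z - x) + K.e (x - y) * K.d (z - x))
      + K.s (z - x) * (K.d (x - y) * K.e (y - z) + K.e (x - y) * K.d (y - z))) := by
  simp [R3, scal, mat, Matrix.trace_fin_two]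
  ring

lemma R4_eq (x y z w : ℝ) : K.R4 x y z w =
    K.s (x - y) * K.s (y - z) * K.s (z - w) * K.s (w - x)
    + (1 / 2) * (K.s (x - y) * K.s (y - z) * (K.d (z - w) * K.e (w - x) + K.e (z - w) * K.d (w - x))
      + K.s (x - y) * K.s (z - w) * (K.d (y - z) * K.e (w - x) + K.e (y - z) * K.d (w - x))
      + K.s (x - y) * K.s (w - x) * (K.d (y - z) * K.e (z - w) + K.e (y - z) * K.d (z - w))
      + K.s (y - z) * K.s (z - w) * (K.d (x - y) * K.e (w - x) + K.e (x - y) * K.d (w - x))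
      + K.s (y - z) * K.s (w - x) * (K.d (x - y) * K.e (z - w) + K.e (x - y) * K.d (z - w))
      + K.s (z - w) * K.s (w - x) * (K.d (x - y) * K.e (y - z) + K.e (x - y) * K.d (y - z))
      + K.d (x - y) * K.e (y - z) * K.d (z - w) * K.e (w - x)
      + K.e (x - y) * K.d (y - z) * K.e (z - w) * K.d (w - x)) := by
  simp [R4, scal, mat, Matrix.trace_fin_two]
  ring

lemma R3_reverse (x y z : ℝ) : K.R3 x z y = K.R3 x y z := by
  rw [R3_eq, R3_eq, K.s_sub_comm x z, K.s_sub_comm z y, K.s_sub_comm y x, K.d_sub_comm x z,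
    K.d_sub_comm z y, K.d_sub_comm y x, K.e_sub_comm x z, K.e_sub_comm z y, K.e_sub_comm y x]
  ring

lemma R4_reverse (x y z w : ℝ) : K.R4 x w z y = K.R4 x y z w := by
  rw [R4_eq, R4_eq, K.s_sub_comm x w, K.s_sub_comm w z, K.s_sub_comm z y, K.s_sub_comm y x,
    K.d_sub_comm x w, K.d_sub_comm w z, K.d_sub_comm z y, K.d_sub_comm y x,
    K.e_sub_comm x w, K.e_sub_comm w z, K.e_sub_comm z y, K.e_sub_comm y x]
  ring

lemma qdet_mat_two (x : Fin 2 → ℝ) :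
    qdet (fun i j => K.mat (x i - x j)) = K.r2 (x 0) (x 1) := by
  rw [qdet_two]
  simp only [scal_mat_zero, scal_mat_mul, r2]
  ring

lemma qdet_mat_three (x : Fin 3 → ℝ) :
    qdet (fun i j => K.mat (x i - x j)) = K.r3 (x 0) (x 1) (x 2) := by
  rw [qdet_three]
  simp only [scal_mat_zero, scal_mat_mul, r3]
  have h := K.R3_reverse (x 0) (x 1) (x 2)
  unfold R3 at h ⊢
  rw [h]
  ring

lemma qdet_mat_four (x : Fin 4 → ℝ) :
    qdet (fun i j => K.mat (x i - x j)) = K.r4 (x 0) (x 1) (x 2) (x 3) := by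
  rw [qdet_four]
  simp only [scal_mat_zero, scal_mat_mul, r4]
  have h1 := K.R3_reverse (x 0) (x 1) (x 2)
  have h2 := K.R3_reverse (x 0) (x 1) (x 3)
  have h3 := K.R3_reverse (x 0) (x 2) (x 3)
  have h4 := K.R3_reverse (x 1) (x 2) (x 3)
  have h5 := K.R4_reverse (x 0) (x 1) (x 2) (x 3)
  have h6 := K.R4_reverse (x 0) (x 1) (x 3) (x 2)
  have h7 := K.R4_reverse (x 0) (x 2) (x 1) (x 3)
  unfold R3 at h1 h2 h3 h4 ⊢
  unfold R4 at h5 h6 h7 ⊢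
  rw [h1, h2, h3, h4, h5, h6, h7]
  ring

end PairKernel

end SineBeta

namespace SineBeta

namespace PairKernel

variable (K : PairKernel)

lemma det_two (hd : ∀ u, K.d u = 0) (x : Fin 2 → ℝ) :
    (Matrix.of fun i j => K.s (x i - x j)).det = K.r2 (x 0) (x 1) := by
  rw [Matrix.det_fin_two]
  simp [r2, T, hd, K.s_zero, K.s_sub_comm (x 1) (x 0)]
  ring

lemma det_three (hd : ∀ u, K.d u = 0) (x : Fin 3 → ℝ) :
    (Matrix.of fun i j => K.s (x i - x j)).det = K.r3 (x 0) (x 1) (x 2) := by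
  rw [Matrix.det_fin_three]
  simp [r3, T, R3_eq, hd, K.s_zero, K.s_sub_comm (x 1) (x 0), K.s_sub_comm (x 2) (x 0),
    K.s_sub_comm (x 2) (x 1)]
  ring

lemma det_four (hd : ∀ u, K.d u = 0) (x : Fin 4 → ℝ) :
    (Matrix.of fun i j => K.s (x i - x j)).det = K.r4 (x 0) (x 1) (x 2) (x 3) := by
  rw [Matrix.det_succ_row_zero]
  simp [Fin.sum_univ_succ, Matrix.det_fin_three, Fin.succAbove, r4, T, R3_eq, R4_eq, hd, K.s_zero,
    K.s_sub_comm (x 1) (x 0), K.s_sub_comm (x 2) (x 0),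
    K.s_sub_comm (x 2) (x 1), K.s_sub_comm (x 3) (x 0), K.s_sub_comm (x 3) (x 1),
    K.s_sub_comm (x 3) (x 2)]
  ring

end PairKernel

/-- The sine kernel matrix is positive semidefinite. -/
lemma posSemidef_sinc {k : ℕ} (c : ℝ) (x : Fin k → ℝ) :
    (Matrix.of fun i j => Real.sinc (c * (x i - x j))).PosSemidef := by
  have hs : ∀ u : ℝ, Real.sinc u = ∫ t in (0 : ℝ)..1, Real.cos (u * t) := by
    intro u
    rcases eq_or_ne u 0 with rfl | hu
    · simp
    · rw [intervalIntegral.integral_comp_mul_left (fun t => Real.cos t) hu]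
      simp [Real.sinc_of_ne_zero hu, div_eq_inv_mul]
  refine Matrix.PosSemidef.of_dotProduct_mulVec_nonneg ?_ ?_
  · ext i j
    simp only [Matrix.conjTranspose_apply, Matrix.of_apply, star_trivial]
    rw [← Real.sinc_neg]; congr 1; ring
  · intro v
    have h : star v ⬝ᵥ (Matrix.of fun i j => Real.sinc (c * (x i - x j))).mulVec v =
        ∫ t in (0 : ℝ)..1, ((∑ i, v i * Real.cos (c * x i * t)) ^ 2
          + (∑ i, v i * Real.sin (c * x i * t)) ^ 2) := by
      have : ∀ t : ℝ, ((∑ i, v i * Real.cos (c * x i * t)) ^ 2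
          + (∑ i, v i * Real.sin (c * x i * t)) ^ 2) =
          ∑ i, ∑ j, v i * v j * Real.cos (c * (x i - x j) * t) := by
        intro t
        rw [sq, sq, Finset.sum_mul_sum, Finset.sum_mul_sum, ← Finset.sum_add_distrib]
        refine Finset.sum_congr rfl fun i _ => ?_
        rw [← Finset.sum_add_distrib]
        refine Finset.sum_congr rfl fun j _ => ?_
        rw [show c * (x i - x j) * t = c * x i * t - c * x j * t by ring, Real.cos_sub]
        ring
      simp only [this]
      rw [intervalIntegral.integral_finsetSum]
      · simp only [dotProduct, Matrix.mulVec, Matrix.of_apply, star_trivial, Finset.mul_sum]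
        refine Finset.sum_congr rfl fun i _ => ?_
        rw [intervalIntegral.integral_finsetSum]
        · refine Finset.sum_congr rfl fun j _ => ?_
          rw [intervalIntegral.integral_const_mul, ← hs]
          ring
        · intro j _; exact (by fun_prop : Continuous _).intervalIntegrable _ _
      · intro j _; exact (by fun_prop : Continuous _).intervalIntegrable _ _
    rw [h]
    exact intervalIntegral.integral_nonneg (by norm_num) fun t _ => by positivity

/-- The null vector of a degenerate kernel on three or four points, built from cofactors. -/
lemma PairKernel.exists_null_two (K : PairKernel) (x : Fin 2 → ℝ) (h : K.r2 (x 0) (x 1) = 0) :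
    ∃ v : Fin 2 → Fin 2 → ℝ, v ≠ 0 ∧ ∀ i p, ∑ j, ∑ q, K.mat (x i - x j) p q * v j q = 0 := by
  refine ⟨![![-K.s (x 0 - x 1), -K.e (x 0 - x 1)], ![1, 0]], ?_, ?_⟩
  · intro h0
    have := congrFun (congrFun h0 1) 0
    simp at this
  · simp only [r2, T] at h
    intro i p
    fin_cases i <;> fin_cases p <;>
      simp [Fin.sum_univ_succ, mat, K.s_zero, K.d_zero, K.e_zero, K.s_sub_comm (x 1) (x 0),
        K.d_sub_comm (x 1) (x 0), K.e_sub_comm (x 1) (x 0)] <;> linarith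

lemma PairKernel.exists_null_three (K : PairKernel) (x : Fin 3 → ℝ)
    (h2 : K.r2 (x 0) (x 1) ≠ 0) (h : K.r3 (x 0) (x 1) (x 2) = 0) :
    ∃ v : Fin 3 → Fin 2 → ℝ, v ≠ 0 ∧ ∀ i p, ∑ j, ∑ q, K.mat (x i - x j) p q * v j q = 0 := by
  set A : Fin 3 → Matrix (Fin 2) (Fin 2) ℝ :=
    ![-K.mat (x 0 - x 2) + K.mat (x 0 - x 1) * K.mat (x 1 - x 2),
      -K.mat (x 1 - x 2) + K.mat (x 1 - x 0) * K.mat (x 0 - x 2),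
      K.r2 (x 0) (x 1) • (1 : Matrix (Fin 2) (Fin 2) ℝ)] with hA
  refine ⟨fun j q => A j q 0, ?_, ?_⟩
  · intro h0
    have := congrFun (congrFun h0 2) 0
    simp [hA] at this
    exact h2 this
  · simp only [r3, R3_eq, T] at h
    intro i p
    fin_cases i <;> fin_cases p <;>
      simp [Fin.sum_univ_succ, mat, hA, K.s_zero, K.d_zero, K.e_zero, r2, T,
        K.s_sub_comm (x 1) (x 0), K.d_sub_comm (x 1) (x 0), K.e_sub_comm (x 1) (x 0),
        K.s_sub_comm (x 2) (x 0), K.d_sub_comm (x 2) (x 0), K.e_sub_comm (x 2) (x 0),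
        K.s_sub_comm (x 2) (x 1), K.d_sub_comm (x 2) (x 1), K.e_sub_comm (x 2) (x 1)] at h ⊢ <;>
      first | ring1 | linear_combination h

namespace PairKernel

/-- The cofactors of the last column of the kernel on four points. -/
def cofactor (K : PairKernel) (x y z w : ℝ) : Matrix (Fin 2) (Fin 2) ℝ :=
  -(K.r2 y z • K.mat (x - w)) + K.mat (x - y) * K.mat (y - w) + K.mat (x - z) * K.mat (z - w)
    - K.mat (x - y) * K.mat (y - z) * K.mat (z - w) - K.mat (x - z) * K.mat (z - y) * K.mat (y - w)

lemma cofactor_comm (K : PairKernel) (x y z w : ℝ) : K.cofactor x y z w = K.cofactor x z y w := by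
  simp only [cofactor, r2, K.T_sub_comm z y]
  abel

lemma r3_swap (K : PairKernel) (x y z : ℝ) : K.r3 y x z = K.r3 x y z := by
  have h : K.R3 y x z = K.R3 x y z := by
    rw [← K.R3_reverse x y z, R3, R3, scal, scal, Matrix.mul_assoc, Matrix.trace_mul_comm]
  simp only [r3, h, K.T_sub_comm y x]
  ring

lemma r3_swap' (K : PairKernel) (x y z : ℝ) : K.r3 x z y = K.r3 x y z := by
  simp only [r3, K.R3_reverse, K.T_sub_comm z y]
  ring

lemma mat_zero (K : PairKernel) (x : ℝ) : K.mat (x - x) = 1 := by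
  ext i j
  fin_cases i <;> fin_cases j <;> simp [mat, K.s_zero, K.d_zero, K.e_zero]

set_option maxHeartbeats 1000000 in
lemma cofactor_row (K : PairKernel) (x y z w : ℝ) :
    K.cofactor x y z w + K.mat (x - y) * K.cofactor y x z w + K.mat (x - z) * K.cofactor z x y w
      + K.mat (x - w) * (K.r3 x y z • 1) = 0 := by
  simp only [cofactor, r2, r3, R3_eq, T, mat, K.s_sub_comm y x, K.d_sub_comm y x, K.e_sub_comm y x,
    K.s_sub_comm z x, K.d_sub_comm z x, K.e_sub_comm z x, K.s_sub_comm z y, K.d_sub_comm z y,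
    K.e_sub_comm z y]
  generalize K.s (x - y) = a₁, K.d (x - y) = a₂, K.e (x - y) = a₃, K.s (x - z) = b₁,
    K.d (x - z) = b₂, K.e (x - z) = b₃, K.s (y - z) = c₁, K.d (y - z) = c₂, K.e (y - z) = c₃,
    K.s (x - w) = d₁, K.d (x - w) = d₂, K.e (x - w) = d₃, K.s (y - w) = e₁,
    K.d (y - w) = e₂, K.e (y - w) = e₃, K.s (z - w) = f₁, K.d (z - w) = f₂, K.e (z - w) = f₃
  ext i j
  fin_cases i <;> fin_cases j <;> simp <;> ring

set_option maxHeartbeats 1000000 in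
lemma cofactor_last_row (K : PairKernel) (x y z w : ℝ) :
    K.mat (w - x) * K.cofactor x y z w + K.mat (w - y) * K.cofactor y x z w
      + K.mat (w - z) * K.cofactor z x y w + K.r3 x y z • 1 = K.r4 x y z w • 1 := by
  simp only [cofactor, r2, r3, r4, R3_eq, R4_eq, T, mat, K.s_sub_comm y x, K.d_sub_comm y x,
    K.e_sub_comm y x, K.s_sub_comm z x, K.d_sub_comm z x, K.e_sub_comm z x, K.s_sub_comm z y,
    K.d_sub_comm z y, K.e_sub_comm z y, K.s_sub_comm w x, K.d_sub_comm w x, K.e_sub_comm w x,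
    K.s_sub_comm w y, K.d_sub_comm w y, K.e_sub_comm w y, K.s_sub_comm w z, K.d_sub_comm w z,
    K.e_sub_comm w z]
  generalize K.s (x - y) = a₁, K.d (x - y) = a₂, K.e (x - y) = a₃, K.s (x - z) = b₁,
    K.d (x - z) = b₂, K.e (x - z) = b₃, K.s (y - z) = c₁, K.d (y - z) = c₂, K.e (y - z) = c₃,
    K.s (x - w) = d₁, K.d (x - w) = d₂, K.e (x - w) = d₃, K.s (y - w) = e₁,
    K.d (y - w) = e₂, K.e (y - w) = e₃, K.s (z - w) = f₁, K.d (z - w) = f₂, K.e (z - w) = f₃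
  ext i j
  fin_cases i <;> fin_cases j <;> simp <;> ring

lemma exists_null_four (K : PairKernel) (x : Fin 4 → ℝ)
    (h3 : K.r3 (x 0) (x 1) (x 2) ≠ 0) (h : K.r4 (x 0) (x 1) (x 2) (x 3) = 0) :
    ∃ v : Fin 4 → Fin 2 → ℝ, v ≠ 0 ∧ ∀ i p, ∑ j, ∑ q, K.mat (x i - x j) p q * v j q = 0 := by
  set A : Fin 4 → Matrix (Fin 2) (Fin 2) ℝ :=
    ![K.cofactor (x 0) (x 1) (x 2) (x 3), K.cofactor (x 1) (x 0) (x 2) (x 3),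
      K.cofactor (x 2) (x 0) (x 1) (x 3), K.r3 (x 0) (x 1) (x 2) • 1] with hA
  refine ⟨fun j q => A j q 0, ?_, ?_⟩
  · intro h0
    have := congrFun (congrFun h0 3) 0
    simp [hA] at this
    exact h3 this
  · have key : ∀ i, ∑ j, K.mat (x i - x j) * A j = 0 := by
      have h0 := K.cofactor_row (x 0) (x 1) (x 2) (x 3)
      have h1 := K.cofactor_row (x 1) (x 0) (x 2) (x 3)
      have h2 := K.cofactor_row (x 2) (x 0) (x 1) (x 3)
      have h3 := K.cofactor_last_row (x 0) (x 1) (x 2) (x 3)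
      rw [K.cofactor_comm (x 2) (x 1), K.r3_swap] at h1
      rw [K.cofactor_comm (x 0) (x 2), K.cofactor_comm (x 1) (x 2), K.r3_swap, K.r3_swap'] at h2
      rw [h, zero_smul] at h3
      intro i
      rw [Fin.sum_univ_four]
      fin_cases i
      · simpa [hA, K.mat_zero, -sub_self] using h0
      · rw [add_comm (K.cofactor _ _ _ _)] at h1
        simpa [hA, K.mat_zero, -sub_self] using h1
      · rw [add_comm, ← add_assoc, ← add_assoc] at h2
        rw [← h2]
        simp [hA, K.mat_zero, -sub_self]
        abel
      · simpa [hA, K.mat_zero, -sub_self] using h3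
    intro i p
    have := congrFun (congrFun (key i) p) 0
    simpa [Matrix.sum_apply, Matrix.mul_apply] using this

end PairKernel

end SineBeta

namespace SineBeta

open Polynomial Complex

/-- The trigonometric polynomial with frequencies `2 k - (2 n - 1)` with the coefficients of `p`. -/
noncomputable def trig (n : ℕ) (p : ℂ[X]) (t : ℝ) : ℂ :=
  cexp (-(I * (2 * n - 1) * t)) * p.eval (cexp (2 * I * t))

/-- The derivative of a trigonometric polynomial. -/
noncomputable def trigDeriv (n : ℕ) (p : ℂ[X]) (t : ℝ) : ℂ :=
  cexp (-(I * (2 * n - 1) * t)) * (-(I * (2 * n - 1)) * p.eval (cexp (2 * I * t))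
    + 2 * I * cexp (2 * I * t) * p.derivative.eval (cexp (2 * I * t)))

lemma hasDerivAt_trig (n : ℕ) (p : ℂ[X]) (t : ℝ) :
    HasDerivAt (trig n p) (trigDeriv n p t) t := by
  have h1 : HasDerivAt (fun t : ℝ => cexp (-(I * (2 * n - 1) * t)))
      (cexp (-(I * (2 * n - 1) * t)) * (-(I * (2 * n - 1)))) t := by
    have : HasDerivAt (fun t : ℝ => -(I * (2 * n - 1) * (t : ℂ))) (-(I * (2 * n - 1) * 1)) t :=
      ((hasDerivAt_id t).ofReal_comp.const_mul _).neg
    simpa using this.cexp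
  have h2 : HasDerivAt (fun t : ℝ => cexp (2 * I * t)) (cexp (2 * I * t) * (2 * I)) t := by
    have : HasDerivAt (fun t : ℝ => 2 * I * (t : ℂ)) (2 * I * 1) t :=
      (hasDerivAt_id t).ofReal_comp.const_mul _
    simpa using this.cexp
  have h3 := (p.hasDerivAt (cexp (2 * I * t))).comp t h2
  have h4 := h1.mul h3
  refine h4.congr_deriv ?_
  simp only [trigDeriv, Function.comp]
  ring

lemma trig_X_pow (n k : ℕ) (t : ℝ) :
    trig n (X ^ k) t = cexp (I * (2 * k - 2 * n + 1) * t) := by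
  rw [trig, eval_pow, eval_X, ← Complex.exp_nat_mul, ← Complex.exp_add]
  congr 1
  ring

lemma trigDeriv_X_pow (n k : ℕ) (t : ℝ) :
    trigDeriv n (X ^ k) t = I * (2 * k - 2 * n + 1) * trig n (X ^ k) t := by
  have h1 : HasDerivAt (fun t : ℝ => cexp (I * (2 * k - 2 * n + 1) * t))
      (cexp (I * (2 * k - 2 * n + 1) * t) * (I * (2 * k - 2 * n + 1))) t := by
    have : HasDerivAt (fun t : ℝ => I * (2 * k - 2 * n + 1) * (t : ℂ))
        (I * (2 * k - 2 * n + 1) * 1) t :=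
      (hasDerivAt_id t).ofReal_comp.const_mul _
    simpa using this.cexp
  have h2 := hasDerivAt_trig n (X ^ k) t
  have h3 : trig n (X ^ k) = fun t : ℝ => cexp (I * (2 * k - 2 * n + 1) * t) :=
    funext (trig_X_pow n k)
  rw [h3] at h2 ⊢
  rw [h2.unique h1]
  ring

lemma trig_eq_sum {n : ℕ} {p : ℂ[X]} (hp : p.natDegree < 2 * n) (t : ℝ) :
    trig n p t = ∑ k ∈ Finset.range (2 * n), p.coeff k * trig n (X ^ k) t := by
  conv_lhs => rw [trig, eval_eq_sum_range' hp]
  rw [Finset.mul_sum]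
  refine Finset.sum_congr rfl fun k _ => ?_
  simp [trig]
  ring

lemma trigDeriv_eq_sum {n : ℕ} {p : ℂ[X]} (hp : p.natDegree < 2 * n) (t : ℝ) :
    trigDeriv n p t = ∑ k ∈ Finset.range (2 * n), p.coeff k * trigDeriv n (X ^ k) t := by
  have h1 : HasDerivAt (trig n p)
      (∑ k ∈ Finset.range (2 * n), p.coeff k * trigDeriv n (X ^ k) t) t := by
    have : trig n p = fun t => ∑ k ∈ Finset.range (2 * n), p.coeff k * trig n (X ^ k) t :=
      funext (trig_eq_sum hp)
    rw [this]
    exact HasDerivAt.fun_sum fun k _ => (hasDerivAt_trig n (X ^ k) t).const_mul _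
  exact (hasDerivAt_trig n p t).unique h1

lemma continuous_trig (n : ℕ) (p : ℂ[X]) : Continuous (trig n p) :=
  continuous_iff_continuousAt.2 fun t => (hasDerivAt_trig n p t).continuousAt

lemma trig_X_pow_add_pi (n k : ℕ) (t : ℝ) :
    trig n (X ^ k) (t + Real.pi) = -trig n (X ^ k) t := by
  rw [trig_X_pow, trig_X_pow]
  have : I * (2 * k - 2 * n + 1) * ((t + Real.pi : ℝ) : ℂ) =
      I * (2 * k - 2 * n + 1) * t + (Real.pi * I + ((k - n : ℤ) : ℂ) * (2 * Real.pi * I)) := by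
    push_cast
    ring
  rw [this, Complex.exp_add, Complex.exp_add, Complex.exp_int_mul_two_pi_mul_I, Complex.exp_pi_mul_I]
  ring

lemma trig_X_pow_add (n k : ℕ) (t y : ℝ) :
    trig n (X ^ k) (t + y) = trig n (X ^ k) t * trig n (X ^ k) y := by
  simp only [trig_X_pow, ← Complex.exp_add]
  congr 1
  push_cast
  ring

/-- The Fourier coefficients of an antiperiodic function, as an integral over half a period. -/
noncomputable def halfCoeff (n : ℕ) (g : ℝ → ℝ) (k : ℕ) : ℂ :=
  ∫ u in (0 : ℝ)..Real.pi, (g u : ℂ) * trig n (X ^ k) u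

lemma integral_mul_trig {n : ℕ} {p : ℂ[X]} (hp : p.natDegree < 2 * n) {g : ℝ → ℝ}
    (hg : ∀ t, g (t + Real.pi) = -g t) (hi : ∀ a b, IntervalIntegrable g volume a b) (y z : ℝ) :
    ∫ t in z..z + Real.pi, (g (t - y) : ℂ) * trig n p t =
      ∑ k ∈ Finset.range (2 * n), p.coeff k * (halfCoeff n g k * trig n (X ^ k) y) := by
  have hgi : ∀ a b, IntervalIntegrable (fun t => (g (t - y) : ℂ)) volume a b := by
    intro a b
    have := (hi (a - y) (b - y)).comp_sub_right y
    simp only [sub_add_cancel] at this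
    exact ⟨this.1.ofReal, this.2.ofReal⟩
  simp_rw [trig_eq_sum hp, Finset.mul_sum]
  rw [intervalIntegral.integral_finsetSum]
  · refine Finset.sum_congr rfl fun k _ => ?_
    have hper : Function.Periodic (fun t => (g (t - y) : ℂ) * trig n (X ^ k) t) Real.pi := by
      intro t
      simp only
      rw [show t + Real.pi - y = t - y + Real.pi by ring, hg, trig_X_pow_add_pi]
      push_cast
      ring
    calc ∫ t in z..z + Real.pi, (g (t - y) : ℂ) * (p.coeff k * trig n (X ^ k) t)
        = p.coeff k * ∫ t in z..z + Real.pi, (g (t - y) : ℂ) * trig n (X ^ k) t := by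
          rw [← intervalIntegral.integral_const_mul]
          congr 1; ext t; ring
      _ = p.coeff k * ∫ t in y..y + Real.pi, (g (t - y) : ℂ) * trig n (X ^ k) t := by
          rw [hper.intervalIntegral_add_eq z y]
      _ = p.coeff k * ∫ u in (0 : ℝ)..Real.pi, (g u : ℂ) * trig n (X ^ k) (u + y) := by
          have := intervalIntegral.integral_comp_sub_right (a := y) (b := y + Real.pi)
            (fun u => (g u : ℂ) * trig n (X ^ k) (u + y)) y
          simp only [sub_add_cancel, sub_self, add_sub_cancel_left] at this
          rw [this]
      _ = _ := by
          rw [halfCoeff, ← intervalIntegral.integral_mul_const]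
          congr 2; ext u; rw [trig_X_pow_add]; ring
  · intro k _
    exact (hgi z _).mul_continuousOn (by
      exact (continuous_const.mul (continuous_trig _ _)).continuousOn)

/-- The circular kernel. -/
noncomputable def circD (n : ℕ) (t : ℝ) : ℝ :=
  (1 / n) * ∑ j ∈ Finset.range n, Real.cos ((2 * j + 1) * t)

/-- The derivative of the circular kernel. -/
noncomputable def circD' (n : ℕ) (t : ℝ) : ℝ :=
  (1 / n) * ∑ j ∈ Finset.range n, -((2 * j + 1) * Real.sin ((2 * j + 1) * t))

/-- The antiderivative of the circular kernel. -/
noncomputable def circE (n : ℕ) (t : ℝ) : ℝ :=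
  (1 / n) * ∑ j ∈ Finset.range n, Real.sin ((2 * j + 1) * t) / (2 * j + 1)

lemma integral_exp_two_int (m : ℤ) :
    ∫ u in (0 : ℝ)..Real.pi, cexp (I * (2 * m) * u) = if m = 0 then (Real.pi : ℂ) else 0 := by
  split_ifs with h
  · simp [h]
  · have hc : I * (2 * m) ≠ 0 := by
      simp [h]
    rw [integral_exp_mul_complex hc]
    have : I * (2 * m) * (Real.pi : ℂ) = m * (2 * Real.pi * I) := by ring
    rw [this, Complex.exp_int_mul_two_pi_mul_I]
    simp

lemma halfCoeff_cos (n k j : ℕ) : halfCoeff n (fun u => Real.cos ((2 * j + 1) * u)) k =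
    (if k + j + 1 = n then (Real.pi / 2 : ℂ) else 0) + if k = n + j then (Real.pi / 2 : ℂ) else 0 := by
  have h1 := integral_exp_two_int (k + j + 1 - n)
  have h2 := integral_exp_two_int (k - n - j)
  have : ∀ u : ℝ, ((Real.cos ((2 * j + 1) * u) : ℝ) : ℂ) * trig n (X ^ k) u =
      (1 / 2) * cexp (I * (2 * ((k + j + 1 - n : ℤ) : ℂ)) * u)
      + (1 / 2) * cexp (I * (2 * ((k - n - j : ℤ) : ℂ)) * u) := by
    intro u
    rw [trig_X_pow, Complex.ofReal_cos, Complex.cos, div_mul_eq_mul_div, add_mul, ← Complex.exp_add,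
      ← Complex.exp_add]
    push_cast
    ring_nf
  simp only [halfCoeff, this]
  rw [intervalIntegral.integral_add, intervalIntegral.integral_const_mul,
    intervalIntegral.integral_const_mul, h1, h2]
  · have e1 : ((k : ℤ) + j + 1 - n = 0) ↔ k + j + 1 = n := by omega
    have e2 : ((k : ℤ) - n - j = 0) ↔ k = n + j := by omega
    simp only [e1, e2]
    split_ifs <;> ring
  · exact (by fun_prop : Continuous _).intervalIntegrable _ _
  · exact (by fun_prop : Continuous _).intervalIntegrable _ _

lemma halfCoeff_sin (n k j : ℕ) : halfCoeff n (fun u => Real.sin ((2 * j + 1) * u)) k =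
    (if k + j + 1 = n then (-(I * Real.pi / 2) : ℂ) else 0)
      + if k = n + j then (I * Real.pi / 2 : ℂ) else 0 := by
  have h1 := integral_exp_two_int (k + j + 1 - n)
  have h2 := integral_exp_two_int (k - n - j)
  have : ∀ u : ℝ, ((Real.sin ((2 * j + 1) * u) : ℝ) : ℂ) * trig n (X ^ k) u =
      (-(I / 2)) * cexp (I * (2 * ((k + j + 1 - n : ℤ) : ℂ)) * u)
      + (I / 2) * cexp (I * (2 * ((k - n - j : ℤ) : ℂ)) * u) := by
    intro u
    rw [trig_X_pow, Complex.ofReal_sin, Complex.sin]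
    have h (a b c : ℂ) : (a - b) * I / 2 * c = -(I / 2) * (b * c) + I / 2 * (a * c) := by ring
    rw [h, ← Complex.exp_add, ← Complex.exp_add]
    push_cast
    ring_nf
  simp only [halfCoeff, this]
  rw [intervalIntegral.integral_add, intervalIntegral.integral_const_mul,
    intervalIntegral.integral_const_mul, h1, h2]
  · have e1 : ((k : ℤ) + j + 1 - n = 0) ↔ k + j + 1 = n := by omega
    have e2 : ((k : ℤ) - n - j = 0) ↔ k = n + j := by omega
    simp only [e1, e2]
    split_ifs <;> ring
  · exact (by fun_prop : Continuous _).intervalIntegrable _ _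
  · exact (by fun_prop : Continuous _).intervalIntegrable _ _

lemma halfCoeff_sum (n k : ℕ) (c : ℕ → ℝ) (g : ℕ → ℝ → ℝ) (hg : ∀ j, Continuous (g j)) :
    halfCoeff n (fun u => (1 / n : ℝ) * ∑ j ∈ Finset.range n, c j * g j u) k =
      (1 / n : ℂ) * ∑ j ∈ Finset.range n, c j * halfCoeff n (g j) k := by
  simp only [halfCoeff]
  push_cast
  simp_rw [mul_assoc, Finset.sum_mul]
  rw [intervalIntegral.integral_const_mul, intervalIntegral.integral_finsetSum]
  · congr 1
    refine Finset.sum_congr rfl fun j _ => ?_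
    simp_rw [mul_assoc]
    rw [intervalIntegral.integral_const_mul]
  · intro j _
    have := hg j
    have := continuous_trig n (X ^ k)
    exact (by fun_prop : Continuous _).intervalIntegrable _ _

/-- Only one frequency contributes to a Fourier coefficient. -/
lemma sum_coeff (n k : ℕ) (hk : k < 2 * n) (c : ℕ → ℝ) (A B : ℂ) :
    ∑ j ∈ Finset.range n, (c j : ℂ) * ((if k + j + 1 = n then A else 0)
      + if k = n + j then B else 0) =
    if k < n then (c (n - 1 - k) : ℂ) * A else c (k - n) * B := by
  split_ifs with h
  · rw [Finset.sum_eq_single (n - 1 - k)]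
    · rw [if_pos (by omega), if_neg (by omega), add_zero]
    · intro j hj hne
      rw [if_neg (by omega), if_neg (by omega)]; simp
    · intro hn; simp at hn; omega
  · rw [Finset.sum_eq_single (k - n)]
    · rw [if_neg (by omega), if_pos (by omega), zero_add]
    · intro j hj hne
      rw [if_neg (by omega), if_neg (by omega)]; simp
    · intro hn; simp at hn; omega

lemma halfCoeff_circD {n k : ℕ} (hk : k < 2 * n) :
    halfCoeff n (circD n) k = (Real.pi / (2 * n) : ℂ) := by
  have := halfCoeff_sum n k (fun _ => 1) (fun j u => Real.cos ((2 * j + 1) * u))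
    (fun j => by fun_prop)
  simp only [one_mul, halfCoeff_cos] at this
  rw [show circD n = fun u => (1 / n : ℝ) * ∑ j ∈ Finset.range n, Real.cos ((2 * j + 1) * u)
    from rfl, this, sum_coeff n k hk (fun _ => 1)]
  simp
  ring

lemma halfCoeff_circD' {n k : ℕ} (hk : k < 2 * n) :
    halfCoeff n (circD' n) k = -(Real.pi / (2 * n)) * (I * (2 * k - 2 * n + 1)) := by
  have := halfCoeff_sum n k (fun j => -(2 * j + 1)) (fun j u => Real.sin ((2 * j + 1) * u))
    (fun j => by fun_prop)
  simp only [halfCoeff_sin] at this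
  rw [sum_coeff n k hk (fun j => -(2 * j + 1))] at this
  have h2 : circD' n = fun u => (1 / n : ℝ) * ∑ j ∈ Finset.range n,
      -(2 * j + 1) * Real.sin ((2 * j + 1) * u) := by
    funext u; simp only [circD', neg_mul]
  rw [h2, this]
  split_ifs with h
  · rw [show n - 1 - k = n - (k + 1) by omega, Nat.cast_sub (by omega)]
    push_cast
    ring
  · rw [Nat.cast_sub (by omega)]
    push_cast
    ring

lemma halfCoeff_circE {n k : ℕ} (hk : k < 2 * n) :
    halfCoeff n (circE n) k = I * Real.pi / (2 * n * (2 * k - 2 * n + 1)) := by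
  have := halfCoeff_sum n k (fun j => 1 / (2 * j + 1)) (fun j u => Real.sin ((2 * j + 1) * u))
    (fun j => by fun_prop)
  simp only [halfCoeff_sin] at this
  rw [sum_coeff n k hk (fun j => 1 / (2 * j + 1))] at this
  have h2 : circE n = fun u => (1 / n : ℝ) * ∑ j ∈ Finset.range n,
      1 / (2 * j + 1) * Real.sin ((2 * j + 1) * u) := by
    funext u; simp [circE, div_eq_inv_mul]
  rw [h2, this]
  have hn : (n : ℂ) ≠ 0 := by
    have : n ≠ 0 := by omega
    exact_mod_cast this
  have hm : (2 * k - 2 * n + 1 : ℂ) ≠ 0 := by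
    have : (2 * k - 2 * n + 1 : ℤ) ≠ 0 := by omega
    exact_mod_cast this
  split_ifs with h
  · rw [show n - 1 - k = n - (k + 1) by omega, Nat.cast_sub (by omega)]
    push_cast
    rw [show (2 * (n - (k + 1)) + 1 : ℂ) = -(2 * k - 2 * n + 1) by ring]
    field_simp
  · rw [Nat.cast_sub (by omega)]
    push_cast
    rw [show (2 * (k - n) + 1 : ℂ) = 2 * k - 2 * n + 1 by ring]
    field_simp

/-- The antiperiodic square wave. -/
noncomputable def squareWave (t : ℝ) : ℝ := Real.sign (Real.sin t)

lemma squareWave_add_pi (t : ℝ) : squareWave (t + Real.pi) = -squareWave t := by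
  simp [squareWave, Real.sin_add_pi, Real.sign_neg]

lemma measurable_squareWave : Measurable squareWave := by
  have : Measurable Real.sign := by
    unfold Real.sign
    exact Measurable.ite measurableSet_Iio measurable_const
      (Measurable.ite measurableSet_Ioi measurable_const measurable_const)
  exact this.comp Real.measurable_sin

lemma abs_squareWave_le (t : ℝ) : |squareWave t| ≤ 1 := by
  unfold squareWave
  rcases Real.sign_apply_eq (Real.sin t) with h | h | h <;> simp [h]

lemma intervalIntegrable_squareWave (a b : ℝ) : IntervalIntegrable squareWave volume a b := by
  refine IntervalIntegrable.mono_fun' (g := fun _ => (1 : ℝ)) (by simp)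
    measurable_squareWave.aestronglyMeasurable (ae_of_all _ fun t => ?_)
  exact abs_squareWave_le t

lemma halfCoeff_squareWave {n k : ℕ} :
    halfCoeff n squareWave k = 2 * I / (2 * k - 2 * n + 1) := by
  have h1 : halfCoeff n squareWave k = ∫ u in (0 : ℝ)..Real.pi, trig n (X ^ k) u := by
    rw [halfCoeff]
    rw [intervalIntegral.integral_of_le Real.pi_pos.le, intervalIntegral.integral_of_le
      Real.pi_pos.le, integral_Ioc_eq_integral_Ioo, integral_Ioc_eq_integral_Ioo]
    refine setIntegral_congr_fun measurableSet_Ioo fun u hu => ?_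
    simp only [squareWave, Real.sign_of_pos (Real.sin_pos_of_pos_of_lt_pi hu.1 hu.2)]
    simp
  have hm : (2 * k - 2 * n + 1 : ℂ) ≠ 0 := by
    have : (2 * k - 2 * n + 1 : ℤ) ≠ 0 := by omega
    exact_mod_cast this
  rw [h1]
  simp only [trig_X_pow]
  rw [integral_exp_mul_complex (mul_ne_zero I_ne_zero hm)]
  have h2 := trig_X_pow_add_pi n k 0
  simp only [trig_X_pow, zero_add] at h2
  rw [h2]
  simp
  field_simp
  norm_num [Complex.I_sq]

end SineBeta

namespace SineBeta

open Polynomial Complex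

lemma hasDerivAt_circE (n : ℕ) (t : ℝ) : HasDerivAt (circE n) (circD n t) t := by
  unfold circE circD
  refine HasDerivAt.const_mul _ (HasDerivAt.fun_sum fun j _ => ?_)
  have hj : (2 * j + 1 : ℝ) ≠ 0 := by positivity
  have := (((hasDerivAt_id t).const_mul (2 * j + 1 : ℝ)).sin).div_const (2 * j + 1 : ℝ)
  refine this.congr_deriv ?_
  simp
  field_simp

lemma hasDerivAt_circD (n : ℕ) (t : ℝ) : HasDerivAt (circD n) (circD' n t) t := by
  unfold circD circD'
  refine HasDerivAt.const_mul _ (HasDerivAt.fun_sum fun j _ => ?_)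
  have := (((hasDerivAt_id t).const_mul (2 * j + 1 : ℝ)).cos)
  refine this.congr_deriv ?_
  simp
  ring

lemma contDiff_circD' (n : ℕ) : ContDiff ℝ ⊤ (circD' n) := by
  unfold circD'
  fun_prop

lemma contDiff_circD (n : ℕ) : ContDiff ℝ ⊤ (circD n) := by
  unfold circD
  fun_prop

lemma contDiff_circE (n : ℕ) : ContDiff ℝ ⊤ (circE n) := by
  unfold circE
  refine contDiff_const.mul (ContDiff.sum fun j _ => ?_)
  exact ContDiff.div_const (by fun_prop) _

lemma cos_odd_add_pi (j : ℕ) (t : ℝ) :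
    Real.cos ((2 * j + 1) * (t + Real.pi)) = -Real.cos ((2 * j + 1) * t) := by
  rw [show (2 * j + 1) * (t + Real.pi) = (2 * j + 1) * t + Real.pi + j * (2 * Real.pi) by ring,
    Real.cos_add_nat_mul_two_pi, Real.cos_add_pi]

lemma sin_odd_add_pi (j : ℕ) (t : ℝ) :
    Real.sin ((2 * j + 1) * (t + Real.pi)) = -Real.sin ((2 * j + 1) * t) := by
  rw [show (2 * j + 1) * (t + Real.pi) = (2 * j + 1) * t + Real.pi + j * (2 * Real.pi) by ring,
    Real.sin_add_nat_mul_two_pi, Real.sin_add_pi]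

lemma circD_add_pi (n : ℕ) (t : ℝ) : circD n (t + Real.pi) = -circD n t := by
  simp [circD, cos_odd_add_pi]

lemma circD'_add_pi (n : ℕ) (t : ℝ) : circD' n (t + Real.pi) = -circD' n t := by
  simp [circD', sin_odd_add_pi]

lemma circE_add_pi (n : ℕ) (t : ℝ) : circE n (t + Real.pi) = -circE n t := by
  simp [circE, sin_odd_add_pi, neg_div]

/-- The real functions which are trigonometric polynomials of the given degree. -/
def IsTrig (n : ℕ) (f : ℝ → ℝ) : Prop :=
  ∃ p : ℂ[X], p.natDegree < 2 * n ∧ ∀ t, (f t : ℂ) = trig n p t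

namespace IsTrig

variable {n : ℕ}

lemma add {f g : ℝ → ℝ} (hf : IsTrig n f) (hg : IsTrig n g) : IsTrig n (fun t => f t + g t) := by
  obtain ⟨p, hp, hf⟩ := hf
  obtain ⟨q, hq, hg⟩ := hg
  refine ⟨p + q, (natDegree_add_le p q).trans_lt (max_lt hp hq), fun t => ?_⟩
  push_cast
  rw [hf, hg]
  simp [trig, mul_add]

lemma const_mul {f : ℝ → ℝ} (hf : IsTrig n f) (c : ℝ) : IsTrig n (fun t => c * f t) := by
  obtain ⟨p, hp, hf⟩ := hf
  refine ⟨C (c : ℂ) * p, (natDegree_C_mul_le _ _).trans_lt hp, fun t => ?_⟩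
  push_cast
  rw [hf]
  simp [trig]
  ring

lemma zero (hn : 0 < n) : IsTrig n (fun _ => 0) :=
  ⟨0, by simpa using hn, fun t => by simp [trig]⟩

lemma sum (hn : 0 < n) {ι : Type*} (s : Finset ι) {f : ι → ℝ → ℝ} (hf : ∀ i ∈ s, IsTrig n (f i)) :
    IsTrig n (fun t => ∑ i ∈ s, f i t) := by
  classical
  induction s using Finset.induction_on with
  | empty => simpa using zero hn
  | insert i s hi ih =>
    simp only [Finset.sum_insert hi]
    exact (hf i (by simp)).add (ih fun j hj => hf j (by simp [hj]))

lemma cos {j : ℕ} (hj : j < n) (y : ℝ) : IsTrig n (fun t => Real.cos ((2 * j + 1) * (t - y))) := by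
  refine ⟨C (1 / 2 * cexp (-(I * (2 * j + 1) * y))) * X ^ (n + j)
    + C (1 / 2 * cexp (I * (2 * j + 1) * y)) * X ^ (n - 1 - j), ?_, fun t => ?_⟩
  · refine (natDegree_add_le _ _).trans_lt (max_lt ?_ ?_)
    · exact (natDegree_C_mul_X_pow_le _ _).trans_lt (by omega)
    · exact (natDegree_C_mul_X_pow_le _ _).trans_lt (by omega)
  · have h (c d : ℂ) (k l : ℕ) : trig n (C c * X ^ k + C d * X ^ l) t =
        c * trig n (X ^ k) t + d * trig n (X ^ l) t := by
      simp [trig]; ring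
    rw [h, trig_X_pow, trig_X_pow, Complex.ofReal_cos, Complex.cos,
      show n - 1 - j = n - (j + 1) by omega, Nat.cast_sub (by omega)]
    simp only [mul_assoc (1 / 2 : ℂ), ← Complex.exp_add]
    push_cast
    ring_nf

lemma sin {j : ℕ} (hj : j < n) (y : ℝ) : IsTrig n (fun t => Real.sin ((2 * j + 1) * (t - y))) := by
  refine ⟨C (-(I / 2) * cexp (-(I * (2 * j + 1) * y))) * X ^ (n + j)
    + C (I / 2 * cexp (I * (2 * j + 1) * y)) * X ^ (n - 1 - j), ?_, fun t => ?_⟩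
  · refine (natDegree_add_le _ _).trans_lt (max_lt ?_ ?_)
    · exact (natDegree_C_mul_X_pow_le _ _).trans_lt (by omega)
    · exact (natDegree_C_mul_X_pow_le _ _).trans_lt (by omega)
  · have h (c d : ℂ) (k l : ℕ) : trig n (C c * X ^ k + C d * X ^ l) t =
        c * trig n (X ^ k) t + d * trig n (X ^ l) t := by
      simp [trig]; ring
    rw [h, trig_X_pow, trig_X_pow, Complex.ofReal_sin, Complex.sin,
      show n - 1 - j = n - (j + 1) by omega, Nat.cast_sub (by omega)]
    simp only [mul_assoc (-(I / 2) : ℂ), mul_assoc (I / 2 : ℂ), ← Complex.exp_add]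
    push_cast
    ring_nf

lemma circD (hn : 0 < n) (y : ℝ) : IsTrig n (fun t => circD n (t - y)) :=
  (sum hn _ fun _ hj => cos (Finset.mem_range.1 hj) y).const_mul _

lemma circD' (hn : 0 < n) (y : ℝ) : IsTrig n (fun t => circD' n (t - y)) := by
  have := (sum hn (Finset.range n) fun j hj =>
    (sin (Finset.mem_range.1 hj) y).const_mul (-(2 * j + 1 : ℝ))).const_mul (1 / n : ℝ)
  simpa only [SineBeta.circD', neg_mul] using this

lemma circE (hn : 0 < n) (y : ℝ) : IsTrig n (fun t => circE n (t - y)) := by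
  have := (sum hn (Finset.range n) fun j hj =>
    (sin (Finset.mem_range.1 hj) y).const_mul ((2 * j + 1 : ℝ)⁻¹)).const_mul (1 / n : ℝ)
  simpa only [SineBeta.circE, div_eq_inv_mul] using this

end IsTrig

lemma contDiff_trig (n : ℕ) (p : ℂ[X]) : ContDiff ℝ ⊤ (trig n p) := by
  have h : trig n p = fun t : ℝ => cexp (-(I * (2 * n - 1) * t)) *
      ∑ k ∈ Finset.range (p.natDegree + 1), p.coeff k * cexp (2 * I * t) ^ k := by
    funext t; rw [trig, eval_eq_sum_range]
  rw [h]
  have h0 : ContDiff ℝ ⊤ (fun t : ℝ => (t : ℂ)) := Complex.ofRealCLM.contDiff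
  have h1 : ContDiff ℝ ⊤ (fun t : ℝ => cexp (-(I * (2 * n - 1) * t))) :=
    (contDiff_const.mul h0).neg.cexp
  have h2 : ContDiff ℝ ⊤ (fun t : ℝ => cexp (2 * I * t)) := (contDiff_const.mul h0).cexp
  exact h1.mul (ContDiff.sum fun k _ => contDiff_const.mul (h2.pow k))

/-- A trigonometric polynomial is divisible by the sine at each of its zeros. -/
lemma IsTrig.exists_div {n : ℕ} {f : ℝ → ℝ} (hf : IsTrig n f) {z : ℝ} (hz : f z = 0) :
    ∃ (v : ℝ → ℝ) (q : ℂ[X]), ContDiff ℝ ⊤ v ∧ q.natDegree < 2 * n ∧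
      (∀ t, f t = Real.sin (t - z) * v t) ∧ ∀ t, (trig n q t).re = Real.cos (t - z) * v t := by
  obtain ⟨p, hp, hf⟩ := hf
  have hroot : p.IsRoot (cexp (2 * I * z)) := by
    have := hf z
    rw [hz, trig] at this
    simpa [Complex.exp_ne_zero] using this
  obtain ⟨r, hr⟩ := dvd_iff_isRoot.2 hroot
  have hrd : r.natDegree + 1 < 2 * n ∨ r = 0 := by
    by_cases h0 : r = 0
    · exact Or.inr h0
    · left
      rw [hr, natDegree_mul (X_sub_C_ne_zero _) h0, natDegree_X_sub_C] at hp
      omega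
  refine ⟨fun t => (2 * I * cexp (I * z) * cexp (I * t) * trig n r t).re,
    C I * (X + C (cexp (2 * I * z))) * r, ?_, ?_, fun t => ?_, fun t => ?_⟩
  · have h0 : ContDiff ℝ ⊤ (fun t : ℝ => (t : ℂ)) := Complex.ofRealCLM.contDiff
    have h1 : ContDiff ℝ ⊤ (fun t : ℝ => 2 * I * cexp (I * z) * cexp (I * t) * trig n r t) :=
      (contDiff_const.mul (contDiff_const.mul h0).cexp).mul (contDiff_trig n r)
    exact Complex.reCLM.contDiff.comp h1
  · rcases hrd with h | h
    · refine natDegree_mul_le.trans_lt ?_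
      have : (C I * (X + C (cexp (2 * I * z)))).natDegree ≤ 1 :=
        (natDegree_C_mul_le _ _).trans (natDegree_X_add_C _).le
      omega
    · rw [h]; simp; omega
  · have h1 : (f t : ℂ) = (Real.sin (t - z) : ℂ) *
        (2 * I * cexp (I * z) * cexp (I * t) * trig n r t) := by
      rw [hf t, hr]
      simp only [trig, eval_mul, eval_sub, eval_X, eval_C]
      rw [Complex.ofReal_sin, Complex.sin]
      have e1 : cexp (2 * I * t) = cexp (((t - z : ℝ) : ℂ) * I) * (cexp (I * z) * cexp (I * t)) := by
        rw [← Complex.exp_add, ← Complex.exp_add]; congr 1; push_cast; ring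
      have e2 : cexp (2 * I * z) = cexp (-((t - z : ℝ) : ℂ) * I) * (cexp (I * z) * cexp (I * t)) := by
        rw [← Complex.exp_add, ← Complex.exp_add]; congr 1; push_cast; ring
      generalize eval (cexp (2 * I * t)) r = R
      rw [e1, e2]
      linear_combination (cexp (((t - z : ℝ) : ℂ) * I) - cexp (-((t - z : ℝ) : ℂ) * I)) *
        (cexp (I * z) * cexp (I * t)) * cexp (-(I * (2 * n - 1) * t)) * R * (Complex.I_sq)
    have h2 := congrArg Complex.re h1
    rw [Complex.ofReal_re, Complex.re_ofReal_mul] at h2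
    exact h2
  · have h1 : trig n (C I * (X + C (cexp (2 * I * z))) * r) t = (Real.cos (t - z) : ℂ) *
        (2 * I * cexp (I * z) * cexp (I * t) * trig n r t) := by
      simp only [trig, eval_mul, eval_add, eval_X, eval_C]
      rw [Complex.ofReal_cos, Complex.cos]
      have e1 : cexp (2 * I * t) = cexp (((t - z : ℝ) : ℂ) * I) * (cexp (I * z) * cexp (I * t)) := by
        rw [← Complex.exp_add, ← Complex.exp_add]; congr 1; push_cast; ring
      have e2 : cexp (2 * I * z) = cexp (-((t - z : ℝ) : ℂ) * I) * (cexp (I * z) * cexp (I * t)) := by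
        rw [← Complex.exp_add, ← Complex.exp_add]; congr 1; push_cast; ring
      generalize eval (cexp (2 * I * t)) r = R
      rw [e1, e2]
      ring
    rw [h1, Complex.re_ofReal_mul]

/-- If a function with a double zero at both ends of a half period has a nonpositive sign, and its
derivative divided by the sine is orthogonal to the cosine, then it vanishes. -/
lemma eq_zero_of_integral_cos {f g : ℝ → ℝ} {S : Set ℝ} {C : ℝ} (hS : S.Countable)
    (hf : Continuous f) (hd : ∀ t ∉ S, HasDerivAt f (g t * Real.sin t) t)
    (hg : ∀ t ∈ Icc 0 Real.pi, |g t| ≤ C) (hgi : ∀ a b, IntervalIntegrable g volume a b)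
    (h0 : f 0 = 0) (hpi : f Real.pi = 0) (hneg : ∀ t, f t ≤ 0)
    (hint : ∫ t in (0 : ℝ)..Real.pi, g t * Real.cos t = 0) (t : ℝ) (ht : t ∈ Ioo 0 Real.pi) :
    f t = 0 := by
  by_contra hne
  have hlt : f t < 0 := lt_of_le_of_ne (hneg t) hne
  have hC : 0 ≤ C := (abs_nonneg _).trans (hg 0 ⟨le_rfl, Real.pi_pos.le⟩)
  have hgs : ∀ a b, IntervalIntegrable (fun t => g t * Real.sin t) volume a b := fun a b =>
    (hgi a b).mul_continuousOn Real.continuous_sin.continuousOn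
  have hgc : ∀ a b, IntervalIntegrable (fun t => g t * Real.cos t) volume a b := fun a b =>
    (hgi a b).mul_continuousOn Real.continuous_cos.continuousOn
  have ftc : ∀ a b, ∫ t in a..b, g t * Real.sin t = f b - f a := fun a b =>
    integral_eq_of_hasDerivAt_off_countable _ _ hS hf.continuousOn (fun x hx => hd x hx.2) (hgs a b)
  -- quadratic decay at both ends
  have hb0 : ∀ e, 0 ≤ e → e ≤ Real.pi → |f e| ≤ C * e * e := by
    intro e he hepi
    have h1 := ftc 0 e
    rw [h0, sub_zero] at h1
    rw [← h1, ← Real.norm_eq_abs]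
    refine (intervalIntegral.norm_integral_le_of_norm_le_const (C := C * e) fun x hx => ?_).trans
      (by rw [sub_zero, abs_of_nonneg he])
    rw [uIoc_of_le he] at hx
    rw [Real.norm_eq_abs, abs_mul]
    refine mul_le_mul (hg x ⟨hx.1.le, hx.2.trans hepi⟩) ?_ (abs_nonneg _) hC
    exact (Real.abs_sin_le_abs.trans (by rw [abs_of_pos hx.1])).trans hx.2
  have hbpi : ∀ e, 0 ≤ e → e ≤ Real.pi → |f (Real.pi - e)| ≤ C * e * e := by
    intro e he hepi
    have h1 := ftc (Real.pi - e) Real.pi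
    rw [hpi, zero_sub] at h1
    rw [← abs_neg, ← h1, ← Real.norm_eq_abs]
    refine (intervalIntegral.norm_integral_le_of_norm_le_const (C := C * e) fun x hx => ?_).trans
      (by rw [sub_sub_cancel, abs_of_nonneg he])
    rw [uIoc_of_le (by linarith)] at hx
    rw [Real.norm_eq_abs, abs_mul]
    refine mul_le_mul (hg x ⟨by linarith [hx.1], hx.2⟩) ?_ (abs_nonneg _) hC
    rw [← Real.sin_pi_sub]
    refine Real.abs_sin_le_abs.trans ?_
    rw [abs_of_nonneg (by linarith [hx.2])]
    linarith [hx.1]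
  have hsin : ∀ x ∈ Ioo 0 Real.pi, 0 < Real.sin x := fun x hx =>
    Real.sin_pos_of_pos_of_lt_pi hx.1 hx.2
  set h : ℝ → ℝ := fun x => -(f x) / Real.sin x ^ 2 with hh
  have hcont : ∀ a b, 0 < a → b < Real.pi → ContinuousOn h (Icc a b) := by
    intro a b ha hb
    refine (hf.neg.continuousOn).div (Real.continuous_sin.pow 2).continuousOn fun x hx => ?_
    exact pow_ne_zero 2 (hsin x ⟨by linarith [hx.1], by linarith [hx.2]⟩).ne'
  have hnn : ∀ x, 0 ≤ h x := fun x => div_nonneg (neg_nonneg.2 (hneg x)) (sq_nonneg _)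
  have hη : 0 < ∫ x in (t / 2)..((t + Real.pi) / 2), h x := by
    refine intervalIntegral.integral_pos (by linarith [ht.2, ht.1])
      (hcont _ _ (by linarith [ht.1]) (by linarith [ht.2])) (fun x _ => hnn x)
      ⟨t, ⟨by linarith [ht.1], by linarith [ht.2]⟩, ?_⟩
    exact div_pos (neg_pos.2 hlt) (pow_pos (hsin t ht) 2)
  set η := ∫ x in (t / 2)..((t + Real.pi) / 2), h x
  have key : ∀ e, 0 < e → e ≤ t / 2 → e ≤ (Real.pi - t) / 2 → η ≤ 6 * C * e := by
    intro e he het hepi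
    have hlep : e ≤ Real.pi - e := by linarith
    have hi : IntervalIntegrable h volume e (Real.pi - e) :=
      (hcont e (Real.pi - e) he (by linarith)).intervalIntegrable_of_Icc hlep
    have h1 : η ≤ ∫ x in e..(Real.pi - e), h x :=
      intervalIntegral.integral_mono_interval het (by linarith [ht.1, ht.2]) (by linarith)
        (ae_of_all _ hnn) hi
    have h2 : ∫ x in e..(Real.pi - e), (g x * Real.cos x + h x) =
        f (Real.pi - e) * (Real.cos (Real.pi - e) / Real.sin (Real.pi - e))
          - f e * (Real.cos e / Real.sin e) := by
      refine integral_eq_of_hasDerivAt_off_countable_of_le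
        (fun x => f x * (Real.cos x / Real.sin x)) _ hlep hS ?_ ?_ ((hgc _ _).add hi)
      · refine hf.continuousOn.mul (Real.continuous_cos.continuousOn.div
          Real.continuous_sin.continuousOn fun x hx => ?_)
        exact (hsin x ⟨by linarith [hx.1], by linarith [hx.2]⟩).ne'
      · intro x hx
        have hsx := (hsin x ⟨by linarith [hx.1.1], by linarith [hx.1.2]⟩).ne'
        have h3 := (hd x hx.2).mul
          ((Real.hasDerivAt_cos x).div (Real.hasDerivAt_sin x) hsx)
        refine h3.congr_deriv ?_
        simp only [hh, Pi.div_apply]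
        field_simp
        linear_combination (-(f x)) * (Real.sin_sq_add_cos_sq x)
    rw [intervalIntegral.integral_add (hgc _ _) hi] at h2
    have h4 : ∫ x in e..(Real.pi - e), g x * Real.cos x =
        -(∫ x in (0 : ℝ)..e, g x * Real.cos x) - ∫ x in (Real.pi - e)..Real.pi, g x * Real.cos x := by
      have h5 := intervalIntegral.integral_add_adjacent_intervals (hgc 0 e) (hgc e (Real.pi - e))
      have h6 := intervalIntegral.integral_add_adjacent_intervals (hgc 0 (Real.pi - e))
        (hgc (Real.pi - e) Real.pi)
      rw [hint] at h6
      linarith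
    have hgcb : ∀ x ∈ Icc 0 Real.pi, |g x * Real.cos x| ≤ C := fun x hx => by
      rw [abs_mul]
      exact (mul_le_mul (hg x hx) (Real.abs_cos_le_one x) (abs_nonneg _) hC).trans (mul_one C).le
    have b1 : |∫ x in (0 : ℝ)..e, g x * Real.cos x| ≤ C * e := by
      have := intervalIntegral.norm_integral_le_of_norm_le_const (a := 0) (b := e)
        (f := fun x => g x * Real.cos x) (C := C) fun x hx => hgcb x (by
          rw [uIoc_of_le he.le] at hx; exact ⟨hx.1.le, by linarith [hx.2, ht.1, ht.2]⟩)
      rwa [sub_zero, abs_of_pos he] at this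
    have b2 : |∫ x in (Real.pi - e)..Real.pi, g x * Real.cos x| ≤ C * e := by
      have := intervalIntegral.norm_integral_le_of_norm_le_const (a := Real.pi - e) (b := Real.pi)
        (f := fun x => g x * Real.cos x) (C := C) fun x hx => hgcb x (by
          rw [uIoc_of_le (by linarith)] at hx; exact ⟨by linarith [hx.1, ht.1, ht.2], hx.2⟩)
      rwa [sub_sub_cancel, abs_of_pos he] at this
    have hsine : 0 < Real.sin e := hsin e ⟨he, by linarith [ht.1, ht.2]⟩
    have hsine' : e ≤ 2 * Real.sin e := by
      have := Real.mul_le_sin he.le (by linarith [ht.1, ht.2])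
      have h7 : e ≤ 2 * (2 / Real.pi * e) := by
        rw [show 2 * (2 / Real.pi * e) = 4 * e / Real.pi by ring, le_div_iff₀ Real.pi_pos]
        nlinarith [Real.pi_le_four]
      linarith
    have hcot : |Real.cos e / Real.sin e| * e ≤ 2 := by
      rw [abs_div, abs_of_pos hsine, div_mul_eq_mul_div, div_le_iff₀ hsine]
      nlinarith [Real.abs_cos_le_one e, abs_nonneg (Real.cos e)]
    have b3 : |f e * (Real.cos e / Real.sin e)| ≤ 2 * C * e := by
      rw [abs_mul]
      calc _ ≤ C * e * e * |Real.cos e / Real.sin e| :=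
            mul_le_mul_of_nonneg_right (hb0 e he.le (by linarith [ht.1, ht.2])) (abs_nonneg _)
        _ = C * e * (|Real.cos e / Real.sin e| * e) := by ring
        _ ≤ C * e * 2 := mul_le_mul_of_nonneg_left hcot (by positivity)
        _ = _ := by ring
    have b4 : |f (Real.pi - e) * (Real.cos (Real.pi - e) / Real.sin (Real.pi - e))| ≤ 2 * C * e := by
      rw [abs_mul, Real.cos_pi_sub, Real.sin_pi_sub, neg_div, abs_neg]
      calc _ ≤ C * e * e * |Real.cos e / Real.sin e| :=
            mul_le_mul_of_nonneg_right (hbpi e he.le (by linarith [ht.1, ht.2])) (abs_nonneg _)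
        _ = C * e * (|Real.cos e / Real.sin e| * e) := by ring
        _ ≤ C * e * 2 := mul_le_mul_of_nonneg_left hcot (by positivity)
        _ = _ := by ring
    have := abs_le.1 b1
    have := abs_le.1 b2
    have := abs_le.1 b3
    have := abs_le.1 b4
    linarith
  have hm : 0 < min (t / 2) ((Real.pi - t) / 2) := lt_min (by linarith [ht.1]) (by linarith [ht.2])
  set e := min (min (t / 2) ((Real.pi - t) / 2)) (η / (6 * C + 1) / 2)
  have he : 0 < e := lt_min hm (by positivity)
  have h8 := key e he ((min_le_left _ _).trans (min_le_left _ _))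
    ((min_le_left _ _).trans (min_le_right _ _))
  have h9 : e ≤ η / (6 * C + 1) / 2 := min_le_right _ _
  have h10 : (6 * C + 1) * e ≤ η / 2 := by
    calc (6 * C + 1) * e ≤ (6 * C + 1) * (η / (6 * C + 1) / 2) := by gcongr
      _ = η / 2 := by field_simp
  linarith

end SineBeta

namespace SineBeta

open Polynomial Complex

lemma integral_circD_trig {n : ℕ} {p : ℂ[X]} (hp : p.natDegree < 2 * n) (y z : ℝ) :
    ∫ t in z..z + Real.pi, (circD n (t - y) : ℂ) * trig n p t =
      Real.pi / (2 * n) * trig n p y := by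
  rw [integral_mul_trig hp (circD_add_pi n)
    (fun _ _ => (contDiff_circD n).continuous.intervalIntegrable _ _), trig_eq_sum hp,
    Finset.mul_sum]
  refine Finset.sum_congr rfl fun k hk => ?_
  rw [halfCoeff_circD (Finset.mem_range.1 hk)]
  ring

lemma integral_circD'_trig {n : ℕ} {p : ℂ[X]} (hp : p.natDegree < 2 * n) (y z : ℝ) :
    ∫ t in z..z + Real.pi, (circD' n (t - y) : ℂ) * trig n p t =
      -(Real.pi / (2 * n)) * trigDeriv n p y := by
  rw [integral_mul_trig hp (circD'_add_pi n)
    (fun _ _ => (contDiff_circD' n).continuous.intervalIntegrable _ _), trigDeriv_eq_sum hp,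
    Finset.mul_sum]
  refine Finset.sum_congr rfl fun k hk => ?_
  rw [halfCoeff_circD' (Finset.mem_range.1 hk), trigDeriv_X_pow]
  ring

lemma integral_circE_sub_trig {n : ℕ} {p : ℂ[X]} (hp : p.natDegree < 2 * n) (y z : ℝ) :
    ∫ t in z..z + Real.pi,
      ((circE n (t - y) - Real.pi / (4 * n) * squareWave (t - y) : ℝ) : ℂ) * trig n p t = 0 := by
  have hi : ∀ a b, IntervalIntegrable (fun u => circE n u - Real.pi / (4 * n) * squareWave u)
      volume a b := fun a b =>
    ((contDiff_circE n).continuous.intervalIntegrable _ _).sub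
      ((intervalIntegrable_squareWave a b).const_mul _)
  rw [integral_mul_trig (g := fun u => circE n u - Real.pi / (4 * n) * squareWave u) hp
    (fun t => by rw [circE_add_pi, squareWave_add_pi]; ring) hi]
  refine Finset.sum_eq_zero fun k hk => ?_
  have hk := Finset.mem_range.1 hk
  have : halfCoeff n (fun u => circE n u - Real.pi / (4 * n) * squareWave u) k = 0 := by
    have h1 := halfCoeff_circE hk
    have h2 := halfCoeff_squareWave (n := n) (k := k)
    unfold halfCoeff at h1 h2 ⊢
    have h3 : ∀ u : ℝ, ((circE n u - Real.pi / (4 * n) * squareWave u : ℝ) : ℂ) * trig n (X ^ k) u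
        = circE n u * trig n (X ^ k) u
          - (Real.pi / (4 * n) : ℂ) * (squareWave u * trig n (X ^ k) u) := by
      intro u; push_cast; ring
    simp only [h3]
    have hc := continuous_trig n (X ^ k)
    have hE := (contDiff_circE n).continuous
    rw [intervalIntegral.integral_sub, intervalIntegral.integral_const_mul, h1, h2]
    · have hn : (n : ℂ) ≠ 0 := by
        have : n ≠ 0 := by omega
        exact_mod_cast this
      have hm : (2 * k - 2 * n + 1 : ℂ) ≠ 0 := by
        have : (2 * k - 2 * n + 1 : ℤ) ≠ 0 := by omega
        exact_mod_cast this
      field_simp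
      ring
    · exact (by fun_prop : Continuous _).intervalIntegrable _ _
    · refine IntervalIntegrable.const_mul ?_ _
      exact (IntervalIntegrable.mul_continuousOn
        (⟨(intervalIntegrable_squareWave _ _).1.ofReal, (intervalIntegrable_squareWave _ _).2.ofReal⟩)
        hc.continuousOn)
  rw [this]
  simp

lemma exp_ne_of_sin_ne {x y : ℝ} (h : Real.sin (x - y) ≠ 0) :
    cexp (2 * I * x) ≠ cexp (2 * I * y) := by
  intro he
  apply h
  have h1 : cexp (((x - y : ℝ) : ℂ) * I) = cexp (-((x - y : ℝ) : ℂ) * I) := by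
    have e1 : cexp (((x - y : ℝ) : ℂ) * I) = cexp (2 * I * x) * cexp (-(I * x) - I * y) := by
      rw [← Complex.exp_add]; congr 1; push_cast; ring
    have e2 : cexp (-((x - y : ℝ) : ℂ) * I) = cexp (2 * I * y) * cexp (-(I * x) - I * y) := by
      rw [← Complex.exp_add]; congr 1; push_cast; ring
    rw [e1, e2, he]
  have h2 : Complex.sin ((x - y : ℝ) : ℂ) = 0 := by
    rw [Complex.sin, h1]; simp
  exact_mod_cast h2

/-- Confluent Vandermonde systems have no nontrivial solution. -/
lemma confluent_vandermonde {n k : ℕ} (hkn : k ≤ n) {t a b : Fin k → ℝ}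
    (hsep : ∀ i j, i ≠ j → Real.sin (t i - t j) ≠ 0)
    (H : ∀ q : ℂ[X], q.natDegree < 2 * n →
      ∑ j, ((a j : ℂ) * trig n q (t j) - b j * trigDeriv n q (t j)) = 0) (l : Fin k) :
    a l = 0 ∧ b l = 0 := by
  set ζ : Fin k → ℂ := fun j => cexp (2 * I * t j) with hζ
  have hne : ∀ i j, i ≠ j → ζ i ≠ ζ j := fun i j hij => exp_ne_of_sin_ne (hsep i j hij)
  set P : ℂ[X] := ∏ i ∈ Finset.univ.erase l, (X - C (ζ i)) ^ 2 with hP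
  have hPdeg : P.natDegree + 1 < 2 * n := by
    have h1 : P.natDegree ≤ ∑ i ∈ Finset.univ.erase l, 2 := by
      refine (natDegree_prod_le _ _).trans (Finset.sum_le_sum fun i _ => ?_)
      exact natDegree_pow_le.trans (by rw [natDegree_X_sub_C])
    rw [Finset.sum_const, Finset.card_erase_of_mem (Finset.mem_univ _), Finset.card_univ,
      Fintype.card_fin, smul_eq_mul] at h1
    have : 0 < k := l.pos
    omega
  have hPl : P.eval (ζ l) ≠ 0 := by
    rw [hP, eval_prod, Finset.prod_ne_zero_iff]
    intro i hi
    simp only [eval_pow, eval_sub, eval_X, eval_C]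
    exact pow_ne_zero 2 (sub_ne_zero.2 (hne l i (Finset.ne_of_mem_erase hi).symm))
  have hPj : ∀ j, j ≠ l → P.eval (ζ j) = 0 ∧ P.derivative.eval (ζ j) = 0 := by
    intro j hj
    have : P = (X - C (ζ j)) ^ 2 * ∏ i ∈ (Finset.univ.erase l).erase j, (X - C (ζ i)) ^ 2 := by
      rw [hP, Finset.mul_prod_erase _ (fun i => (X - C (ζ i)) ^ 2) (by simp [hj])]
    rw [this]
    constructor
    · simp
    · simp [derivative_mul, derivative_pow]
  have htr : ∀ (q : ℂ[X]) j, q.eval (ζ j) = 0 → trig n q (t j) = 0 := by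
    intro q j hq
    simp only [hζ] at hq
    rw [trig, hq, mul_zero]
  have htr' : ∀ (q : ℂ[X]) j, q.eval (ζ j) = 0 → trigDeriv n q (t j) =
      cexp (-(I * (2 * n - 1) * t j)) * (2 * I * ζ j * q.derivative.eval (ζ j)) := by
    intro q j hq
    simp only [hζ] at hq ⊢
    rw [trigDeriv, hq, mul_zero, zero_add]
  have hb : b l = 0 := by
    have h1 := H ((X - C (ζ l)) * P) ?_
    · rw [Finset.sum_eq_single l] at h1
      · rw [htr _ _ (by simp), htr' _ _ (by simp)] at h1
        simp only [derivative_mul, derivative_sub, derivative_X, derivative_C, eval_add, eval_mul,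
          eval_sub, eval_X, eval_C, sub_self, zero_mul, add_zero, mul_zero, zero_sub, sub_zero,
          one_mul, neg_eq_zero, mul_eq_zero, Complex.exp_ne_zero, hζ] at h1
        simp only [hζ] at hPl
        simpa [Complex.exp_ne_zero, hPl] using h1
      · intro j _ hj
        have := hPj j hj
        rw [htr _ _ (by simp [this.1]), htr' _ _ (by simp [this.1])]
        simp [derivative_mul, this.1, this.2]
      · simp
    · refine natDegree_mul_le.trans_lt ?_
      rw [natDegree_X_sub_C]
      omega
  refine ⟨?_, hb⟩
  have h1 := H P (by omega)
  rw [Finset.sum_eq_single l] at h1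
  · rw [hb] at h1
    simp only [trig, ofReal_zero, zero_mul, sub_zero, mul_eq_zero, Complex.exp_ne_zero, false_or]
      at h1
    rcases h1 with h1 | h1
    · exact_mod_cast h1
    · exact absurd h1 hPl
  · intro j _ hj
    have := hPj j hj
    rw [htr _ _ this.1, htr' _ _ this.1, this.2]
    simp
  · simp

end SineBeta

namespace SineBeta

open Polynomial Complex

/-- The potential of charges `a` and dipoles `b` at the points `t`. -/
noncomputable def circF (n : ℕ) {k : ℕ} (t a b : Fin k → ℝ) (x : ℝ) : ℝ :=
  ∑ j, (a j * circE n (x - t j) + b j * circD n (x - t j))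

/-- The derivative of `circF`. -/
noncomputable def circF' (n : ℕ) {k : ℕ} (t a b : Fin k → ℝ) (x : ℝ) : ℝ :=
  ∑ j, (a j * circD n (x - t j) + b j * circD' n (x - t j))

section

variable {n k : ℕ} {t a b : Fin k → ℝ}

lemma hasDerivAt_circF (x : ℝ) : HasDerivAt (circF n t a b) (circF' n t a b x) x := by
  unfold circF circF'
  refine HasDerivAt.fun_sum fun j _ => ?_
  exact (((hasDerivAt_circE n _).comp_sub_const x (t j)).const_mul _).add
    (((hasDerivAt_circD n _).comp_sub_const x (t j)).const_mul _)

lemma contDiff_circF : ContDiff ℝ ⊤ (circF n t a b) := by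
  unfold circF
  have h1 := contDiff_circE n
  have h2 := contDiff_circD n
  refine ContDiff.sum fun j _ => ?_
  exact (contDiff_const.mul (h1.comp (contDiff_id.sub contDiff_const))).add
    (contDiff_const.mul (h2.comp (contDiff_id.sub contDiff_const)))

lemma contDiff_circF' : ContDiff ℝ ⊤ (circF' n t a b) := by
  unfold circF'
  have h1 := contDiff_circD n
  have h2 := contDiff_circD' n
  refine ContDiff.sum fun j _ => ?_
  exact (contDiff_const.mul (h1.comp (contDiff_id.sub contDiff_const))).add
    (contDiff_const.mul (h2.comp (contDiff_id.sub contDiff_const)))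

lemma circF_add_pi (x : ℝ) : circF n t a b (x + Real.pi) = -circF n t a b x := by
  simp only [circF, ← Finset.sum_neg_distrib]
  refine Finset.sum_congr rfl fun j _ => ?_
  rw [show x + Real.pi - t j = x - t j + Real.pi by ring, circE_add_pi, circD_add_pi]
  ring

lemma circF'_add_pi (x : ℝ) : circF' n t a b (x + Real.pi) = -circF' n t a b x := by
  simp only [circF', ← Finset.sum_neg_distrib]
  refine Finset.sum_congr rfl fun j _ => ?_
  rw [show x + Real.pi - t j = x - t j + Real.pi by ring, circD_add_pi, circD'_add_pi]
  ring

lemma isTrig_circF (hn : 0 < n) : IsTrig n (circF n t a b) :=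
  IsTrig.sum hn _ fun j _ => ((IsTrig.circE hn (t j)).const_mul (a j)).add
    ((IsTrig.circD hn (t j)).const_mul (b j))

lemma isTrig_circF' (hn : 0 < n) : IsTrig n (circF' n t a b) :=
  IsTrig.sum hn _ fun j _ => ((IsTrig.circD hn (t j)).const_mul (a j)).add
    ((IsTrig.circD' hn (t j)).const_mul (b j))

lemma integral_circF'_trig {p : ℂ[X]} (hp : p.natDegree < 2 * n) (z : ℝ) :
    ∫ x in z..z + Real.pi, (circF' n t a b x : ℂ) * trig n p x =
      Real.pi / (2 * n) * ∑ j, ((a j : ℂ) * trig n p (t j) - b j * trigDeriv n p (t j)) := by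
  have h : ∀ x, (circF' n t a b x : ℂ) * trig n p x =
      ∑ j, ((a j : ℂ) * ((circD n (x - t j) : ℂ) * trig n p x)
        + (b j : ℂ) * ((circD' n (x - t j) : ℂ) * trig n p x)) := by
    intro x
    simp only [circF']
    push_cast
    rw [Finset.sum_mul]
    refine Finset.sum_congr rfl fun j _ => ?_
    ring
  simp only [h]
  have hc := continuous_trig n p
  have h1 := (contDiff_circD n).continuous
  have h2 := (contDiff_circD' n).continuous
  rw [intervalIntegral.integral_finsetSum, Finset.mul_sum]
  · refine Finset.sum_congr rfl fun j _ => ?_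
    rw [intervalIntegral.integral_add, intervalIntegral.integral_const_mul,
      intervalIntegral.integral_const_mul, integral_circD_trig hp, integral_circD'_trig hp]
    · ring
    · exact (by fun_prop : Continuous _).intervalIntegrable _ _
    · exact (by fun_prop : Continuous _).intervalIntegrable _ _
  · intro j _
    exact (by fun_prop : Continuous _).intervalIntegrable _ _

lemma eq_zero_of_circF'_eq_zero (hkn : k ≤ n) (hsep : ∀ i j, i ≠ j → Real.sin (t i - t j) ≠ 0)
    {S : Set ℝ} (hS : S.Countable) {z : ℝ}
    (h : ∀ x ∈ Ioo z (z + Real.pi), x ∉ S → circF' n t a b x = 0) (l : Fin k) :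
    a l = 0 ∧ b l = 0 := by
  refine confluent_vandermonde hkn hsep (fun q hq => ?_) l
  have h1 := integral_circF'_trig (t := t) (a := a) (b := b) hq z
  have h2 : ∫ x in z..z + Real.pi, (circF' n t a b x : ℂ) * trig n q x = 0 := by
    rw [intervalIntegral.integral_of_le (by linarith [Real.pi_pos]), integral_Ioc_eq_integral_Ioo]
    rw [← integral_zero ℝ ℂ (μ := volume.restrict (Ioo z (z + Real.pi)))]
    refine integral_congr_ae ?_
    rw [Filter.EventuallyEq, ae_restrict_iff' measurableSet_Ioo]
    have : ∀ᵐ x ∂(volume : Measure ℝ), x ∉ S := by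
      rw [ae_iff]; simpa using hS.measure_zero volume
    filter_upwards [this] with x hx hxI
    rw [h x hxI hx]; simp
  rw [h2] at h1
  have hn : (Real.pi / (2 * n) : ℂ) ≠ 0 := by
    have : n ≠ 0 := by have := l.pos; omega
    have : (n : ℂ) ≠ 0 := by exact_mod_cast this
    have : (Real.pi : ℂ) ≠ 0 := by exact_mod_cast Real.pi_pos.ne'
    exact div_ne_zero ‹_› (mul_ne_zero two_ne_zero ‹_›)
  exact (mul_eq_zero.1 h1.symm).resolve_left hn

end

/-- A smooth function which changes sign has a zero which is not an extremum to second order. -/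
lemma exists_sign_change {f : ℝ → ℝ} (hf : ContDiff ℝ ⊤ f) {x₀ x₁ : ℝ} (hlt : x₀ < x₁)
    (h0 : 0 < f x₀) (h1 : f x₁ < 0) :
    ∃ z, f z = 0 ∧ (deriv f z = 0 → deriv (deriv f) z = 0) := by
  set A : Set ℝ := {x | x ∈ Icc x₀ x₁ ∧ 0 < f x}
  have hA0 : x₀ ∈ A := ⟨⟨le_rfl, hlt.le⟩, h0⟩
  have hAb : BddAbove A := ⟨x₁, fun x hx => hx.1.2⟩
  set z := sSup A
  have hzA : z ∈ closure A := csSup_mem_closure ⟨x₀, hA0⟩ hAb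
  have hz1 : z ≤ x₁ := csSup_le ⟨x₀, hA0⟩ fun x hx => hx.1.2
  have hz0 : x₀ ≤ z := le_csSup hAb hA0
  have hcont := hf.continuous
  have hright : ∀ x, z < x → x ≤ x₁ → f x ≤ 0 := by
    intro x hx hx1
    by_contra! hpos
    exact absurd (le_csSup hAb (⟨⟨hz0.trans hx.le, hx1⟩, hpos⟩ : x ∈ A)) (not_le.2 hx)
  have hfz : 0 ≤ f z := by
    have hcl : IsClosed {x | 0 ≤ f x} := isClosed_le continuous_const hcont
    exact closure_minimal (fun x hx => hx.2.le) hcl hzA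
  have hzlt : z < x₁ := lt_of_le_of_ne hz1 fun h => by rw [h] at hfz; linarith
  have hfz' : f z = 0 := by
    refine le_antisymm ?_ hfz
    have h2 : ∀ᶠ x in 𝓝[>] z, f x ≤ 0 := by
      filter_upwards [Ioo_mem_nhdsGT hzlt] with x hx
      exact hright x hx.1 hx.2.le
    exact le_of_tendsto (hcont.continuousAt.tendsto.mono_left nhdsWithin_le_nhds) h2
  refine ⟨z, hfz', fun hd => ?_⟩
  by_contra hne
  rcases lt_or_gt_of_ne hne with hneg | hpos
  · have hmax := isLocalMax_of_deriv_deriv_neg hneg hd hcont.continuousAt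
    rw [IsLocalMax, IsMaxFilter, hfz'] at hmax
    obtain ⟨x, hx, hxA⟩ := mem_closure_iff_nhds.1 hzA _ hmax
    have : f x ≤ 0 := hx
    exact absurd hxA.2 (not_lt.2 this)
  · have hmin := isLocalMin_of_deriv_deriv_pos hpos hd hcont.continuousAt
    rw [IsLocalMin, IsMinFilter, hfz'] at hmin
    have hz : ∀ᶠ x in 𝓝[>] z, f x = 0 := by
      filter_upwards [hmin.filter_mono nhdsWithin_le_nhds, Ioo_mem_nhdsGT hzlt] with x hx hx'
      exact le_antisymm (hright x hx'.1 hx'.2.le) hx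
    obtain ⟨u, hu, hsub⟩ := mem_nhdsGT_iff_exists_Ioo_subset.1 hz
    have hd1 : ∀ x ∈ Ioo z u, deriv f x = 0 := fun x hx => by
      have : f =ᶠ[𝓝 x] fun _ => 0 := by
        filter_upwards [Ioo_mem_nhds hx.1 hx.2] with y hy using hsub hy
      rw [this.deriv_eq, deriv_const]
    have hd2 : ∀ x ∈ Ioo z u, deriv (deriv f) x = 0 := fun x hx => by
      have : deriv f =ᶠ[𝓝 x] fun _ => 0 := by
        filter_upwards [Ioo_mem_nhds hx.1 hx.2] with y hy using hd1 y hy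
      rw [this.deriv_eq, deriv_const]
    have hc2 : Continuous (deriv (deriv f)) := by
      have h3 : ContDiff ℝ 1 (deriv f) :=
        (contDiff_succ_iff_deriv.1 (hf.of_le le_top : ContDiff ℝ (1 + 1) f)).2.2
      exact h3.continuous_deriv le_rfl
    have hlim : Tendsto (deriv (deriv f)) (𝓝[>] z) (𝓝 0) := by
      refine tendsto_const_nhds.congr' ?_
      filter_upwards [Ioo_mem_nhdsGT hu] with x hx using (hd2 x hx).symm
    exact hne (tendsto_nhds_unique
      (hc2.continuousAt.tendsto.mono_left nhdsWithin_le_nhds) hlim)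

lemma sin_sub_eq_zero_iff {x y : ℝ} : Real.sin (x - y) = 0 ↔ ∃ m : ℤ, x = y + m * Real.pi := by
  rw [Real.sin_eq_zero_iff]
  constructor
  · rintro ⟨m, hm⟩; exact ⟨m, by linarith⟩
  · rintro ⟨m, hm⟩; exact ⟨m, by linarith⟩

lemma sq_eq_of_antiperiodic {f : ℝ → ℝ} (hf : ∀ x, f (x + Real.pi) = -f x) {x y : ℝ}
    (h : Real.sin (x - y) = 0) : f x ^ 2 = f y ^ 2 := by
  obtain ⟨m, rfl⟩ := sin_sub_eq_zero_iff.1 h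
  have hp : Function.Periodic (fun x => f x ^ 2) Real.pi := fun x => by simp [hf]
  exact hp.int_mul m y

lemma re_integral_mul {f : ℝ → ℝ} {g : ℝ → ℂ} (a b : ℝ)
    (h : IntervalIntegrable (fun x => (f x : ℂ) * g x) volume a b) :
    ∫ x in a..b, f x * (g x).re = (∫ x in a..b, (f x : ℂ) * g x).re := by
  have := Complex.reCLM.intervalIntegral_comp_comm h
  simp only [Complex.reCLM_apply, Complex.re_ofReal_mul] at this
  exact this

/-- The circular kernel of symplectic type is nondegenerate at distinct points. -/
theorem circ_nondegenerate {n k : ℕ} {t a b : Fin k → ℝ} (hkn : k ≤ n)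
    (hsep : ∀ i j, i ≠ j → Real.sin (t i - t j) ≠ 0) (hF : ∀ i, circF n t a b (t i) = 0)
    (hF' : ∀ i, circF' n t a b (t i) = 0) (l : Fin k) : a l = 0 ∧ b l = 0 := by
  have hn : 0 < n := by have := l.pos; omega
  set F := circF n t a b with hFdef
  set F' := circF' n t a b with hFdef'
  have hderiv : deriv F = F' := funext fun x => (hasDerivAt_circF x).deriv
  by_cases hall : ∀ x, F x = 0
  · refine eq_zero_of_circF'_eq_zero hkn hsep countable_empty (z := 0) (fun x _ _ => ?_) l
    rw [← hFdef', ← hderiv, show F = fun _ => 0 from funext hall]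
    simp
  push Not at hall
  obtain ⟨x₀, hx₀⟩ := hall
  have hap : ∀ x, F (x + Real.pi) = -F x := circF_add_pi
  have hap' : ∀ x, F' (x + Real.pi) = -F' x := circF'_add_pi
  obtain ⟨z, hz, hz2⟩ : ∃ z, F z = 0 ∧ (deriv F z = 0 → deriv (deriv F) z = 0) := by
    rcases lt_or_gt_of_ne hx₀ with h | h
    · refine exists_sign_change contDiff_circF (x₀ := x₀ + Real.pi)
        (x₁ := x₀ + Real.pi + Real.pi) (by linarith [Real.pi_pos]) ?_ ?_
      · rw [hap]; linarith
      · rw [hap, hap]; linarith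
    · refine exists_sign_change contDiff_circF (x₀ := x₀) (x₁ := x₀ + Real.pi)
        (by linarith [Real.pi_pos]) h ?_
      rw [hap]; linarith
  obtain ⟨v, q, hv, hq, hFv, hqv⟩ := (isTrig_circF (t := t) (a := a) (b := b) hn).exists_div hz
  rw [← hFdef] at hFv
  have hvd : ∀ x, HasDerivAt v (deriv v x) x := fun x =>
    (hv.differentiable (by simp) x).hasDerivAt
  have hF'v : ∀ x, F' x = Real.cos (x - z) * v x + Real.sin (x - z) * deriv v x := by
    intro x
    have h1 : HasDerivAt F (Real.cos (x - z) * v x + Real.sin (x - z) * deriv v x) x := by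
      have := (((hasDerivAt_id x).sub_const z).sin).fun_mul (hvd x)
      rw [show F = fun x => Real.sin (x - z) * v x from funext hFv]
      simpa using this
    exact (hasDerivAt_circF x).unique h1
  have hv2 : ContDiff ℝ 1 (deriv v) :=
    (contDiff_succ_iff_deriv.1 (hv.of_le le_top : ContDiff ℝ (1 + 1) v)).2.2
  have hF''v : ∀ x, deriv F' x = -Real.sin (x - z) * v x + 2 * Real.cos (x - z) * deriv v x
      + Real.sin (x - z) * deriv (deriv v) x := by
    intro x
    have hd2 : HasDerivAt (deriv v) (deriv (deriv v) x) x :=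
      (hv2.differentiable (by simp) x).hasDerivAt
    have h1 := ((((hasDerivAt_id x).sub_const z).cos).mul (hvd x)).add
      ((((hasDerivAt_id x).sub_const z).sin).mul hd2)
    have h2 : F' = (fun x => Real.cos (x - z)) * v + (fun x => Real.sin (x - z)) * deriv v := by
      funext x; rw [hF'v x]; rfl
    rw [h2]
    refine (h1.congr_deriv ?_).deriv
    simp
    ring
  have hap'' : ∀ x, deriv F' (x + Real.pi) = -deriv F' x := by
    intro x
    rw [← deriv_comp_add_const, show (fun x => F' (x + Real.pi)) = fun x => -F' x from funext hap']
    simp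
  have hvt : ∀ j, v (t j) = 0 ∧ deriv v (t j) = 0 := by
    intro j
    have e1 := hFv (t j)
    have e2 := hF'v (t j)
    rw [hF j] at e1
    rw [hF' j] at e2
    by_cases hs : Real.sin (t j - z) = 0
    · have hc : Real.cos (t j - z) ≠ 0 := fun h => by
        have := Real.sin_sq_add_cos_sq (t j - z)
        rw [hs, h] at this; norm_num at this
      rw [hs] at e2
      have hvz : v (t j) = 0 := by
        rcases mul_eq_zero.1 (by linarith : Real.cos (t j - z) * v (t j) = 0) with h | h
        · exact absurd h hc
        · exact h
      refine ⟨hvz, ?_⟩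
      have h3 : F' z = 0 := by
        have := sq_eq_of_antiperiodic hap' hs
        rw [hF' j] at this
        simpa using this.symm
      have h4 := hz2 (by rw [hderiv]; exact h3)
      rw [hderiv] at h4
      have h5 : deriv F' (t j) = 0 := by
        have := sq_eq_of_antiperiodic hap'' hs
        rw [h4] at this
        simpa using this
      have e3 := hF''v (t j)
      rw [h5, hs, hvz] at e3
      rcases mul_eq_zero.1 (by linarith : Real.cos (t j - z) * deriv v (t j) = 0) with h | h
      · exact absurd h hc
      · exact h
    · have hvz : v (t j) = 0 := (mul_eq_zero.1 e1.symm).resolve_left hs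
      refine ⟨hvz, ?_⟩
      rw [hvz, mul_zero, zero_add] at e2
      exact (mul_eq_zero.1 e2.symm).resolve_left hs
  have hqd : ∀ x, (trigDeriv n q x).re = -Real.sin (x - z) * v x + Real.cos (x - z) * deriv v x := by
    intro x
    have h1 : HasDerivAt (fun x => (trig n q x).re) (trigDeriv n q x).re x :=
      Complex.reCLM.hasFDerivAt.comp_hasDerivAt x (hasDerivAt_trig n q x)
    have h2 := (((hasDerivAt_id x).sub_const z).cos).fun_mul (hvd x)
    rw [show (fun x => (trig n q x).re) = fun x => Real.cos (x - z) * v x from funext hqv] at h1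
    rw [h1.unique h2]
    simp
  have hint : ∫ x in z..z + Real.pi, F' x * (trig n q x).re = 0 := by
    have hc := continuous_trig n q
    have hc' : Continuous F' := (contDiff_circF' (n := n) (t := t) (a := a) (b := b)).continuous
    rw [re_integral_mul _ _ ((by fun_prop : Continuous _).intervalIntegrable _ _),
      hFdef', integral_circF'_trig hq]
    have : (Real.pi / (2 * n) : ℂ) = ((Real.pi / (2 * n) : ℝ) : ℂ) := by push_cast; ring
    rw [this, Complex.re_ofReal_mul, Complex.re_sum]
    refine mul_eq_zero_of_right _ (Finset.sum_eq_zero fun j _ => ?_)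
    rw [Complex.sub_re, Complex.re_ofReal_mul, Complex.re_ofReal_mul, hqd, hqv, (hvt j).1,
      (hvt j).2]
    simp
  have hgc : Continuous fun x => -2 * F' (x + z) * v (x + z) := by
    have hc' : Continuous F' := (contDiff_circF' (n := n) (t := t) (a := a) (b := b)).continuous
    have := hv.continuous
    fun_prop
  obtain ⟨C, hC⟩ := isCompact_Icc.exists_bound_of_continuousOn (s := Icc 0 Real.pi) hgc.continuousOn
  have hzero : ∀ x ∈ Ioo 0 Real.pi, -(F (x + z)) ^ 2 = 0 := by
    refine eq_zero_of_integral_cos (f := fun x => -(F (x + z)) ^ 2) (C := C)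
      (g := fun x => -2 * F' (x + z) * v (x + z)) countable_empty ?_ ?_ hC
      (fun _ _ => hgc.intervalIntegrable _ _) ?_ ?_ ?_ ?_
    · have hc' : Continuous F := (contDiff_circF (n := n) (t := t) (a := a) (b := b)).continuous
      fun_prop
    · intro x _
      have h1 := (((hasDerivAt_circF (n := n) (t := t) (a := a) (b := b) (x + z)).comp_add_const
        x z).pow 2).neg
      refine h1.congr_deriv ?_
      have := hFv (x + z)
      rw [hFdef] at this
      simp only [add_sub_cancel_right] at this
      rw [this]
      push_cast
      ring
    · simp [hz]
    · rw [add_comm, hap, hz]; simp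
    · intro x; nlinarith [sq_nonneg (F (x + z))]
    · have h1 := intervalIntegral.integral_comp_add_right (a := 0) (b := Real.pi)
        (fun x => F' x * (trig n q x).re) z
      rw [zero_add, add_comm Real.pi, hint] at h1
      have h2 : ∀ x, -2 * F' (x + z) * v (x + z) * Real.cos x =
          -2 * (F' (x + z) * (trig n q (x + z)).re) := fun x => by
        rw [hqv, add_sub_cancel_right]
        ring
      simp only [h2]
      rw [intervalIntegral.integral_const_mul, h1, mul_zero]
  refine eq_zero_of_circF'_eq_zero hkn hsep countable_empty (z := z) (fun x hx _ => ?_) l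
  have : F =ᶠ[𝓝 x] fun _ => 0 := by
    filter_upwards [Ioo_mem_nhds hx.1 hx.2] with y hy
    have := hzero (y - z) ⟨by linarith [hy.1], by linarith [hy.2]⟩
    simpa using this
  rw [← hFdef', ← hderiv, this.deriv_eq, deriv_const]

end SineBeta

namespace SineBeta

open Polynomial Complex

lemma squareWave_sq {x : ℝ} (h : Real.sin x ≠ 0) : squareWave x ^ 2 = 1 := by
  unfold squareWave
  rcases lt_or_gt_of_ne h with h | h
  · rw [Real.sign_of_neg h]; norm_num
  · rw [Real.sign_of_pos h]; norm_num

lemma squareWave_of_sin_eq_zero {x : ℝ} (h : Real.sin x = 0) : squareWave x = 0 := by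
  simp [squareWave, h]

lemma squareWave_mul_sin (x : ℝ) : squareWave x * Real.sin x = |Real.sin x| := by
  unfold squareWave
  rcases lt_trichotomy (Real.sin x) 0 with h | h | h
  · rw [Real.sign_of_neg h, abs_of_neg h]; ring
  · simp [h]
  · rw [Real.sign_of_pos h, abs_of_pos h]; ring

lemma squareWave_eventuallyEq {x : ℝ} (h : Real.sin x ≠ 0) :
    squareWave =ᶠ[𝓝 x] fun _ => squareWave x := by
  rcases lt_or_gt_of_ne h with h | h
  · filter_upwards [Real.continuous_sin.continuousAt.eventually_lt continuousAt_const h] with y hy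
    simp only [squareWave, Real.sign_of_neg h, Real.sign_of_neg hy]
  · filter_upwards [continuousAt_const.eventually_lt Real.continuous_sin.continuousAt h] with y hy
    simp only [squareWave, Real.sign_of_pos h, Real.sign_of_pos hy]

lemma hasDerivAt_squareWave_sub {x y : ℝ} (h : Real.sin (x - y) ≠ 0) :
    HasDerivAt (fun x => squareWave (x - y)) 0 x := by
  have h1 : HasDerivAt squareWave 0 (x - y) :=
    (hasDerivAt_const (x - y) (squareWave (x - y))).congr_of_eventuallyEq (squareWave_eventuallyEq h)
  exact h1.comp_sub_const x y

lemma countable_sin_zeros {k : ℕ} (t : Fin k → ℝ) :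
    {x : ℝ | ∃ j, Real.sin (x - t j) = 0}.Countable := by
  have : {x : ℝ | ∃ j, Real.sin (x - t j) = 0} ⊆
      ⋃ j : Fin k, Set.range fun m : ℤ => t j + m * Real.pi := by
    rintro x ⟨j, hj⟩
    obtain ⟨m, hm⟩ := sin_sub_eq_zero_iff.1 hj
    exact Set.mem_iUnion.2 ⟨j, m, hm.symm⟩
  exact (Set.countable_iUnion fun j => Set.countable_range _).mono this

/-- The potential with jumps at the charges. -/
noncomputable def circG (n : ℕ) {k : ℕ} (t a b : Fin k → ℝ) (x : ℝ) : ℝ :=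
  circF n t a b x - Real.pi / (4 * n) * ∑ j, a j * squareWave (x - t j)

/-- The continuous version of the square of the potential. -/
noncomputable def circSq (n : ℕ) {k : ℕ} (t a b : Fin k → ℝ) (x : ℝ) : ℝ :=
  circG n t a b x ^ 2 + (Real.pi / (4 * n)) ^ 2 * ∑ j, a j ^ 2 * (1 - squareWave (x - t j) ^ 2)

section

variable {n k : ℕ} {t a b : Fin k → ℝ}

lemma circG_add_pi (x : ℝ) : circG n t a b (x + Real.pi) = -circG n t a b x := by
  have : ∀ j, squareWave (x + Real.pi - t j) = -squareWave (x - t j) := fun j => by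
    rw [show x + Real.pi - t j = x - t j + Real.pi by ring, squareWave_add_pi]
  simp only [circG, circF_add_pi, this, mul_neg, Finset.sum_neg_distrib]
  ring

lemma circSq_add_pi (x : ℝ) : circSq n t a b (x + Real.pi) = circSq n t a b x := by
  have : ∀ j, squareWave (x + Real.pi - t j) = -squareWave (x - t j) := fun j => by
    rw [show x + Real.pi - t j = x - t j + Real.pi by ring, squareWave_add_pi]
  simp only [circSq, circG_add_pi, this, neg_sq]

lemma integral_circG_trig {p : ℂ[X]} (hp : p.natDegree < 2 * n) (z : ℝ) :
    ∫ x in z..z + Real.pi, (circG n t a b x : ℂ) * trig n p x =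
      Real.pi / (2 * n) * ∑ j, (b j : ℂ) * trig n p (t j) := by
  have h : ∀ x, (circG n t a b x : ℂ) * trig n p x =
      ∑ j, ((a j : ℂ) * (((circE n (x - t j)
          - Real.pi / (4 * n) * squareWave (x - t j) : ℝ) : ℂ) * trig n p x)
        + (b j : ℂ) * ((circD n (x - t j) : ℂ) * trig n p x)) := by
    intro x
    simp only [circG, circF]
    push_cast
    rw [Finset.mul_sum, ← Finset.sum_sub_distrib, Finset.sum_mul]
    refine Finset.sum_congr rfl fun j _ => ?_
    ring
  simp only [h]
  have hc := continuous_trig n p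
  have h1 := (contDiff_circD n).continuous
  have h2 := (contDiff_circE n).continuous
  have hi : ∀ j, IntervalIntegrable (fun x => ((circE n (x - t j)
          - Real.pi / (4 * n) * squareWave (x - t j) : ℝ) : ℂ) * trig n p x) volume z
          (z + Real.pi) := by
    intro j
    refine IntervalIntegrable.mul_continuousOn ?_ hc.continuousOn
    have h3 : IntervalIntegrable (fun x => circE n (x - t j)
          - Real.pi / (4 * n) * squareWave (x - t j)) volume z (z + Real.pi) := by
      refine IntervalIntegrable.sub ((by fun_prop : Continuous _).intervalIntegrable _ _)
        (IntervalIntegrable.const_mul ?_ _)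
      have := (intervalIntegrable_squareWave (z - t j) (z + Real.pi - t j)).comp_sub_right (t j)
      simpa using this
    exact ⟨h3.1.ofReal, h3.2.ofReal⟩
  have hi' : ∀ j, IntervalIntegrable (fun x => (circD n (x - t j) : ℂ) * trig n p x) volume z
          (z + Real.pi) := fun j => (by fun_prop : Continuous _).intervalIntegrable _ _
  rw [intervalIntegral.integral_finsetSum, Finset.mul_sum]
  · refine Finset.sum_congr rfl fun j _ => ?_
    rw [intervalIntegral.integral_add ((hi j).const_mul _) ((hi' j).const_mul _),
      intervalIntegral.integral_const_mul,
      intervalIntegral.integral_const_mul, integral_circD_trig hp, integral_circE_sub_trig hp]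
    ring
  · intro j _
    exact ((hi j).const_mul _).add ((hi' j).const_mul _)

lemma hasDerivAt_circG {x : ℝ} (hx : ∀ j, Real.sin (x - t j) ≠ 0) :
    HasDerivAt (circG n t a b) (circF' n t a b x) x := by
  have h1 : HasDerivAt (fun x => ∑ j, a j * squareWave (x - t j)) (∑ j : Fin k, a j * 0) x :=
    HasDerivAt.fun_sum fun j _ => (hasDerivAt_squareWave_sub (hx j)).const_mul _
  have h2 := (hasDerivAt_circF (n := n) (t := t) (a := a) (b := b) x).sub
    (h1.const_mul (Real.pi / (4 * n)))
  refine h2.congr_deriv ?_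
  simp

lemma hasDerivAt_circSq {x : ℝ} (hx : ∀ j, Real.sin (x - t j) ≠ 0) :
    HasDerivAt (circSq n t a b) (2 * circG n t a b x * circF' n t a b x) x := by
  have h1 : HasDerivAt (fun x => ∑ j, a j ^ 2 * (1 - squareWave (x - t j) ^ 2))
      (∑ j : Fin k, a j ^ 2 * (-(2 * squareWave (x - t j) * 0))) x :=
    HasDerivAt.fun_sum fun j _ => by
      have := ((((hasDerivAt_squareWave_sub (hx j)).pow 2).const_sub 1).const_mul (a j ^ 2))
      refine this.congr_deriv ?_
      simp
  have h2 := ((hasDerivAt_circG (n := n) (a := a) (b := b) hx).pow 2).add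
    (h1.const_mul ((Real.pi / (4 * n)) ^ 2))
  refine h2.congr_deriv ?_
  simp

lemma circSq_eq_sq {x : ℝ} (hx : ∀ j, Real.sin (x - t j) ≠ 0) :
    circSq n t a b x = circG n t a b x ^ 2 := by
  have : ∀ j, squareWave (x - t j) ^ 2 = 1 := fun j => squareWave_sq (hx j)
  simp [circSq, this]

/-- The potential without the jump at one of the points. -/
noncomputable def circR (n : ℕ) {k : ℕ} (t a b : Fin k → ℝ) (l : Fin k) (x : ℝ) : ℝ :=
  circF n t a b x - Real.pi / (4 * n) * ∑ j ∈ Finset.univ.erase l, a j * squareWave (x - t j)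

lemma circG_eq_circR (l : Fin k) (x : ℝ) : circG n t a b x =
    circR n t a b l x - Real.pi / (4 * n) * a l * squareWave (x - t l) := by
  rw [circG, circR, ← Finset.add_sum_erase _ _ (Finset.mem_univ l)]
  ring

lemma hasDerivAt_circR {l : Fin k} {x : ℝ} (hx : ∀ j, j ≠ l → Real.sin (x - t j) ≠ 0) :
    HasDerivAt (circR n t a b l) (circF' n t a b x) x := by
  have h1 : HasDerivAt (fun x => ∑ j ∈ Finset.univ.erase l, a j * squareWave (x - t j))
      (∑ j ∈ Finset.univ.erase l, a j * 0) x :=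
    HasDerivAt.fun_sum fun j hj =>
      (hasDerivAt_squareWave_sub (hx j (Finset.ne_of_mem_erase hj))).const_mul _
  have h2 := (hasDerivAt_circF (n := n) (t := t) (a := a) (b := b) x).sub
    (h1.const_mul (Real.pi / (4 * n)))
  refine h2.congr_deriv ?_
  simp

lemma continuousAt_circSq {x : ℝ} (hsep : ∀ i j, i ≠ j → Real.sin (t i - t j) ≠ 0)
    (hG : ∀ x, (∃ j, Real.sin (x - t j) = 0) → circG n t a b x = 0) :
    ContinuousAt (circSq n t a b) x := by
  by_cases hS : ∃ l, Real.sin (x - t l) = 0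
  swap
  · push Not at hS
    exact (hasDerivAt_circSq hS).continuousAt
  obtain ⟨l, hl⟩ := hS
  have hne : ∀ j, j ≠ l → Real.sin (x - t j) ≠ 0 := by
    intro j hj h0
    obtain ⟨m, hm⟩ := sin_sub_eq_zero_iff.1 hl
    obtain ⟨m', hm'⟩ := sin_sub_eq_zero_iff.1 h0
    refine hsep j l hj (sin_sub_eq_zero_iff.2 ⟨m - m', ?_⟩)
    push_cast
    linarith
  set c := Real.pi / (4 * n) with hc
  have hR0 : circR n t a b l x = 0 := by
    have := circG_eq_circR (n := n) (t := t) (a := a) (b := b) l x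
    rw [hG x ⟨l, hl⟩, squareWave_of_sin_eq_zero hl] at this
    linarith
  have hRc : ContinuousAt (circR n t a b l) x := (hasDerivAt_circR hne).continuousAt
  have hform : circSq n t a b = fun x => (circR n t a b l x ^ 2
      + squareWave (x - t l) * (-2 * c * a l * circR n t a b l x)) + (c ^ 2 * a l ^ 2
      + c ^ 2 * ∑ j ∈ Finset.univ.erase l, a j ^ 2 * (1 - squareWave (x - t j) ^ 2)) := by
    funext y
    rw [circSq, circG_eq_circR l, ← Finset.add_sum_erase _ _ (Finset.mem_univ l)]
    ring
  rw [hform]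
  refine ContinuousAt.add (ContinuousAt.add (hRc.pow 2) ?_) (continuousAt_const.add
    (continuousAt_const.mul ?_))
  · have h0 : Tendsto (fun y => -2 * c * a l * circR n t a b l y) (𝓝 x) (𝓝 0) := by
      have h := hRc.tendsto.const_mul (-2 * c * a l)
      rw [hR0, mul_zero] at h
      exact h
    have : Tendsto (fun y => squareWave (y - t l) * (-2 * c * a l * circR n t a b l y)) (𝓝 x)
        (𝓝 0) := by
      rw [tendsto_zero_iff_abs_tendsto_zero] at h0 ⊢
      refine squeeze_zero (fun y => abs_nonneg _) (fun y => ?_) h0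
      simp only [Function.comp]
      rw [abs_mul]
      exact mul_le_of_le_one_left (abs_nonneg _) (abs_squareWave_le _)
    simpa [ContinuousAt, hR0] using this
  · refine tendsto_finsetSum _ fun j hj => ?_
    have := (hasDerivAt_squareWave_sub (hne j (Finset.ne_of_mem_erase hj))).continuousAt
    exact continuousAt_const.mul (continuousAt_const.sub (this.pow 2))

/-- At a maximum of the square of the potential located at a charge, the field has a double zero. -/
lemma factor_eq_zero_of_max {l : Fin k} {v : ℝ → ℝ} (hn : 0 < n)
    (hsep : ∀ i j, i ≠ j → Real.sin (t i - t j) ≠ 0)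
    (hcont : Continuous (circSq n t a b))
    (hG : circG n t a b (t l) = 0) (hmax : ∀ x, circSq n t a b x ≤ circSq n t a b (t l))
    (hpos : 0 < circSq n t a b (t l)) (hv : Continuous v)
    (hFv : ∀ x, circF' n t a b x = Real.sin (x - t l) * v x) : v (t l) = 0 := by
  have hne : ∀ j, j ≠ l → Real.sin (t l - t j) ≠ 0 := fun j hj => hsep l j (Ne.symm hj)
  set c := Real.pi / (4 * n) with hc
  have hcpos : 0 < c := by
    have : (0 : ℝ) < n := by exact_mod_cast hn
    have := Real.pi_pos
    positivity
  have hR0 : circR n t a b l (t l) = 0 := by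
    have := circG_eq_circR (n := n) (t := t) (a := a) (b := b) l (t l)
    rw [hG, squareWave_of_sin_eq_zero (by simp)] at this
    linarith
  have hRc : ContinuousAt (circR n t a b l) (t l) := (hasDerivAt_circR hne).continuousAt
  have hal : a l ≠ 0 := by
    intro h0
    rw [circSq, hG, ← Finset.add_sum_erase _ _ (Finset.mem_univ l), h0] at hpos
    rw [Finset.sum_eq_zero fun j hj => by
      rw [squareWave_sq (hne j (Finset.ne_of_mem_erase hj))]; ring] at hpos
    simp at hpos
  by_contra hvne
  -- the derivative near the charge
  have hlim : Tendsto (fun x => v x * (2 * circR n t a b l x * squareWave (x - t l) - 2 * c * a l))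
      (𝓝 (t l)) (𝓝 (v (t l) * (0 - 2 * c * a l))) := by
    refine hv.continuousAt.tendsto.mul (Tendsto.sub ?_ tendsto_const_nhds)
    have h0 : Tendsto (fun y => 2 * circR n t a b l y) (𝓝 (t l)) (𝓝 0) := by
      have h := hRc.tendsto.const_mul 2
      rw [hR0, mul_zero] at h
      exact h
    rw [tendsto_zero_iff_abs_tendsto_zero] at h0 ⊢
    refine squeeze_zero (fun y => abs_nonneg _) (fun y => ?_) h0
    simp only [Function.comp]
    rw [abs_mul]
    exact mul_le_of_le_one_right (abs_nonneg _) (abs_squareWave_le _)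
  have hsinj : ∀ᶠ x in 𝓝 (t l), ∀ j, j ≠ l → Real.sin (x - t j) ≠ 0 := by
    rw [eventually_all]
    intro j
    by_cases hj : j = l
    · simp [hj]
    · have : ContinuousAt (fun x => Real.sin (x - t j)) (t l) := by fun_prop
      filter_upwards [this.eventually_ne (hne j hj)] with x hx _ using hx
  have hder : ∀ᶠ x in 𝓝 (t l), x ≠ t l → Real.sin (x - t l) ≠ 0 ∧ HasDerivAt (circSq n t a b)
      (|Real.sin (x - t l)| *
        (v x * (2 * circR n t a b l x * squareWave (x - t l) - 2 * c * a l))) x := by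
    have hnear : ∀ᶠ x in 𝓝 (t l), |x - t l| < Real.pi := by
      have : ContinuousAt (fun x => |x - t l|) (t l) := by fun_prop
      exact this.eventually_lt continuousAt_const (by simpa using Real.pi_pos)
    filter_upwards [hsinj, hnear] with x hx hxn hxl
    have hs : Real.sin (x - t l) ≠ 0 := by
      intro h0
      rw [abs_lt] at hxn
      exact hxl (sub_eq_zero.1 ((Real.sin_eq_zero_iff_of_lt_of_lt hxn.1 hxn.2).1 h0))
    refine ⟨hs, ?_⟩
    have h1 : ∀ j, Real.sin (x - t j) ≠ 0 := fun j => by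
      by_cases hj : j = l
      · rw [hj]; exact hs
      · exact hx j hj
    refine (hasDerivAt_circSq h1).congr_deriv ?_
    rw [hFv, circG_eq_circR l]
    have e1 := squareWave_mul_sin (x - t l)
    have e2 := squareWave_sq hs
    rw [← e1]
    linear_combination (-(2 * circR n t a b l x * v x * Real.sin (x - t l))) * e2
  have hval : v (t l) * (0 - 2 * c * a l) ≠ 0 := by
    refine mul_ne_zero hvne ?_
    rw [zero_sub]
    exact neg_ne_zero.2 (mul_ne_zero (mul_ne_zero two_ne_zero hcpos.ne') hal)
  rcases lt_or_gt_of_ne hval with hneg | hpos'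
  · obtain ⟨e, he, hball⟩ := Metric.eventually_nhds_iff_ball.1
      (hder.and (hlim.eventually_lt tendsto_const_nhds hneg))
    have hanti : StrictAntiOn (circSq n t a b) (Icc (t l - e / 2) (t l)) := by
      refine strictAntiOn_of_deriv_neg (convex_Icc _ _) hcont.continuousOn fun x hx => ?_
      rw [interior_Icc] at hx
      have hx' := hball x (by rw [Metric.mem_ball, Real.dist_eq, abs_lt]; constructor <;>
        linarith [hx.1, hx.2])
      obtain ⟨h1, h2⟩ := hx'.1 hx.2.ne
      rw [h2.deriv]
      exact mul_neg_of_pos_of_neg (abs_pos.2 h1) hx'.2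
    have := hanti (left_mem_Icc.2 (by linarith)) (right_mem_Icc.2 (by linarith))
      (by linarith : t l - e / 2 < t l)
    exact absurd (hmax (t l - e / 2)) (not_le.2 this)
  · obtain ⟨e, he, hball⟩ := Metric.eventually_nhds_iff_ball.1
      (hder.and (hlim.eventually_const_lt hpos'))
    have hmono : StrictMonoOn (circSq n t a b) (Icc (t l) (t l + e / 2)) := by
      refine strictMonoOn_of_deriv_pos (convex_Icc _ _) hcont.continuousOn fun x hx => ?_
      rw [interior_Icc] at hx
      have hx' := hball x (by rw [Metric.mem_ball, Real.dist_eq, abs_lt]; constructor <;>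
        linarith [hx.1, hx.2])
      obtain ⟨h1, h2⟩ := hx'.1 hx.1.ne'
      rw [h2.deriv]
      exact mul_pos (abs_pos.2 h1) hx'.2
    have := hmono (left_mem_Icc.2 (by linarith)) (right_mem_Icc.2 (by linarith))
      (by linarith : t l < t l + e / 2)
    exact absurd (hmax (t l + e / 2)) (not_le.2 this)

/-- The circular kernel of orthogonal type is nondegenerate at distinct points. -/
theorem circ_nondegenerate_orthogonal (hkn : k ≤ n)
    (hsep : ∀ i j, i ≠ j → Real.sin (t i - t j) ≠ 0) (hG : ∀ i, circG n t a b (t i) = 0)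
    (hF' : ∀ i, circF' n t a b (t i) = 0) (l : Fin k) : a l = 0 ∧ b l = 0 := by
  have hn : 0 < n := by have := l.pos; omega
  have hG' : ∀ x, (∃ j, Real.sin (x - t j) = 0) → circG n t a b x = 0 := by
    rintro x ⟨j, hj⟩
    have := sq_eq_of_antiperiodic (circG_add_pi (n := n) (t := t) (a := a) (b := b)) hj
    rw [hG j] at this
    simpa using this
  have hcont : Continuous (circSq n t a b) :=
    continuous_iff_continuousAt.2 fun x => continuousAt_circSq hsep hG'
  set S : Set ℝ := {x : ℝ | ∃ j, Real.sin (x - t j) = 0} with hSdef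
  have hS : S.Countable := countable_sin_zeros t
  have hnS : ∀ x, x ∉ S → ∀ j, Real.sin (x - t j) ≠ 0 := fun x hx j hj => hx ⟨j, hj⟩
  have hSo : IsOpen {x : ℝ | ∀ j, Real.sin (x - t j) ≠ 0} := by
    simp only [Set.ofPred_forall]
    refine isOpen_iInter_of_finite fun j => ?_
    exact isOpen_ne_fun (by fun_prop) continuous_const
  have hper : Function.Periodic (circSq n t a b) Real.pi := circSq_add_pi
  have hnonneg : ∀ x, 0 ≤ circSq n t a b x := by
    intro x
    refine add_nonneg (sq_nonneg _) (mul_nonneg (sq_nonneg _) (Finset.sum_nonneg fun j _ =>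
      mul_nonneg (sq_nonneg _) ?_))
    have := abs_squareWave_le (x - t j)
    rw [sub_nonneg, sq_le_one_iff_abs_le_one]
    exact this
  -- a maximum which is either off the charges or at a charge
  obtain ⟨z, hmax, hz⟩ : ∃ z, (∀ x, circSq n t a b x ≤ circSq n t a b z) ∧
      (z ∉ S ∨ ∃ l, z = t l) := by
    obtain ⟨z, -, hz⟩ := isCompact_Icc.exists_isMaxOn (s := Icc 0 Real.pi)
      ⟨0, le_rfl, Real.pi_pos.le⟩ hcont.continuousOn
    have hmax : ∀ x, circSq n t a b x ≤ circSq n t a b z := by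
      intro x
      obtain ⟨y, hy, hxy⟩ := hper.exists_mem_Ico₀ Real.pi_pos x
      rw [hxy]
      exact hz ⟨hy.1, hy.2.le⟩
    by_cases hzS : z ∈ S
    · obtain ⟨l, hl⟩ := hzS
      obtain ⟨m, hm⟩ := sin_sub_eq_zero_iff.1 hl
      refine ⟨t l, fun x => ?_, Or.inr ⟨l, rfl⟩⟩
      have := hper.int_mul m (t l)
      rw [← this, ← hm]
      exact hmax x
    · exact ⟨z, hmax, Or.inl hzS⟩
  -- if the square is constant the field vanishes
  have hfinal : (∀ x ∈ Ioo z (z + Real.pi), circSq n t a b x = circSq n t a b z) →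
      a l = 0 ∧ b l = 0 := by
    intro hconst
    refine eq_zero_of_circF'_eq_zero hkn hsep hS (z := z) (fun x hx hxS => ?_) l
    have hd := hasDerivAt_circSq (n := n) (a := a) (b := b) (hnS x hxS)
    have heq : circSq n t a b =ᶠ[𝓝 x] fun _ => circSq n t a b z := by
      filter_upwards [Ioo_mem_nhds hx.1 hx.2] with y hy using hconst y hy
    have h0 : 2 * circG n t a b x * circF' n t a b x = 0 := by
      rw [← hd.deriv, heq.deriv_eq, deriv_const]
    by_cases hM : circSq n t a b z = 0
    · have hGe : circG n t a b =ᶠ[𝓝 x] fun _ => 0 := by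
        filter_upwards [heq, hSo.mem_nhds (hnS x hxS)] with y hy hyS
        rw [circSq_eq_sq hyS, hM] at hy
        simpa using hy
      rw [← (hasDerivAt_circG (n := n) (a := a) (b := b) (hnS x hxS)).deriv, hGe.deriv_eq,
        deriv_const]
    · have hGx : circG n t a b x ≠ 0 := by
        intro hg
        have := hconst x hx
        rw [circSq_eq_sq (hnS x hxS), hg] at this
        exact hM (by rw [← this]; simp)
      exact (mul_eq_zero.1 h0).resolve_left (mul_ne_zero two_ne_zero hGx)
  rcases (hnonneg z).eq_or_lt with hM | hM
  · exact hfinal fun x _ => le_antisymm (hmax x) (hM ▸ hnonneg x)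
  have hF'z : circF' n t a b z = 0 := by
    rcases hz with hz | ⟨l, rfl⟩
    · have hd := hasDerivAt_circSq (n := n) (a := a) (b := b) (hnS z hz)
      have h0 := (isMaxOn_univ_iff.2 hmax).isLocalMax univ_mem |>.hasDerivAt_eq_zero hd
      rw [circSq_eq_sq (hnS z hz)] at hM
      have : circG n t a b z ≠ 0 := fun h => by rw [h] at hM; norm_num at hM
      exact (mul_eq_zero.1 h0).resolve_left (mul_ne_zero two_ne_zero this)
    · exact hF' l
  obtain ⟨v, q, hv, hq, hFv, hqv⟩ := (isTrig_circF' (t := t) (a := a) (b := b) hn).exists_div hF'z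
  have hvt : ∀ j, v (t j) = 0 := by
    intro j
    by_cases hs : Real.sin (t j - z) = 0
    · rcases hz with hz | ⟨l, rfl⟩
      · exact absurd (by rw [← neg_sub, Real.sin_neg, hs, neg_zero]) (hnS z hz j)
      · by_cases hjl : j = l
        · rw [hjl]
          exact factor_eq_zero_of_max hn hsep hcont (hG l) hmax hM hv.continuous hFv
        · exact absurd hs (hsep j l hjl)
    · have := hFv (t j)
      rw [hF' j] at this
      exact (mul_eq_zero.1 this.symm).resolve_left hs
  have hGi : ∀ c d, IntervalIntegrable (circG n t a b) volume c d := by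
    intro c d
    refine ((contDiff_circF (n := n) (t := t) (a := a) (b := b)).continuous.intervalIntegrable
      c d).sub (IntervalIntegrable.const_mul ?_ _)
    have hfun : (fun x => ∑ j, a j * squareWave (x - t j)) =
        ∑ j, fun x => a j * squareWave (x - t j) := by
      funext x; rw [Finset.sum_apply]
    rw [hfun]
    refine IntervalIntegrable.sum _ fun j _ => IntervalIntegrable.const_mul ?_ _
    have := (intervalIntegrable_squareWave (c - t j) (d - t j)).comp_sub_right (t j)
    simpa using this
  have hint : ∫ x in z..z + Real.pi, circG n t a b x * (trig n q x).re = 0 := by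
    have hc := continuous_trig n q
    rw [re_integral_mul, integral_circG_trig hq]
    · have : (Real.pi / (2 * n) : ℂ) = ((Real.pi / (2 * n) : ℝ) : ℂ) := by push_cast; ring
      rw [this, Complex.re_ofReal_mul, Complex.re_sum]
      refine mul_eq_zero_of_right _ (Finset.sum_eq_zero fun j _ => ?_)
      rw [Complex.re_ofReal_mul, hqv, hvt j]
      simp
    · exact IntervalIntegrable.mul_continuousOn ⟨(hGi _ _).1.ofReal, (hGi _ _).2.ofReal⟩
        hc.continuousOn
  have hvc := hv.continuous
  have hFc : Continuous (circF n t a b) := contDiff_circF.continuous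
  obtain ⟨C₁, hC₁⟩ := isCompact_Icc.exists_bound_of_continuousOn (s := Icc 0 Real.pi)
    (f := fun x => circF n t a b (x + z)) (by fun_prop)
  obtain ⟨C₂, hC₂⟩ := isCompact_Icc.exists_bound_of_continuousOn (s := Icc 0 Real.pi)
    (f := fun x => v (x + z)) (by fun_prop)
  have hGb : ∀ x ∈ Icc 0 Real.pi, |circG n t a b (x + z)| ≤
      C₁ + |Real.pi / (4 * n)| * ∑ j, |a j| := by
    intro x hx
    refine (abs_sub _ _).trans (add_le_add (hC₁ x hx) ?_)
    rw [abs_mul]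
    refine mul_le_mul_of_nonneg_left ?_ (abs_nonneg _)
    refine (Finset.abs_sum_le_sum_abs _ _).trans (Finset.sum_le_sum fun j _ => ?_)
    rw [abs_mul]
    exact mul_le_of_le_one_right (abs_nonneg _) (abs_squareWave_le _)
  have hzero : ∀ x ∈ Ioo 0 Real.pi, circSq n t a b (x + z) - circSq n t a b z = 0 := by
    refine eq_zero_of_integral_cos (f := fun x => circSq n t a b (x + z) - circSq n t a b z)
      (C := 2 * (C₁ + |Real.pi / (4 * n)| * ∑ j, |a j|) * C₂)
      (g := fun x => 2 * circG n t a b (x + z) * v (x + z))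
      (S := (fun x => x + z) ⁻¹' S) (hS.preimage (add_left_injective z)) ?_ ?_ ?_ ?_ ?_ ?_ ?_ ?_
    · fun_prop
    · intro x hx
      have h1 := ((hasDerivAt_circSq (n := n) (a := a) (b := b)
        (hnS (x + z) hx)).comp_add_const x z).sub_const (circSq n t a b z)
      refine h1.congr_deriv ?_
      have := hFv (x + z)
      simp only [add_sub_cancel_right] at this
      rw [this]
      ring
    · intro x hx
      rw [abs_mul, abs_mul, abs_two]
      exact mul_le_mul (mul_le_mul_of_nonneg_left (hGb x hx) zero_le_two) (hC₂ x hx) (abs_nonneg _)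
        (mul_nonneg zero_le_two ((abs_nonneg _).trans (hGb x hx)))
    · intro c d
      have h1 := (hGi (c + z) (d + z)).comp_add_right z
      simp only [add_sub_cancel_right] at h1
      exact (h1.const_mul 2).mul_continuousOn (by fun_prop)
    · simp
    · rw [add_comm, circSq_add_pi, sub_self]
    · intro x; linarith [hmax (x + z)]
    · have h1 := intervalIntegral.integral_comp_add_right (a := 0) (b := Real.pi)
        (fun x => circG n t a b x * (trig n q x).re) z
      rw [zero_add, add_comm Real.pi, hint] at h1
      have h2 : ∀ x, 2 * circG n t a b (x + z) * v (x + z) * Real.cos x =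
          2 * (circG n t a b (x + z) * (trig n q (x + z)).re) := fun x => by
        rw [hqv, add_sub_cancel_right]
        ring
      simp only [h2]
      rw [intervalIntegral.integral_const_mul, h1, mul_zero]
  refine hfinal fun x hx => ?_
  have := hzero (x - z) ⟨by linarith [hx.1], by linarith [hx.2]⟩
  rw [sub_add_cancel] at this
  linarith

end

end SineBeta

namespace SineBeta

/-! ### The cardinal sine and the sine integral -/

lemma contDiff_sinc : ContDiff ℝ 2 Real.sinc := by
  rw [contDiff_iff_contDiffAt]
  intro x
  rcases eq_or_ne x 0 with rfl | hx
  · have h : AnalyticAt ℝ Real.sin 0 := Real.analyticAt_sin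
    obtain ⟨p, hp⟩ := h
    have : AnalyticAt ℝ (dslope Real.sin 0) 0 := ⟨_, hp.has_fpower_series_dslope_fslope⟩
    rw [← Real.sinc_eq_dslope] at this
    exact this.contDiffAt
  · have h : ContDiffAt ℝ 2 (fun y => Real.sin y / y) x :=
      Real.contDiff_sin.contDiffAt.div contDiffAt_id hx
    refine h.congr_of_eventuallyEq ?_
    filter_upwards [isOpen_ne.mem_nhds hx] with y hy
    exact Real.sinc_of_ne_zero hy

lemma differentiable_sinc : Differentiable ℝ Real.sinc := contDiff_sinc.differentiable (by norm_num)

lemma continuous_deriv_sinc : Continuous (deriv Real.sinc) :=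
  contDiff_sinc.continuous_deriv (by norm_num)

lemma mul_sinc (x : ℝ) : x * Real.sinc x = Real.sin x := by
  rcases eq_or_ne x 0 with rfl | hx
  · simp
  · rw [Real.sinc_of_ne_zero hx]; field_simp

lemma deriv_sinc {x : ℝ} (hx : x ≠ 0) : deriv Real.sinc x = Real.cos x / x - Real.sin x / x ^ 2 := by
  have h : HasDerivAt (fun y => Real.sin y / y) ((Real.cos x * x - Real.sin x * 1) / x ^ 2) x :=
    (Real.hasDerivAt_sin x).div (hasDerivAt_id x) hx
  have h2 : Real.sinc =ᶠ[𝓝 x] fun y => Real.sin y / y := by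
    filter_upwards [isOpen_ne.mem_nhds hx] with y hy
    exact Real.sinc_of_ne_zero hy
  rw [h2.deriv_eq, h.deriv]
  field_simp

lemma deriv_sinc_neg (x : ℝ) : deriv Real.sinc (-x) = -deriv Real.sinc x := by
  have h := deriv_comp_neg (f := Real.sinc) (x := x)
  have h2 : (fun x => Real.sinc (-x)) = Real.sinc := by funext y; exact Real.sinc_neg y
  rw [h2] at h
  linarith

/-- The sine integral. -/
noncomputable def sineIntegral (x : ℝ) : ℝ := ∫ t in (0 : ℝ)..x, Real.sinc t

lemma hasDerivAt_sineIntegral (x : ℝ) : HasDerivAt sineIntegral (Real.sinc x) x :=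
  Real.continuous_sinc.integral_hasStrictDerivAt 0 x |>.hasDerivAt

lemma sineIntegral_zero : sineIntegral 0 = 0 := by simp [sineIntegral]

lemma sineIntegral_neg (x : ℝ) : sineIntegral (-x) = -sineIntegral x := by
  have h := intervalIntegral.integral_comp_neg (a := 0) (b := x) (fun t => Real.sinc t)
  simp only [Real.sinc_neg, neg_zero] at h
  rw [sineIntegral, sineIntegral, h, intervalIntegral.integral_symm]

lemma continuous_sineIntegral : Continuous sineIntegral :=
  continuous_iff_continuousAt.2 fun x => (hasDerivAt_sineIntegral x).continuousAt

lemma integral_sinc_eq_sub (a b : ℝ) :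
    ∫ t in a..b, Real.sinc t = sineIntegral b - sineIntegral a :=
  intervalIntegral.integral_eq_sub_of_hasDerivAt (fun x _ => hasDerivAt_sineIntegral x)
    (Real.continuous_sinc.intervalIntegrable _ _)

lemma abs_sineIntegral_sub_le {x y : ℝ} (hx : 0 < x) (hxy : x ≤ y) :
    |sineIntegral y - sineIntegral x| ≤ 2 / x := by
  have hy : 0 < y := hx.trans_le hxy
  have hne : ∀ t ∈ uIcc x y, t ≠ 0 := fun t ht => by
    rw [uIcc_of_le hxy] at ht; exact (hx.trans_le ht.1).ne'
  have hcont : ContinuousOn (fun t : ℝ => Real.cos t / t ^ 2) (uIcc x y) :=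
    Real.continuous_cos.continuousOn.div (by fun_prop) fun t ht => pow_ne_zero 2 (hne t ht)
  have h1 : ∫ t in x..y, (Real.sinc t + Real.cos t / t ^ 2) = -Real.cos y / y - -Real.cos x / x := by
    refine intervalIntegral.integral_eq_sub_of_hasDerivAt (f := fun t => -Real.cos t / t)
      (fun t ht => ?_) ?_
    · have h : HasDerivAt (fun t => -Real.cos t / t)
          ((- -Real.sin t * t - (-Real.cos t) * 1) / t ^ 2) t :=
        ((Real.hasDerivAt_cos t).neg).div (hasDerivAt_id t) (hne t ht)
      refine h.congr_deriv ?_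
      rw [Real.sinc_of_ne_zero (hne t ht)]
      have := hne t ht
      field_simp
      ring
    · exact (Real.continuous_sinc.continuousOn.add hcont).intervalIntegrable
  rw [intervalIntegral.integral_add (Real.continuous_sinc.intervalIntegrable _ _)
    hcont.intervalIntegrable, integral_sinc_eq_sub] at h1
  have h2 : |∫ t in x..y, Real.cos t / t ^ 2| ≤ ∫ t in x..y, 1 / t ^ 2 := by
    rw [← Real.norm_eq_abs]
    refine intervalIntegral.norm_integral_le_of_norm_le hxy (ae_of_all _ fun t ht => ?_) ?_
    · have : 0 < t := hx.trans ht.1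
      rw [Real.norm_eq_abs, abs_div, abs_of_pos (by positivity : 0 < t ^ 2)]
      gcongr
      exact Real.abs_cos_le_one t
    · exact (continuousOn_const.div (by fun_prop)
        fun t ht => pow_ne_zero 2 (hne t ht)).intervalIntegrable
  have h3 : ∫ t in x..y, 1 / t ^ 2 = -1 / y - -1 / x := by
    refine intervalIntegral.integral_eq_sub_of_hasDerivAt (f := fun t => -1 / t)
      (fun t ht => ?_) ?_
    · have h := (hasDerivAt_const t (-1 : ℝ)).div (hasDerivAt_id t) (hne t ht)
      refine h.congr_deriv ?_
      simp
    · exact (continuousOn_const.div (by fun_prop)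
        fun t ht => pow_ne_zero 2 (hne t ht)).intervalIntegrable
  have h4 : |Real.cos y / y| ≤ 1 / y := by
    rw [abs_div, abs_of_pos hy]; gcongr; exact Real.abs_cos_le_one y
  have h5 : |Real.cos x / x| ≤ 1 / x := by
    rw [abs_div, abs_of_pos hx]; gcongr; exact Real.abs_cos_le_one x
  rw [h3] at h2
  have e1 : -1 / y = -(1 / y) := by ring
  have e2 : -1 / x = -(1 / x) := by ring
  have e3 : -Real.cos y / y = -(Real.cos y / y) := by ring
  have e4 : -Real.cos x / x = -(Real.cos x / x) := by ring
  have e5 : 2 / x = 1 / x + 1 / x := by ring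
  rw [e1, e2] at h2
  rw [e3, e4] at h1
  rw [e5]
  rw [abs_le] at *
  constructor <;> linarith [h2.1, h2.2, h4.1, h4.2, h5.1, h5.2]

lemma sin_mul_circD (n : ℕ) (t : ℝ) :
    2 * n * Real.sin t * circD n t = Real.sin (2 * n * t) := by
  rcases Nat.eq_zero_or_pos n with rfl | hn
  · simp
  have hn' : (n : ℝ) ≠ 0 := by positivity
  have h : ∀ m : ℕ, 2 * Real.sin t * ∑ j ∈ Finset.range m, Real.cos ((2 * j + 1) * t)
      = Real.sin (2 * m * t) := by
    intro m
    induction m with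
    | zero => simp
    | succ m ih =>
      rw [Finset.sum_range_succ, mul_add, ih]
      have e1 : 2 * ((m + 1 : ℕ) : ℝ) * t = (2 * m + 1) * t + t := by push_cast; ring
      have e2 : 2 * (m : ℝ) * t = (2 * m + 1) * t - t := by ring
      rw [e1, e2, Real.sin_add, Real.sin_sub]
      ring
  rw [circD, ← h n]
  generalize ∑ j ∈ Finset.range n, Real.cos ((2 * (j : ℝ) + 1) * t) = S
  field_simp

lemma abs_inv_sin_sub_inv_le {t : ℝ} (h0 : 0 < t) (h1 : t ≤ Real.pi / 2) :
    |1 / Real.sin t - 1 / t| ≤ 2 := by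
  have hs : 2 / Real.pi * t ≤ Real.sin t := Real.mul_le_sin h0.le h1
  have hpi := Real.pi_pos
  have hpi4 := Real.pi_lt_four
  have hs0 : 0 < Real.sin t := lt_of_lt_of_le (by positivity) hs
  have hle : Real.sin t ≤ t := Real.sin_le h0.le
  have hhalf : t / 2 ≤ Real.sin t := by
    refine le_trans ?_ hs
    have : (1 : ℝ) / 2 ≤ 2 / Real.pi := by
      rw [div_le_div_iff₀ (by norm_num) hpi]; linarith
    nlinarith
  have hcube : t - Real.sin t ≤ t ^ 2 := by
    rcases le_total t 1 with h | h
    · have := Real.sin_gt_sub_cube h0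
      nlinarith [sq_nonneg t, pow_pos h0 3]
    · nlinarith
  have e : 1 / Real.sin t - 1 / t = (t - Real.sin t) / (Real.sin t * t) := by field_simp
  rw [e, abs_of_nonneg (div_nonneg (by linarith) (by positivity)), div_le_iff₀ (by positivity)]
  nlinarith

lemma tendsto_integral_sin_mul {f : ℝ → ℝ} {b : ℝ} (hb : 0 ≤ b)
    (hf : IntervalIntegrable f volume 0 b) :
    Tendsto (fun n : ℕ => ∫ t in (0 : ℝ)..b, Real.sin (2 * n * t) * f t) atTop (𝓝 0) := by
  set g : ℝ → ℂ := (Ioc 0 b).indicator fun t => (f t : ℂ) with hg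
  have h := Real.tendsto_integral_exp_smul_cocompact g
  have hw : Tendsto (fun n : ℕ => (n : ℝ) / Real.pi) atTop (cocompact ℝ) :=
    (Tendsto.atTop_div_const Real.pi_pos tendsto_natCast_atTop_atTop).mono_right atTop_le_cocompact
  have h2 := h.comp hw
  have h3 := (Complex.continuous_im.tendsto _).comp h2
  rw [Complex.zero_im] at h3
  have h4 := h3.neg
  rw [neg_zero] at h4
  refine h4.congr fun n => ?_
  simp only [Function.comp]
  have hind : ∀ v : ℝ, (Real.fourierChar (-(v * (n / Real.pi)))) • g v =
      (Ioc 0 b).indicator (fun t : ℝ => Complex.exp (-(2 * n * t : ℝ) * Complex.I) * (f t : ℂ)) v := by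
    intro v
    rw [Circle.smul_def, Real.fourierChar_apply, hg]
    by_cases hv : v ∈ Ioc 0 b
    · rw [indicator_of_mem hv, indicator_of_mem hv, smul_eq_mul]
      congr 2
      have := Real.pi_ne_zero
      have : (Real.pi : ℂ) ≠ 0 := by exact_mod_cast this
      push_cast
      field_simp
    · rw [indicator_of_notMem hv, indicator_of_notMem hv, smul_zero]
  simp_rw [hind]
  rw [integral_indicator measurableSet_Ioc]
  have hint : IntegrableOn (fun t : ℝ => Complex.exp (-(2 * n * t : ℝ) * Complex.I) * (f t : ℂ))
      (Ioc 0 b) := by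
    have := (hf.1.ofReal (𝕜 := ℂ))
    refine Integrable.bdd_mul (c := 1) this (by fun_prop) (ae_of_all _ fun t => ?_)
    rw [← Complex.ofReal_neg, Complex.norm_exp_ofReal_mul_I]
  have him := (RCLike.imCLM (K := ℂ)).integral_comp_comm hint
  rw [intervalIntegral.integral_of_le hb]
  have e : ∀ z : ℂ, RCLike.imCLM (K := ℂ) z = z.im := fun z => rfl
  simp only [e] at him
  rw [← him, ← integral_neg]
  refine integral_congr_ae (ae_of_all _ fun t => ?_)
  simp only
  rw [mul_comm (Complex.exp _), Complex.im_ofReal_mul, ← Complex.ofReal_neg,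
    Complex.exp_ofReal_mul_I_im, Real.sin_neg]
  ring

lemma tendsto_sineIntegral_nat :
    Tendsto (fun n : ℕ => sineIntegral (n * Real.pi)) atTop (𝓝 (Real.pi / 2)) := by
  have hpi := Real.pi_pos
  set φ : ℝ → ℝ := fun t => 1 / Real.sin t - 1 / t with hφ
  have hφm : Measurable φ := by rw [hφ]; fun_prop
  have hφi : IntervalIntegrable φ volume 0 (Real.pi / 2) := by
    rw [intervalIntegrable_iff_integrableOn_Ioc_of_le (by positivity)]
    refine Measure.integrableOn_of_bounded (M := 2) (by simp) hφm.aestronglyMeasurable ?_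
    refine (ae_restrict_iff' measurableSet_Ioc).2 (ae_of_all _ fun t ht => ?_)
    exact abs_inv_sin_sub_inv_le ht.1 ht.2
  have h1 := tendsto_integral_sin_mul (b := Real.pi / 2) (by positivity) hφi
  have h2 := Real.tendsto_sum_pi_div_four
  have h3 := (h2.const_mul 2).sub h1
  rw [sub_zero, show 2 * (Real.pi / 4) = Real.pi / 2 by ring] at h3
  refine h3.congr' ?_
  filter_upwards [eventually_gt_atTop 0] with n hn
  have hn' : (n : ℝ) ≠ 0 := by positivity
  have hE : ∫ t in (0 : ℝ)..Real.pi / 2, 2 * n * circD n t =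
      2 * ∑ i ∈ Finset.range n, (-1 : ℝ) ^ i / (2 * i + 1) := by
    rw [intervalIntegral.integral_const_mul]
    simp only [circD]
    rw [intervalIntegral.integral_const_mul, intervalIntegral.integral_finsetSum]
    · have : ∀ i : ℕ, ∫ t in (0 : ℝ)..Real.pi / 2, Real.cos ((2 * i + 1) * t) =
          (-1 : ℝ) ^ i / (2 * i + 1) := by
        intro i
        have h0 : (2 * (i : ℝ) + 1) ≠ 0 := by positivity
        rw [intervalIntegral.integral_comp_mul_left (fun t => Real.cos t) h0, integral_cos]
        have : (2 * (i : ℝ) + 1) * (Real.pi / 2) = Real.pi / 2 + i * Real.pi := by ring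
        rw [this, Real.sin_add_nat_mul_pi, Real.sin_pi_div_two]
        simp
        field_simp
      simp_rw [this]
      field_simp
    · intro i _
      exact Continuous.intervalIntegrable (by fun_prop) _ _
  have hS : ∫ t in (0 : ℝ)..Real.pi / 2, 2 * n * Real.sinc (2 * n * t) = sineIntegral (n * Real.pi) := by
    rw [intervalIntegral.integral_const_mul, intervalIntegral.integral_comp_mul_left
      (fun t => Real.sinc t) (by positivity), sineIntegral]
    rw [mul_zero, show 2 * (n : ℝ) * (Real.pi / 2) = n * Real.pi by ring, smul_eq_mul]
    field_simp
  rw [← hE, ← hS, ← intervalIntegral.integral_sub]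
  · refine intervalIntegral.integral_congr_ae (ae_of_all _ fun t ht => ?_)
    rw [uIoc_of_le (by positivity)] at ht
    have ht0 : t ≠ 0 := ht.1.ne'
    have hs : Real.sin t ≠ 0 :=
      (Real.sin_pos_of_pos_of_lt_pi ht.1 (by linarith [ht.2])).ne'
    have hD := sin_mul_circD n t
    rw [Real.sinc_of_ne_zero (by positivity), ← hD, hφ]
    field_simp
    ring
  · refine Continuous.intervalIntegrable ?_ _ _
    unfold circD
    fun_prop
  · exact IntervalIntegrable.continuousOn_mul hφi (by fun_prop)

lemma abs_pi_div_two_sub_sineIntegral_le {x : ℝ} (hx : 0 < x) :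
    |Real.pi / 2 - sineIntegral x| ≤ 2 / x := by
  refine le_of_tendsto ((tendsto_sineIntegral_nat.sub_const (sineIntegral x)).abs) ?_
  have h : Tendsto (fun n : ℕ => (n : ℝ) * Real.pi) atTop atTop :=
    tendsto_natCast_atTop_atTop.atTop_mul_const Real.pi_pos
  filter_upwards [h.eventually_ge_atTop x] with n hn
  exact abs_sineIntegral_sub_le hx hn

lemma abs_sineIntegral_le (x : ℝ) : |sineIntegral x| ≤ 4 := by
  wlog hx : 0 ≤ x generalizing x
  · have := this (-x) (by linarith)
    rwa [sineIntegral_neg, abs_neg] at this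
  rcases le_or_gt x 1 with h1 | h1
  · have := intervalIntegral.norm_integral_le_of_norm_le_const (a := 0) (b := x)
      (f := Real.sinc) (C := 1) fun t _ => Real.abs_sinc_le_one t
    rw [Real.norm_eq_abs, sub_zero, abs_of_nonneg hx] at this
    rw [sineIntegral]
    linarith
  · have := abs_pi_div_two_sub_sineIntegral_le (x := x) (by linarith)
    have h2 : 2 / x ≤ 2 := by rw [div_le_iff₀ (by linarith)]; linarith
    have := Real.pi_lt_four
    have := Real.pi_pos
    rw [abs_le] at *
    constructor <;> linarith

lemma hasDerivAt_sineIntegral_two_mul_sub (x : ℝ) :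
    HasDerivAt (fun x => sineIntegral (2 * x) - x * Real.sinc x ^ 2) (Real.sinc x ^ 2) x := by
  have h1 : HasDerivAt (fun x => sineIntegral (2 * x)) (Real.sinc (2 * x) * (2 * 1)) x :=
    (hasDerivAt_sineIntegral (2 * x)).comp x ((hasDerivAt_id x).const_mul 2)
  have h2 : HasDerivAt (fun x => x * Real.sinc x ^ 2)
      (1 * Real.sinc x ^ 2 + x * (2 * Real.sinc x ^ (2 - 1) * deriv Real.sinc x)) x :=
    (hasDerivAt_id x).mul ((differentiable_sinc x).hasDerivAt.pow 2)
  refine (h1.sub h2).congr_deriv ?_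
  rcases eq_or_ne x 0 with rfl | hx
  · simp; norm_num
  · rw [deriv_sinc hx, Real.sinc_of_ne_zero hx, Real.sinc_of_ne_zero (by positivity),
      Real.sin_two_mul]
    simp only [Nat.add_one_sub_one, pow_one]
    field_simp
    ring

lemma integral_sinc_sq (x : ℝ) :
    ∫ t in (0 : ℝ)..x, Real.sinc t ^ 2 = sineIntegral (2 * x) - x * Real.sinc x ^ 2 := by
  rw [intervalIntegral.integral_eq_sub_of_hasDerivAt
    (fun t _ => hasDerivAt_sineIntegral_two_mul_sub t)
    ((Real.continuous_sinc.pow 2).intervalIntegrable _ _)]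
  simp [sineIntegral_zero]

end SineBeta

namespace SineBeta

/-! ### Positivity of the correlation functions -/

lemma continuous_qdet {n : ℕ} :
    Continuous fun Q : Fin n → Fin n → Matrix (Fin 2) (Fin 2) ℝ => qdet Q := by
  unfold qdet cycleScalar
  refine continuous_finsetSum _ fun σ _ => continuous_const.mul
    (continuous_finsetProd _ fun i _ => continuous_const.mul (Continuous.matrix_trace ?_))
  refine continuous_list_prod _ fun j _ => ?_
  fun_prop

/-- The kernel `[[s, s'], [∫ s - c sgn, s]]` with `s u = sinc (κ u)`. -/
noncomputable def sineKernel (κ c : ℝ) : PairKernel where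
  s u := Real.sinc (κ * u)
  d u := κ * deriv Real.sinc (κ * u)
  e u := sineIntegral (κ * u) / κ - c * Real.sign u
  s_neg u := by simp [mul_neg, Real.sinc_neg]
  d_neg u := by rw [mul_neg, deriv_sinc_neg]; ring
  e_neg u := by rw [mul_neg, sineIntegral_neg, Real.sign_neg]; ring
  s_zero := by simp

/-- The kernel of a circular ensemble. -/
noncomputable def circKernel (n : ℕ) (hn : n ≠ 0) (w c : ℝ) : PairKernel where
  s u := circD n (w * u)
  d u := w * circD' n (w * u)
  e u := circE n (w * u) / w - c * Real.sign u
  s_neg u := by simp [circD, mul_neg]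
  d_neg u := by simp [circD', mul_neg]
  e_neg u := by simp [circE, mul_neg, Real.sign_neg, neg_div]; ring
  s_zero := by simp [circD, hn]

lemma circKernel_nondegenerate {n : ℕ} {hn : n ≠ 0} {w c : ℝ} (hw : 0 < w)
    (hc : c = 0 ∨ c * w = Real.pi / (4 * n)) {k : ℕ} (hkn : k ≤ n) {x : Fin k → ℝ}
    (hx : Function.Injective x) (hsep : ∀ i j, w * |x i - x j| < Real.pi)
    {v : Fin k → Fin 2 → ℝ}
    (hv : ∀ i p, ∑ j, ∑ q, (circKernel n hn w c).mat (x i - x j) p q * v j q = 0) : v = 0 := by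
  have hpi := Real.pi_pos
  have hsep' : ∀ i j, |w * x i - w * x j| < Real.pi := fun i j => by
    rw [← mul_sub, abs_mul, abs_of_pos hw]; exact hsep i j
  have hsin : ∀ i j, i ≠ j → Real.sin (w * x i - w * x j) ≠ 0 := by
    intro i j hij h0
    have := (Real.sin_eq_zero_iff_of_lt_of_lt (abs_lt.1 (hsep' i j)).1 (abs_lt.1 (hsep' i j)).2).1 h0
    rw [← mul_sub] at this
    rcases mul_eq_zero.1 this with h | h
    · exact hw.ne' h
    · exact hij (hx (sub_eq_zero.1 h))
  have hsq : ∀ i j, squareWave (w * x i - w * x j) = Real.sign (x i - x j) := by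
    intro i j
    have h1 := hsep' i j
    rw [← mul_sub] at h1 ⊢
    rw [abs_lt] at h1
    rcases lt_trichotomy (x i - x j) 0 with h | h | h
    · rw [squareWave, Real.sign_of_neg h, Real.sign_of_neg]
      exact Real.sin_neg_of_neg_of_neg_pi_lt (mul_neg_of_pos_of_neg hw h) h1.1
    · simp [h, squareWave]
    · rw [squareWave, Real.sign_of_pos h, Real.sign_of_pos]
      exact Real.sin_pos_of_pos_of_lt_pi (mul_pos hw h) h1.2
  have h0 : ∀ i, circF' n (fun j => w * x j) (fun j => v j 0) (fun j => w * v j 1) (w * x i) = 0 := by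
    intro i
    rw [← hv i 0, circF']
    refine Finset.sum_congr rfl fun j _ => ?_
    simp [PairKernel.mat, circKernel, Fin.sum_univ_two, mul_sub]
    ring
  have h1 : ∀ i, circF n (fun j => w * x j) (fun j => v j 0) (fun j => w * v j 1) (w * x i)
      - c * w * ∑ j, v j 0 * squareWave (w * x i - w * x j) = 0 := by
    intro i
    have h := hv i 1
    have : circF n (fun j => w * x j) (fun j => v j 0) (fun j => w * v j 1) (w * x i)
      - c * w * ∑ j, v j 0 * squareWave (w * x i - w * x j)
        = w * ∑ j, ∑ q, (circKernel n hn w c).mat (x i - x j) 1 q * v j q := by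
      rw [circF, Finset.mul_sum, Finset.mul_sum, ← Finset.sum_sub_distrib]
      refine Finset.sum_congr rfl fun j _ => ?_
      simp only [hsq]
      simp [PairKernel.mat, circKernel, Fin.sum_univ_two, mul_sub]
      field_simp
      ring
    rw [this, h, mul_zero]
  have key : ∀ l, v l 0 = 0 ∧ w * v l 1 = 0 := by
    rcases hc with hc | hc
    · simp only [hc, zero_mul, sub_zero] at h1
      exact circ_nondegenerate hkn hsin h1 h0
    · refine circ_nondegenerate_orthogonal hkn hsin (fun i => ?_) h0
      rw [circG, ← hc]
      exact h1 i
  funext l q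
  have := key l
  fin_cases q
  · exact this.1
  · simpa [hw.ne'] using this.2

lemma circKernel_qdet_ne_zero {n : ℕ} {hn : n ≠ 0} {w c : ℝ} (hw : 0 < w)
    (hc : c = 0 ∨ c * w = Real.pi / (4 * n)) {k : ℕ} (h4 : 4 ≤ n) (hk : k = 2 ∨ k = 3 ∨ k = 4)
    {x : Fin k → ℝ} (hx : Function.Injective x) (hsep : ∀ i j, w * |x i - x j| < Real.pi) :
    qdet (fun i j => (circKernel n hn w c).mat (x i - x j)) ≠ 0 := by
  set K := circKernel n hn w c with hK
  have h2 : ∀ x : Fin 2 → ℝ, Function.Injective x → (∀ i j, w * |x i - x j| < Real.pi) →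
      K.r2 (x 0) (x 1) ≠ 0 := by
    intro x hx hs h0
    obtain ⟨v, hv, hv'⟩ := K.exists_null_two x h0
    exact hv (circKernel_nondegenerate hw hc (by omega) hx hs hv')
  have h3 : ∀ x : Fin 3 → ℝ, Function.Injective x → (∀ i j, w * |x i - x j| < Real.pi) →
      K.r3 (x 0) (x 1) (x 2) ≠ 0 := by
    intro x hx hs h0
    have := h2 (x ∘ Fin.castSucc) (hx.comp (Fin.castSucc_injective 2)) fun i j => hs _ _
    obtain ⟨v, hv, hv'⟩ := K.exists_null_three x this h0
    exact hv (circKernel_nondegenerate hw hc (by omega) hx hs hv')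
  rcases hk with rfl | rfl | rfl
  · rw [K.qdet_mat_two]; exact h2 x hx hsep
  · rw [K.qdet_mat_three]; exact h3 x hx hsep
  · rw [K.qdet_mat_four]
    intro h0
    have := h3 (x ∘ Fin.castSucc) (hx.comp (Fin.castSucc_injective 3)) fun i j => hsep _ _
    obtain ⟨v, hv, hv'⟩ := K.exists_null_four x this h0
    exact hv (circKernel_nondegenerate hw hc (by omega) hx hsep hv')

lemma circKernel_qdet_pos_of_dilation {n : ℕ} {hn : n ≠ 0} {w c : ℝ} (hw : 0 < w)
    (hc : c = 0 ∨ c * w = Real.pi / (4 * n)) {k : ℕ} (h4 : 4 ≤ n) (hk : k = 2 ∨ k = 3 ∨ k = 4)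
    {x : Fin k → ℝ} (hx : Function.Injective x) {R : ℝ} (hR : 1 ≤ R)
    (hsep : ∀ i j, w * (R * |x i - x j|) < Real.pi)
    (hpos : 0 < qdet (fun i j => (circKernel n hn w c).mat (R * (x i - x j)))) :
    0 < qdet (fun i j => (circKernel n hn w c).mat (x i - x j)) := by
  set K := circKernel n hn w c with hK
  by_contra hneg
  set f : ℝ → ℝ := fun r => qdet (fun i j => K.mat (r * (x i - x j))) with hf
  have hcont : ContinuousOn f (Icc 1 R) := by
    have : ∀ r ∈ Icc 1 R, f r = qdet (fun i j => !![circD n (w * (r * (x i - x j))),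
        w * circD' n (w * (r * (x i - x j)));
        circE n (w * (r * (x i - x j))) / w - c * Real.sign (x i - x j),
        circD n (w * (r * (x i - x j)))]) := by
      intro r hr
      have hr0 : 0 < r := by linarith [hr.1]
      have hs : ∀ u, Real.sign (r * u) = Real.sign u := fun u => by
        rcases lt_trichotomy u 0 with h | h | h
        · rw [Real.sign_of_neg h, Real.sign_of_neg (mul_neg_of_pos_of_neg hr0 h)]
        · simp [h]
        · rw [Real.sign_of_pos h, Real.sign_of_pos (mul_pos hr0 h)]
      simp only [hf, PairKernel.mat, hK, circKernel, hs]
    refine ContinuousOn.congr (Continuous.continuousOn ?_) this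
    refine continuous_qdet.comp (continuous_pi fun i => continuous_pi fun j => ?_)
    have hD := (contDiff_circD n).continuous
    have hD' := (contDiff_circD' n).continuous
    have hE := (contDiff_circE n).continuous
    refine continuous_matrix fun p q => ?_
    fin_cases p <;> fin_cases q <;> simp <;> fun_prop
  have h1 : f 1 ≤ 0 := by simpa [hf] using not_lt.1 hneg
  obtain ⟨r, hr, hr0⟩ := intermediate_value_Icc hR hcont ⟨h1, hpos.le⟩
  have hrp : 0 < r := by linarith [hr.1]
  refine circKernel_qdet_ne_zero (hn := hn) hw hc h4 hk (x := fun i => r * x i)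
    (fun i j hij => hx (mul_left_cancel₀ hrp.ne' hij)) (fun i j => ?_) ?_
  · refine lt_of_le_of_lt ?_ (hsep i j)
    rw [← mul_sub, abs_mul, abs_of_pos hrp]
    have := hr.2
    gcongr
  · rw [← hr0]
    simp only [hf, mul_sub, hK]

lemma sineKernel_tendsto_far {κ c u : ℝ} (hκ : 0 < κ) (hu : u ≠ 0) :
    Tendsto (fun r => (sineKernel κ c).mat (r * u)) atTop
      (𝓝 !![0, 0; (Real.pi / (2 * κ) - c) * Real.sign u, 0]) := by
  wlog hu' : 0 < u generalizing u
  · have h := this (u := -u) (by simpa using hu) (by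
      rcases lt_or_gt_of_ne hu with h | h
      · linarith
      · exact absurd h hu')
    refine tendsto_pi_nhds.2 fun p => tendsto_pi_nhds.2 fun q => ?_
    have hq := tendsto_pi_nhds.1 (tendsto_pi_nhds.1 h p) q
    fin_cases p <;> fin_cases q <;>
      simp [PairKernel.mat, PairKernel.s_neg, PairKernel.d_neg, PairKernel.e_neg,
        Real.sign_neg] at hq ⊢
    · exact hq
    · simpa using hq.neg
    · simpa using hq.neg
    · exact hq
  have ht : Tendsto (fun r : ℝ => κ * (r * u)) atTop atTop :=
    (tendsto_id.atTop_mul_const hu').const_mul_atTop hκ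
  have h1 : Tendsto (fun x : ℝ => 2 / x) atTop (𝓝 0) := tendsto_id.const_div_atTop 2
  have hs : Tendsto Real.sinc atTop (𝓝 0) := by
    refine squeeze_zero_norm' ?_ h1
    filter_upwards [eventually_gt_atTop 0] with x hx
    rw [Real.sinc_of_ne_zero hx.ne', Real.norm_eq_abs, abs_div, abs_of_pos hx]
    gcongr
    linarith [Real.abs_sin_le_one x]
  have hd : Tendsto (deriv Real.sinc) atTop (𝓝 0) := by
    refine squeeze_zero_norm' ?_ h1
    filter_upwards [eventually_ge_atTop 1] with x hx
    have hx0 : 0 < x := by linarith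
    have e : Real.cos x / x - Real.sin x / x ^ 2 = (Real.cos x - Real.sin x / x) / x := by
      field_simp
    rw [deriv_sinc hx0.ne', e, Real.norm_eq_abs, abs_div, abs_of_pos hx0]
    gcongr
    have h1 := Real.abs_cos_le_one x
    have h2 := Real.abs_sinc_le_one x
    rw [Real.sinc_of_ne_zero hx0.ne'] at h2
    rw [abs_le] at *
    constructor <;> linarith
  have he : Tendsto sineIntegral atTop (𝓝 (Real.pi / 2)) := by
    rw [tendsto_iff_norm_sub_tendsto_zero]
    refine squeeze_zero' (Eventually.of_forall fun _ => norm_nonneg _) ?_ h1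
    filter_upwards [eventually_gt_atTop 0] with x hx
    rw [norm_sub_rev]
    exact abs_pi_div_two_sub_sineIntegral_le hx
  refine tendsto_pi_nhds.2 fun p => tendsto_pi_nhds.2 fun q => ?_
  fin_cases p <;> fin_cases q
  · simpa [PairKernel.mat, sineKernel, Function.comp_def] using hs.comp ht
  · simpa [PairKernel.mat, sineKernel] using (hd.comp ht).const_mul κ
  · simp only [PairKernel.mat, sineKernel]
    rw [Real.sign_of_pos hu']
    have := ((he.comp ht).div_const κ).sub_const c
    simp only [Function.comp] at this
    have e : (Real.pi / (2 * κ) - c) * 1 = Real.pi / 2 / κ - c := by field_simp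
    rw [e]
    refine this.congr' ?_
    filter_upwards [eventually_gt_atTop 0] with r hr
    simp [Real.sign_of_pos (mul_pos hr hu')]
  · simpa [PairKernel.mat, sineKernel, Function.comp_def] using hs.comp ht

lemma qdet_nilpotent {k : ℕ} (hk : k = 2 ∨ k = 3 ∨ k = 4) (a : Fin k → Fin k → ℝ) :
    qdet (fun i j => if i = j then 1 else !![0, 0; a i j, 0]) = 1 := by
  rcases hk with rfl | rfl | rfl
  · simp [qdet_two, scal, Matrix.trace_fin_two]
  · simp [qdet_three, scal, Matrix.trace_fin_two]
  · simp [qdet_four, scal, Matrix.trace_fin_two]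

lemma sineKernel_qdet_tendsto_far {κ c : ℝ} (hκ : 0 < κ) {k : ℕ} (hk : k = 2 ∨ k = 3 ∨ k = 4)
    {x : Fin k → ℝ} (hx : Function.Injective x) :
    Tendsto (fun r => qdet (fun i j => (sineKernel κ c).mat (r * (x i - x j)))) atTop (𝓝 1) := by
  rw [← qdet_nilpotent hk fun i j => (Real.pi / (2 * κ) - c) * Real.sign (x i - x j)]
  refine (continuous_qdet.tendsto _).comp
    (tendsto_pi_nhds.2 fun i => tendsto_pi_nhds.2 fun j => ?_)
  by_cases hij : i = j
  · subst hij
    have h := (sineKernel κ c).mat_zero (x i)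
    simp only [sub_self] at h
    simp [h]
  · simp only [hij, if_false]
    exact sineKernel_tendsto_far hκ (sub_ne_zero.2 fun h => hij (hx h))

lemma abs_circD_le (n : ℕ) (t : ℝ) : |circD n t| ≤ 1 := by
  rcases Nat.eq_zero_or_pos n with rfl | hn
  · simp [circD]
  have hn' : (0 : ℝ) < n := by positivity
  rw [circD, abs_mul, abs_of_pos (by positivity : (0 : ℝ) < 1 / n)]
  have : |∑ j ∈ Finset.range n, Real.cos ((2 * j + 1) * t)| ≤ n := by
    refine (Finset.abs_sum_le_sum_abs _ _).trans ?_
    refine (Finset.sum_le_sum fun j _ => Real.abs_cos_le_one _).trans ?_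
    simp
  calc 1 / (n : ℝ) * _ ≤ 1 / n * n := by gcongr
    _ = 1 := by field_simp

lemma circD'_mul_sin (n : ℕ) (hn : n ≠ 0) (t : ℝ) :
    circD' n t * Real.sin t = Real.cos (2 * n * t) - Real.cos t * circD n t := by
  have h1 : HasDerivAt (fun t => 2 * n * Real.sin t * circD n t)
      (2 * n * Real.cos t * circD n t + 2 * n * Real.sin t * circD' n t) t :=
    ((Real.hasDerivAt_sin t).const_mul _).mul (hasDerivAt_circD n t)
  have h2 : HasDerivAt (fun t => Real.sin (2 * n * t)) (Real.cos (2 * n * t) * (2 * n * 1)) t :=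
    (Real.hasDerivAt_sin _).comp t ((hasDerivAt_id t).const_mul _)
  have h3 : (fun t => 2 * n * Real.sin t * circD n t) = fun t => Real.sin (2 * n * t) :=
    funext (sin_mul_circD n)
  rw [h3] at h1
  have := h1.unique h2
  have hn' : (n : ℝ) ≠ 0 := by exact_mod_cast hn
  have h4 : (2 * n : ℝ) * (circD' n t * Real.sin t) =
      2 * n * (Real.cos (2 * n * t) - Real.cos t * circD n t) := by linarith
  exact mul_left_cancel₀ (by positivity) h4

section limit

variable {κ : ℝ}

lemma tendsto_sin_scaled (hκ : 0 < κ) (u : ℝ) :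
    Tendsto (fun n : ℕ => 2 * n * Real.sin (κ / (2 * n) * u)) atTop (𝓝 (κ * u)) := by
  have h0 : Tendsto (fun n : ℕ => κ / (2 * n) * u) atTop (𝓝 0) := by
    have : Tendsto (fun n : ℕ => 2 * (n : ℝ)) atTop atTop :=
      tendsto_natCast_atTop_atTop.const_mul_atTop (by norm_num)
    simpa using (this.const_div_atTop κ).mul_const u
  have h1 := (Real.continuous_sinc.tendsto 0).comp h0
  have h2 := h1.const_mul (κ * u)
  rw [Real.sinc_zero, mul_one] at h2
  refine h2.congr' ?_
  filter_upwards [eventually_gt_atTop 0] with n hn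
  have hn' : (0 : ℝ) < n := by positivity
  simp only [Function.comp]
  rw [← mul_sinc]
  field_simp

lemma tendsto_circD_scaled (hκ : 0 < κ) (u : ℝ) :
    Tendsto (fun n : ℕ => circD n (κ / (2 * n) * u)) atTop (𝓝 (Real.sinc (κ * u))) := by
  rcases eq_or_ne u 0 with rfl | hu
  · refine tendsto_const_nhds.congr' ?_
    filter_upwards [eventually_gt_atTop 0] with n hn
    have hn' : (n : ℝ) ≠ 0 := by positivity
    simp [circD, hn']
  · have h := tendsto_sin_scaled hκ u
    have hne : κ * u ≠ 0 := by positivity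
    rw [Real.sinc_of_ne_zero hne]
    refine ((tendsto_const_nhds (x := Real.sin (κ * u))).div h hne).congr' ?_
    filter_upwards [eventually_gt_atTop 0, h.eventually_ne hne] with n hn hn2
    have hn' : (n : ℝ) ≠ 0 := by positivity
    have := sin_mul_circD n (κ / (2 * n) * u)
    rw [show 2 * (n : ℝ) * (κ / (2 * n) * u) = κ * u by field_simp] at this
    rw [Pi.div_apply, div_eq_iff hn2, ← this]
    ring

lemma tendsto_circD'_scaled (hκ : 0 < κ) (u : ℝ) :
    Tendsto (fun n : ℕ => κ / (2 * n) * circD' n (κ / (2 * n) * u)) atTop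
      (𝓝 (κ * deriv Real.sinc (κ * u))) := by
  rcases eq_or_ne u 0 with rfl | hu
  · have : deriv Real.sinc 0 = 0 := by have := deriv_sinc_neg 0; simp at this; linarith
    simp [circD', this]
  · have h := tendsto_sin_scaled hκ u
    have hne : κ * u ≠ 0 := by positivity
    have h0 : Tendsto (fun n : ℕ => κ / (2 * n) * u) atTop (𝓝 0) := by
      have : Tendsto (fun n : ℕ => 2 * (n : ℝ)) atTop atTop :=
        tendsto_natCast_atTop_atTop.const_mul_atTop (by norm_num)
      simpa using (this.const_div_atTop κ).mul_const u
    have hcos := (Real.continuous_cos.tendsto 0).comp h0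
    have h1 := ((tendsto_const_nhds (x := Real.cos (κ * u))).sub
      (hcos.mul (tendsto_circD_scaled hκ u))).div h hne
    have h2 := h1.const_mul κ
    have e : κ * ((Real.cos (κ * u) - Real.cos 0 * Real.sinc (κ * u)) / (κ * u)) =
        κ * deriv Real.sinc (κ * u) := by
      rw [deriv_sinc hne, Real.sinc_of_ne_zero hne, Real.cos_zero]
      field_simp
    rw [e] at h2
    refine h2.congr' ?_
    filter_upwards [eventually_gt_atTop 0, h.eventually_ne hne] with n hn hn2
    have hn' : (n : ℝ) ≠ 0 := by positivity
    have hn'' : n ≠ 0 := by omega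
    have := circD'_mul_sin n hn'' (κ / (2 * n) * u)
    rw [show 2 * (n : ℝ) * (κ / (2 * n) * u) = κ * u by field_simp] at this
    simp only [Pi.div_apply, Function.comp]
    rw [← this]
    have h3 : Real.sin (κ / (2 * n) * u) ≠ 0 := fun h => hn2 (by rw [h]; ring)
    have h4 : ∀ a b : ℝ, b ≠ 0 → κ * (a * b / (2 * n * b)) = κ / (2 * n) * a := by
      intro a b hb
      field_simp
    exact h4 _ _ h3

lemma tendsto_circE_scaled (hκ : 0 < κ) (u : ℝ) :
    Tendsto (fun n : ℕ => circE n (κ / (2 * n) * u) / (κ / (2 * n))) atTop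
      (𝓝 (sineIntegral (κ * u) / κ)) := by
  have e1 : sineIntegral (κ * u) / κ = ∫ v in (0 : ℝ)..u, Real.sinc (κ * v) := by
    rw [intervalIntegral.integral_comp_mul_left (fun t => Real.sinc t) hκ.ne', mul_zero,
      sineIntegral, smul_eq_mul]
    field_simp
  rw [e1]
  have h : Tendsto (fun n : ℕ => ∫ v in (0 : ℝ)..u, circD n (κ / (2 * n) * v)) atTop
      (𝓝 (∫ v in (0 : ℝ)..u, Real.sinc (κ * v))) := by
    refine intervalIntegral.tendsto_integral_filter_of_dominated_convergence (fun _ => 1)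
      (Eventually.of_forall fun n => ?_) (Eventually.of_forall fun n => ?_) (by simp) ?_
    · have := (contDiff_circD n).continuous
      exact (by fun_prop : Continuous fun v => circD n (κ / (2 * n) * v)).aestronglyMeasurable
    · exact ae_of_all _ fun v _ => abs_circD_le n _
    · exact ae_of_all _ fun v _ => tendsto_circD_scaled hκ v
  refine h.congr' ?_
  filter_upwards [eventually_gt_atTop 0] with n hn
  have hn' : (0 : ℝ) < n := by positivity
  have hw : κ / (2 * n) ≠ 0 := by positivity
  rw [intervalIntegral.integral_comp_mul_left (fun t => circD n t) hw, mul_zero,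
    intervalIntegral.integral_eq_sub_of_hasDerivAt (fun t _ => hasDerivAt_circE n t)
    ((contDiff_circD n).continuous.intervalIntegrable _ _)]
  have : circE n 0 = 0 := by simp [circE]
  rw [this, smul_eq_mul, sub_zero]
  field_simp

/-- The circular kernel scaled to unit density. -/
noncomputable def scaledKernel (κ c : ℝ) (n : ℕ) : PairKernel :=
  circKernel (n + 1) n.succ_ne_zero (κ / (2 * (n + 1 : ℕ))) c

lemma scaledKernel_tendsto (hκ : 0 < κ) (c u : ℝ) :
    Tendsto (fun n => (scaledKernel κ c n).mat u) atTop (𝓝 ((sineKernel κ c).mat u)) := by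
  have hs := (tendsto_circD_scaled hκ u).comp (tendsto_add_atTop_nat 1)
  have hd := (tendsto_circD'_scaled hκ u).comp (tendsto_add_atTop_nat 1)
  have he := ((tendsto_circE_scaled hκ u).comp (tendsto_add_atTop_nat 1)).sub_const
    (c * Real.sign u)
  refine tendsto_pi_nhds.2 fun p => tendsto_pi_nhds.2 fun q => ?_
  fin_cases p <;> fin_cases q
  · exact hs
  · exact hd
  · exact he
  · exact hs

lemma scaledKernel_qdet_tendsto (hκ : 0 < κ) (c : ℝ) {k : ℕ} (u : Fin k → Fin k → ℝ) :
    Tendsto (fun n => qdet fun i j => (scaledKernel κ c n).mat (u i j)) atTop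
      (𝓝 (qdet fun i j => (sineKernel κ c).mat (u i j))) :=
  (continuous_qdet.tendsto _).comp (tendsto_pi_nhds.2 fun i => tendsto_pi_nhds.2 fun j =>
    scaledKernel_tendsto hκ c (u i j))

/-- The correlation functions of the sine kernels are nonnegative. -/
theorem sineKernel_qdet_nonneg (hκ : 0 < κ) {c : ℝ} (hc : c = 0 ∨ c = Real.pi / (2 * κ)) {k : ℕ}
    (hk : k = 2 ∨ k = 3 ∨ k = 4) {x : Fin k → ℝ} (hx : Function.Injective x) :
    0 ≤ qdet fun i j => (sineKernel κ c).mat (x i - x j) := by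
  obtain ⟨R, hR, hR1⟩ := (((sineKernel_qdet_tendsto_far (c := c) hκ hk hx).eventually_const_lt
    zero_lt_one).and (eventually_ge_atTop 1)).exists
  refine ge_of_tendsto (scaledKernel_qdet_tendsto hκ c fun i j => x i - x j) ?_
  have h1 := (scaledKernel_qdet_tendsto hκ c fun i j => R * (x i - x j)).eventually_const_lt hR
  have h2 : ∀ᶠ n : ℕ in atTop, ∀ i j,
      κ / (2 * (n + 1 : ℕ)) * (R * |x i - x j|) < Real.pi := by
    rw [eventually_all]; intro i
    rw [eventually_all]; intro j
    have ht : Tendsto (fun n : ℕ => κ / (2 * (n + 1 : ℕ)) * (R * |x i - x j|)) atTop (𝓝 0) := by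
      have : Tendsto (fun n : ℕ => 2 * ((n + 1 : ℕ) : ℝ)) atTop atTop :=
        (tendsto_natCast_atTop_atTop.comp (tendsto_add_atTop_nat 1)).const_mul_atTop (by norm_num)
      simpa using (this.const_div_atTop κ).mul_const (R * |x i - x j|)
    exact ht.eventually_lt_const Real.pi_pos
  filter_upwards [h1, h2, eventually_ge_atTop 3] with n h1 h2 h3
  refine (circKernel_qdet_pos_of_dilation (n := n + 1) (by positivity) ?_ (by omega) hk hx hR1 h2
    h1).le
  rcases hc with hc | hc
  · exact Or.inl hc
  · right
    rw [hc]
    push_cast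
    field_simp
    norm_num

end limit

end SineBeta

namespace SineBeta

/-! ### Decay of the kernels -/

/-- The weight `1 / (1 + |u|)`. -/
noncomputable def decay (u : ℝ) : ℝ := 1 / (1 + |u|)

lemma decay_pos (u : ℝ) : 0 < decay u := by unfold decay; positivity

lemma decay_le_one (u : ℝ) : decay u ≤ 1 := by
  unfold decay
  rw [div_le_one (by positivity)]
  linarith [abs_nonneg u]

lemma decay_neg (u : ℝ) : decay (-u) = decay u := by simp [decay]

lemma decay_sub_comm (x y : ℝ) : decay (x - y) = decay (y - x) := by rw [← decay_neg, neg_sub]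

lemma continuous_decay : Continuous decay := by
  unfold decay
  exact continuous_const.div (by fun_prop) fun u => by positivity

lemma exists_le_decay {f : ℝ → ℝ} {A B : ℝ} (hB : ∀ u, |u| ≤ 1 → |f u| ≤ B)
    (hA : ∀ u, 1 ≤ |u| → |f u| ≤ A / |u|) : ∃ C, 0 ≤ C ∧ ∀ u, |f u| ≤ C * decay u := by
  refine ⟨2 * |A| + 2 * |B|, by positivity, fun u => ?_⟩
  have h1 := abs_nonneg u
  have hA' := le_abs_self A
  have hB' := le_abs_self B
  rw [decay, mul_one_div, le_div_iff₀ (by positivity)]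
  rcases le_total |u| 1 with h | h
  · have := hB u h
    nlinarith [abs_nonneg A, abs_nonneg B, abs_nonneg (f u)]
  · have h0 : 0 < |u| := by linarith
    have := hA u h
    rw [le_div_iff₀ h0] at this
    nlinarith [abs_nonneg A, abs_nonneg B, abs_nonneg (f u)]

lemma exists_le_decay_of_continuous {f : ℝ → ℝ} {A : ℝ} (hf : Continuous f)
    (hA : ∀ u, 1 ≤ |u| → |f u| ≤ A / |u|) : ∃ C, 0 ≤ C ∧ ∀ u, |f u| ≤ C * decay u := by
  obtain ⟨B, hB⟩ := (isCompact_Icc (a := (-1 : ℝ)) (b := 1)).exists_bound_of_continuousOn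
    hf.continuousOn
  exact exists_le_decay (fun u hu => hB u (abs_le.1 hu)) hA

lemma abs_sinc_le_inv {x : ℝ} (hx : x ≠ 0) : |Real.sinc x| ≤ 1 / |x| := by
  rw [Real.sinc_of_ne_zero hx, abs_div]
  gcongr
  exact Real.abs_sin_le_one x

lemma abs_deriv_sinc_le {x : ℝ} (hx : x ≠ 0) : |deriv Real.sinc x| ≤ 2 / |x| := by
  have e : deriv Real.sinc x = (Real.cos x - Real.sinc x) / x := by
    rw [deriv_sinc hx, Real.sinc_of_ne_zero hx]; field_simp
  rw [e, abs_div]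
  gcongr
  refine (abs_sub _ _).trans ?_
  linarith [Real.abs_cos_le_one x, Real.abs_sinc_le_one x]

lemma sign_mul_of_pos {r : ℝ} (hr : 0 < r) (u : ℝ) : Real.sign (r * u) = Real.sign u := by
  rcases lt_trichotomy u 0 with h | h | h
  · rw [Real.sign_of_neg h, Real.sign_of_neg (mul_neg_of_pos_of_neg hr h)]
  · simp [h]
  · rw [Real.sign_of_pos h, Real.sign_of_pos (mul_pos hr h)]

lemma measurable_sign : Measurable Real.sign := by
  unfold Real.sign
  exact Measurable.ite measurableSet_Iio measurable_const
    (Measurable.ite measurableSet_Ioi measurable_const measurable_const)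

/-- The analytic properties of the sine kernels on which the variance estimate relies. -/
structure PairKernel.IsAdmissible (K : PairKernel) : Prop where
  measurable_s : Measurable K.s
  measurable_d : Measurable K.d
  measurable_e : Measurable K.e
  s_le : ∃ C, 0 ≤ C ∧ ∀ u, |K.s u| ≤ C * decay u
  d_le : ∃ C, 0 ≤ C ∧ ∀ u, |K.d u| ≤ C * decay u
  e_le : ∃ C, 0 ≤ C ∧ ∀ u, |K.e u| ≤ C
  continuous_T : Continuous K.T
  mass : ∃ C, 0 ≤ C ∧ ∀ u, 0 ≤ u → |1 / 2 - ∫ v in (0 : ℝ)..u, K.T v| ≤ C * decay u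
  e_decay_or_deriv : (∃ C, 0 ≤ C ∧ ∀ u, |K.e u| ≤ C * decay u) ∨
    ((∀ u, HasDerivAt K.s (K.d u) u) ∧ (∀ u, HasDerivAt K.e (K.s u) u) ∧ Continuous K.d)
  r2_nonneg : ∀ x : Fin 2 → ℝ, Function.Injective x → 0 ≤ K.r2 (x 0) (x 1)
  r3_nonneg : ∀ x : Fin 3 → ℝ, Function.Injective x → 0 ≤ K.r3 (x 0) (x 1) (x 2)
  r4_nonneg : ∀ x : Fin 4 → ℝ, Function.Injective x → 0 ≤ K.r4 (x 0) (x 1) (x 2) (x 3)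

section sine

variable {κ c : ℝ}

lemma hasDerivAt_sinc_mul (κ u : ℝ) :
    HasDerivAt (fun u => Real.sinc (κ * u)) (κ * deriv Real.sinc (κ * u)) u := by
  have h : HasDerivAt (fun u : ℝ => κ * u) (κ * 1) u := (hasDerivAt_id u).const_mul κ
  have := (differentiable_sinc (κ * u)).hasDerivAt.comp u h
  exact this.congr_deriv (by ring)

lemma hasDerivAt_sineIntegral_mul (hκ : 0 < κ) (u : ℝ) :
    HasDerivAt (fun u => sineIntegral (κ * u) / κ) (Real.sinc (κ * u)) u := by
  have h : HasDerivAt (fun u : ℝ => κ * u) (κ * 1) u := (hasDerivAt_id u).const_mul κ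
  have := ((hasDerivAt_sineIntegral (κ * u)).comp u h).div_const κ
  exact this.congr_deriv (by field_simp)

lemma exists_sinc_le (hκ : 0 < κ) : ∃ C, 0 ≤ C ∧ ∀ u, |Real.sinc (κ * u)| ≤ C * decay u := by
  refine exists_le_decay_of_continuous (A := 1 / κ)
    (Real.continuous_sinc.comp (by fun_prop : Continuous fun u => κ * u)) fun u hu => ?_
  have hu0 : u ≠ 0 := fun h => by norm_num [h] at hu
  refine (abs_sinc_le_inv (by positivity)).trans (le_of_eq ?_)
  rw [abs_mul, abs_of_pos hκ]
  field_simp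

lemma abs_sineIntegral_sub_sign_le {x : ℝ} (hx : x ≠ 0) :
    |sineIntegral x - Real.pi / 2 * Real.sign x| ≤ 2 / |x| := by
  rcases lt_or_gt_of_ne hx with h | h
  · have := abs_pi_div_two_sub_sineIntegral_le (x := -x) (by linarith)
    rw [sineIntegral_neg] at this
    rw [Real.sign_of_neg h, abs_of_neg h]
    convert this using 2
    ring
  · have := abs_pi_div_two_sub_sineIntegral_le h
    rw [Real.sign_of_pos h, abs_of_pos h, abs_sub_comm]
    convert this using 2
    ring

lemma integral_sinc_mul_sq (hκ : 0 < κ) (u : ℝ) : ∫ v in (0 : ℝ)..u, Real.sinc (κ * v) ^ 2 =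
    (sineIntegral (2 * (κ * u)) - κ * u * Real.sinc (κ * u) ^ 2) / κ := by
  rw [intervalIntegral.integral_comp_mul_left (fun t => Real.sinc t ^ 2) hκ.ne', mul_zero,
    integral_sinc_sq, smul_eq_mul]
  field_simp

lemma exists_remainder_le (hκ : 0 < κ) : ∃ C, 0 ≤ C ∧ ∀ u, 0 ≤ u →
    |Real.pi / (2 * κ) - ∫ v in (0 : ℝ)..u, Real.sinc (κ * v) ^ 2| ≤ C * decay u := by
  have hcont : Continuous fun u : ℝ => Real.pi / (2 * κ) -
      ∫ v in (0 : ℝ)..|u|, Real.sinc (κ * v) ^ 2 := by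
    have h1 : Continuous fun v => Real.sinc (κ * v) ^ 2 :=
      (Real.continuous_sinc.comp (by fun_prop : Continuous fun u => κ * u)).pow 2
    exact continuous_const.sub
      ((intervalIntegral.continuous_primitive (fun a b => h1.intervalIntegrable a b) 0).comp
        continuous_abs)
  obtain ⟨C, hC, h⟩ := exists_le_decay_of_continuous (A := 2 / κ ^ 2) hcont fun u hu => by
    have hu0 : 0 < |u| := by linarith
    rw [integral_sinc_mul_sq hκ]
    have h1 := abs_pi_div_two_sub_sineIntegral_le (x := 2 * (κ * |u|)) (by positivity)
    have h2 : |κ * |u| * Real.sinc (κ * |u|) ^ 2| ≤ 1 / (κ * |u|) := by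
      have h3 := abs_sinc_le_inv (x := κ * |u|) (by positivity)
      rw [abs_of_pos (by positivity : 0 < κ * |u|)] at h3
      rw [abs_mul, abs_of_pos (by positivity : 0 < κ * |u|), abs_pow]
      calc κ * |u| * |Real.sinc (κ * |u|)| ^ 2 ≤ κ * |u| * (1 / (κ * |u|)) ^ 2 := by gcongr
        _ = 1 / (κ * |u|) := by field_simp
    have e : Real.pi / (2 * κ) - (sineIntegral (2 * (κ * |u|)) - κ * |u| * Real.sinc (κ * |u|) ^ 2)
        / κ = ((Real.pi / 2 - sineIntegral (2 * (κ * |u|))) + κ * |u| * Real.sinc (κ * |u|) ^ 2)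
          / κ := by field_simp; ring
    rw [e, abs_div, abs_of_pos hκ]
    have e2 : 2 / κ ^ 2 / |u| = (2 / (2 * (κ * |u|)) + 1 / (κ * |u|)) / κ := by field_simp; norm_num
    rw [e2]
    gcongr
    exact (abs_add_le _ _).trans (add_le_add h1 h2)
  refine ⟨C, hC, fun u hu => ?_⟩
  have := h u
  rwa [abs_of_nonneg hu] at this

lemma sineKernel_d_mul_sign (κ c u : ℝ) :
    (sineKernel κ c).d u * Real.sign u = (sineKernel κ c).d |u| := by
  rcases lt_trichotomy u 0 with h | h | h
  · rw [Real.sign_of_neg h, abs_of_neg h, PairKernel.d_neg]; ring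
  · simp [h, PairKernel.d_zero]
  · rw [Real.sign_of_pos h, abs_of_pos h, mul_one]

lemma continuous_sineKernel_d (κ c : ℝ) : Continuous (sineKernel κ c).d :=
  continuous_const.mul (continuous_deriv_sinc.comp (by fun_prop : Continuous fun u => κ * u))

lemma continuous_sineKernel_s (κ c : ℝ) : Continuous (sineKernel κ c).s :=
  Real.continuous_sinc.comp (by fun_prop : Continuous fun u => κ * u)

lemma sineKernel_T_eq (κ c u : ℝ) : (sineKernel κ c).T u = (sineKernel κ c).s u ^ 2
    - (sineKernel κ c).d u * (sineIntegral (κ * u) / κ) + c * (sineKernel κ c).d |u| := by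
  rw [← sineKernel_d_mul_sign]
  simp only [PairKernel.T, sineKernel]
  ring

lemma continuous_sineKernel_T (κ c : ℝ) : Continuous (sineKernel κ c).T := by
  have h1 := continuous_sineKernel_d κ c
  have h2 := continuous_sineKernel_s κ c
  have h3 : Continuous fun u => sineIntegral (κ * u) :=
    continuous_sineIntegral.comp (by fun_prop : Continuous fun u => κ * u)
  rw [show (sineKernel κ c).T = fun u => (sineKernel κ c).s u ^ 2
    - (sineKernel κ c).d u * (sineIntegral (κ * u) / κ) + c * (sineKernel κ c).d |u| from
    funext (sineKernel_T_eq κ c)]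
  exact ((h2.pow 2).sub (h1.mul (h3.div_const κ))).add
    (continuous_const.mul (h1.comp continuous_abs))

lemma integral_sineKernel_T (hκ : 0 < κ) (c : ℝ) {u : ℝ} (hu : 0 ≤ u) :
    ∫ v in (0 : ℝ)..u, (sineKernel κ c).T v = 2 * (∫ v in (0 : ℝ)..u, Real.sinc (κ * v) ^ 2)
      - Real.sinc (κ * u) * (sineIntegral (κ * u) / κ - c) - c := by
  have hsq : Continuous fun v => Real.sinc (κ * v) ^ 2 :=
      (Real.continuous_sinc.comp (by fun_prop : Continuous fun u => κ * u)).pow 2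
  have hd : ∀ v, HasDerivAt (fun v => 2 * (∫ t in (0 : ℝ)..v, Real.sinc (κ * t) ^ 2)
      - Real.sinc (κ * v) * (sineIntegral (κ * v) / κ - c))
      (2 * Real.sinc (κ * v) ^ 2 - (κ * deriv Real.sinc (κ * v) * (sineIntegral (κ * v) / κ - c)
        + Real.sinc (κ * v) * Real.sinc (κ * v))) v := fun v =>
    ((hsq.integral_hasStrictDerivAt 0 v).hasDerivAt.const_mul 2).sub
      ((hasDerivAt_sinc_mul κ v).mul ((hasDerivAt_sineIntegral_mul hκ v).sub_const c))
  rw [intervalIntegral.integral_eq_sub_of_hasDerivAt (f := fun v =>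
    2 * (∫ t in (0 : ℝ)..v, Real.sinc (κ * t) ^ 2)
      - Real.sinc (κ * v) * (sineIntegral (κ * v) / κ - c)) (fun v hv => ?_)
    ((continuous_sineKernel_T κ c).intervalIntegrable _ _)]
  · simp [sineIntegral_zero]
  · rw [uIcc_of_le hu] at hv
    refine (hd v).congr_deriv ?_
    rw [sineKernel_T_eq, abs_of_nonneg hv.1]
    simp only [sineKernel]
    ring

lemma sineKernel_mass (hκ : 0 < κ) (hc : 1 / 2 + c = Real.pi / κ) : ∃ C, 0 ≤ C ∧ ∀ u, 0 ≤ u →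
    |1 / 2 - ∫ v in (0 : ℝ)..u, (sineKernel κ c).T v| ≤ C * decay u := by
  obtain ⟨C₁, hC₁, h₁⟩ := exists_remainder_le hκ
  obtain ⟨C₂, hC₂, h₂⟩ := exists_sinc_le hκ
  refine ⟨2 * C₁ + C₂ * (4 / κ + |c|), by positivity, fun u hu => ?_⟩
  rw [integral_sineKernel_T hκ c hu]
  have e : 1 / 2 - (2 * (∫ v in (0 : ℝ)..u, Real.sinc (κ * v) ^ 2)
      - Real.sinc (κ * u) * (sineIntegral (κ * u) / κ - c) - c) =
      2 * (Real.pi / (2 * κ) - ∫ v in (0 : ℝ)..u, Real.sinc (κ * v) ^ 2)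
        + Real.sinc (κ * u) * (sineIntegral (κ * u) / κ - c) := by
    have : 2 * (Real.pi / (2 * κ)) = 1 / 2 + c := by rw [hc]; field_simp
    linarith
  rw [e]
  refine (abs_add_le _ _).trans ?_
  rw [abs_mul, abs_mul, abs_two]
  have h3 : |sineIntegral (κ * u) / κ - c| ≤ 4 / κ + |c| := by
    refine (abs_sub _ _).trans ?_
    rw [abs_div, abs_of_pos hκ]
    gcongr
    exact abs_sineIntegral_le _
  have := mul_le_mul (h₂ u) h3 (abs_nonneg _) (mul_nonneg hC₂ (decay_pos u).le)
  nlinarith [h₁ u hu]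

lemma sineKernel_isAdmissible (hκ : 0 < κ) (hc : 1 / 2 + c = Real.pi / κ)
    (hc' : c = 0 ∨ c = Real.pi / (2 * κ)) : (sineKernel κ c).IsAdmissible where
  measurable_s := (continuous_sineKernel_s κ c).measurable
  measurable_d := (continuous_sineKernel_d κ c).measurable
  measurable_e := ((continuous_sineIntegral.comp
    (by fun_prop : Continuous fun u => κ * u)).measurable.div_const κ).sub
      (measurable_sign.const_mul c)
  s_le := exists_sinc_le hκ
  d_le := by
    refine exists_le_decay_of_continuous (A := 2) (continuous_sineKernel_d κ c) fun u hu => ?_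
    have hu0 : u ≠ 0 := fun h => by norm_num [h] at hu
    have := abs_deriv_sinc_le (x := κ * u) (by positivity)
    simp only [sineKernel]
    rw [abs_mul, abs_of_pos hκ]
    calc κ * |deriv Real.sinc (κ * u)| ≤ κ * (2 / |κ * u|) := by gcongr
      _ = 2 / |u| := by rw [abs_mul, abs_of_pos hκ]; field_simp
  e_le := by
    refine ⟨4 / κ + |c|, by positivity, fun u => (abs_sub _ _).trans ?_⟩
    rw [abs_div, abs_of_pos hκ, abs_mul]
    gcongr
    · exact abs_sineIntegral_le _
    · refine mul_le_of_le_one_right (abs_nonneg _) ?_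
      rcases Real.sign_apply_eq u with h | h | h <;> simp [h]
  continuous_T := continuous_sineKernel_T κ c
  mass := sineKernel_mass hκ hc
  e_decay_or_deriv := by
    rcases hc' with h0 | h0
    · right
      refine ⟨hasDerivAt_sinc_mul κ, fun u => ?_, continuous_sineKernel_d κ c⟩
      have := hasDerivAt_sineIntegral_mul hκ u
      simpa [sineKernel, h0] using this
    · left
      refine exists_le_decay (B := 4 / κ + |c|) (A := 2 / κ ^ 2) (fun u _ => ?_) fun u hu => ?_
      · refine (abs_sub _ _).trans ?_
        rw [abs_div, abs_of_pos hκ, abs_mul]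
        gcongr
        · exact abs_sineIntegral_le _
        · refine mul_le_of_le_one_right (abs_nonneg _) ?_
          rcases Real.sign_apply_eq u with h | h | h <;> simp [h]
      · have hu0 : u ≠ 0 := fun h => by norm_num [h] at hu
        have := abs_sineIntegral_sub_sign_le (x := κ * u) (by positivity)
        rw [sign_mul_of_pos hκ] at this
        have e : (sineKernel κ c).e u = (sineIntegral (κ * u) - Real.pi / 2 * Real.sign u) / κ := by
          simp only [sineKernel, h0]; field_simp
        rw [e, abs_div, abs_of_pos hκ]
        calc _ ≤ 2 / |κ * u| / κ := by gcongr
          _ = 2 / κ ^ 2 / |u| := by rw [abs_mul, abs_of_pos hκ]; field_simp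
  r2_nonneg x hx := by
    rw [← PairKernel.qdet_mat_two]
    exact sineKernel_qdet_nonneg hκ hc' (by simp) hx
  r3_nonneg x hx := by
    rw [← PairKernel.qdet_mat_three]
    exact sineKernel_qdet_nonneg hκ hc' (by simp) hx
  r4_nonneg x hx := by
    rw [← PairKernel.qdet_mat_four]
    exact sineKernel_qdet_nonneg hκ hc' (by simp) hx

/-- The scalar sine kernel of density one. -/
noncomputable def scalarSineKernel : PairKernel where
  s u := Real.sinc (Real.pi * u)
  d _ := 0
  e _ := 0
  s_neg u := by simp [mul_neg, Real.sinc_neg]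
  d_neg u := by simp
  e_neg u := by simp
  s_zero := by simp

lemma scalarSineKernel_isAdmissible : scalarSineKernel.IsAdmissible where
  measurable_s := (Real.continuous_sinc.comp
    (by fun_prop : Continuous fun u => Real.pi * u)).measurable
  measurable_d := measurable_const
  measurable_e := measurable_const
  s_le := exists_sinc_le Real.pi_pos
  d_le := ⟨0, le_rfl, fun u => by simp [scalarSineKernel]⟩
  e_le := ⟨0, le_rfl, fun u => by simp [scalarSineKernel]⟩
  continuous_T := by
    have : scalarSineKernel.T = fun u => Real.sinc (Real.pi * u) ^ 2 := by
      funext u; simp [PairKernel.T, scalarSineKernel]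
    rw [this]
    exact (Real.continuous_sinc.comp (by fun_prop : Continuous fun u => Real.pi * u)).pow 2
  mass := by
    have : scalarSineKernel.T = fun u => Real.sinc (Real.pi * u) ^ 2 := by
      funext u; simp [PairKernel.T, scalarSineKernel]
    rw [this]
    have h := exists_remainder_le Real.pi_pos
    have e : Real.pi / (2 * Real.pi) = 1 / 2 := by field_simp
    rwa [e] at h
  e_decay_or_deriv := Or.inl ⟨0, le_rfl, fun u => by simp [scalarSineKernel]⟩
  r2_nonneg x _ := by
    rw [← scalarSineKernel.det_two fun u => rfl]
    exact (posSemidef_sinc Real.pi x).det_nonneg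
  r3_nonneg x _ := by
    rw [← scalarSineKernel.det_three fun u => rfl]
    exact (posSemidef_sinc Real.pi x).det_nonneg
  r4_nonneg x _ := by
    rw [← scalarSineKernel.det_four fun u => rfl]
    exact (posSemidef_sinc Real.pi x).det_nonneg

end sine

lemma deriv_sinc_comp (κ x y : ℝ) :
    deriv (fun u => Real.sinc (κ * (u - y))) x = κ * deriv Real.sinc (κ * (x - y)) := by
  have h := (hasDerivAt_sinc_mul κ (x - y)).comp x ((hasDerivAt_id x).sub_const y)
  simp only [mul_one] at h
  exact h.deriv

lemma kernelOne_eq (x y : ℝ) : kernelOne x y = (sineKernel Real.pi (1 / 2)).mat (x - y) := by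
  rw [kernelOne, deriv_sinc_comp]
  simp [PairKernel.mat, sineKernel, sineIntegral]
  ring

lemma kernelFour_eq (x y : ℝ) : kernelFour x y = (sineKernel (2 * Real.pi) 0).mat (x - y) := by
  rw [kernelFour, deriv_sinc_comp]
  simp [PairKernel.mat, sineKernel, sineIntegral]
  ring

/-- The correlation functions of order two, three and four of the sine processes are those of an
admissible kernel. -/
theorem exists_admissible_kernel {β : ℕ} (hβ : β = 1 ∨ β = 2 ∨ β = 4) :
    ∃ K : PairKernel, K.IsAdmissible ∧
      (∀ x : Fin 2 → ℝ, sineCorrelation β 2 x = K.r2 (x 0) (x 1)) ∧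
      (∀ x : Fin 3 → ℝ, sineCorrelation β 3 x = K.r3 (x 0) (x 1) (x 2)) ∧
      (∀ x : Fin 4 → ℝ, sineCorrelation β 4 x = K.r4 (x 0) (x 1) (x 2) (x 3)) := by
  have hpi := Real.pi_pos
  rcases hβ with rfl | rfl | rfl
  · refine ⟨sineKernel Real.pi (1 / 2), sineKernel_isAdmissible hpi ?_ (Or.inr ?_), ?_, ?_, ?_⟩
    · field_simp; norm_num
    · field_simp
    · intro x; simp only [sineCorrelation, kernelOne_eq, if_true, PairKernel.qdet_mat_two]
    · intro x; simp only [sineCorrelation, kernelOne_eq, if_true, PairKernel.qdet_mat_three]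
    · intro x; simp only [sineCorrelation, kernelOne_eq, if_true, PairKernel.qdet_mat_four]
  · have h : ∀ k x, sineCorrelation 2 k x =
        (Matrix.of fun i j => scalarSineKernel.s (x i - x j)).det := by
      intro k x
      simp [sineCorrelation, kernelTwo, scalarSineKernel]
    refine ⟨scalarSineKernel, scalarSineKernel_isAdmissible, ?_, ?_, ?_⟩
    · intro x; rw [h, PairKernel.det_two _ fun u => rfl]
    · intro x; rw [h, PairKernel.det_three _ fun u => rfl]
    · intro x; rw [h, PairKernel.det_four _ fun u => rfl]
  · refine ⟨sineKernel (2 * Real.pi) 0, sineKernel_isAdmissible (by positivity) ?_ (Or.inl rfl),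
      ?_, ?_, ?_⟩
    · field_simp; norm_num
    · intro x; simp [sineCorrelation, kernelFour_eq, PairKernel.qdet_mat_two]
    · intro x; simp [sineCorrelation, kernelFour_eq, PairKernel.qdet_mat_three]
    · intro x; simp [sineCorrelation, kernelFour_eq, PairKernel.qdet_mat_four]

end SineBeta

namespace SineBeta

/-! ### Sums over tuples of points -/

section measurability

/-- A random finite set whose number of points in every Borel set is measurable. -/
def MeasurablePoints {Ω : Type*} [MeasurableSpace Ω] (A : Ω → Finset ℝ) : Prop :=
  ∀ B : Set ℝ, MeasurableSet B → Measurable fun ω => ∑ y ∈ A ω, B.indicator (1 : ℝ → ENNReal) y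

variable {Ω α : Type*} [MeasurableSpace Ω] [MeasurableSpace α] {A : Ω → Finset ℝ}

/-- The empirical measure of a random finite set, as a kernel. -/
noncomputable def empiricalKernel (hA : MeasurablePoints A) : Kernel Ω ℝ where
  toFun ω := ((A ω).card : ENNReal)⁻¹ • ∑ y ∈ A ω, Measure.dirac y
  measurable' := by
    refine Measure.measurable_of_measurable_coe _ fun B hB => ?_
    have h1 := hA B hB
    have h2 := hA univ MeasurableSet.univ
    simp only [indicator_univ, Pi.one_apply, Finset.sum_const, nsmul_eq_mul, mul_one] at h2
    convert h2.inv.mul h1 using 1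
    funext ω
    simp [Measure.finsetSum_apply, Measure.dirac_apply' _ hB]

instance (hA : MeasurablePoints A) : IsFiniteKernel (empiricalKernel hA) :=
  ⟨1, ENNReal.one_lt_top, fun ω => by
    simp only [empiricalKernel, Kernel.coe_mk, Measure.smul_apply, Measure.finsetSum_apply,
      measure_univ, Finset.sum_const, nsmul_eq_mul, mul_one, smul_eq_mul]
    exact ENNReal.inv_mul_le_one _⟩

lemma card_mul_lintegral_empiricalKernel (hA : MeasurablePoints A) (ω : Ω) (f : ℝ → ENNReal) :
    ((A ω).card : ENNReal) * ∫⁻ y, f y ∂(empiricalKernel hA ω) = ∑ y ∈ A ω, f y := by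
  simp only [empiricalKernel, Kernel.coe_mk, lintegral_smul_measure, lintegral_finsetSum_measure,
    lintegral_dirac, smul_eq_mul]
  rcases Finset.eq_empty_or_nonempty (A ω) with h | h
  · simp [h]
  · rw [← mul_assoc, ENNReal.mul_inv_cancel (by simpa using h.ne_empty) (by simp), one_mul]

lemma MeasurablePoints.measurable_sum (hA : MeasurablePoints A) {p : α → Ω} (hp : Measurable p)
    {F : α × ℝ → ENNReal} (hF : Measurable F) :
    Measurable fun a => ∑ y ∈ A (p a), F (a, y) := by
  have h2 := (hA univ MeasurableSet.univ).comp hp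
  simp only [Function.comp_def, indicator_univ, Pi.one_apply, Finset.sum_const, nsmul_eq_mul,
    mul_one] at h2
  have h3 := Measurable.lintegral_kernel_prod_right' (κ := (empiricalKernel hA).comap p hp) hF
  convert h2.mul h3 using 1
  funext a
  exact (card_mul_lintegral_empiricalKernel hA (p a) fun y => F (a, y)).symm

lemma sum_piFinset_snoc {M : Type*} [AddCommMonoid M] (S : Finset ℝ) (k : ℕ)
    (f : (Fin (k + 1) → ℝ) → M) :
    ∑ x ∈ Fintype.piFinset (fun _ : Fin (k + 1) => S), f x =
      ∑ x ∈ Fintype.piFinset (fun _ : Fin k => S), ∑ y ∈ S, f (Fin.snoc (α := fun _ => ℝ) x y) := by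
  rw [← Finset.sum_product']
  refine Finset.sum_nbij' (fun x => (Fin.init x, x (Fin.last k)))
    (fun p => Fin.snoc (α := fun _ => ℝ) p.1 p.2) ?_ ?_ ?_ ?_ ?_
  · intro x hx
    simp only [Fintype.mem_piFinset] at hx
    simp only [Finset.mem_product, Fintype.mem_piFinset]
    exact ⟨fun i => hx _, hx _⟩
  · rintro ⟨x, y⟩ hx
    simp only [Finset.mem_product, Fintype.mem_piFinset] at hx
    simp only [Fintype.mem_piFinset]
    intro i
    refine Fin.lastCases ?_ (fun j => ?_) i
    · simpa using hx.2
    · simpa using hx.1 j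
  · intro x _
    exact Fin.snoc_init_self x
  · rintro ⟨x, y⟩ _
    simp
  · intro x _
    rw [Fin.snoc_init_self]

lemma measurable_snoc (k : ℕ) : Measurable fun p : (Fin k → ℝ) × ℝ =>
    (Fin.snoc (α := fun _ => ℝ) p.1 p.2 : Fin (k + 1) → ℝ) := by
  refine measurable_pi_iff.2 fun i => ?_
  refine Fin.lastCases ?_ (fun j => ?_) i
  · simp only [Fin.snoc_last]
    fun_prop
  · simp only [Fin.snoc_castSucc]
    fun_prop

lemma MeasurablePoints.measurable_sum_piFinset (hA : MeasurablePoints A) (k : ℕ)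
    {F : Ω × (Fin k → ℝ) → ENNReal} (hF : Measurable F) :
    Measurable fun ω => ∑ x ∈ Fintype.piFinset (fun _ : Fin k => A ω), F (ω, x) := by
  induction k with
  | zero =>
    simp only [Fintype.piFinset_of_isEmpty, Finset.univ_unique, Finset.sum_singleton]
    fun_prop
  | succ k ih =>
    simp only [sum_piFinset_snoc]
    have hs := measurable_snoc k
    have h := hA.measurable_sum (p := fun a : Ω × (Fin k → ℝ) => a.1) measurable_fst
      (F := fun a => F (a.1.1, Fin.snoc (α := fun _ => ℝ) a.1.2 a.2))
      (hF.comp (by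
        refine Measurable.prodMk (by fun_prop) ?_
        exact hs.comp (by fun_prop : Measurable fun a : (Ω × (Fin k → ℝ)) × ℝ => (a.1.2, a.2))))
    have h2 := ih (F := fun a => ∑ y ∈ A a.1, F (a.1, Fin.snoc (α := fun _ => ℝ) a.2 y)) h
    exact h2

end measurability

open Classical in
/-- The points of a set in the window `[0, N]`. -/
noncomputable def windowPoints (N : ℝ) (A : Set ℝ) : Finset ℝ :=
  if h : (A ∩ Icc 0 N).Finite then h.toFinset else ∅

open Classical in
/-- The sum of `G` over the `k`-tuples of distinct points of a finite set. -/
noncomputable def tupleSum (S : Finset ℝ) (k : ℕ) (G : (Fin k → ℝ) → ℝ) : ℝ :=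
  ∑ x ∈ Fintype.piFinset (fun _ : Fin k => S), if Function.Injective x then G x else 0

/-- The window `[0, N]ᵏ`. -/
def cube (k : ℕ) (N : ℝ) : Set (Fin k → ℝ) := Set.pi univ fun _ => Icc 0 N

lemma measurableSet_cube (k : ℕ) (N : ℝ) : MeasurableSet (cube k N) :=
  MeasurableSet.univ_pi fun _ => measurableSet_Icc

lemma measurableSet_injective (k : ℕ) : MeasurableSet {x : Fin k → ℝ | Function.Injective x} := by
  have : {x : Fin k → ℝ | Function.Injective x} =
      ⋂ i, ⋂ j, {x : Fin k → ℝ | x i = x j → i = j} := by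
    ext x; simp [Function.Injective]
  rw [this]
  refine MeasurableSet.iInter fun i => MeasurableSet.iInter fun j => ?_
  by_cases hij : i = j
  · simp [hij]
  · simp only [hij, imp_false]
    exact (measurableSet_eq_fun (measurable_pi_apply i) (measurable_pi_apply j)).compl

section campbell

variable {Ω : Type*} [MeasurableSpace Ω] {P : Measure Ω} {X : Ω → Set ℝ}
  {ρ : (k : ℕ) → (Fin k → ℝ) → ℝ} {N : ℝ}

lemma coe_windowPoints (hX : IsSimplePointProcess X) (N : ℝ) (ω : Ω) :
    (windowPoints N (X ω) : Set ℝ) = X ω ∩ Icc 0 N := by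
  rw [windowPoints, dif_pos (hX.locallyFinite ω 0 N), Finite.coe_toFinset]

lemma mem_windowPoints (hX : IsSimplePointProcess X) {N : ℝ} {ω : Ω} {y : ℝ} :
    y ∈ windowPoints N (X ω) ↔ y ∈ X ω ∧ y ∈ Icc 0 N := by
  rw [← Finset.mem_coe, coe_windowPoints hX, mem_inter_iff]

lemma measurablePoints_windowPoints (hX : IsSimplePointProcess X) (N : ℝ) :
    MeasurablePoints fun ω => windowPoints N (X ω) := by
  classical
  intro B hB
  have h := hX.measurable_count (Icc 0 N ∩ B) (measurableSet_Icc.inter hB)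
  have h2 : Measurable fun ω => ((X ω ∩ (Icc 0 N ∩ B)).encard : ENNReal) :=
    (Measurable.of_discrete (f := fun n : ENat => (n : ENNReal))).comp h
  convert h2 using 1
  funext ω
  symm
  have e : X ω ∩ (Icc 0 N ∩ B) = ((windowPoints N (X ω)).filter (· ∈ B) : Finset ℝ) := by
    ext y
    simp only [mem_inter_iff, Finset.coe_filter, mem_ofPred_eq, mem_windowPoints hX]
    tauto
  rw [e, Set.encard_coe_eq_coe_finsetCard, ← Finset.sum_filter_add_sum_filter_not _ (· ∈ B)]
  rw [Finset.sum_congr rfl (g := fun _ => (1 : ENNReal)) fun y hy => by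
      rw [indicator_of_mem (Finset.mem_filter.1 hy).2]; rfl,
    Finset.sum_eq_zero (s := Finset.filter (fun y => y ∉ B) _) fun y hy =>
      indicator_of_notMem (Finset.mem_filter.1 hy).2 _]
  simp

open Classical in
lemma distinctSum_indicator (hX : IsSimplePointProcess X) (N : ℝ) (ω : Ω) (k : ℕ)
    (F : (Fin k → ℝ) → ENNReal) :
    distinctSum (X ω) k ((cube k N).indicator F) =
      ∑ x ∈ Fintype.piFinset (fun _ : Fin k => windowPoints N (X ω)),
        if Function.Injective x then F x else 0 := by
  have h0 := tsum_subtype {x : Fin k → ℝ | Function.Injective x ∧ ∀ i, x i ∈ X ω}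
    ((cube k N).indicator F)
  refine (show distinctSum (X ω) k ((cube k N).indicator F) = _ from h0).trans ?_
  rw [tsum_eq_sum (s := Fintype.piFinset (fun _ : Fin k => windowPoints N (X ω)))]
  · refine Finset.sum_congr rfl fun x hx => ?_
    simp only [Fintype.mem_piFinset, mem_windowPoints hX] at hx
    have hc : x ∈ cube k N := fun i _ => (hx i).2
    by_cases hi : Function.Injective x
    · have hmem : x ∈ {x : Fin k → ℝ | Function.Injective x ∧ ∀ i, x i ∈ X ω} :=
        ⟨hi, fun i => (hx i).1⟩
      rw [indicator_of_mem hmem, indicator_of_mem hc, if_pos hi]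
    · rw [indicator_of_notMem (fun h => hi h.1), if_neg hi]
  · intro x hx
    simp only [Fintype.mem_piFinset, mem_windowPoints hX] at hx
    by_cases h : x ∈ {x : Fin k → ℝ | Function.Injective x ∧ ∀ i, x i ∈ X ω}
    · rw [indicator_of_mem h, indicator_of_notMem]
      exact fun hc => hx fun i => ⟨h.2 i, hc i trivial⟩
    · rw [indicator_of_notMem h]

lemma ofReal_tupleSum (hX : IsSimplePointProcess X) (N : ℝ) (ω : Ω) (k : ℕ)
    {G : (Fin k → ℝ) → ℝ} (hG : ∀ x, 0 ≤ G x) :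
    ENNReal.ofReal (tupleSum (windowPoints N (X ω)) k G) =
      distinctSum (X ω) k ((cube k N).indicator fun x => ENNReal.ofReal (G x)) := by
  classical
  rw [distinctSum_indicator hX, tupleSum, ENNReal.ofReal_sum_of_nonneg]
  · refine Finset.sum_congr rfl fun x _ => ?_
    split_ifs <;> simp
  · intro x _
    split_ifs
    · exact hG x
    · exact le_rfl

lemma tupleSum_nonneg (S : Finset ℝ) (k : ℕ) {G : (Fin k → ℝ) → ℝ} (hG : ∀ x, 0 ≤ G x) :
    0 ≤ tupleSum S k G := by
  refine Finset.sum_nonneg fun x _ => ?_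
  split_ifs
  · exact hG x
  · exact le_rfl

lemma tupleSum_sub (S : Finset ℝ) (k : ℕ) (G H : (Fin k → ℝ) → ℝ) :
    tupleSum S k (fun x => G x - H x) = tupleSum S k G - tupleSum S k H := by
  rw [tupleSum, tupleSum, tupleSum, ← Finset.sum_sub_distrib]
  refine Finset.sum_congr rfl fun x _ => ?_
  split_ifs <;> simp

lemma measurable_tupleSum_of_nonneg (hX : IsSimplePointProcess X) (N : ℝ) (k : ℕ)
    {G : (Fin k → ℝ) → ℝ} (hGm : Measurable G) (hG : ∀ x, 0 ≤ G x) :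
    Measurable fun ω => tupleSum (windowPoints N (X ω)) k G := by
  classical
  have h : Measurable fun ω => ENNReal.ofReal (tupleSum (windowPoints N (X ω)) k G) := by
    simp only [ofReal_tupleSum hX N _ k hG, distinctSum_indicator hX]
    refine (measurablePoints_windowPoints hX N).measurable_sum_piFinset k
      (F := fun a => if Function.Injective a.2 then ENNReal.ofReal (G a.2) else 0) ?_
    exact Measurable.ite (measurable_snd (measurableSet_injective k))
      (hGm.ennreal_ofReal.comp measurable_snd) measurable_const
  convert h.ennreal_toReal using 1
  funext ω
  symm
  exact ENNReal.toReal_ofReal (tupleSum_nonneg _ _ hG)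

lemma tupleSum_eq_pos_sub_neg (S : Finset ℝ) (k : ℕ) (G : (Fin k → ℝ) → ℝ) :
    tupleSum S k G = tupleSum S k (fun x => max (G x) 0) - tupleSum S k fun x => max (-G x) 0 := by
  rw [← tupleSum_sub]
  congr 1
  funext x
  rw [max_zero_sub_max_neg_zero_eq_self]

lemma measurable_tupleSum (hX : IsSimplePointProcess X) (N : ℝ) (k : ℕ)
    {G : (Fin k → ℝ) → ℝ} (hGm : Measurable G) :
    Measurable fun ω => tupleSum (windowPoints N (X ω)) k G := by
  simp only [tupleSum_eq_pos_sub_neg _ k G]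
  exact (measurable_tupleSum_of_nonneg hX N k (hGm.max measurable_const) fun x =>
    le_max_right _ _).sub (measurable_tupleSum_of_nonneg hX N k (hGm.neg.max measurable_const)
      fun x => le_max_right _ _)

lemma campbell_of_nonneg (hX : IsSimplePointProcess X) (hρ : HasCorrelationFunctions P X ρ)
    {k : ℕ} (hρ0 : ∀ᵐ x, 0 ≤ ρ k x) {G : (Fin k → ℝ) → ℝ}
    (hGm : Measurable G) (hG : ∀ x, 0 ≤ G x)
    (hint : IntegrableOn (fun x => G x * ρ k x) (cube k N)) :
    Integrable (fun ω => tupleSum (windowPoints N (X ω)) k G) P ∧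
      ∫ ω, tupleSum (windowPoints N (X ω)) k G ∂P = ∫ x in cube k N, G x * ρ k x := by
  have hm := measurable_tupleSum hX N k hGm
  have h0 : ∀ ω, 0 ≤ tupleSum (windowPoints N (X ω)) k G := fun ω => tupleSum_nonneg _ _ hG
  have hpos : 0 ≤ᵐ[volume.restrict (cube k N)] fun x => G x * ρ k x := by
    filter_upwards [ae_restrict_of_ae hρ0] with x hx using mul_nonneg (hG x) hx
  have key : ∫⁻ ω, ENNReal.ofReal (tupleSum (windowPoints N (X ω)) k G) ∂P =
      ∫⁻ x in cube k N, ENNReal.ofReal (G x * ρ k x) := by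
    simp only [ofReal_tupleSum hX N _ k hG]
    rw [hρ k _ (hGm.ennreal_ofReal.indicator (measurableSet_cube k N)),
      ← lintegral_indicator (measurableSet_cube k N)]
    refine lintegral_congr fun x => ?_
    by_cases hx : x ∈ cube k N
    · rw [indicator_of_mem hx, indicator_of_mem hx, ENNReal.ofReal_mul (hG x)]
    · rw [indicator_of_notMem hx, indicator_of_notMem hx, zero_mul]
  have hfin : ∫⁻ ω, ENNReal.ofReal (tupleSum (windowPoints N (X ω)) k G) ∂P ≠ ⊤ := by
    rw [key]
    exact ((hasFiniteIntegral_iff_ofReal hpos).1 hint.2).ne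
  refine ⟨⟨hm.aestronglyMeasurable, ?_⟩, ?_⟩
  · rw [hasFiniteIntegral_iff_ofReal (ae_of_all _ h0)]
    exact hfin.lt_top
  · rw [integral_eq_lintegral_of_nonneg_ae (ae_of_all _ h0) hm.aestronglyMeasurable, key,
      integral_eq_lintegral_of_nonneg_ae hpos hint.1]

/-- **Campbell's formula** for the sums over tuples of distinct points in a window. -/
theorem campbell (hX : IsSimplePointProcess X) (hρ : HasCorrelationFunctions P X ρ)
    {k : ℕ} (hρm : Measurable (ρ k)) (hρ0 : ∀ᵐ x, 0 ≤ ρ k x) {G : (Fin k → ℝ) → ℝ}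
    (hGm : Measurable G) (hint : IntegrableOn (fun x => G x * ρ k x) (cube k N)) :
    Integrable (fun ω => tupleSum (windowPoints N (X ω)) k G) P ∧
      ∫ ω, tupleSum (windowPoints N (X ω)) k G ∂P = ∫ x in cube k N, G x * ρ k x := by
  have hb : ∀ x : Fin k → ℝ, |max (G x) 0 * ρ k x| ≤ |G x * ρ k x| := fun x => by
    rw [abs_mul, abs_mul, abs_of_nonneg (le_max_right _ _)]
    refine mul_le_mul_of_nonneg_right ?_ (abs_nonneg _)
    exact max_le (le_abs_self _) (abs_nonneg _)
  have hb' : ∀ x : Fin k → ℝ, |max (-G x) 0 * ρ k x| ≤ |G x * ρ k x| := fun x => by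
    rw [abs_mul, abs_mul, abs_of_nonneg (le_max_right _ _)]
    refine mul_le_mul_of_nonneg_right ?_ (abs_nonneg _)
    exact max_le (neg_le_abs _) (abs_nonneg _)
  have i1 : IntegrableOn (fun x => max (G x) 0 * ρ k x) (cube k N) := Integrable.mono hint
    (((hGm.max measurable_const).mul hρm).aestronglyMeasurable) (ae_of_all _ hb)
  have i2 : IntegrableOn (fun x => max (-G x) 0 * ρ k x) (cube k N) := Integrable.mono hint
    (((hGm.neg.max measurable_const).mul hρm).aestronglyMeasurable) (ae_of_all _ hb')
  have h1 := campbell_of_nonneg hX hρ hρ0 (hGm.max measurable_const)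
    (fun x => le_max_right _ _) i1
  have h2 := campbell_of_nonneg (G := fun x => max (-G x) 0) hX hρ hρ0
    (hGm.neg.max measurable_const) (fun x => le_max_right _ _) i2
  simp only [tupleSum_eq_pos_sub_neg _ k G]
  refine ⟨h1.1.sub h2.1, ?_⟩
  rw [integral_sub h1.1 h2.1, h1.2, h2.2, ← integral_sub i1 i2]
  refine integral_congr_ae (ae_of_all _ fun x => ?_)
  simp only
  rw [← sub_mul, max_zero_sub_max_neg_zero_eq_self]

end campbell

end SineBeta

namespace SineBeta

/-! ### The square of a pair sum -/

lemma sum_piFinset_two (S : Finset ℝ) (f : (Fin 2 → ℝ) → ℝ) :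
    ∑ x ∈ Fintype.piFinset (fun _ : Fin 2 => S), f x = ∑ a ∈ S, ∑ b ∈ S, f ![a, b] := by
  rw [sum_piFinset_snoc, sum_piFinset_snoc]
  simp only [Fintype.piFinset_of_isEmpty, Finset.univ_unique, Finset.sum_singleton]
  refine Finset.sum_congr rfl fun a _ => Finset.sum_congr rfl fun b _ => congrArg f ?_
  ext i; fin_cases i <;> rfl

lemma sum_piFinset_three (S : Finset ℝ) (f : (Fin 3 → ℝ) → ℝ) :
    ∑ x ∈ Fintype.piFinset (fun _ : Fin 3 => S), f x =
      ∑ a ∈ S, ∑ b ∈ S, ∑ c ∈ S, f ![a, b, c] := by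
  rw [sum_piFinset_snoc, sum_piFinset_two]
  refine Finset.sum_congr rfl fun a _ => Finset.sum_congr rfl fun b _ =>
    Finset.sum_congr rfl fun c _ => congrArg f ?_
  ext i; fin_cases i <;> rfl

lemma sum_piFinset_four (S : Finset ℝ) (f : (Fin 4 → ℝ) → ℝ) :
    ∑ x ∈ Fintype.piFinset (fun _ : Fin 4 => S), f x =
      ∑ a ∈ S, ∑ b ∈ S, ∑ c ∈ S, ∑ d ∈ S, f ![a, b, c, d] := by
  rw [sum_piFinset_snoc, sum_piFinset_three]
  refine Finset.sum_congr rfl fun a _ => Finset.sum_congr rfl fun b _ =>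
    Finset.sum_congr rfl fun c _ => Finset.sum_congr rfl fun d _ => congrArg f ?_
  ext i; fin_cases i <;> rfl

lemma injective_two {a b : ℝ} : Function.Injective ![a, b] ↔ a ≠ b := by
  simp [Function.Injective, Fin.forall_fin_succ]; grind

lemma injective_three {a b c : ℝ} : Function.Injective ![a, b, c] ↔ a ≠ b ∧ a ≠ c ∧ b ≠ c := by
  simp [Function.Injective, Fin.forall_fin_succ]; grind

lemma injective_four {a b c d : ℝ} : Function.Injective ![a, b, c, d] ↔
    a ≠ b ∧ a ≠ c ∧ a ≠ d ∧ b ≠ c ∧ b ≠ d ∧ c ≠ d := by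
  simp [Function.Injective, Fin.forall_fin_succ]; grind

open Classical in
lemma mul_ite_ne_eq {φ : ℝ → ℝ → ℝ} (hφ : ∀ a b, φ a b = φ b a) (a b c d : ℝ) :
    (if a ≠ b then φ a b else 0) * (if c ≠ d then φ c d else 0) =
      (if a ≠ b ∧ a ≠ c ∧ a ≠ d ∧ b ≠ c ∧ b ≠ d ∧ c ≠ d then φ a b * φ c d else 0)
      + (if c = a then (if a ≠ b ∧ a ≠ d ∧ b ≠ d then φ a b * φ a d else 0) else 0)
      + (if c = b then (if b ≠ a ∧ b ≠ d ∧ a ≠ d then φ b a * φ b d else 0) else 0)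
      + (if d = a then (if a ≠ b ∧ a ≠ c ∧ b ≠ c then φ a b * φ a c else 0) else 0)
      + (if d = b then (if b ≠ a ∧ b ≠ c ∧ a ≠ c then φ b a * φ b c else 0) else 0)
      + (if c = a then (if d = b then (if a ≠ b then φ a b ^ 2 else 0) else 0) else 0)
      + (if c = b then (if d = a then (if a ≠ b then φ a b ^ 2 else 0) else 0) else 0) := by
  have h1 := hφ a b
  have h2 := hφ c d
  by_cases hab : a = b
  · subst hab
    simp
  by_cases hca : c = a
  · subst hca
    by_cases hdb : d = b
    · subst hdb; simp [hab, Ne.symm hab]; ring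
    · by_cases hda : d = c
      · subst hda; simp [hab]
      · simp [hab, hdb, hda, Ne.symm hdb, Ne.symm hda]
  · by_cases hcb : c = b
    · subst hcb
      by_cases hda : d = a
      · subst hda; simp [hab, Ne.symm hab, h1]; ring
      · by_cases hdb : d = c
        · subst hdb; simp [hab, hda]
        · simp [hab, hdb, hda, Ne.symm hdb, Ne.symm hda, Ne.symm hab, h1]
    · by_cases hda : d = a
      · subst hda
        simp [hca, hcb, hab, Ne.symm hca, Ne.symm hcb, h2]
      · by_cases hdb : d = b
        · subst hdb
          simp [hca, hcb, hab, Ne.symm hca, Ne.symm hcb, Ne.symm hab, h1, h2]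
        · simp [hca, hcb, hda, hdb, hab, Ne.symm hca, Ne.symm hcb, Ne.symm hda, Ne.symm hdb]

/-- The square of a pair sum as a combination of sums over tuples of distinct points. -/
lemma tupleSum_two_sq {φ : ℝ → ℝ → ℝ} (hφ : ∀ a b, φ a b = φ b a) (S : Finset ℝ) :
    tupleSum S 2 (fun x => φ (x 0) (x 1)) ^ 2 =
      tupleSum S 4 (fun x => φ (x 0) (x 1) * φ (x 2) (x 3))
        + 4 * tupleSum S 3 (fun x => φ (x 0) (x 1) * φ (x 0) (x 2))
        + 2 * tupleSum S 2 (fun x => φ (x 0) (x 1) ^ 2) := by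
  classical
  simp only [tupleSum, sum_piFinset_two, sum_piFinset_three, sum_piFinset_four, injective_two,
    injective_three, injective_four]
  simp only [Matrix.cons_val_zero, Matrix.cons_val_one, Matrix.cons_val]
  set D3 : ℝ → ℝ → ℝ → ℝ := fun a b c => if a ≠ b ∧ a ≠ c ∧ b ≠ c then φ a b * φ a c else 0 with hD3
  have key : ∀ a ∈ S, ∀ b ∈ S, (∑ c ∈ S, ∑ d ∈ S,
      (if a ≠ b then φ a b else 0) * (if c ≠ d then φ c d else 0)) =
      (∑ c ∈ S, ∑ d ∈ S, if a ≠ b ∧ a ≠ c ∧ a ≠ d ∧ b ≠ c ∧ b ≠ d ∧ c ≠ d then φ a b * φ c d else 0)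
      + (∑ d ∈ S, D3 a b d) + (∑ d ∈ S, D3 b a d) + (∑ d ∈ S, D3 a b d) + (∑ d ∈ S, D3 b a d)
      + (if a ≠ b then φ a b ^ 2 else 0) + (if a ≠ b then φ a b ^ 2 else 0) := by
    intro a ha b hb
    simp only [mul_ite_ne_eq hφ a b, Finset.sum_add_distrib]
    congr 1
    · congr 1
      · congr 1
        · congr 1
          · congr 1
            · congr 1
              rw [Finset.sum_comm]
              refine Finset.sum_congr rfl fun d _ => ?_
              rw [Finset.sum_ite_eq' S a, if_pos ha]
            · rw [Finset.sum_comm]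
              refine Finset.sum_congr rfl fun d _ => ?_
              rw [Finset.sum_ite_eq' S b, if_pos hb]
          · refine Finset.sum_congr rfl fun c _ => ?_
            rw [Finset.sum_ite_eq' S a, if_pos ha]
        · refine Finset.sum_congr rfl fun c _ => ?_
          rw [Finset.sum_ite_eq' S b, if_pos hb]
      · rw [Finset.sum_comm]
        have : ∀ d ∈ S, (∑ c ∈ S, if c = a then (if d = b then (if a ≠ b then φ a b ^ 2 else 0)
            else 0) else 0) = if d = b then (if a ≠ b then φ a b ^ 2 else 0) else 0 := by
          intro d _
          rw [Finset.sum_ite_eq' S a, if_pos ha]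
        rw [Finset.sum_congr rfl this, Finset.sum_ite_eq' S b, if_pos hb]
    · rw [Finset.sum_comm]
      have : ∀ d ∈ S, (∑ c ∈ S, if c = b then (if d = a then (if a ≠ b then φ a b ^ 2 else 0)
          else 0) else 0) = if d = a then (if a ≠ b then φ a b ^ 2 else 0) else 0 := by
        intro d _
        rw [Finset.sum_ite_eq' S b, if_pos hb]
      rw [Finset.sum_congr rfl this, Finset.sum_ite_eq' S a, if_pos ha]
  have hsq : (∑ a ∈ S, ∑ b ∈ S, if a ≠ b then φ a b else 0) ^ 2 =
      ∑ a ∈ S, ∑ b ∈ S, ∑ c ∈ S, ∑ d ∈ S,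
        (if a ≠ b then φ a b else 0) * (if c ≠ d then φ c d else 0) := by
    simp only [sq, Finset.sum_mul]
    refine Finset.sum_congr rfl fun a _ => Finset.sum_congr rfl fun b _ => ?_
    simp only [Finset.mul_sum]
  rw [hsq, Finset.sum_congr rfl fun a ha => Finset.sum_congr rfl fun b hb => key a ha b hb]
  simp only [Finset.sum_add_distrib]
  have hswap : ∑ a ∈ S, ∑ b ∈ S, ∑ d ∈ S, D3 b a d = ∑ a ∈ S, ∑ b ∈ S, ∑ d ∈ S, D3 a b d :=
    Finset.sum_comm
  rw [hswap]
  ring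

/-! ### Independent uniform points in the window -/

/-- The uniform distribution on `[0, N]`. -/
noncomputable def unif (N : ℝ) : Measure ℝ := (ENNReal.ofReal N)⁻¹ • volume.restrict (Icc 0 N)

/-- The law of `k` independent uniform points in `[0, N]`. -/
noncomputable def unifPi (k : ℕ) (N : ℝ) : Measure (Fin k → ℝ) := Measure.pi fun _ => unif N

section uniform

variable {N : ℝ} [hN : Fact (0 < N)]

instance : IsProbabilityMeasure (unif N) := ⟨by
  have : ENNReal.ofReal N ≠ 0 := by simpa using hN.out
  simp [unif, ENNReal.inv_mul_cancel this ENNReal.ofReal_ne_top]⟩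

instance (k : ℕ) : IsProbabilityMeasure (unifPi k N) := by unfold unifPi; infer_instance

lemma integral_unif (g : ℝ → ℝ) : ∫ y, g y ∂unif N = (1 / N) * ∫ y in (0 : ℝ)..N, g y := by
  rw [unif, integral_smul_measure, intervalIntegral.integral_of_le hN.out.le,
    integral_Icc_eq_integral_Ioc, ENNReal.toReal_inv, ENNReal.toReal_ofReal hN.out.le, smul_eq_mul,
    one_div]

lemma restrict_cube_eq (k : ℕ) : (volume : Measure (Fin k → ℝ)).restrict (cube k N) =
    ENNReal.ofReal N ^ k • unifPi k N := by
  have h0 : ENNReal.ofReal N ≠ 0 := by simpa using hN.out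
  rw [cube, volume_pi, Measure.restrict_pi_pi]
  refine Measure.pi_eq fun s hs => ?_
  rw [Measure.smul_apply, unifPi, Measure.pi_pi, smul_eq_mul]
  simp only [unif, Measure.smul_apply, smul_eq_mul, Finset.prod_mul_distrib, Finset.prod_const,
    Finset.card_univ, Fintype.card_fin]
  rw [← mul_assoc, ← mul_pow, ENNReal.mul_inv_cancel h0 ENNReal.ofReal_ne_top, one_pow, one_mul]

lemma setIntegral_cube (k : ℕ) (G : (Fin k → ℝ) → ℝ) :
    ∫ x in cube k N, G x = N ^ k * ∫ x, G x ∂unifPi k N := by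
  rw [restrict_cube_eq, integral_smul_measure, ENNReal.toReal_pow,
    ENNReal.toReal_ofReal hN.out.le, smul_eq_mul]

lemma integrableOn_cube {k : ℕ} {G : (Fin k → ℝ) → ℝ} (h : Integrable G (unifPi k N)) :
    IntegrableOn G (cube k N) := by
  rw [IntegrableOn, restrict_cube_eq]
  exact h.smul_measure (ENNReal.pow_ne_top ENNReal.ofReal_ne_top)

lemma measurePreserving_comp {k m : ℕ} {ι : Fin k → Fin m} (hι : Function.Injective ι) :
    MeasurePreserving (fun x : Fin m → ℝ => x ∘ ι) (unifPi m N) (unifPi k N) := by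
  classical
  have hmeas : Measurable fun x : Fin m → ℝ => x ∘ ι :=
    measurable_pi_iff.2 fun i => measurable_pi_apply _
  refine ⟨hmeas, ?_⟩
  symm
  refine Measure.pi_eq fun s hs => ?_
  rw [Measure.map_apply hmeas (MeasurableSet.univ_pi hs)]
  set s' : Fin m → Set ℝ := fun j => if h : ∃ i, ι i = j then s h.choose else univ with hs'
  have hs'ι : ∀ i, s' (ι i) = s i := fun i => by
    have h : ∃ i', ι i' = ι i := ⟨i, rfl⟩
    rw [hs']
    simp only
    rw [dif_pos h, hι h.choose_spec]
  have hpre : (fun x : Fin m → ℝ => x ∘ ι) ⁻¹' (univ.pi s) = univ.pi s' := by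
    ext x
    simp only [mem_preimage, mem_univ_pi, Function.comp]
    constructor
    · intro h j
      by_cases hj : ∃ i, ι i = j
      · obtain ⟨i, rfl⟩ := hj
        rw [hs'ι]; exact h i
      · simp [hs', hj]
    · intro h i
      rw [← hs'ι]; exact h _
  rw [hpre, unifPi, Measure.pi_pi, ← Finset.prod_subset (Finset.subset_univ
    (Finset.univ.map ⟨ι, hι⟩)) fun j _ hj => by
      have : ¬ ∃ i, ι i = j := by simpa using hj
      simp [hs', this], Finset.prod_map]
  simp only [Function.Embedding.coeFn_mk, hs'ι]

lemma measurePreserving_update {k : ℕ} (i : Fin k) :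
    MeasurePreserving (fun p : (Fin k → ℝ) × ℝ => Function.update p.1 i p.2)
      ((unifPi k N).prod (unif N)) (unifPi k N) := by
  have hmeas : Measurable fun p : (Fin k → ℝ) × ℝ => Function.update p.1 i p.2 := by
    refine measurable_pi_iff.2 fun j => ?_
    by_cases hj : j = i
    · subst hj; simp only [Function.update_self]; fun_prop
    · simp only [Function.update_of_ne hj]; fun_prop
  refine ⟨hmeas, ?_⟩
  symm
  refine Measure.pi_eq fun s hs => ?_
  rw [Measure.map_apply hmeas (MeasurableSet.univ_pi hs)]
  have hpre : (fun p : (Fin k → ℝ) × ℝ => Function.update p.1 i p.2) ⁻¹' (univ.pi s) =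
      (univ.pi (Function.update s i univ)) ×ˢ s i := by
    ext ⟨x, y⟩
    simp only [mem_preimage, mem_univ_pi, mem_prod]
    constructor
    · intro h
      refine ⟨fun j => ?_, by simpa using h i⟩
      by_cases hj : j = i
      · subst hj; simp
      · simpa [Function.update_of_ne hj] using h j
    · rintro ⟨h, hi⟩ j
      by_cases hj : j = i
      · subst hj; simpa using hi
      · simpa [Function.update_of_ne hj] using h j
  rw [hpre, Measure.prod_prod, unifPi, Measure.pi_pi, ← Finset.mul_prod_erase _ _ (Finset.mem_univ i),
    ← Finset.mul_prod_erase (Finset.univ) (fun j => unif N (s j)) (Finset.mem_univ i)]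
  simp only [Function.update_self, measure_univ, one_mul]
  rw [mul_comm]
  congr 1
  refine Finset.prod_congr rfl fun j hj => ?_
  rw [Function.update_of_ne (Finset.ne_of_mem_erase hj)]

lemma integrable_update {k : ℕ} (i : Fin k) {G : (Fin k → ℝ) → ℝ} (hG : Integrable G (unifPi k N)) :
    Integrable (fun x => ∫ y, G (Function.update x i y) ∂unif N) (unifPi k N) :=
  ((measurePreserving_update i).integrable_comp_of_integrable hG).integral_prod_left

/-- Averaging over one coordinate. -/
lemma integral_update {k : ℕ} (i : Fin k) {G : (Fin k → ℝ) → ℝ} (hG : Integrable G (unifPi k N)) :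
    ∫ x, G x ∂unifPi k N = ∫ x, ∫ y, G (Function.update x i y) ∂unif N ∂unifPi k N := by
  have h := (measurePreserving_update (N := N) i).integrable_comp_of_integrable hG
  have h2 := integral_prod _ h
  simp only [Function.comp] at h2
  rw [← h2]
  have := (measurePreserving_update (N := N) i).map_eq
  conv_lhs => rw [← this]
  rw [integral_map (measurePreserving_update (N := N) i).measurable.aemeasurable
    (by rw [this]; exact hG.aestronglyMeasurable)]

lemma integral_eq_zero_of_update {k : ℕ} (i : Fin k) {G : (Fin k → ℝ) → ℝ}
    (hG : Integrable G (unifPi k N)) (h : ∀ x, ∫ y, G (Function.update x i y) ∂unif N = 0) :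
    ∫ x, G x ∂unifPi k N = 0 := by
  rw [integral_update i hG]; simp [h]

lemma integral_comp_injective {k m : ℕ} {ι : Fin k → Fin m} (hι : Function.Injective ι)
    {G : (Fin k → ℝ) → ℝ} (hG : Measurable G) :
    ∫ x, G (x ∘ ι) ∂unifPi m N = ∫ x, G x ∂unifPi k N := by
  have := (measurePreserving_comp (N := N) hι).map_eq
  rw [← this, integral_map (measurePreserving_comp (N := N) hι).measurable.aemeasurable
    hG.aestronglyMeasurable]

end uniform

end SineBeta

namespace SineBeta

/-! ### Bounds for the correlation functions -/

lemma abs_mul_le_mul {a b A B : ℝ} (ha : |a| ≤ A) (hb : |b| ≤ B) : |a * b| ≤ A * B := by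
  rw [abs_mul]
  exact mul_le_mul ha hb (abs_nonneg _) ((abs_nonneg _).trans ha)

namespace PairKernel

/-- The diagonal and the upper right entry decay with constant `C`, the lower left entry is bounded
by `C`. -/
structure BoundedBy (K : PairKernel) (C : ℝ) : Prop where
  pos : 0 < C
  s_le : ∀ u, |K.s u| ≤ C * decay u
  d_le : ∀ u, |K.d u| ≤ C * decay u
  e_le : ∀ u, |K.e u| ≤ C

variable {K : PairKernel} {C : ℝ}

lemma IsAdmissible.exists_boundedBy (hK : K.IsAdmissible) : ∃ C, K.BoundedBy C := by
  obtain ⟨C₁, h₁, hs⟩ := hK.s_le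
  obtain ⟨C₂, h₂, hd⟩ := hK.d_le
  obtain ⟨C₃, h₃, he⟩ := hK.e_le
  refine ⟨C₁ + C₂ + C₃ + 1, by positivity, fun u => (hs u).trans ?_, fun u => (hd u).trans ?_,
    fun u => (he u).trans (by linarith)⟩
  · exact mul_le_mul_of_nonneg_right (by linarith) (decay_pos u).le
  · exact mul_le_mul_of_nonneg_right (by linarith) (decay_pos u).le

lemma BoundedBy.T_le (h : K.BoundedBy C) (u : ℝ) : |K.T u| ≤ 2 * C ^ 2 * decay u := by
  have h1 := abs_mul_le_mul (h.s_le u) (h.s_le u)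
  have h2 := abs_mul_le_mul (h.d_le u) (h.e_le u)
  have hw := decay_pos u
  have h3 : C * decay u * (C * decay u) ≤ C * decay u * C := by
    have := h.pos
    exact mul_le_mul_of_nonneg_left (mul_le_of_le_one_right this.le (decay_le_one u))
      (by positivity)
  rw [T, sq]
  refine (abs_sub _ _).trans ?_
  linarith

lemma scalar_three_le {s₁ s₂ s₃ d₁ d₂ d₃ e₁ e₂ e₃ p₁ p₂ p₃ : ℝ} (hC : 0 < C) (hp₁ : 0 ≤ p₁)
    (hp₂ : 0 ≤ p₂) (hp₃ : 0 ≤ p₃) (hp₃' : p₃ ≤ 1)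
    (hs₁ : |s₁| ≤ C * p₁) (hs₂ : |s₂| ≤ C * p₂) (hs₃ : |s₃| ≤ C * p₃)
    (hd₁ : |d₁| ≤ C * p₁) (hd₂ : |d₂| ≤ C * p₂) (hd₃ : |d₃| ≤ C * p₃)
    (he₁ : |e₁| ≤ C) (he₂ : |e₂| ≤ C) (he₃ : |e₃| ≤ C) :
    |s₁ * s₂ * s₃ + (1 / 2) * (s₁ * (d₂ * e₃ + e₂ * d₃) + s₂ * (d₁ * e₃ + e₁ * d₃)
      + s₃ * (d₁ * e₂ + e₁ * d₂))| ≤ 2 * C ^ 3 * (p₁ * p₂ + p₂ * p₃ + p₃ * p₁) := by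
  have h0 := abs_le.1 (abs_mul_le_mul (abs_mul_le_mul hs₁ hs₂) hs₃)
  have h1 := abs_le.1 (abs_mul_le_mul (abs_mul_le_mul hs₁ hd₂) he₃)
  have h2 := abs_le.1 (abs_mul_le_mul (abs_mul_le_mul hs₁ he₂) hd₃)
  have h3 := abs_le.1 (abs_mul_le_mul (abs_mul_le_mul hs₂ hd₁) he₃)
  have h4 := abs_le.1 (abs_mul_le_mul (abs_mul_le_mul hs₂ he₁) hd₃)
  have h5 := abs_le.1 (abs_mul_le_mul (abs_mul_le_mul hs₃ hd₁) he₂)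
  have h6 := abs_le.1 (abs_mul_le_mul (abs_mul_le_mul hs₃ he₁) hd₂)
  have q1 : C ^ 3 * (p₁ * p₂) * p₃ ≤ C ^ 3 * (p₁ * p₂) := mul_le_of_le_one_right (by positivity) hp₃'
  have q2 : 0 ≤ C ^ 3 * (p₂ * p₃) := by positivity
  have q3 : 0 ≤ C ^ 3 * (p₃ * p₁) := by positivity
  rw [abs_le]
  constructor <;> nlinarith

lemma BoundedBy.R3_le (h : K.BoundedBy C) (x y z : ℝ) : |K.R3 x y z| ≤ 2 * C ^ 3 *
    (decay (x - y) * decay (y - z) + decay (y - z) * decay (z - x)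
      + decay (z - x) * decay (x - y)) := by
  rw [R3_eq]
  exact scalar_three_le h.pos (decay_pos _).le (decay_pos _).le (decay_pos _).le (decay_le_one _)
    (h.s_le _) (h.s_le _) (h.s_le _) (h.d_le _) (h.d_le _) (h.d_le _) (h.e_le _) (h.e_le _)
    (h.e_le _)

/-- The part of `R4` all of whose monomials contain at least three decaying factors. -/
noncomputable def R4dec (K : PairKernel) (x y z w : ℝ) : ℝ :=
    K.s (x - y) * K.s (y - z) * K.s (z - w) * K.s (w - x)
    + (1 / 2) * (K.s (x - y) * K.s (y - z) * (K.d (z - w) * K.e (w - x) + K.e (z - w) * K.d (w - x))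
      + K.s (x - y) * K.s (z - w) * (K.d (y - z) * K.e (w - x) + K.e (y - z) * K.d (w - x))
      + K.s (x - y) * K.s (w - x) * (K.d (y - z) * K.e (z - w) + K.e (y - z) * K.d (z - w))
      + K.s (y - z) * K.s (z - w) * (K.d (x - y) * K.e (w - x) + K.e (x - y) * K.d (w - x))
      + K.s (y - z) * K.s (w - x) * (K.d (x - y) * K.e (z - w) + K.e (x - y) * K.d (z - w))
      + K.s (z - w) * K.s (w - x) * (K.d (x - y) * K.e (y - z) + K.e (x - y) * K.d (y - z)))

/-- The alternating monomial of `R4`. -/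
def R4alt (K : PairKernel) (x y z w : ℝ) : ℝ :=
  K.d (x - y) * K.e (y - z) * K.d (z - w) * K.e (w - x)

lemma R4_eq_add (x y z w : ℝ) :
    K.R4 x y z w = K.R4dec x y z w + 1 / 2 * (K.R4alt x y z w + K.R4alt y z w x) := by
  rw [R4_eq, R4dec, R4alt, R4alt]
  ring

lemma scalar_four_le {s₁ s₂ s₃ s₄ d₁ d₂ d₃ d₄ e₁ e₂ e₃ e₄ p₁ p₂ p₃ p₄ : ℝ} (hC : 0 < C)
    (hp₁ : 0 ≤ p₁) (hp₂ : 0 ≤ p₂) (hp₃ : 0 ≤ p₃) (hp₄ : 0 ≤ p₄) (hp₄' : p₄ ≤ 1)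
    (hs₁ : |s₁| ≤ C * p₁) (hs₂ : |s₂| ≤ C * p₂) (hs₃ : |s₃| ≤ C * p₃) (hs₄ : |s₄| ≤ C * p₄)
    (hd₁ : |d₁| ≤ C * p₁) (hd₂ : |d₂| ≤ C * p₂) (hd₃ : |d₃| ≤ C * p₃) (hd₄ : |d₄| ≤ C * p₄)
    (he₁ : |e₁| ≤ C) (he₂ : |e₂| ≤ C) (he₃ : |e₃| ≤ C) (he₄ : |e₄| ≤ C) :
    |s₁ * s₂ * s₃ * s₄ + (1 / 2) * (s₁ * s₂ * (d₃ * e₄ + e₃ * d₄) + s₁ * s₃ * (d₂ * e₄ + e₂ * d₄)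
      + s₁ * s₄ * (d₂ * e₃ + e₂ * d₃) + s₂ * s₃ * (d₁ * e₄ + e₁ * d₄)
      + s₂ * s₄ * (d₁ * e₃ + e₁ * d₃) + s₃ * s₄ * (d₁ * e₂ + e₁ * d₂))| ≤
      3 * C ^ 4 * (p₁ * p₂ * p₃ + p₂ * p₃ * p₄ + p₃ * p₄ * p₁ + p₄ * p₁ * p₂) := by
  have t : ∀ {a b c d A B D E : ℝ}, |a| ≤ A → |b| ≤ B → |c| ≤ D → |d| ≤ E →
      |a * b * c * d| ≤ A * B * D * E := fun ha hb hc hd =>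
    abs_mul_le_mul (abs_mul_le_mul (abs_mul_le_mul ha hb) hc) hd
  have h0 := abs_le.1 (t hs₁ hs₂ hs₃ hs₄)
  have a1 := abs_le.1 (t hs₁ hs₂ hd₃ he₄)
  have a2 := abs_le.1 (t hs₁ hs₂ he₃ hd₄)
  have a3 := abs_le.1 (t hs₁ hs₃ hd₂ he₄)
  have a4 := abs_le.1 (t hs₁ hs₃ he₂ hd₄)
  have a5 := abs_le.1 (t hs₁ hs₄ hd₂ he₃)
  have a6 := abs_le.1 (t hs₁ hs₄ he₂ hd₃)
  have a7 := abs_le.1 (t hs₂ hs₃ hd₁ he₄)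
  have a8 := abs_le.1 (t hs₂ hs₃ he₁ hd₄)
  have a9 := abs_le.1 (t hs₂ hs₄ hd₁ he₃)
  have b1 := abs_le.1 (t hs₂ hs₄ he₁ hd₃)
  have b2 := abs_le.1 (t hs₃ hs₄ hd₁ he₂)
  have b3 := abs_le.1 (t hs₃ hs₄ he₁ hd₂)
  have q1 : C ^ 4 * (p₁ * p₂ * p₃) * p₄ ≤ C ^ 4 * (p₁ * p₂ * p₃) :=
    mul_le_of_le_one_right (by positivity) hp₄'
  have q2 : 0 ≤ C ^ 4 * (p₁ * p₂ * p₃) := by positivity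
  have q3 : 0 ≤ C ^ 4 * (p₂ * p₃ * p₄) := by positivity
  have q4 : 0 ≤ C ^ 4 * (p₃ * p₄ * p₁) := by positivity
  have q5 : 0 ≤ C ^ 4 * (p₄ * p₁ * p₂) := by positivity
  ring_nf at h0 a1 a2 a3 a4 a5 a6 a7 a8 a9 b1 b2 b3 q1 q2 q3 q4 q5
  rw [abs_le]
  constructor <;> ring_nf <;> linarith [h0.1, h0.2, a1.1, a1.2, a2.1, a2.2, a3.1, a3.2, a4.1, a4.2,
    a5.1, a5.2, a6.1, a6.2, a7.1, a7.2, a8.1, a8.2, a9.1, a9.2, b1.1, b1.2, b2.1, b2.2, b3.1, b3.2]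

lemma BoundedBy.R4dec_le (h : K.BoundedBy C) (x y z w : ℝ) : |K.R4dec x y z w| ≤ 3 * C ^ 4 *
    (decay (x - y) * decay (y - z) * decay (z - w) + decay (y - z) * decay (z - w) * decay (w - x)
      + decay (z - w) * decay (w - x) * decay (x - y)
      + decay (w - x) * decay (x - y) * decay (y - z)) :=
  scalar_four_le h.pos (decay_pos _).le (decay_pos _).le (decay_pos _).le (decay_pos _).le
    (decay_le_one _) (h.s_le _) (h.s_le _) (h.s_le _) (h.s_le _) (h.d_le _) (h.d_le _) (h.d_le _)
    (h.d_le _) (h.e_le _) (h.e_le _) (h.e_le _) (h.e_le _)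

lemma BoundedBy.R4alt_le (h : K.BoundedBy C) (x y z w : ℝ) :
    |K.R4alt x y z w| ≤ C ^ 4 * (decay (x - y) * decay (z - w)) := by
  refine (abs_mul_le_mul (abs_mul_le_mul (abs_mul_le_mul (h.d_le _) (h.e_le _)) (h.d_le _))
    (h.e_le _)).trans (le_of_eq ?_)
  ring

lemma decay_mul_le_left (u v : ℝ) : decay u * decay v ≤ decay u :=
  mul_le_of_le_one_right (decay_pos u).le (decay_le_one v)

lemma decay_mul_le_right (u v : ℝ) : decay u * decay v ≤ decay v :=
  mul_le_of_le_one_left (decay_pos v).le (decay_le_one u)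

lemma decay_mul_le_one (u v : ℝ) : decay u * decay v ≤ 1 :=
  (decay_mul_le_left u v).trans (decay_le_one u)

lemma BoundedBy.R3_bounded (h : K.BoundedBy C) (x y z : ℝ) : |K.R3 x y z| ≤ 6 * C ^ 3 := by
  refine (h.R3_le x y z).trans ?_
  have hC := h.pos
  have := decay_mul_le_one (x - y) (y - z)
  have := decay_mul_le_one (y - z) (z - x)
  have := decay_mul_le_one (z - x) (x - y)
  calc _ ≤ 2 * C ^ 3 * (1 + 1 + 1) := by gcongr
    _ = _ := by ring

lemma BoundedBy.R4_bounded (h : K.BoundedBy C) (x y z w : ℝ) : |K.R4 x y z w| ≤ 13 * C ^ 4 := by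
  have hC := h.pos
  have h3 : ∀ a b c : ℝ, decay a * decay b * decay c ≤ 1 := fun a b c =>
    (mul_le_of_le_one_left (decay_pos c).le (decay_mul_le_one a b)).trans (decay_le_one c)
  have hd : |K.R4dec x y z w| ≤ 12 * C ^ 4 := by
    refine (h.R4dec_le x y z w).trans ?_
    calc _ ≤ 3 * C ^ 4 * (1 + 1 + 1 + 1) := by gcongr <;> exact h3 _ _ _
      _ = _ := by ring
  have ha : ∀ x y z w, |K.R4alt x y z w| ≤ C ^ 4 := fun x y z w =>
    (h.R4alt_le x y z w).trans (mul_le_of_le_one_right (by positivity) (decay_mul_le_one _ _))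
  rw [R4_eq_add]
  have h1 := abs_le.1 hd
  have h2 := abs_le.1 (ha x y z w)
  have h4 := abs_le.1 (ha y z w x)
  rw [abs_le]
  constructor <;> linarith

lemma BoundedBy.T_bounded (h : K.BoundedBy C) (u : ℝ) : |K.T u| ≤ 2 * C ^ 2 :=
  (h.T_le u).trans (mul_le_of_le_one_right (by have := h.pos; positivity) (decay_le_one u))

lemma BoundedBy.r_bounded (h : K.BoundedBy C) : ∃ B, 0 ≤ B ∧ (∀ x y, |K.r2 x y| ≤ B) ∧
    (∀ x y z, |K.r3 x y z| ≤ B) ∧ ∀ x y z w, |K.r4 x y z w| ≤ B := by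
  have hC := h.pos
  refine ⟨1 + 6 * (2 * C ^ 2) + 3 * (2 * C ^ 2) ^ 2 + 8 * (6 * C ^ 3) + 6 * (13 * C ^ 4),
    by positivity, fun x y => ?_, fun x y z => ?_, fun x y z w => ?_⟩
  · have h1 := abs_le.1 (h.T_bounded (x - y))
    have : 0 ≤ (2 * C ^ 2) ^ 2 := by positivity
    have : 0 ≤ C ^ 2 := by positivity
    have : 0 ≤ C ^ 3 := by positivity
    have : 0 ≤ C ^ 4 := by positivity
    rw [r2, abs_le]
    constructor <;> linarith
  · have h1 := abs_le.1 (h.T_bounded (x - y))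
    have h2 := abs_le.1 (h.T_bounded (x - z))
    have h3 := abs_le.1 (h.T_bounded (y - z))
    have h4 := abs_le.1 (h.R3_bounded x y z)
    have : 0 ≤ (2 * C ^ 2) ^ 2 := by positivity
    have : 0 ≤ C ^ 2 := by positivity
    have : 0 ≤ C ^ 3 := by positivity
    have : 0 ≤ C ^ 4 := by positivity
    rw [r3, abs_le]
    constructor <;> linarith
  · have h1 := fun u => abs_le.1 (h.T_bounded u)
    have h2 := fun u v => abs_le.1 (abs_mul_le_mul (h.T_bounded u) (h.T_bounded v))
    have h3 := fun x y z => abs_le.1 (h.R3_bounded x y z)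
    have h4 := fun x y z w => abs_le.1 (h.R4_bounded x y z w)
    rw [r4, abs_le]
    constructor <;> linarith [h1 (x - y), h1 (x - z), h1 (x - w), h1 (y - z), h1 (y - w),
      h1 (z - w), h2 (x - y) (z - w), h2 (x - z) (y - w), h2 (x - w) (y - z), h3 x y z, h3 x y w,
      h3 x z w, h3 y z w, h4 x y z w, h4 x y w z, h4 x z y w]

lemma IsAdmissible.measurable_r2 (hK : K.IsAdmissible) {α : Type*} [MeasurableSpace α]
    {x y : α → ℝ} (hx : Measurable x) (hy : Measurable y) :
    Measurable fun a => K.r2 (x a) (y a) := by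
  have hT := hK.continuous_T.measurable
  unfold r2
  exact measurable_const.sub (hT.comp (hx.sub hy))

lemma IsAdmissible.measurable_R3 (hK : K.IsAdmissible) {α : Type*} [MeasurableSpace α]
    {x y z : α → ℝ} (hx : Measurable x) (hy : Measurable y) (hz : Measurable z) :
    Measurable fun a => K.R3 (x a) (y a) (z a) := by
  have hs := hK.measurable_s
  have hd := hK.measurable_d
  have he := hK.measurable_e
  simp only [R3_eq]
  obtain ⟨s, d, e, _, _, _, _⟩ := K
  simp only at hs hd he ⊢
  fun_prop

lemma IsAdmissible.measurable_r3 (hK : K.IsAdmissible) {α : Type*} [MeasurableSpace α]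
    {x y z : α → ℝ} (hx : Measurable x) (hy : Measurable y) (hz : Measurable z) :
    Measurable fun a => K.r3 (x a) (y a) (z a) := by
  have hT : ∀ {x y : α → ℝ}, Measurable x → Measurable y → Measurable fun a => K.T (x a - y a) :=
    fun hx hy => hK.continuous_T.measurable.comp (hx.sub hy)
  unfold r3
  exact (((measurable_const.sub (hT hx hy)).sub (hT hx hz)).sub (hT hy hz)).add
    (measurable_const.mul (hK.measurable_R3 hx hy hz))

lemma IsAdmissible.measurable_R4 (hK : K.IsAdmissible) {α : Type*} [MeasurableSpace α]
    {x y z w : α → ℝ} (hx : Measurable x) (hy : Measurable y) (hz : Measurable z)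
    (hw : Measurable w) : Measurable fun a => K.R4 (x a) (y a) (z a) (w a) := by
  have hs := hK.measurable_s
  have hd := hK.measurable_d
  have he := hK.measurable_e
  simp only [R4_eq]
  obtain ⟨s, d, e, _, _, _, _⟩ := K
  simp only at hs hd he ⊢
  fun_prop

lemma IsAdmissible.measurable_r4 (hK : K.IsAdmissible) {α : Type*} [MeasurableSpace α]
    {x y z w : α → ℝ} (hx : Measurable x) (hy : Measurable y) (hz : Measurable z)
    (hw : Measurable w) : Measurable fun a => K.r4 (x a) (y a) (z a) (w a) := by
  have hT : ∀ {x y : α → ℝ}, Measurable x → Measurable y → Measurable fun a => K.T (x a - y a) :=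
    fun hx hy => hK.continuous_T.measurable.comp (hx.sub hy)
  have h1 := hT hx hy
  have h2 := hT hx hz
  have h3 := hT hx hw
  have h4 := hT hy hz
  have h5 := hT hy hw
  have h6 := hT hz hw
  have h7 := hK.measurable_R3 hx hy hz
  have h8 := hK.measurable_R3 hx hy hw
  have h9 := hK.measurable_R3 hx hz hw
  have h10 := hK.measurable_R3 hy hz hw
  have h11 := hK.measurable_R4 hx hy hz hw
  have h12 := hK.measurable_R4 hx hy hw hz
  have h13 := hK.measurable_R4 hx hz hy hw
  unfold r4
  exact (((((((((((measurable_const.sub h1).sub h2).sub h3).sub h4).sub h5).sub h6).add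
    (h1.mul h6)).add (h2.mul h5)).add (h3.mul h4)).add
    (measurable_const.mul (((h7.add h8).add h9).add h10))).sub
    (measurable_const.mul ((h11.add h12).add h13)))

end PairKernel

/-! ### The variance of a pair sum -/

section variance

variable {Ω : Type*} [MeasurableSpace Ω] {P : Measure Ω} [IsProbabilityMeasure P] {X : Ω → Set ℝ}
  {ρ : (k : ℕ) → (Fin k → ℝ) → ℝ} {N : ℝ} [hN : Fact (0 < N)] {K : PairKernel} {g : ℝ → ℝ}

/-- The sum of `g (a - b)` over the pairs of distinct points `a`, `b` in the window. -/
noncomputable def pairSum (N : ℝ) (g : ℝ → ℝ) (A : Set ℝ) : ℝ :=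
  tupleSum (windowPoints N A) 2 fun x => g (x 0 - x 1)

/-- Square integrability over a window of a function of the difference of two points. -/
def SquareIntegrableOn (N : ℝ) (g : ℝ → ℝ) : Prop :=
  Measurable g ∧ Integrable (fun x : Fin 2 → ℝ => g (x 0 - x 1) ^ 2) (unifPi 2 N)

lemma SquareIntegrableOn.memLp (hg : SquareIntegrableOn N g) {m : ℕ} {i j : Fin m} (hij : i ≠ j) :
    MemLp (fun x : Fin m → ℝ => g (x i - x j)) 2 (unifPi m N) := by
  have hgm := hg.1
  have hm : Measurable fun x : Fin m → ℝ => g (x i - x j) :=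
    hgm.comp ((measurable_pi_apply i).sub (measurable_pi_apply j))
  rw [memLp_two_iff_integrable_sq hm.aestronglyMeasurable]
  have hι : Function.Injective ![i, j] := by
    intro a b; fin_cases a <;> fin_cases b <;> simp [hij, hij.symm]
  exact (measurePreserving_comp (N := N) hι).integrable_comp_of_integrable hg.2

lemma SquareIntegrableOn.integrable_mul (hg : SquareIntegrableOn N g) {m : ℕ} {i j k l : Fin m}
    (hij : i ≠ j) (hkl : k ≠ l) {r : (Fin m → ℝ) → ℝ} (hr : Measurable r) {B : ℝ}
    (hB : ∀ x, |r x| ≤ B) :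
    Integrable (fun x : Fin m → ℝ => g (x i - x j) * g (x k - x l) * r x) (unifPi m N) :=
  ((hg.memLp hij).integrable_mul (hg.memLp hkl)).mul_bdd (c := B)
    hr.aestronglyMeasurable (ae_of_all _ hB)

lemma SquareIntegrableOn.integrable_mul_one (hg : SquareIntegrableOn N g) {m : ℕ} {i j : Fin m}
    (hij : i ≠ j) {r : (Fin m → ℝ) → ℝ} (hr : Measurable r) {B : ℝ} (hB : ∀ x, |r x| ≤ B) :
    Integrable (fun x : Fin m → ℝ => g (x i - x j) * r x) (unifPi m N) :=
  ((hg.memLp hij).integrable (by norm_num)).mul_bdd (c := B)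
    hr.aestronglyMeasurable (ae_of_all _ hB)

lemma ae_injective (k : ℕ) : ∀ᵐ x : Fin k → ℝ, Function.Injective x := by
  have h : ∀ i j : Fin k, ∀ᵐ x : Fin k → ℝ, x i = x j → i = j := by
    intro i j
    by_cases hij : i = j
    · exact ae_of_all _ fun _ _ => hij
    · simp only [hij, imp_false]
      have := Measure.addHaar_submodule (volume : Measure (Fin k → ℝ))
        (LinearMap.ker ((LinearMap.proj i : (Fin k → ℝ) →ₗ[ℝ] ℝ) - LinearMap.proj j)) (by
          intro h
          have h2 : (Pi.single i 1 : Fin k → ℝ) ∈ LinearMap.ker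
            ((LinearMap.proj i : (Fin k → ℝ) →ₗ[ℝ] ℝ) - LinearMap.proj j) := by rw [h]; trivial
          simp [Pi.single_eq_of_ne (Ne.symm hij)] at h2)
      rw [ae_iff]
      convert this using 2
      ext x
      simp [sub_eq_zero]
  filter_upwards [ae_all_iff.2 fun i => ae_all_iff.2 (h i)] with x hx i j using hx i j

/-- The second moment of a pair sum in terms of the correlation functions. -/
theorem variance_pairSum (hX : IsSimplePointProcess X) (hρ : HasCorrelationFunctions P X ρ)
    (hK : K.IsAdmissible) (h2 : ∀ x, ρ 2 x = K.r2 (x 0) (x 1))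
    (h3 : ∀ x, ρ 3 x = K.r3 (x 0) (x 1) (x 2)) (h4 : ∀ x, ρ 4 x = K.r4 (x 0) (x 1) (x 2) (x 3))
    (hg : SquareIntegrableOn N g) (heven : ∀ u, g (-u) = g u) :
    MemLp (fun ω => pairSum N g (X ω)) 2 P ∧ variance (fun ω => pairSum N g (X ω)) P =
      N ^ 4 * ∫ x, g (x 0 - x 1) * g (x 2 - x 3) * (K.r4 (x 0) (x 1) (x 2) (x 3)
        - K.r2 (x 0) (x 1) * K.r2 (x 2) (x 3)) ∂unifPi 4 N
      + 4 * N ^ 3 * (∫ x, g (x 0 - x 1) * g (x 0 - x 2) * K.r3 (x 0) (x 1) (x 2) ∂unifPi 4 N)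
      + 2 * N ^ 2 * ∫ x, g (x 0 - x 1) * g (x 0 - x 1) * K.r2 (x 0) (x 1) ∂unifPi 4 N := by
  obtain ⟨C, hC⟩ := hK.exists_boundedBy
  obtain ⟨B, hB, hB2, hB3, hB4⟩ := hC.r_bounded
  have hgm := hg.1
  have hr2 : ∀ {m : ℕ} (i j : Fin m), Measurable fun x : Fin m → ℝ => K.r2 (x i) (x j) :=
    fun i j => hK.measurable_r2 (measurable_pi_apply i) (measurable_pi_apply j)
  have hr3 : ∀ {m : ℕ} (i j k : Fin m), Measurable fun x : Fin m → ℝ => K.r3 (x i) (x j) (x k) :=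
    fun i j k => hK.measurable_r3 (measurable_pi_apply i) (measurable_pi_apply j)
      (measurable_pi_apply k)
  have hr4 : Measurable fun x : Fin 4 → ℝ => K.r4 (x 0) (x 1) (x 2) (x 3) :=
    hK.measurable_r4 (measurable_pi_apply _) (measurable_pi_apply _) (measurable_pi_apply _)
      (measurable_pi_apply _)
  have hgij : ∀ {m : ℕ} (i j : Fin m), Measurable fun x : Fin m → ℝ => g (x i - x j) :=
    fun i j => hgm.comp ((measurable_pi_apply i).sub (measurable_pi_apply j))
  have hmρ2 : Measurable (ρ 2) := by rw [funext h2]; exact hr2 _ _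
  have hmρ3 : Measurable (ρ 3) := by rw [funext h3]; exact hr3 _ _ _
  have hmρ4 : Measurable (ρ 4) := by rw [funext h4]; exact hr4
  have hp2 : ∀ᵐ x, 0 ≤ ρ 2 x := by
    filter_upwards [ae_injective 2] with x hx
    rw [h2]; exact hK.r2_nonneg x hx
  have hp3 : ∀ᵐ x, 0 ≤ ρ 3 x := by
    filter_upwards [ae_injective 3] with x hx
    rw [h3]; exact hK.r3_nonneg x hx
  have hp4 : ∀ᵐ x, 0 ≤ ρ 4 x := by
    filter_upwards [ae_injective 4] with x hx
    rw [h4]; exact hK.r4_nonneg x hx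
  have i4 : Integrable (fun x : Fin 4 → ℝ => g (x 0 - x 1) * g (x 2 - x 3) *
      K.r4 (x 0) (x 1) (x 2) (x 3)) (unifPi 4 N) :=
    hg.integrable_mul (by decide) (by decide) hr4 fun x => hB4 _ _ _ _
  have i3 : Integrable (fun x : Fin 3 → ℝ => g (x 0 - x 1) * g (x 0 - x 2) *
      K.r3 (x 0) (x 1) (x 2)) (unifPi 3 N) :=
    hg.integrable_mul (by decide) (by decide) (hr3 _ _ _) fun x => hB3 _ _ _
  have i2 : Integrable (fun x : Fin 2 → ℝ => g (x 0 - x 1) * g (x 0 - x 1) *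
      K.r2 (x 0) (x 1)) (unifPi 2 N) :=
    hg.integrable_mul (by decide) (by decide) (hr2 _ _) fun x => hB2 _ _
  have i1 : Integrable (fun x : Fin 2 → ℝ => g (x 0 - x 1) * K.r2 (x 0) (x 1)) (unifPi 2 N) :=
    hg.integrable_mul_one (by decide) (hr2 _ _) fun x => hB2 _ _
  have c4 := campbell (N := N) hX hρ hmρ4 hp4 (G := fun x => g (x 0 - x 1) * g (x 2 - x 3))
    ((hgij _ _).mul (hgij _ _)) (by simp only [h4]; exact integrableOn_cube i4)
  have c3 := campbell (N := N) hX hρ hmρ3 hp3 (G := fun x => g (x 0 - x 1) * g (x 0 - x 2))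
    ((hgij _ _).mul (hgij _ _)) (by simp only [h3]; exact integrableOn_cube i3)
  have c2 := campbell (N := N) hX hρ hmρ2 hp2 (G := fun x => g (x 0 - x 1) * g (x 0 - x 1))
    ((hgij _ _).mul (hgij _ _)) (by simp only [h2]; exact integrableOn_cube i2)
  have c1 := campbell (N := N) hX hρ hmρ2 hp2 (G := fun x => g (x 0 - x 1))
    (hgij _ _) (by simp only [h2]; exact integrableOn_cube i1)
  have hsq : ∀ ω, pairSum N g (X ω) ^ 2 =
      tupleSum (windowPoints N (X ω)) 4 (fun x => g (x 0 - x 1) * g (x 2 - x 3))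
        + 4 * tupleSum (windowPoints N (X ω)) 3 (fun x => g (x 0 - x 1) * g (x 0 - x 2))
        + 2 * tupleSum (windowPoints N (X ω)) 2 (fun x => g (x 0 - x 1) * g (x 0 - x 1)) := by
    intro ω
    have := tupleSum_two_sq (φ := fun a b => g (a - b)) (fun a b => by rw [← heven, neg_sub])
      (windowPoints N (X ω))
    simp only [sq] at this ⊢
    exact this
  have hmS : Measurable fun ω => pairSum N g (X ω) := measurable_tupleSum hX N 2 (hgij _ _)
  have hL : MemLp (fun ω => pairSum N g (X ω)) 2 P := by
    rw [memLp_two_iff_integrable_sq hmS.aestronglyMeasurable]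
    simp only [hsq]
    exact (c4.1.add (c3.1.const_mul 4)).add (c2.1.const_mul 2)
  refine ⟨hL, ?_⟩
  rw [variance_eq_sub hL]
  have hE2 : ∫ ω, ((fun ω => pairSum N g (X ω)) ^ 2) ω ∂P =
      N ^ 4 * (∫ x, g (x 0 - x 1) * g (x 2 - x 3) * K.r4 (x 0) (x 1) (x 2) (x 3) ∂unifPi 4 N)
      + 4 * (N ^ 3 * (∫ x, g (x 0 - x 1) * g (x 0 - x 2) * K.r3 (x 0) (x 1) (x 2) ∂unifPi 4 N))
      + 2 * (N ^ 2 * ∫ x, g (x 0 - x 1) * g (x 0 - x 1) * K.r2 (x 0) (x 1) ∂unifPi 4 N) := by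
    simp only [Pi.pow_apply, hsq]
    have c43 : Integrable (fun ω =>
        tupleSum (windowPoints N (X ω)) 4 (fun x => g (x 0 - x 1) * g (x 2 - x 3))
        + 4 * tupleSum (windowPoints N (X ω)) 3 (fun x => g (x 0 - x 1) * g (x 0 - x 2))) P :=
      c4.1.add (c3.1.const_mul 4)
    rw [integral_add c43 (c2.1.const_mul 2),
      integral_add c4.1 (c3.1.const_mul 4), integral_const_mul, integral_const_mul, c4.2, c3.2, c2.2]
    simp only [h2, h3, h4]
    rw [setIntegral_cube, setIntegral_cube, setIntegral_cube]
    have e3 := integral_comp_injective (N := N) (ι := Fin.castLE (show 3 ≤ 4 by norm_num))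
      (Fin.castLE_injective _) (((hgij 0 1).mul (hgij 0 2)).mul (hr3 0 1 2))
    have e2 := integral_comp_injective (N := N) (ι := Fin.castLE (show 2 ≤ 4 by norm_num))
      (Fin.castLE_injective _) (((hgij 0 1).mul (hgij 0 1)).mul (hr2 0 1))
    simp only [Pi.mul_apply] at e3 e2
    rw [← e3, ← e2]
    rfl
  have hE1 : (∫ ω, pairSum N g (X ω) ∂P) ^ 2 = N ^ 4 * ∫ x, g (x 0 - x 1) * g (x 2 - x 3) *
      (K.r2 (x 0) (x 1) * K.r2 (x 2) (x 3)) ∂unifPi 4 N := by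
    have h1 : ∫ ω, pairSum N g (X ω) ∂P =
        N ^ 2 * ∫ x, g (x 0 - x 1) * K.r2 (x 0) (x 1) ∂unifPi 2 N := by
      rw [← setIntegral_cube]
      simpa only [h2, pairSum] using c1.2
    set φ : ℝ × ℝ → ℝ := fun p => g (p.1 - p.2) * K.r2 p.1 p.2 with hφ
    have hφm : Measurable φ :=
      (hgm.comp (measurable_fst.sub measurable_snd)).mul (hK.measurable_r2 measurable_fst
        measurable_snd)
    have e01 := integral_comp_injective (N := N) (ι := (![0, 1] : Fin 2 → Fin 4)) (by decide)
      ((hgij 0 1).mul (hr2 0 1))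
    have e23 := integral_comp_injective (N := N) (ι := (![2, 3] : Fin 2 → Fin 4)) (by decide)
      ((hgij 0 1).mul (hr2 0 1))
    have hind : iIndepFun (fun (i : Fin 4) (x : Fin 4 → ℝ) => x i) (unifPi 4 N) :=
      iIndepFun_pi (X := fun _ x => x) fun _ => aemeasurable_id
    have hind2 := (hind.indepFun_prodMk_prodMk (fun i => measurable_pi_apply i) 0 1 2 3 (by decide)
      (by decide) (by decide) (by decide)).comp hφm hφm
    have hprod := hind2.integral_fun_mul_eq_mul_integral
      (hφm.comp ((measurable_pi_apply 0).prodMk (measurable_pi_apply 1))).aestronglyMeasurable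
      (hφm.comp ((measurable_pi_apply 2).prodMk (measurable_pi_apply 3))).aestronglyMeasurable
    have e1 : ∫ x, (φ ∘ fun a : Fin 4 → ℝ => (a 0, a 1)) x ∂unifPi 4 N =
        ∫ x, g (x 0 - x 1) * K.r2 (x 0) (x 1) ∂unifPi 2 N := e01
    have e2 : ∫ x, (φ ∘ fun a : Fin 4 → ℝ => (a 2, a 3)) x ∂unifPi 4 N =
        ∫ x, g (x 0 - x 1) * K.r2 (x 0) (x 1) ∂unifPi 2 N := e23
    rw [e1, e2] at hprod
    have e3 : ∫ x, g (x 0 - x 1) * g (x 2 - x 3) * (K.r2 (x 0) (x 1) * K.r2 (x 2) (x 3))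
        ∂unifPi 4 N = ∫ x, (φ ∘ fun a : Fin 4 → ℝ => (a 0, a 1)) x *
          (φ ∘ fun a : Fin 4 → ℝ => (a 2, a 3)) x ∂unifPi 4 N := by
      refine integral_congr_ae (ae_of_all _ fun x => ?_)
      simp only [hφ, Function.comp]
      ring
    rw [e3, hprod, h1]
    ring
  rw [hE2, hE1]
  have i22 : Integrable (fun x : Fin 4 → ℝ => g (x 0 - x 1) * g (x 2 - x 3) *
      (K.r2 (x 0) (x 1) * K.r2 (x 2) (x 3))) (unifPi 4 N) :=
    hg.integrable_mul (by decide) (by decide) ((hr2 _ _).mul (hr2 _ _)) (B := B * B) fun x =>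
      abs_mul_le_mul (hB2 _ _) (hB2 _ _)
  simp only [mul_sub]
  rw [integral_sub i4 i22]
  ring

end variance

end SineBeta

namespace SineBeta

/-! ### Averages of products of decaying factors -/

lemma integral_decay_of_nonneg {t : ℝ} (ht : 0 ≤ t) :
    ∫ u in (0 : ℝ)..t, decay u = Real.log (1 + t) := by
  have h : ∀ u ∈ uIcc 0 t, HasDerivAt (fun u => Real.log (1 + u)) (decay u) u := by
    intro u hu
    rw [uIcc_of_le ht] at hu
    have h1 : HasDerivAt (fun u : ℝ => 1 + u) 1 u := (hasDerivAt_id u).const_add 1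
    have := h1.log (by linarith [hu.1])
    rwa [show decay u = 1 / (1 + u) by rw [decay, abs_of_nonneg hu.1]]
  rw [intervalIntegral.integral_eq_sub_of_hasDerivAt h (continuous_decay.intervalIntegrable _ _)]
  simp

lemma integral_decay (t : ℝ) : |∫ u in (0 : ℝ)..t, decay u| = Real.log (1 + |t|) := by
  rcases le_total 0 t with h | h
  · rw [integral_decay_of_nonneg h, abs_of_nonneg h, abs_of_nonneg (Real.log_nonneg (by linarith))]
  · have := intervalIntegral.integral_comp_neg (a := 0) (b := -t) (fun u => decay u)
    simp only [decay_neg, neg_neg, neg_zero] at this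
    rw [intervalIntegral.integral_symm, ← this, integral_decay_of_nonneg (by linarith), abs_neg,
      abs_of_nonpos h, abs_of_nonneg (Real.log_nonneg (by linarith))]

/-- A bound for the integral of the weight over a window of length `N`. -/
noncomputable def logBound (N : ℝ) : ℝ := 1 + 2 * Real.log (1 + N)

lemma one_le_logBound {N : ℝ} (hN : 0 ≤ N) : 1 ≤ logBound N := by
  have := Real.log_nonneg (show 1 ≤ 1 + N by linarith)
  unfold logBound; linarith

lemma integral_decay_sub_le {N : ℝ} (hN : 0 ≤ N) (y : ℝ) :
    ∫ x in (0 : ℝ)..N, decay (x - y) ≤ logBound N := by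
  have hi : ∀ a b, IntervalIntegrable decay volume a b :=
    fun a b => continuous_decay.intervalIntegrable a b
  have hlog := Real.log_nonneg (show 1 ≤ 1 + N by linarith)
  have hcomp : ∫ x in (0 : ℝ)..N, decay (x - y) = ∫ x in (0 - y)..(N - y), decay x :=
    intervalIntegral.integral_comp_sub_right (fun u => decay u) y
  have hmon : ∀ t, 0 ≤ t → (∫ u in t..t + N, decay u) ≤ Real.log (1 + N) := by
    intro t ht
    rw [← integral_decay_of_nonneg hN]
    have h1 : ∫ u in t..t + N, decay u = ∫ u in (0 : ℝ)..N, decay (u + t) := by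
      rw [intervalIntegral.integral_comp_add_right (fun u => decay u) t, zero_add, add_comm]
    rw [h1]
    refine intervalIntegral.integral_mono_on hN
      ((continuous_decay.comp (by fun_prop : Continuous fun u => u + t)).intervalIntegrable _ _)
      (hi _ _) fun u hu => ?_
    unfold decay
    rw [abs_of_nonneg hu.1, abs_of_nonneg (by linarith [hu.1])]
    have := hu.1
    gcongr
    linarith
  rw [hcomp]
  unfold logBound
  rcases le_total y 0 with h | h
  · have := hmon (0 - y) (by linarith)
    rw [show 0 - y + N = N - y by ring] at this
    linarith
  rcases le_total y N with h' | h'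
  · rw [← intervalIntegral.integral_interval_sub_left (hi 0 _) (hi 0 _)]
    have h1 := integral_decay (N - y)
    have h2 := integral_decay (0 - y)
    have h3 : Real.log (1 + |N - y|) ≤ Real.log (1 + N) := by
      rw [abs_of_nonneg (by linarith)]
      exact Real.log_le_log (by linarith) (by linarith)
    have h4 : Real.log (1 + |0 - y|) ≤ Real.log (1 + N) := by
      rw [zero_sub, abs_neg, abs_of_nonneg h]
      exact Real.log_le_log (by linarith) (by linarith)
    have h5 := le_abs_self (∫ u in (0 : ℝ)..(N - y), decay u)
    have h6 := neg_abs_le (∫ u in (0 : ℝ)..(0 - y), decay u)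
    linarith
  · have h1 : ∫ x in (0 - y)..(N - y), decay x = ∫ x in (y - N)..(y - N + N), decay x := by
      have := intervalIntegral.integral_comp_neg (a := 0 - y) (b := N - y) (fun u => decay u)
      simp only [decay_neg] at this
      rw [this]
      congr 1 <;> ring
    have := hmon (y - N) (by linarith)
    rw [h1]
    linarith

/-- Bounded measurable functions of finitely many points. -/
def BddMeas {k : ℕ} (H : (Fin k → ℝ) → ℝ) : Prop := Measurable H ∧ ∃ B, ∀ x, |H x| ≤ B

namespace BddMeas

variable {k : ℕ} {G H : (Fin k → ℝ) → ℝ} {N : ℝ} [hN : Fact (0 < N)]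

lemma integrable (h : BddMeas H) : Integrable H (unifPi k N) := by
  obtain ⟨hm, B, hB⟩ := h
  exact Integrable.of_bound hm.aestronglyMeasurable B (ae_of_all _ hB)

lemma const (c : ℝ) : BddMeas fun _ : Fin k → ℝ => c := ⟨measurable_const, |c|, fun _ => le_rfl⟩

lemma mul (hG : BddMeas G) (hH : BddMeas H) : BddMeas fun x => G x * H x := by
  obtain ⟨hm, B, hB⟩ := hG
  obtain ⟨hm', B', hB'⟩ := hH
  exact ⟨hm.mul hm', B * B', fun x => abs_mul_le_mul (hB x) (hB' x)⟩

lemma add (hG : BddMeas G) (hH : BddMeas H) : BddMeas fun x => G x + H x := by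
  obtain ⟨hm, B, hB⟩ := hG
  obtain ⟨hm', B', hB'⟩ := hH
  exact ⟨hm.add hm', B + B', fun x => (abs_add_le _ _).trans (add_le_add (hB x) (hB' x))⟩

lemma neg (hG : BddMeas G) : BddMeas fun x => -G x := by
  obtain ⟨hm, B, hB⟩ := hG
  exact ⟨hm.neg, B, fun x => by rw [abs_neg]; exact hB x⟩

lemma sub (hG : BddMeas G) (hH : BddMeas H) : BddMeas fun x => G x - H x := by
  simpa only [sub_eq_add_neg] using hG.add hH.neg

lemma comp_sub {f : ℝ → ℝ} (hf : Measurable f) {B : ℝ} (hB : ∀ u, |f u| ≤ B) (i j : Fin k) :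
    BddMeas fun x => f (x i - x j) :=
  ⟨hf.comp ((measurable_pi_apply i).sub (measurable_pi_apply j)), B, fun _ => hB _⟩

lemma decay_sub (i j : Fin k) : BddMeas fun x => decay (x i - x j) :=
  comp_sub continuous_decay.measurable (B := 1) (fun u => by
    rw [abs_of_pos (decay_pos u)]; exact decay_le_one u) i j

end BddMeas

section peel

variable {k : ℕ} {N : ℝ} [hN : Fact (0 < N)]

lemma integral_decay_unif_le (y : ℝ) : ∫ z, decay (z - y) ∂unif N ≤ logBound N / N := by
  rw [integral_unif, one_div, div_eq_inv_mul]
  exact mul_le_mul_of_nonneg_left (integral_decay_sub_le hN.out.le y) (inv_nonneg.2 hN.out.le)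

/-- Integrating out a point that enters through one decaying factor only. -/
lemma integral_decay_mul_le {i j : Fin k} (hij : i ≠ j) {H : (Fin k → ℝ) → ℝ} (hH : BddMeas H)
    (h0 : ∀ x, 0 ≤ H x) (hi : ∀ x y, H (Function.update x i y) = H x) :
    ∫ x, decay (x i - x j) * H x ∂unifPi k N ≤ logBound N / N * ∫ x, H x ∂unifPi k N := by
  have hint : BddMeas fun x : Fin k → ℝ => decay (x i - x j) * H x :=
    (BddMeas.decay_sub i j).mul hH
  rw [integral_update i hint.integrable, ← integral_const_mul]
  refine integral_mono (integrable_update i hint.integrable) (hH.integrable.const_mul _) fun x => ?_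
  simp only [Function.update_self, Function.update_of_ne (Ne.symm hij), hi]
  rw [integral_mul_const]
  exact mul_le_mul_of_nonneg_right (integral_decay_unif_le _) (h0 x)

lemma integral_decay_le {i j : Fin k} (hij : i ≠ j) :
    ∫ x, decay (x i - x j) ∂unifPi k N ≤ logBound N / N := by
  have := integral_decay_mul_le (N := N) hij (BddMeas.const 1) (fun _ => zero_le_one)
    (fun _ _ => rfl)
  simpa using this

lemma logBound_div_nonneg : 0 ≤ logBound N / N :=
  div_nonneg (zero_le_one.trans (one_le_logBound hN.out.le)) hN.out.le

lemma integral_decay_two_le {a b c : Fin k} (hab : a ≠ b) (hac : a ≠ c) (hbc : b ≠ c) :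
    ∫ x, decay (x a - x b) * decay (x b - x c) ∂unifPi k N ≤ (logBound N / N) ^ 2 := by
  refine (integral_decay_mul_le hab (BddMeas.decay_sub b c) (fun x => (decay_pos _).le)
    fun x y => ?_).trans ?_
  · rw [Function.update_of_ne hab.symm, Function.update_of_ne hac.symm]
  · rw [sq]
    exact mul_le_mul_of_nonneg_left (integral_decay_le hbc) logBound_div_nonneg

lemma integral_decay_three_le {a b c d : Fin k} (hab : a ≠ b) (hac : a ≠ c) (had : a ≠ d)
    (hbc : b ≠ c) (hbd : b ≠ d) (hcd : c ≠ d) :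
    ∫ x, decay (x a - x b) * decay (x b - x c) * decay (x c - x d) ∂unifPi k N ≤
      (logBound N / N) ^ 3 := by
  simp only [mul_assoc]
  refine (integral_decay_mul_le hab ((BddMeas.decay_sub b c).mul (BddMeas.decay_sub c d))
    (fun x => mul_nonneg (decay_pos _).le (decay_pos _).le) fun x y => ?_).trans ?_
  · rw [Function.update_of_ne hab.symm, Function.update_of_ne hac.symm, Function.update_of_ne had.symm]
  · rw [pow_succ' _ 2]
    exact mul_le_mul_of_nonneg_left (integral_decay_two_le hbc hbd hcd) logBound_div_nonneg

end peel

/-- The absolute value of an average is bounded by the average of a dominating function. -/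
lemma abs_integral_le {k : ℕ} {N : ℝ} {G H : (Fin k → ℝ) → ℝ} (hH : Integrable H (unifPi k N))
    (h : ∀ x, |G x| ≤ H x) : |∫ x, G x ∂unifPi k N| ≤ ∫ x, H x ∂unifPi k N :=
  (Real.norm_eq_abs _).symm.le.trans (norm_integral_le_of_norm_le hH (ae_of_all _ h))

section byParts

variable {N : ℝ}

/-- Integration by parts against the truncated two-point function. -/
lemma PairKernel.exists_abs_sub_convolution_le {K : PairKernel} (hK : K.IsAdmissible) :
    ∃ C, 0 ≤ C ∧ ∀ {N : ℝ} {g g' : ℝ → ℝ} {A D a : ℝ} (b : ℝ), (∀ u, HasDerivAt g (g' u) u) →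
      Continuous g' → (∀ u, |g u| ≤ A) → (∀ u, |g' u| ≤ D) → a ∈ Icc 0 N →
      |g (a - b) - ∫ z in (0 : ℝ)..N, K.T (a - z) * g (z - b)| ≤
        C * (A * (decay a + decay (N - a)) + D * logBound N) := by
  obtain ⟨C, hC, hmass⟩ := hK.mass
  refine ⟨C, hC, ?_⟩
  intro N g g' A D a b hg hg' hA hD ha
  have hT := hK.continuous_T
  have hgc : Continuous g := continuous_iff_continuousAt.2 fun u => (hg u).continuousAt
  have hD0 : 0 ≤ D := (abs_nonneg _).trans (hD 0)
  have hA0 : 0 ≤ A := (abs_nonneg _).trans (hA 0)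
  have hN : 0 ≤ N := ha.1.trans ha.2
  set M : ℝ → ℝ := fun u => ∫ v in (0 : ℝ)..u, K.T v with hM
  have hMd : ∀ u, HasDerivAt M (K.T u) u := fun u => (hT.integral_hasStrictDerivAt 0 u).hasDerivAt
  have hMc : Continuous M := continuous_iff_continuousAt.2 fun u => (hMd u).continuousAt
  have hgd : ∀ z, HasDerivAt (fun z => g (z - b)) (g' (z - b)) z := fun z =>
    (hg (z - b)).comp_sub_const z b
  have hdec : ∀ p q : ℝ, IntervalIntegrable (fun z => decay (z - a)) volume p q := fun p q =>
    (continuous_decay.comp (by fun_prop : Continuous fun z => z - a)).intervalIntegrable _ _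
  -- the part to the right of `a`
  have hr : ∫ z in a..N, K.T (a - z) * g (z - b) =
      1 / 2 * g (a - b) - (1 / 2 - M (N - a)) * g (N - b)
        + ∫ z in a..N, (1 / 2 - M (z - a)) * g' (z - b) := by
    have h1 : ∀ z, HasDerivAt (fun z => -(1 / 2 - M (z - a)) * g (z - b))
        (K.T (a - z) * g (z - b) - (1 / 2 - M (z - a)) * g' (z - b)) z := by
      intro z
      have hz : HasDerivAt (fun z => -(1 / 2 - M (z - a))) (K.T (z - a)) z := by
        have := (((hMd (z - a)).comp_sub_const z a).const_sub (1 / 2)).neg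
        rwa [neg_neg] at this
      refine (hz.mul (hgd z)).congr_deriv ?_
      rw [K.T_sub_comm a z]
      ring
    have h2 := intervalIntegral.integral_eq_sub_of_hasDerivAt (a := a) (b := N) (fun z _ => h1 z)
      (Continuous.intervalIntegrable (by fun_prop) _ _)
    rw [intervalIntegral.integral_sub (Continuous.intervalIntegrable (by fun_prop) _ _)
      (Continuous.intervalIntegrable (by fun_prop) _ _)] at h2
    have h3 : M 0 = 0 := by simp [hM]
    rw [sub_self, h3] at h2
    linarith
  have hl : ∫ z in (0 : ℝ)..a, K.T (a - z) * g (z - b) =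
      1 / 2 * g (a - b) - (1 / 2 - M a) * g (0 - b)
        - ∫ z in (0 : ℝ)..a, (1 / 2 - M (a - z)) * g' (z - b) := by
    have h1 : ∀ z, HasDerivAt (fun z => (1 / 2 - M (a - z)) * g (z - b))
        (K.T (a - z) * g (z - b) + (1 / 2 - M (a - z)) * g' (z - b)) z := by
      intro z
      have hz : HasDerivAt (fun z => 1 / 2 - M (a - z)) (K.T (a - z)) z := by
        have := ((hMd (a - z)).comp_const_sub a z).const_sub (1 / 2)
        rwa [neg_neg] at this
      exact hz.mul (hgd z)
    have h2 := intervalIntegral.integral_eq_sub_of_hasDerivAt (a := 0) (b := a) (fun z _ => h1 z)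
      (Continuous.intervalIntegrable (by fun_prop) _ _)
    rw [intervalIntegral.integral_add (Continuous.intervalIntegrable (by fun_prop) _ _)
      (Continuous.intervalIntegrable (by fun_prop) _ _)] at h2
    have h3 : M 0 = 0 := by simp [hM]
    simp only [sub_self, h3, sub_zero] at h2
    linarith
  have hsplit := intervalIntegral.integral_add_adjacent_intervals (a := 0) (b := a) (c := N)
    (f := fun z => K.T (a - z) * g (z - b)) (μ := volume)
    (Continuous.intervalIntegrable (by fun_prop) _ _)
    (Continuous.intervalIntegrable (by fun_prop) _ _)
  have b1 : |(1 / 2 - M (N - a)) * g (N - b)| ≤ C * decay (N - a) * A :=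
    abs_mul_le_mul (hmass _ (by linarith [ha.2])) (hA _)
  have b2 : |(1 / 2 - M a) * g (0 - b)| ≤ C * decay a * A :=
    abs_mul_le_mul (hmass _ ha.1) (hA _)
  have b3 : |∫ z in a..N, (1 / 2 - M (z - a)) * g' (z - b)| ≤
      ∫ z in a..N, C * D * decay (z - a) := by
    rw [← Real.norm_eq_abs]
    refine intervalIntegral.norm_integral_le_of_norm_le ha.2 (ae_of_all _ fun z hz => ?_)
      ((hdec _ _).const_mul _)
    refine (abs_mul_le_mul (hmass _ (by linarith [hz.1])) (hD _)).trans (le_of_eq (by ring))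
  have b4 : |∫ z in (0 : ℝ)..a, (1 / 2 - M (a - z)) * g' (z - b)| ≤
      ∫ z in (0 : ℝ)..a, C * D * decay (z - a) := by
    rw [← Real.norm_eq_abs]
    refine intervalIntegral.norm_integral_le_of_norm_le ha.1 (ae_of_all _ fun z hz => ?_)
      ((hdec _ _).const_mul _)
    refine (abs_mul_le_mul (hmass _ (by linarith [hz.2])) (hD _)).trans (le_of_eq ?_)
    rw [decay_sub_comm a z]
    ring
  have b5 : (∫ z in (0 : ℝ)..a, C * D * decay (z - a)) + ∫ z in a..N, C * D * decay (z - a) ≤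
      C * D * logBound N := by
    rw [intervalIntegral.integral_add_adjacent_intervals ((hdec _ _).const_mul _)
      ((hdec _ _).const_mul _), intervalIntegral.integral_const_mul]
    exact mul_le_mul_of_nonneg_left (integral_decay_sub_le hN a) (by positivity)
  rw [← hsplit, hr, hl]
  rw [abs_le] at *
  constructor <;> nlinarith

/-- Integration by parts against `d e` for kernels with `d = s'` and `s = e'`. -/
lemma PairKernel.BoundedBy.abs_integral_mul_le {K : PairKernel} {C : ℝ} (hC : K.BoundedBy C)
    (hs : ∀ u, HasDerivAt K.s (K.d u) u) (he : ∀ u, HasDerivAt K.e (K.s u) u)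
    (hd : Continuous K.d) {g g' : ℝ → ℝ} {A D : ℝ} (hN : 0 ≤ N) (hg : ∀ u, HasDerivAt g (g' u) u)
    (hg' : Continuous g') (hA : ∀ u, |g u| ≤ A) (hD : ∀ u, |g' u| ≤ D) (b p q : ℝ) :
    |∫ z in (0 : ℝ)..N, g (z - b) * K.d (z - p) * K.e (q - z)| ≤
      C ^ 2 * (A * (decay (N - p) + decay (0 - p)) + D * logBound N
        + A * ∫ z in (0 : ℝ)..N, decay (z - p) * decay (z - q)) := by
  have hC0 := hC.pos
  have hgc : Continuous g := continuous_iff_continuousAt.2 fun u => (hg u).continuousAt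
  have hsc : Continuous K.s := continuous_iff_continuousAt.2 fun u => (hs u).continuousAt
  have hec : Continuous K.e := continuous_iff_continuousAt.2 fun u => (he u).continuousAt
  have hdecay := continuous_decay
  have hD0 : 0 ≤ D := (abs_nonneg _).trans (hD 0)
  have h1 : ∀ z, HasDerivAt (fun z => g (z - b) * K.s (z - p) * K.e (q - z))
      (g (z - b) * K.d (z - p) * K.e (q - z) + (g' (z - b) * K.s (z - p) * K.e (q - z)
        - g (z - b) * K.s (z - p) * K.s (q - z))) z := by
    intro z
    have e1 : HasDerivAt (fun z => g (z - b)) (g' (z - b)) z :=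
      (hg (z - b)).comp_sub_const z b
    have e2 : HasDerivAt (fun z => K.s (z - p)) (K.d (z - p)) z :=
      (hs (z - p)).comp_sub_const z p
    have e3 : HasDerivAt (fun z => K.e (q - z)) (-K.s (q - z)) z :=
      (he (q - z)).comp_const_sub q z
    exact ((e1.mul e2).mul e3).congr_deriv (by simp only [Pi.mul_apply]; ring)
  have h2 := intervalIntegral.integral_eq_sub_of_hasDerivAt (a := 0) (b := N) (fun z _ => h1 z)
    (Continuous.intervalIntegrable (by fun_prop) _ _)
  rw [intervalIntegral.integral_add (Continuous.intervalIntegrable (by fun_prop) _ _)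
    (Continuous.intervalIntegrable (by fun_prop) _ _),
    intervalIntegral.integral_sub (Continuous.intervalIntegrable (by fun_prop) _ _)
    (Continuous.intervalIntegrable (by fun_prop) _ _)] at h2
  have b1 : |g (N - b) * K.s (N - p) * K.e (q - N)| ≤ A * (C * decay (N - p)) * C :=
    abs_mul_le_mul (abs_mul_le_mul (hA _) (hC.s_le _)) (hC.e_le _)
  have b2 : |g (0 - b) * K.s (0 - p) * K.e (q - 0)| ≤ A * (C * decay (0 - p)) * C :=
    abs_mul_le_mul (abs_mul_le_mul (hA _) (hC.s_le _)) (hC.e_le _)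
  have b3 : |∫ z in (0 : ℝ)..N, g' (z - b) * K.s (z - p) * K.e (q - z)| ≤
      C ^ 2 * (D * logBound N) := by
    have h3 : |∫ z in (0 : ℝ)..N, g' (z - b) * K.s (z - p) * K.e (q - z)| ≤
        ∫ z in (0 : ℝ)..N, C ^ 2 * D * decay (z - p) := by
      rw [← Real.norm_eq_abs]
      refine intervalIntegral.norm_integral_le_of_norm_le hN (ae_of_all _ fun z hz => ?_)
        (Continuous.intervalIntegrable (by fun_prop) _ _)
      exact (abs_mul_le_mul (abs_mul_le_mul (hD _) (hC.s_le _)) (hC.e_le _)).trans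
        (le_of_eq (by ring))
    refine h3.trans ?_
    rw [intervalIntegral.integral_const_mul, mul_assoc]
    exact mul_le_mul_of_nonneg_left (mul_le_mul_of_nonneg_left (integral_decay_sub_le hN p) hD0)
      (by positivity)
  have b4 : |∫ z in (0 : ℝ)..N, g (z - b) * K.s (z - p) * K.s (q - z)| ≤
      C ^ 2 * (A * ∫ z in (0 : ℝ)..N, decay (z - p) * decay (z - q)) := by
    rw [← mul_assoc, ← intervalIntegral.integral_const_mul, ← Real.norm_eq_abs]
    refine intervalIntegral.norm_integral_le_of_norm_le hN (ae_of_all _ fun z hz => ?_)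
      (Continuous.intervalIntegrable (by fun_prop) _ _)
    refine (abs_mul_le_mul (abs_mul_le_mul (hA _) (hC.s_le _)) (hC.s_le _)).trans (le_of_eq ?_)
    rw [decay_sub_comm q z]
    ring
  rw [abs_le] at *
  constructor <;> nlinarith

end byParts

end SineBeta

namespace SineBeta

/-! ### The variance of a smooth pair sum -/

/-- Even differentiable test functions whose average over the window seen from any point is zero. -/
structure IsSmoothTest (N A D : ℝ) (g g' : ℝ → ℝ) : Prop where
  even : ∀ u, g (-u) = g u
  deriv : ∀ u, HasDerivAt g (g' u) u
  cont : Continuous g'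
  le : ∀ u, |g u| ≤ A
  deriv_le : ∀ u, |g' u| ≤ D
  mean : ∀ y, ∫ x in (0 : ℝ)..N, g (x - y) = 0

section point

variable {k : ℕ} {N : ℝ} [hN : Fact (0 < N)]

lemma ae_mem_window (k : ℕ) : ∀ᵐ x ∂unifPi k N, ∀ i, x i ∈ Icc 0 N := by
  rw [ae_all_iff]
  intro i
  have h : ∀ᵐ y ∂unif N, y ∈ Icc 0 N := by
    unfold unif
    exact Measure.ae_smul_measure (ae_restrict_mem measurableSet_Icc) _
  exact (Measure.quasiMeasurePreserving_eval (fun _ : Fin k => unif N) i).ae h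

lemma integral_decay_sub_const_mul_le (i : Fin k) (c : ℝ) {H : (Fin k → ℝ) → ℝ} (hH : BddMeas H)
    (h0 : ∀ x, 0 ≤ H x) (hi : ∀ x y, H (Function.update x i y) = H x) :
    ∫ x, decay (x i - c) * H x ∂unifPi k N ≤ logBound N / N * ∫ x, H x ∂unifPi k N := by
  have hd : BddMeas fun x : Fin k → ℝ => decay (x i - c) :=
    ⟨continuous_decay.measurable.comp ((measurable_pi_apply i).sub measurable_const), 1, fun x => by
      rw [abs_of_pos (decay_pos _)]; exact decay_le_one _⟩
  rw [integral_update i (hd.mul hH).integrable, ← integral_const_mul]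
  refine integral_mono (integrable_update i (hd.mul hH).integrable) (hH.integrable.const_mul _)
    fun x => ?_
  simp only [Function.update_self, hi]
  rw [integral_mul_const]
  exact mul_le_mul_of_nonneg_right (integral_decay_unif_le _) (h0 x)

end point

namespace IsSmoothTest

variable {N A D : ℝ} {g g' : ℝ → ℝ}

lemma nonneg (hg : IsSmoothTest N A D g g') : 0 ≤ A := (abs_nonneg _).trans (hg.le 0)

lemma deriv_nonneg (hg : IsSmoothTest N A D g g') : 0 ≤ D := (abs_nonneg _).trans (hg.deriv_le 0)

lemma continuous (hg : IsSmoothTest N A D g g') : Continuous g :=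
  continuous_iff_continuousAt.2 fun u => (hg.deriv u).continuousAt

lemma sub_comm (hg : IsSmoothTest N A D g g') (x y : ℝ) : g (x - y) = g (y - x) := by
  rw [← hg.even, neg_sub]

variable {k : ℕ}

lemma bdd (hg : IsSmoothTest N A D g g') (i j : Fin k) :
    BddMeas fun x : Fin k → ℝ => g (x i - x j) :=
  BddMeas.comp_sub hg.continuous.measurable hg.le i j

variable [hN : Fact (0 < N)]

lemma squareIntegrableOn (hg : IsSmoothTest N A D g g') : SquareIntegrableOn N g := by
  refine ⟨hg.continuous.measurable, ?_⟩
  simp only [sq]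
  exact ((hg.bdd 0 1).mul (hg.bdd 0 1)).integrable

/-- A factor through which alone a point enters averages to zero. -/
lemma integral_eq_zero (hg : IsSmoothTest N A D g g') {i j : Fin k} (hij : i ≠ j)
    {H : (Fin k → ℝ) → ℝ} (hH : BddMeas H) (hi : ∀ x y, H (Function.update x i y) = H x) :
    ∫ x, g (x i - x j) * H x ∂unifPi k N = 0 := by
  refine integral_eq_zero_of_update i ((hg.bdd i j).mul hH).integrable fun x => ?_
  simp only [Function.update_self, Function.update_of_ne (Ne.symm hij), hi]
  rw [integral_mul_const, integral_unif, hg.mean]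
  simp

end IsSmoothTest

section bounds

variable {N A D : ℝ} {g g' : ℝ → ℝ} [hN : Fact (0 < N)] {K : PairKernel} {C : ℝ}

lemma PairKernel.BoundedBy.bdd_T (hC : K.BoundedBy C) (hK : K.IsAdmissible) {k : ℕ} (i j : Fin k) :
    BddMeas fun x : Fin k → ℝ => K.T (x i - x j) :=
  BddMeas.comp_sub hK.continuous_T.measurable hC.T_bounded i j

lemma PairKernel.BoundedBy.bdd_R3 (hC : K.BoundedBy C) (hK : K.IsAdmissible) {k : ℕ}
    (a b c : Fin k) : BddMeas fun x : Fin k → ℝ => K.R3 (x a) (x b) (x c) :=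
  ⟨hK.measurable_R3 (measurable_pi_apply _) (measurable_pi_apply _) (measurable_pi_apply _), _,
    fun _ => hC.R3_bounded _ _ _⟩

lemma PairKernel.BoundedBy.bdd_R4alt (hC : K.BoundedBy C) (hK : K.IsAdmissible) {k : ℕ}
    (a b c d : Fin k) : BddMeas fun x : Fin k → ℝ => K.R4alt (x a) (x b) (x c) (x d) := by
  have hd : ∀ i j, BddMeas fun x : Fin k → ℝ => K.d (x i - x j) := BddMeas.comp_sub
    hK.measurable_d (B := C) fun u => (hC.d_le u).trans
      (mul_le_of_le_one_right hC.pos.le (decay_le_one u))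
  have he : ∀ i j, BddMeas fun x : Fin k → ℝ => K.e (x i - x j) := BddMeas.comp_sub
    hK.measurable_e hC.e_le
  exact (((hd a b).mul (he b c)).mul (hd c d)).mul (he d a)

lemma PairKernel.BoundedBy.bdd_R4dec (hC : K.BoundedBy C) (hK : K.IsAdmissible) {k : ℕ}
    (a b c d : Fin k) : BddMeas fun x : Fin k → ℝ => K.R4dec (x a) (x b) (x c) (x d) := by
  have h1 : BddMeas fun x : Fin k → ℝ => K.R4 (x a) (x b) (x c) (x d) :=
    ⟨hK.measurable_R4 (measurable_pi_apply _) (measurable_pi_apply _) (measurable_pi_apply _)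
      (measurable_pi_apply _), _, fun _ => hC.R4_bounded _ _ _ _⟩
  have h2 := h1.sub ((BddMeas.const (1 / 2)).mul ((hC.bdd_R4alt hK a b c d).add
    (hC.bdd_R4alt hK b c d a)))
  refine (congrArg BddMeas (funext fun x => ?_)).mp h2
  rw [K.R4_eq_add]
  ring

lemma abs_integral_R4dec_le (hC : K.BoundedBy C) {G : (Fin 4 → ℝ) → ℝ} {B : ℝ}
    (hG : ∀ x, |G x| ≤ B) {a b c d : Fin 4} (hab : a ≠ b) (hac : a ≠ c) (had : a ≠ d)
    (hbc : b ≠ c) (hbd : b ≠ d) (hcd : c ≠ d) :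
    |∫ x, G x * K.R4dec (x a) (x b) (x c) (x d) ∂unifPi 4 N| ≤
      12 * B * C ^ 4 * (logBound N / N) ^ 3 := by
  have hB : 0 ≤ B := (abs_nonneg _).trans (hG 0)
  have hC0 := hC.pos
  have w : ∀ i j : Fin 4, BddMeas fun x : Fin 4 → ℝ => decay (x i - x j) :=
    fun i j => BddMeas.decay_sub i j
  have h1 := ((w a b).mul (w b c)).mul (w c d)
  have h2 := ((w b c).mul (w c d)).mul (w d a)
  have h3 := ((w c d).mul (w d a)).mul (w a b)
  have h4 := ((w d a).mul (w a b)).mul (w b c)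
  refine (abs_integral_le (((((h1.add h2).add h3).add h4).integrable).const_mul
    (B * (3 * C ^ 4))) fun x => ?_).trans ?_
  · rw [mul_assoc]
    exact abs_mul_le_mul (hG x) (hC.R4dec_le _ _ _ _)
  · rw [integral_const_mul, integral_add ((h1.add h2).add h3).integrable h4.integrable,
      integral_add (h1.add h2).integrable h3.integrable,
      integral_add h1.integrable h2.integrable]
    have q1 := integral_decay_three_le (N := N) hab hac had hbc hbd hcd
    have q2 := integral_decay_three_le (N := N) hbc hbd hab.symm hcd hac.symm had.symm
    have q3 := integral_decay_three_le (N := N) hcd hac.symm hbc.symm had.symm hbd.symm hab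
    have q4 := integral_decay_three_le (N := N) had.symm hbd.symm hcd.symm hab hac hbc
    refine (mul_le_mul_of_nonneg_left (add_le_add (add_le_add (add_le_add q1 q2) q3) q4)
      (by positivity)).trans (le_of_eq ?_)
    ring

lemma abs_integral_R3_le (hC : K.BoundedBy C) {G : (Fin 4 → ℝ) → ℝ} {B : ℝ}
    (hG : ∀ x, |G x| ≤ B) {a b c : Fin 4} (hab : a ≠ b) (hac : a ≠ c) (hbc : b ≠ c) :
    |∫ x, G x * K.R3 (x a) (x b) (x c) ∂unifPi 4 N| ≤ 6 * B * C ^ 3 * (logBound N / N) ^ 2 := by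
  have hB : 0 ≤ B := (abs_nonneg _).trans (hG 0)
  have hC0 := hC.pos
  have w : ∀ i j : Fin 4, BddMeas fun x : Fin 4 → ℝ => decay (x i - x j) :=
    fun i j => BddMeas.decay_sub i j
  have h1 := (w a b).mul (w b c)
  have h2 := (w b c).mul (w c a)
  have h3 := (w c a).mul (w a b)
  refine (abs_integral_le (((h1.add h2).add h3).integrable.const_mul (B * (2 * C ^ 3)))
    fun x => ?_).trans ?_
  · rw [mul_assoc]
    exact abs_mul_le_mul (hG x) (hC.R3_le _ _ _)
  · rw [integral_const_mul, integral_add (h1.add h2).integrable h3.integrable,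
      integral_add h1.integrable h2.integrable]
    have q1 := integral_decay_two_le (N := N) hab hac hbc
    have q2 := integral_decay_two_le (N := N) hbc hab.symm hac.symm
    have q3 := integral_decay_two_le (N := N) hac.symm hbc.symm hab
    refine (mul_le_mul_of_nonneg_left (add_le_add (add_le_add q1 q2) q3)
      (by positivity)).trans (le_of_eq ?_)
    ring

lemma abs_integral_T_le (hC : K.BoundedBy C) {G : (Fin 4 → ℝ) → ℝ} {B : ℝ}
    (hG : ∀ x, |G x| ≤ B) {a b : Fin 4} (hab : a ≠ b) :
    |∫ x, G x * K.T (x a - x b) ∂unifPi 4 N| ≤ 2 * B * C ^ 2 * (logBound N / N) := by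
  have hB : 0 ≤ B := (abs_nonneg _).trans (hG 0)
  have hC0 := hC.pos
  have w : BddMeas fun x : Fin 4 → ℝ => decay (x a - x b) := BddMeas.decay_sub a b
  refine (abs_integral_le (w.integrable.const_mul (B * (2 * C ^ 2))) fun x => ?_).trans ?_
  · rw [mul_assoc]
    exact abs_mul_le_mul (hG x) (hC.T_le _)
  · rw [integral_const_mul]
    refine (mul_le_mul_of_nonneg_left (integral_decay_le hab) (by positivity)).trans (le_of_eq ?_)
    ring

/-- The alternating monomials, for kernels all of whose entries decay. -/
lemma abs_integral_R4alt_le_of_decay (hC : K.BoundedBy C) (he : ∀ u, |K.e u| ≤ C * decay u)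
    {G : (Fin 4 → ℝ) → ℝ} {B : ℝ} (hG : ∀ x, |G x| ≤ B) {a b c d : Fin 4} (hab : a ≠ b)
    (hac : a ≠ c) (had : a ≠ d) (hbc : b ≠ c) (hbd : b ≠ d) (hcd : c ≠ d) :
    |∫ x, G x * K.R4alt (x a) (x b) (x c) (x d) ∂unifPi 4 N| ≤
      B * C ^ 4 * (logBound N / N) ^ 3 := by
  have hB : 0 ≤ B := (abs_nonneg _).trans (hG 0)
  have hC0 := hC.pos
  have w : ∀ i j : Fin 4, BddMeas fun x : Fin 4 → ℝ => decay (x i - x j) :=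
    fun i j => BddMeas.decay_sub i j
  have h1 := ((w a b).mul (w b c)).mul (w c d)
  refine (abs_integral_le (h1.integrable.const_mul (B * C ^ 4)) fun x => ?_).trans ?_
  · refine (abs_mul_le_mul (hG x) (abs_mul_le_mul (abs_mul_le_mul (abs_mul_le_mul (hC.d_le _)
      (he _)) (hC.d_le _)) (he _))).trans ?_
    have h0 := fun u => (decay_pos u).le
    have hp : 0 ≤ B * C ^ 4 * (decay (x a - x b) * decay (x b - x c) * decay (x c - x d)) := by
      have := h0 (x a - x b); have := h0 (x b - x c); have := h0 (x c - x d)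
      positivity
    calc _ = B * C ^ 4 * (decay (x a - x b) * decay (x b - x c) * decay (x c - x d))
          * decay (x d - x a) := by ring
      _ ≤ _ := mul_le_of_le_one_right hp (decay_le_one _)
  · rw [integral_const_mul]
    exact mul_le_mul_of_nonneg_left (integral_decay_three_le hab hac had hbc hbd hcd)
      (by positivity)

/-- The alternating monomials, for kernels with `d = s'` and `s = e'`. -/
lemma IsSmoothTest.abs_integral_R4alt_le_of_deriv (hg : IsSmoothTest N A D g g')
    (hK : K.IsAdmissible) (hC : K.BoundedBy C) (hs : ∀ u, HasDerivAt K.s (K.d u) u)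
    (he : ∀ u, HasDerivAt K.e (K.s u) u) (hd : Continuous K.d) {q r s : Fin 4} (hq : q ≠ 0)
    (hr : r ≠ 0) (hs0 : s ≠ 0) (hqr : q ≠ r) (hqs : q ≠ s) (hrs : r ≠ s) :
    |∫ x, g (x 0 - x 1) * g (x 2 - x 3) * K.R4alt (x 0) (x q) (x r) (x s) ∂unifPi 4 N| ≤
      A * C ^ 4 * (2 * A * (logBound N / N) ^ 2 / N + D * logBound N * (logBound N / N) / N
        + A * (logBound N / N) ^ 3) := by
  have hN0 := hN.out
  have hA := hg.nonneg
  have hD := hg.deriv_nonneg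
  have hC0 := hC.pos
  set L := logBound N with hL
  have hL0 : 0 ≤ L := zero_le_one.trans (one_le_logBound hN.out.le)
  have w : ∀ i j : Fin 4, BddMeas fun x : Fin 4 → ℝ => decay (x i - x j) :=
    fun i j => BddMeas.decay_sub i j
  have wc : ∀ (i : Fin 4) (c : ℝ), BddMeas fun x : Fin 4 → ℝ => decay (x i - c) := fun i c =>
    ⟨continuous_decay.measurable.comp ((measurable_pi_apply i).sub measurable_const), 1, fun x => by
      rw [abs_of_pos (decay_pos _)]; exact decay_le_one _⟩
  have hG : BddMeas fun x : Fin 4 → ℝ => g (x 0 - x 1) * g (x 2 - x 3) *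
      K.R4alt (x 0) (x q) (x r) (x s) :=
    ((hg.bdd 0 1).mul (hg.bdd 2 3)).mul (hC.bdd_R4alt hK 0 q r s)
  have hpath : BddMeas fun x : Fin 4 → ℝ => decay (x 0 - x q) * decay (x 0 - x s) *
      decay (x r - x s) := ((w 0 q).mul (w 0 s)).mul (w r s)
  rw [integral_update 0 hG.integrable]
  have hdom : Integrable (fun x : Fin 4 → ℝ => A * C ^ 4 * (A / N * (decay (x q - N) *
      decay (x r - x s) + decay (x q - 0) * decay (x r - x s)) + D * L / N * decay (x r - x s)
      + A * ∫ y, decay (Function.update x 0 y 0 - Function.update x 0 y q) *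
        decay (Function.update x 0 y 0 - Function.update x 0 y s) *
        decay (Function.update x 0 y r - Function.update x 0 y s) ∂unif N)) (unifPi 4 N) := by
    refine (((((((wc q N).mul (w r s)).add ((wc q 0).mul (w r s))).integrable).const_mul _).add
      ((w r s).integrable.const_mul _)).add ((integrable_update 0 hpath.integrable).const_mul _)
      ).const_mul _
  refine (abs_integral_le hdom fun x => ?_).trans ?_
  · simp only [Function.update_self, Function.update_of_ne hq, Function.update_of_ne hr,
      Function.update_of_ne hs0, Function.update_of_ne (show (1 : Fin 4) ≠ 0 by decide),
      Function.update_of_ne (show (2 : Fin 4) ≠ 0 by decide),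
      Function.update_of_ne (show (3 : Fin 4) ≠ 0 by decide)]
    have e1 : ∀ y, g (y - x 1) * g (x 2 - x 3) * K.R4alt y (x q) (x r) (x s) =
        g (x 2 - x 3) * K.d (x r - x s) * K.e (x q - x r) *
          (g (y - x 1) * K.d (y - x q) * K.e (x s - y)) := fun y => by
      rw [PairKernel.R4alt]; ring
    simp only [e1]
    rw [integral_const_mul, integral_mul_const, integral_unif, integral_unif]
    have h1 := hC.abs_integral_mul_le hs he hd hN0.le hg.deriv hg.cont hg.le hg.deriv_le
      (x 1) (x q) (x s)
    have h2 : |g (x 2 - x 3) * K.d (x r - x s) * K.e (x q - x r)| ≤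
        A * (C * decay (x r - x s)) * C :=
      abs_mul_le_mul (abs_mul_le_mul (hg.le _) (hC.d_le _)) (hC.e_le _)
    have h3 : |1 / N * ∫ z in (0 : ℝ)..N, g (z - x 1) * K.d (z - x q) * K.e (x s - z)| ≤
        1 / N * (C ^ 2 * (A * (decay (N - x q) + decay (0 - x q)) + D * logBound N +
          A * ∫ z in (0 : ℝ)..N, decay (z - x q) * decay (z - x s))) := by
      rw [abs_mul, abs_of_pos (by positivity : 0 < 1 / N)]
      exact mul_le_mul_of_nonneg_left h1 (by positivity)
    refine (abs_mul_le_mul h2 h3).trans (le_of_eq ?_)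
    rw [decay_sub_comm (x q) N, decay_sub_comm (x q) 0]
    field_simp
    ring
  · rw [integral_const_mul, integral_add, integral_add, integral_const_mul, integral_const_mul,
      integral_const_mul, integral_add, ← integral_update 0 hpath.integrable]
    · refine mul_le_mul_of_nonneg_left ?_ (by positivity)
      have hup : ∀ (x : Fin 4 → ℝ) (y : ℝ), decay (Function.update x q y r - Function.update x q y s) =
          decay (x r - x s) := fun x y => by
        rw [Function.update_of_ne hqr.symm, Function.update_of_ne hqs.symm]
      have b1 := integral_decay_sub_const_mul_le (N := N) q N (w r s) (fun x => (decay_pos _).le) hup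
      have b2 := integral_decay_sub_const_mul_le (N := N) q 0 (w r s) (fun x => (decay_pos _).le) hup
      have b3 := integral_decay_le (N := N) hrs
      have b4 := integral_decay_three_le (N := N) hq hqs hqr hs0.symm hr.symm hrs.symm
      have e4 : ∫ x, decay (x 0 - x q) * decay (x 0 - x s) * decay (x r - x s) ∂unifPi 4 N =
          ∫ x, decay (x q - x 0) * decay (x 0 - x s) * decay (x s - x r) ∂unifPi 4 N := by
        refine integral_congr_ae (ae_of_all _ fun x => ?_)
        simp only
        rw [decay_sub_comm (x 0) (x q), decay_sub_comm (x r) (x s)]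
      rw [e4]
      have hl : 0 ≤ L / N := by positivity
      have b5 : L / N * ∫ x, decay (x r - x s) ∂unifPi 4 N ≤ (L / N) ^ 2 := by
        rw [sq]; exact mul_le_mul_of_nonneg_left b3 hl
      have c1 : A / N * ((∫ x, decay (x q - N) * decay (x r - x s) ∂unifPi 4 N) +
          ∫ x, decay (x q - 0) * decay (x r - x s) ∂unifPi 4 N) ≤ A / N * (2 * (L / N) ^ 2) :=
        mul_le_mul_of_nonneg_left (by linarith) (by positivity)
      have c2 : D * L / N * ∫ x, decay (x r - x s) ∂unifPi 4 N ≤ D * L / N * (L / N) :=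
        mul_le_mul_of_nonneg_left b3 (by positivity)
      have c3 := mul_le_mul_of_nonneg_left b4 hA
      calc _ ≤ A / N * (2 * (L / N) ^ 2) + D * L / N * (L / N) + A * (L / N) ^ 3 :=
            add_le_add (add_le_add c1 c2) c3
        _ = _ := by ring
    · exact ((wc q N).mul (w r s)).integrable
    · exact ((wc q 0).mul (w r s)).integrable
    · exact (((wc q N).mul (w r s)).add ((wc q 0).mul (w r s))).integrable.const_mul _
    · exact (w r s).integrable.const_mul _
    · exact ((((wc q N).mul (w r s)).add ((wc q 0).mul (w r s))).integrable.const_mul _).add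
        ((w r s).integrable.const_mul _)
    · exact (integrable_update 0 hpath.integrable).const_mul _

end bounds

lemma PairKernel.R4alt_reverse (K : PairKernel) (x y z w : ℝ) :
    K.R4alt w z y x = K.R4alt x y z w := by
  rw [R4alt, R4alt, K.d_sub_comm w z, K.e_sub_comm z y, K.d_sub_comm y x, K.e_sub_comm x w]
  ring

end SineBeta

namespace SineBeta

section smooth

variable {N A D : ℝ} {g g' : ℝ → ℝ} [hN : Fact (0 < N)] {K : PairKernel} {C : ℝ}

/-- The cyclic terms of length four in the variance. -/
lemma IsSmoothTest.abs_integral_R4_le (hg : IsSmoothTest N A D g g')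
    (hK : K.IsAdmissible) (hC : K.BoundedBy C)
    (he : (∀ u, |K.e u| ≤ C * decay u) ∨
      ((∀ u, HasDerivAt K.s (K.d u) u) ∧ (∀ u, HasDerivAt K.e (K.s u) u) ∧ Continuous K.d))
    {q r s : Fin 4} (hq : q ≠ 0)
    (hr : r ≠ 0) (hs : s ≠ 0) (hqr : q ≠ r) (hqs : q ≠ s) (hrs : r ≠ s) :
    |∫ x, g (x 0 - x 1) * g (x 2 - x 3) * K.R4 (x 0) (x q) (x r) (x s) ∂unifPi 4 N| ≤
      A * C ^ 4 * (2 * A * (logBound N / N) ^ 2 / N + D * logBound N * (logBound N / N) / N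
        + 13 * A * (logBound N / N) ^ 3) := by
  have hA := hg.nonneg
  have hD := hg.deriv_nonneg
  have hC0 := hC.pos
  have hN0 := hN.out
  have hl := logBound_div_nonneg (N := N)
  have hL : 0 ≤ logBound N := zero_le_one.trans (one_le_logBound hN0.le)
  have hgg : BddMeas fun x : Fin 4 → ℝ => g (x 0 - x 1) * g (x 2 - x 3) :=
    (hg.bdd 0 1).mul (hg.bdd 2 3)
  have hB : ∀ x : Fin 4 → ℝ, |g (x 0 - x 1) * g (x 2 - x 3)| ≤ A * A := fun x =>
    abs_mul_le_mul (hg.le _) (hg.le _)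
  have halt : ∀ {q r s : Fin 4}, q ≠ 0 → r ≠ 0 → s ≠ 0 → q ≠ r → q ≠ s → r ≠ s →
      |∫ x, g (x 0 - x 1) * g (x 2 - x 3) * K.R4alt (x 0) (x q) (x r) (x s) ∂unifPi 4 N| ≤
      A * C ^ 4 * (2 * A * (logBound N / N) ^ 2 / N + D * logBound N * (logBound N / N) / N
        + A * (logBound N / N) ^ 3) := by
    intro q r s hq hr hs hqr hqs hrs
    rcases he with he | ⟨h1, h2, h3⟩
    · refine (abs_integral_R4alt_le_of_decay hC he hB hq.symm hr.symm hs.symm hqr hqs hrs).trans ?_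
      have : 0 ≤ 2 * A * (logBound N / N) ^ 2 / N + D * logBound N * (logBound N / N) / N := by
        positivity
      calc _ = A * C ^ 4 * (A * (logBound N / N) ^ 3) := by ring
        _ ≤ _ := mul_le_mul_of_nonneg_left (by linarith) (by positivity)
    · exact hg.abs_integral_R4alt_le_of_deriv hK hC h1 h2 h3 hq hr hs hqr hqs hrs
  have b1 := abs_integral_R4dec_le (N := N) hC hB hq.symm hr.symm hs.symm hqr hqs hrs
  have b2 := halt hq hr hs hqr hqs hrs
  have b3 := halt hs hr hq hrs.symm hqs.symm hqr.symm
  have i1 := hgg.mul (hC.bdd_R4dec hK 0 q r s)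
  have i2 := hgg.mul (hC.bdd_R4alt hK 0 q r s)
  have i3 := hgg.mul (hC.bdd_R4alt hK 0 s r q)
  have e : ∀ x : Fin 4 → ℝ, g (x 0 - x 1) * g (x 2 - x 3) * K.R4 (x 0) (x q) (x r) (x s) =
      g (x 0 - x 1) * g (x 2 - x 3) * K.R4dec (x 0) (x q) (x r) (x s)
      + 1 / 2 * (g (x 0 - x 1) * g (x 2 - x 3) * K.R4alt (x 0) (x q) (x r) (x s)
        + g (x 0 - x 1) * g (x 2 - x 3) * K.R4alt (x 0) (x s) (x r) (x q)) := by
    intro x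
    rw [K.R4_eq_add, ← K.R4alt_reverse (x q)]
    ring
  simp only [e]
  rw [integral_add i1.integrable ((i2.add i3).integrable.const_mul _), integral_const_mul,
    integral_add i2.integrable i3.integrable]
  rw [abs_le] at *
  constructor <;> linarith [b1.1, b1.2, b2.1, b2.2, b3.1, b3.2]

/-- The convolution over the window of the truncated two-point function with a test function. -/
noncomputable def windowConv (K : PairKernel) (N : ℝ) (g : ℝ → ℝ) (a b : ℝ) : ℝ :=
  ∫ z, K.T (a - z) * g (z - b) ∂unif N

lemma IsSmoothTest.bdd_windowConv (hg : IsSmoothTest N A D g g') (hK : K.IsAdmissible)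
    (hC : K.BoundedBy C) {k : ℕ} (i j : Fin k) :
    BddMeas fun x : Fin k → ℝ => windowConv K N g (x i) (x j) := by
  refine ⟨?_, 2 * C ^ 2 * A, fun x => ?_⟩
  · have hT := hK.continuous_T.measurable
    have hgm := hg.continuous.measurable
    have h : Measurable fun p : (Fin k → ℝ) × ℝ => K.T (p.1 i - p.2) * g (p.2 - p.1 j) := by
      have h1 : Measurable fun p : (Fin k → ℝ) × ℝ => p.1 i :=
        (measurable_pi_apply i).comp measurable_fst
      have h2 : Measurable fun p : (Fin k → ℝ) × ℝ => p.1 j :=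
        (measurable_pi_apply j).comp measurable_fst
      exact (hT.comp (h1.sub measurable_snd)).mul (hgm.comp (measurable_snd.sub h2))
    exact (h.stronglyMeasurable.integral_prod_right' (ν := unif N)).measurable
  · have := norm_integral_le_of_norm_le_const (μ := unif N)
      (f := fun z => K.T (x i - z) * g (z - x j)) (C := 2 * C ^ 2 * A)
      (ae_of_all _ fun z => abs_mul_le_mul (hC.T_bounded _) (hg.le _))
    simpa [windowConv] using this

lemma IsSmoothTest.integral_windowConv_mul (hg : IsSmoothTest N A D g g') (hK : K.IsAdmissible)
    (hC : K.BoundedBy C) {k : ℕ} {i j m : Fin k} (hi : i ≠ m) (hj : j ≠ m) {H : (Fin k → ℝ) → ℝ}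
    (hH : BddMeas H) (hm : ∀ x y, H (Function.update x m y) = H x) :
    ∫ x, windowConv K N g (x i) (x j) * H x ∂unifPi k N =
      ∫ x, K.T (x i - x m) * g (x m - x j) * H x ∂unifPi k N := by
  rw [integral_update m (((hC.bdd_T hK i m).mul (hg.bdd m j)).mul hH).integrable]
  refine integral_congr_ae (ae_of_all _ fun x => ?_)
  simp only [Function.update_self, Function.update_of_ne hi, Function.update_of_ne hj, hm]
  rw [integral_mul_const, windowConv]

lemma IsSmoothTest.integral_windowConv_mul_self (hg : IsSmoothTest N A D g g')
    (hK : K.IsAdmissible) (hC : K.BoundedBy C) :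
    ∫ x, windowConv K N g (x 0) (x 1) * g (x 1 - x 0) ∂unifPi 4 N =
      ∫ x, g (x 0 - x 1) * g (x 0 - x 2) * K.T (x 1 - x 2) ∂unifPi 4 N := by
  rw [hg.integral_windowConv_mul hK hC (m := 2) (by decide) (by decide) (hg.bdd 1 0) fun x y => by
    rw [Function.update_of_ne (by decide), Function.update_of_ne (by decide)],
    ← integral_comp_injective (N := N) (ι := (![1, 0, 2, 3] : Fin 4 → Fin 4)) (by decide)
      (((hg.bdd 0 1).mul (hg.bdd 0 2)).mul (hC.bdd_T hK 1 2)).1]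
  refine integral_congr_ae (ae_of_all _ fun x => ?_)
  simp [hg.sub_comm (x 2) (x 1)]
  ring

lemma IsSmoothTest.integral_windowConv_sq (hg : IsSmoothTest N A D g g')
    (hK : K.IsAdmissible) (hC : K.BoundedBy C) :
    ∫ x, windowConv K N g (x 0) (x 1) * windowConv K N g (x 1) (x 0) ∂unifPi 4 N =
      ∫ x, g (x 0 - x 1) * g (x 2 - x 3) * (K.T (x 0 - x 2) * K.T (x 1 - x 3)) ∂unifPi 4 N := by
  have h1 := hg.integral_windowConv_mul hK hC (i := 0) (j := (1 : Fin 4)) (m := 2) (by decide)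
    (by decide) (hg.bdd_windowConv hK hC 1 0) fun x y => by
      rw [Function.update_of_ne (by decide), Function.update_of_ne (by decide)]
  have h2 := hg.integral_windowConv_mul hK hC (i := 1) (j := (0 : Fin 4)) (m := 3) (by decide)
    (by decide) ((hC.bdd_T hK 0 2).mul (hg.bdd 2 1)) fun x y => by
      rw [Function.update_of_ne (by decide), Function.update_of_ne (by decide),
        Function.update_of_ne (by decide)]
  rw [h1]
  simp only [mul_comm (K.T _ * g _) (windowConv _ _ _ _ _)]
  rw [h2, ← integral_comp_injective (N := N) (ι := (![2, 1, 0, 3] : Fin 4 → Fin 4)) (by decide)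
      (((hg.bdd 0 1).mul (hg.bdd 2 3)).mul ((hC.bdd_T hK 0 2).mul (hC.bdd_T hK 1 3))).1]
  refine integral_congr_ae (ae_of_all _ fun x => ?_)
  simp [hg.sub_comm (x 3) (x 0), K.T_sub_comm (x 2) (x 0)]
  ring

/-- The part of the variance made of the two-point functions is a square up to transposition of
`g - K * g`, which integration by parts shows to be small away from the boundary. -/
lemma IsSmoothTest.abs_twoPoint_le (hg : IsSmoothTest N A D g g') (hK : K.IsAdmissible)
    (hC : K.BoundedBy C) {C₁ : ℝ} (hC₁ : 0 ≤ C₁)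
    (h : ∀ a ∈ Icc 0 N, ∀ b, |g (a - b) - ∫ z in (0 : ℝ)..N, K.T (a - z) * g (z - b)| ≤
      C₁ * (A * (decay a + decay (N - a)) + D * logBound N)) :
    |2 * N ^ 2 * (∫ x, g (x 0 - x 1) * g (x 0 - x 1) ∂unifPi 4 N)
      - 4 * N ^ 3 * (∫ x, g (x 0 - x 1) * g (x 0 - x 2) * K.T (x 1 - x 2) ∂unifPi 4 N)
      + N ^ 4 * ((∫ x, g (x 0 - x 1) * g (x 2 - x 3) * (K.T (x 0 - x 2) * K.T (x 1 - x 3))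
          ∂unifPi 4 N)
        + ∫ x, g (x 0 - x 1) * g (x 2 - x 3) * (K.T (x 0 - x 3) * K.T (x 1 - x 2)) ∂unifPi 4 N)| ≤
      2 * C₁ ^ 2 * (2 * A * logBound N + N * D * logBound N) ^ 2 := by
  have hN0 := hN.out
  have hA := hg.nonneg
  have hD := hg.deriv_nonneg
  have hL : 0 ≤ logBound N := zero_le_one.trans (one_le_logBound hN0.le)
  have hw := hg.bdd_windowConv (N := N) hK hC (0 : Fin 4) 1
  have hw' := hg.bdd_windowConv (N := N) hK hC (1 : Fin 4) 0
  have hgb := hg.bdd (0 : Fin 4) 1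
  have hgb' := hg.bdd (1 : Fin 4) 0
  have hswap : ∫ x, windowConv K N g (x 1) (x 0) * g (x 0 - x 1) ∂unifPi 4 N =
      ∫ x, windowConv K N g (x 0) (x 1) * g (x 1 - x 0) ∂unifPi 4 N := by
    rw [← integral_comp_injective (N := N) (ι := (![1, 0, 2, 3] : Fin 4 → Fin 4)) (by decide)
      (hw.mul hgb').1]
    simp
  have hswap' : ∫ x, g (x 0 - x 1) * g (x 2 - x 3) * (K.T (x 0 - x 3) * K.T (x 1 - x 2))
        ∂unifPi 4 N =
      ∫ x, g (x 0 - x 1) * g (x 2 - x 3) * (K.T (x 0 - x 2) * K.T (x 1 - x 3)) ∂unifPi 4 N := by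
    rw [← integral_comp_injective (N := N) (ι := (![0, 1, 3, 2] : Fin 4 → Fin 4)) (by decide)
      (((hg.bdd 0 1).mul (hg.bdd 2 3)).mul ((hC.bdd_T hK 0 2).mul (hC.bdd_T hK 1 3))).1]
    refine integral_congr_ae (ae_of_all _ fun x => ?_)
    simp [hg.sub_comm (x 3) (x 2)]
  have hexp : ∫ x, (g (x 0 - x 1) - N * windowConv K N g (x 0) (x 1)) *
      (g (x 1 - x 0) - N * windowConv K N g (x 1) (x 0)) ∂unifPi 4 N =
      (∫ x, g (x 0 - x 1) * g (x 0 - x 1) ∂unifPi 4 N)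
      - 2 * N * (∫ x, g (x 0 - x 1) * g (x 0 - x 2) * K.T (x 1 - x 2) ∂unifPi 4 N)
      + N ^ 2 * ∫ x, g (x 0 - x 1) * g (x 2 - x 3) * (K.T (x 0 - x 2) * K.T (x 1 - x 3))
        ∂unifPi 4 N := by
    rw [← hg.integral_windowConv_sq hK hC, ← hg.integral_windowConv_mul_self hK hC]
    have e : ∀ x : Fin 4 → ℝ, (g (x 0 - x 1) - N * windowConv K N g (x 0) (x 1)) *
        (g (x 1 - x 0) - N * windowConv K N g (x 1) (x 0)) =
        g (x 0 - x 1) * g (x 0 - x 1) - N * (windowConv K N g (x 0) (x 1) * g (x 1 - x 0))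
        - N * (windowConv K N g (x 1) (x 0) * g (x 0 - x 1))
        + N ^ 2 * (windowConv K N g (x 0) (x 1) * windowConv K N g (x 1) (x 0)) := fun x => by
      rw [hg.sub_comm (x 1) (x 0)]; ring
    have i1 := hgb.mul hgb
    have i2 := (BddMeas.const N).mul (hw.mul hgb')
    have i3 := (BddMeas.const N).mul (hw'.mul hgb)
    have i4 := (BddMeas.const (N ^ 2)).mul (hw.mul hw')
    simp only [e]
    rw [integral_add ((i1.sub i2).sub i3).integrable i4.integrable,
      integral_sub (i1.sub i2).integrable i3.integrable,
      integral_sub i1.integrable i2.integrable,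
      integral_const_mul, integral_const_mul, integral_const_mul, hswap]
    ring
  -- the pointwise bound
  set η : ℝ → ℝ := fun y => C₁ * (A * (decay (y - 0) + decay (y - N)) + D * logBound N) with hη
  have hη0 : ∀ y, 0 ≤ η y := fun y => by
    have := decay_pos (y - 0); have := decay_pos (y - N); positivity
  have hd : ∀ (i : Fin 4) (c : ℝ), BddMeas fun x : Fin 4 → ℝ => decay (x i - c) := fun i c =>
    ⟨continuous_decay.measurable.comp ((measurable_pi_apply i).sub measurable_const), 1, fun x => by
      rw [abs_of_pos (decay_pos _)]; exact decay_le_one _⟩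
  have hηb : ∀ i : Fin 4, BddMeas fun x : Fin 4 → ℝ => η (x i) := fun i =>
    (BddMeas.const C₁).mul (((BddMeas.const A).mul ((hd i 0).add (hd i N))).add
      (BddMeas.const (D * logBound N)))
  have hηi : ∀ (i : Fin 4) {H : (Fin 4 → ℝ) → ℝ}, BddMeas H → (∀ x, 0 ≤ H x) →
      (∀ x y, H (Function.update x i y) = H x) → ∫ x, η (x i) * H x ∂unifPi 4 N ≤
      C₁ * (2 * A * (logBound N / N) + D * logBound N) * ∫ x, H x ∂unifPi 4 N := by
    intro i H hH h0 hi
    have e : ∀ x : Fin 4 → ℝ, η (x i) * H x = C₁ * A * (decay (x i - 0) * H x) +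
        C₁ * A * (decay (x i - N) * H x) + C₁ * (D * logBound N) * H x := fun x => by
      simp only [hη]; ring
    simp only [e]
    have i1 := (BddMeas.const (C₁ * A)).mul ((hd i 0).mul hH)
    have i2 := (BddMeas.const (C₁ * A)).mul ((hd i N).mul hH)
    rw [integral_add (i1.add i2).integrable (hH.integrable.const_mul _),
      integral_add i1.integrable i2.integrable,
      integral_const_mul, integral_const_mul, integral_const_mul]
    have b1 := mul_le_mul_of_nonneg_left (integral_decay_sub_const_mul_le (N := N) i 0 hH h0 hi)
      (by positivity : 0 ≤ C₁ * A)
    have b2 := mul_le_mul_of_nonneg_left (integral_decay_sub_const_mul_le (N := N) i N hH h0 hi)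
      (by positivity : 0 ≤ C₁ * A)
    linarith
  have hpt : ∀ᵐ x ∂unifPi 4 N, ‖(g (x 0 - x 1) - N * windowConv K N g (x 0) (x 1)) *
      (g (x 1 - x 0) - N * windowConv K N g (x 1) (x 0))‖ ≤ η (x 0) * (η (x 1) * 1) := by
    filter_upwards [ae_mem_window (N := N) 4] with x hx
    have hb : ∀ a ∈ Icc 0 N, ∀ b, |g (a - b) - N * windowConv K N g a b| ≤ η a := by
      intro a ha b
      have := h a ha b
      have e : N * windowConv K N g a b = ∫ z in (0 : ℝ)..N, K.T (a - z) * g (z - b) := by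
        rw [windowConv, integral_unif]; field_simp
      rw [e]
      refine this.trans (le_of_eq ?_)
      simp only [hη, decay_sub_comm N a, sub_zero]
    rw [Real.norm_eq_abs, mul_one]
    exact abs_mul_le_mul (hb _ (hx 0) _) (hb _ (hx 1) _)
  have hint : |∫ x, (g (x 0 - x 1) - N * windowConv K N g (x 0) (x 1)) *
      (g (x 1 - x 0) - N * windowConv K N g (x 1) (x 0)) ∂unifPi 4 N| ≤
      (C₁ * (2 * A * (logBound N / N) + D * logBound N)) ^ 2 := by
    rw [← Real.norm_eq_abs]
    refine (norm_integral_le_of_norm_le ((hηb 0).mul ((hηb 1).mul (BddMeas.const 1))).integrable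
      hpt).trans ?_
    have q1 := hηi 0 ((hηb 1).mul (BddMeas.const 1)) (fun x => by simpa using hη0 _) fun x y => by
      rw [Function.update_of_ne (by decide)]
    have q2 := hηi 1 (BddMeas.const 1) (fun _ => zero_le_one) fun _ _ => rfl
    have q3 : 0 ≤ C₁ * (2 * A * (logBound N / N) + D * logBound N) := by positivity
    refine q1.trans ?_
    rw [sq]
    refine mul_le_mul_of_nonneg_left (q2.trans ?_) q3
    simp
  rw [hswap']
  have e1 : ∀ V U M : ℝ, 2 * N ^ 2 * V - 4 * N ^ 3 * U + N ^ 4 * (M + M) =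
      2 * N ^ 2 * (V - 2 * N * U + N ^ 2 * M) := fun V U M => by ring
  rw [e1, ← hexp, abs_mul, abs_of_nonneg (by positivity : 0 ≤ 2 * N ^ 2)]
  refine (mul_le_mul_of_nonneg_left hint (by positivity)).trans (le_of_eq ?_)
  field_simp

end smooth

end SineBeta

namespace SineBeta

/-- The variance of the pair sum of `g` over the window `[0, N]`, in terms of the kernel. -/
noncomputable def pairVariance (K : PairKernel) (N : ℝ) (g : ℝ → ℝ) : ℝ :=
  N ^ 4 * ∫ x, g (x 0 - x 1) * g (x 2 - x 3) * (K.r4 (x 0) (x 1) (x 2) (x 3)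
    - K.r2 (x 0) (x 1) * K.r2 (x 2) (x 3)) ∂unifPi 4 N
  + 4 * N ^ 3 * (∫ x, g (x 0 - x 1) * g (x 0 - x 2) * K.r3 (x 0) (x 1) (x 2) ∂unifPi 4 N)
  + 2 * N ^ 2 * ∫ x, g (x 0 - x 1) * g (x 0 - x 1) * K.r2 (x 0) (x 1) ∂unifPi 4 N

lemma PairKernel.BoundedBy.mono {K : PairKernel} {C C' : ℝ} (hC : K.BoundedBy C) (h : C ≤ C') :
    K.BoundedBy C' :=
  ⟨hC.pos.trans_le h, fun u => (hC.s_le u).trans (mul_le_mul_of_nonneg_right h (decay_pos u).le),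
    fun u => (hC.d_le u).trans (mul_le_mul_of_nonneg_right h (decay_pos u).le),
    fun u => (hC.e_le u).trans h⟩

lemma PairKernel.IsAdmissible.exists_boundedBy_decay {K : PairKernel} (hK : K.IsAdmissible) :
    ∃ C, K.BoundedBy C ∧ ((∀ u, |K.e u| ≤ C * decay u) ∨
      ((∀ u, HasDerivAt K.s (K.d u) u) ∧ (∀ u, HasDerivAt K.e (K.s u) u) ∧ Continuous K.d)) := by
  obtain ⟨C, hC⟩ := hK.exists_boundedBy
  rcases hK.e_decay_or_deriv with ⟨C', hC', he⟩ | h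
  · exact ⟨C + C', hC.mono (by linarith), Or.inl fun u => (he u).trans
      (mul_le_mul_of_nonneg_right (by linarith [hC.pos]) (decay_pos u).le)⟩
  · exact ⟨C, hC, Or.inr h⟩

section smooth

variable {N A D : ℝ} {g g' : ℝ → ℝ} [hN : Fact (0 < N)] {K : PairKernel} {C : ℝ}

lemma IsSmoothTest.integral_four_eq (hg : IsSmoothTest N A D g g') (hK : K.IsAdmissible)
    (hC : K.BoundedBy C) :
    ∫ x, g (x 0 - x 1) * g (x 2 - x 3) * (K.r4 (x 0) (x 1) (x 2) (x 3)
        - K.r2 (x 0) (x 1) * K.r2 (x 2) (x 3)) ∂unifPi 4 N =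
      (∫ x, g (x 0 - x 1) * g (x 2 - x 3) * (K.T (x 0 - x 2) * K.T (x 1 - x 3)) ∂unifPi 4 N)
      + (∫ x, g (x 0 - x 1) * g (x 2 - x 3) * (K.T (x 0 - x 3) * K.T (x 1 - x 2)) ∂unifPi 4 N)
      - 2 * ((∫ x, g (x 0 - x 1) * g (x 2 - x 3) * K.R4 (x 0) (x 1) (x 2) (x 3) ∂unifPi 4 N)
        + (∫ x, g (x 0 - x 1) * g (x 2 - x 3) * K.R4 (x 0) (x 1) (x 3) (x 2) ∂unifPi 4 N)
        + ∫ x, g (x 0 - x 1) * g (x 2 - x 3) * K.R4 (x 0) (x 2) (x 1) (x 3) ∂unifPi 4 N) := by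
  have hT : ∀ i j : Fin 4, BddMeas fun x : Fin 4 → ℝ => K.T (x i - x j) := hC.bdd_T hK
  have hR : ∀ a b c : Fin 4, BddMeas fun x : Fin 4 → ℝ => K.R3 (x a) (x b) (x c) := hC.bdd_R3 hK
  have hR4 : ∀ a b c d : Fin 4, BddMeas fun x : Fin 4 → ℝ => K.R4 (x a) (x b) (x c) (x d) :=
    fun a b c d => ⟨hK.measurable_R4 (measurable_pi_apply _) (measurable_pi_apply _)
      (measurable_pi_apply _) (measurable_pi_apply _), _, fun _ => hC.R4_bounded _ _ _ _⟩
  have hgg : BddMeas fun x : Fin 4 → ℝ => g (x 0 - x 1) * g (x 2 - x 3) :=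
    (hg.bdd 0 1).mul (hg.bdd 2 3)
  have b1 : BddMeas fun x : Fin 4 → ℝ => g (x 2 - x 3) *
      (2 * K.R3 (x 0) (x 2) (x 3) - K.T (x 0 - x 2) - K.T (x 0 - x 3)) :=
    (hg.bdd 2 3).mul ((((BddMeas.const 2).mul (hR 0 2 3)).sub (hT 0 2)).sub (hT 0 3))
  have b2 : BddMeas fun x : Fin 4 → ℝ => g (x 2 - x 3) *
      (2 * K.R3 (x 1) (x 2) (x 3) - K.T (x 1 - x 2) - K.T (x 1 - x 3)) :=
    (hg.bdd 2 3).mul ((((BddMeas.const 2).mul (hR 1 2 3)).sub (hT 1 2)).sub (hT 1 3))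
  have b3 : BddMeas fun x : Fin 4 → ℝ => g (x 0 - x 1) * (2 * K.R3 (x 0) (x 1) (x 2)) :=
    (hg.bdd 0 1).mul ((BddMeas.const 2).mul (hR 0 1 2))
  have b4 : BddMeas fun x : Fin 4 → ℝ => g (x 0 - x 1) * (2 * K.R3 (x 0) (x 1) (x 3)) :=
    (hg.bdd 0 1).mul ((BddMeas.const 2).mul (hR 0 1 3))
  have z1 := hg.integral_eq_zero (N := N) (i := 1) (j := 0) (by decide) b1
    fun x y => by simp only [Function.update_of_ne (show (0 : Fin 4) ≠ 1 by decide),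
      Function.update_of_ne (show (2 : Fin 4) ≠ 1 by decide),
      Function.update_of_ne (show (3 : Fin 4) ≠ 1 by decide)]
  have z2 := hg.integral_eq_zero (N := N) (i := 0) (j := 1) (by decide) b2
    fun x y => by simp only [Function.update_of_ne (show (1 : Fin 4) ≠ 0 by decide),
      Function.update_of_ne (show (2 : Fin 4) ≠ 0 by decide),
      Function.update_of_ne (show (3 : Fin 4) ≠ 0 by decide)]
  have z3 := hg.integral_eq_zero (N := N) (i := 3) (j := 2) (by decide) b3
    fun x y => by simp only [Function.update_of_ne (show (0 : Fin 4) ≠ 3 by decide),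
      Function.update_of_ne (show (1 : Fin 4) ≠ 3 by decide),
      Function.update_of_ne (show (2 : Fin 4) ≠ 3 by decide)]
  have z4 := hg.integral_eq_zero (N := N) (i := 2) (j := 3) (by decide) b4
    fun x y => by simp only [Function.update_of_ne (show (0 : Fin 4) ≠ 2 by decide),
      Function.update_of_ne (show (1 : Fin 4) ≠ 2 by decide),
      Function.update_of_ne (show (3 : Fin 4) ≠ 2 by decide)]
  have c1 := (hg.bdd 1 0).mul b1
  have c2 := (hg.bdd 0 1).mul b2
  have c3 := (hg.bdd 3 2).mul b3
  have c4 := (hg.bdd 2 3).mul b4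
  have m1 := hgg.mul ((hT 0 2).mul (hT 1 3))
  have m2 := hgg.mul ((hT 0 3).mul (hT 1 2))
  have p1 := hgg.mul (hR4 0 1 2 3)
  have p2 := hgg.mul (hR4 0 1 3 2)
  have p3 := hgg.mul (hR4 0 2 1 3)
  have e : ∀ x : Fin 4 → ℝ, g (x 0 - x 1) * g (x 2 - x 3) * (K.r4 (x 0) (x 1) (x 2) (x 3)
        - K.r2 (x 0) (x 1) * K.r2 (x 2) (x 3)) =
      ((((g (x 1 - x 0) * (g (x 2 - x 3) *
          (2 * K.R3 (x 0) (x 2) (x 3) - K.T (x 0 - x 2) - K.T (x 0 - x 3)))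
      + g (x 0 - x 1) * (g (x 2 - x 3) *
          (2 * K.R3 (x 1) (x 2) (x 3) - K.T (x 1 - x 2) - K.T (x 1 - x 3))))
      + g (x 3 - x 2) * (g (x 0 - x 1) * (2 * K.R3 (x 0) (x 1) (x 2))))
      + g (x 2 - x 3) * (g (x 0 - x 1) * (2 * K.R3 (x 0) (x 1) (x 3))))
      + (g (x 0 - x 1) * g (x 2 - x 3) * (K.T (x 0 - x 2) * K.T (x 1 - x 3))
        + g (x 0 - x 1) * g (x 2 - x 3) * (K.T (x 0 - x 3) * K.T (x 1 - x 2))))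
      - 2 * ((g (x 0 - x 1) * g (x 2 - x 3) * K.R4 (x 0) (x 1) (x 2) (x 3)
        + g (x 0 - x 1) * g (x 2 - x 3) * K.R4 (x 0) (x 1) (x 3) (x 2))
        + g (x 0 - x 1) * g (x 2 - x 3) * K.R4 (x 0) (x 2) (x 1) (x 3)) := by
    intro x
    rw [hg.sub_comm (x 1) (x 0), hg.sub_comm (x 3) (x 2), PairKernel.r4, PairKernel.r2,
      PairKernel.r2]
    ring
  simp only [e]
  rw [integral_sub ((((c1.add c2).add c3).add c4).add (m1.add m2)).integrable
      ((BddMeas.const 2).mul ((p1.add p2).add p3)).integrable,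
    integral_add (((c1.add c2).add c3).add c4).integrable (m1.add m2).integrable,
    integral_add ((c1.add c2).add c3).integrable c4.integrable,
    integral_add (c1.add c2).integrable c3.integrable,
    integral_add c1.integrable c2.integrable, integral_add m1.integrable m2.integrable,
    integral_const_mul, integral_add (p1.add p2).integrable p3.integrable,
    integral_add p1.integrable p2.integrable, z1, z2, z3, z4]
  ring

lemma IsSmoothTest.integral_three_eq (hg : IsSmoothTest N A D g g') (hK : K.IsAdmissible)
    (hC : K.BoundedBy C) :
    ∫ x, g (x 0 - x 1) * g (x 0 - x 2) * K.r3 (x 0) (x 1) (x 2) ∂unifPi 4 N =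
      -(∫ x, g (x 0 - x 1) * g (x 0 - x 2) * K.T (x 1 - x 2) ∂unifPi 4 N)
      + 2 * ∫ x, g (x 0 - x 1) * g (x 0 - x 2) * K.R3 (x 0) (x 1) (x 2) ∂unifPi 4 N := by
  have hT : ∀ i j : Fin 4, BddMeas fun x : Fin 4 → ℝ => K.T (x i - x j) := hC.bdd_T hK
  have hgg : BddMeas fun x : Fin 4 → ℝ => g (x 0 - x 1) * g (x 0 - x 2) :=
    (hg.bdd 0 1).mul (hg.bdd 0 2)
  have b1 : BddMeas fun x : Fin 4 → ℝ => g (x 0 - x 2) * (1 - K.T (x 0 - x 2)) :=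
    (hg.bdd 0 2).mul ((BddMeas.const 1).sub (hT 0 2))
  have b2 : BddMeas fun x : Fin 4 → ℝ => g (x 0 - x 1) * -K.T (x 0 - x 1) :=
    (hg.bdd 0 1).mul (hT 0 1).neg
  have z1 := hg.integral_eq_zero (N := N) (i := 1) (j := 0) (by decide) b1
    fun x y => by simp only [Function.update_of_ne (show (0 : Fin 4) ≠ 1 by decide),
      Function.update_of_ne (show (2 : Fin 4) ≠ 1 by decide)]
  have z2 := hg.integral_eq_zero (N := N) (i := 2) (j := 0) (by decide) b2
    fun x y => by simp only [Function.update_of_ne (show (0 : Fin 4) ≠ 2 by decide),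
      Function.update_of_ne (show (1 : Fin 4) ≠ 2 by decide)]
  have c1 := (hg.bdd 1 0).mul b1
  have c2 := (hg.bdd 2 0).mul b2
  have m1 := hgg.mul (hT 1 2)
  have p1 := hgg.mul (hC.bdd_R3 hK 0 1 2)
  have e : ∀ x : Fin 4 → ℝ, g (x 0 - x 1) * g (x 0 - x 2) * K.r3 (x 0) (x 1) (x 2) =
      ((g (x 1 - x 0) * (g (x 0 - x 2) * (1 - K.T (x 0 - x 2)))
      + g (x 2 - x 0) * (g (x 0 - x 1) * -K.T (x 0 - x 1)))
      - g (x 0 - x 1) * g (x 0 - x 2) * K.T (x 1 - x 2))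
      + 2 * (g (x 0 - x 1) * g (x 0 - x 2) * K.R3 (x 0) (x 1) (x 2)) := by
    intro x
    rw [hg.sub_comm (x 1) (x 0), hg.sub_comm (x 2) (x 0), PairKernel.r3]
    ring
  simp only [e]
  rw [integral_add ((c1.add c2).sub m1).integrable ((BddMeas.const 2).mul p1).integrable,
    integral_sub (c1.add c2).integrable m1.integrable, integral_add c1.integrable c2.integrable,
    integral_const_mul, z1, z2]
  ring

lemma IsSmoothTest.integral_two_eq (hg : IsSmoothTest N A D g g') (hK : K.IsAdmissible)
    (hC : K.BoundedBy C) :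
    ∫ x, g (x 0 - x 1) * g (x 0 - x 1) * K.r2 (x 0) (x 1) ∂unifPi 4 N =
      (∫ x, g (x 0 - x 1) * g (x 0 - x 1) ∂unifPi 4 N)
      - ∫ x, g (x 0 - x 1) * g (x 0 - x 1) * K.T (x 0 - x 1) ∂unifPi 4 N := by
  have hgg : BddMeas fun x : Fin 4 → ℝ => g (x 0 - x 1) * g (x 0 - x 1) :=
    (hg.bdd 0 1).mul (hg.bdd 0 1)
  rw [← integral_sub hgg.integrable (hgg.mul (hC.bdd_T hK 0 1)).integrable]
  refine integral_congr_ae (ae_of_all _ fun x => ?_)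
  simp only [PairKernel.r2]
  ring

end smooth

lemma abs_six_le {z a b c d e B₀ B₁ B₂ B₃ B₄ B₅ : ℝ} (hz : |z| ≤ B₀) (ha : |a| ≤ B₁)
    (hb : |b| ≤ B₂) (hc : |c| ≤ B₃) (hd : |d| ≤ B₄) (he : |e| ≤ B₅) :
    |z - a - b - c + d - e| ≤ B₀ + B₁ + B₂ + B₃ + B₄ + B₅ := by
  rw [abs_le] at *
  constructor <;> linarith

/-- The variance of a smooth pair sum. -/
theorem PairKernel.IsAdmissible.exists_smooth_bound {K : PairKernel} (hK : K.IsAdmissible) :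
    ∃ C, 0 ≤ C ∧ ∀ {N A D : ℝ} {g g' : ℝ → ℝ}, 0 < N → IsSmoothTest N A D g g' →
      |pairVariance K N g| ≤
        C * (logBound N ^ 3 * ((1 + N) * A ^ 2 + N ^ 2 * D ^ 2 + N ^ 2 * (A * D))) := by
  obtain ⟨C, hC, he⟩ := hK.exists_boundedBy_decay
  obtain ⟨C₁, hC₁, hconv⟩ := PairKernel.exists_abs_sub_convolution_le hK
  have hC0 := hC.pos
  refine ⟨16 * C₁ ^ 2 + 96 * C ^ 4 + 48 * C ^ 3 + 4 * C ^ 2, by positivity, ?_⟩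
  intro N A D g g' hN0 hg
  have hN : Fact (0 < N) := ⟨hN0⟩
  have hA := hg.nonneg
  have hD := hg.deriv_nonneg
  have hL1 := one_le_logBound hN0.le
  have two := hg.abs_twoPoint_le hK hC hC₁ fun a ha b =>
    hconv b hg.deriv hg.cont hg.le hg.deriv_le ha
  have q1 := hg.abs_integral_R4_le hK hC he (q := 1) (r := 2) (s := 3) (by decide) (by decide)
    (by decide) (by decide) (by decide) (by decide)
  have q2 := hg.abs_integral_R4_le hK hC he (q := 1) (r := 3) (s := 2) (by decide) (by decide)
    (by decide) (by decide) (by decide) (by decide)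
  have q3 := hg.abs_integral_R4_le hK hC he (q := 2) (r := 1) (s := 3) (by decide) (by decide)
    (by decide) (by decide) (by decide) (by decide)
  have q4 := abs_integral_R3_le (N := N) hC (G := fun x => g (x 0 - x 1) * g (x 0 - x 2))
    (fun x => abs_mul_le_mul (hg.le _) (hg.le _)) (a := 0) (b := 1) (c := 2) (by decide)
    (by decide) (by decide)
  have q5 := abs_integral_T_le (N := N) hC (G := fun x => g (x 0 - x 1) * g (x 0 - x 1))
    (fun x => abs_mul_le_mul (hg.le _) (hg.le _)) (a := 0) (b := 1) (by decide)
  rw [pairVariance, hg.integral_four_eq hK hC, hg.integral_three_eq hK hC,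
    hg.integral_two_eq hK hC]
  set L := logBound N with hL
  generalize (∫ x, g (x 0 - x 1) * g (x 0 - x 1) ∂unifPi 4 N) = V at *
  generalize (∫ x, g (x 0 - x 1) * g (x 0 - x 2) * K.T (x 1 - x 2) ∂unifPi 4 N) = U at *
  generalize (∫ x, g (x 0 - x 1) * g (x 2 - x 3) * (K.T (x 0 - x 2) * K.T (x 1 - x 3))
    ∂unifPi 4 N) = M₁ at *
  generalize (∫ x, g (x 0 - x 1) * g (x 2 - x 3) * (K.T (x 0 - x 3) * K.T (x 1 - x 2))
    ∂unifPi 4 N) = M₂ at *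
  generalize (∫ x, g (x 0 - x 1) * g (x 2 - x 3) * K.R4 (x 0) (x 1) (x 2) (x 3) ∂unifPi 4 N) = I₁
    at *
  generalize (∫ x, g (x 0 - x 1) * g (x 2 - x 3) * K.R4 (x 0) (x 1) (x 3) (x 2) ∂unifPi 4 N) = I₂
    at *
  generalize (∫ x, g (x 0 - x 1) * g (x 2 - x 3) * K.R4 (x 0) (x 2) (x 1) (x 3) ∂unifPi 4 N) = I₃
    at *
  generalize (∫ x, g (x 0 - x 1) * g (x 0 - x 2) * K.R3 (x 0) (x 1) (x 2) ∂unifPi 4 N) = J at *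
  generalize (∫ x, g (x 0 - x 1) * g (x 0 - x 1) * K.T (x 0 - x 1) ∂unifPi 4 N) = I₀ at *
  have scale : ∀ {c x b : ℝ}, 0 ≤ c → |x| ≤ b → |c * x| ≤ c * b := fun hc h => by
    rw [abs_mul, abs_of_nonneg hc]; exact mul_le_mul_of_nonneg_left h hc
  have r1 := scale (by positivity : 0 ≤ 2 * N ^ 4) q1
  have r2 := scale (by positivity : 0 ≤ 2 * N ^ 4) q2
  have r3 := scale (by positivity : 0 ≤ 2 * N ^ 4) q3
  have r4 := scale (by positivity : 0 ≤ 8 * N ^ 3) q4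
  have r5 := scale (by positivity : 0 ≤ 2 * N ^ 2) q5
  have e4 : 2 * N ^ 4 * (A * C ^ 4 * (2 * A * (L / N) ^ 2 / N + D * L * (L / N) / N
      + 13 * A * (L / N) ^ 3)) =
      C ^ 4 * (4 * (N * A ^ 2 * L ^ 2) + 2 * (N ^ 2 * (A * D) * L ^ 2)
        + 26 * (N * A ^ 2 * L ^ 3)) := by field_simp; ring
  have e3 : 8 * N ^ 3 * (6 * (A * A) * C ^ 3 * (L / N) ^ 2) = C ^ 3 * (48 * (N * A ^ 2 * L ^ 2)) := by
    field_simp; ring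
  have e2 : 2 * N ^ 2 * (2 * (A * A) * C ^ 2 * (L / N)) = C ^ 2 * (4 * (N * A ^ 2 * L)) := by
    field_simp; ring
  rw [e4] at r1 r2 r3
  rw [e3] at r4
  rw [e2] at r5
  have hL2 : L ^ 2 ≤ L ^ 3 := pow_le_pow_right₀ hL1 (by norm_num)
  have hL3 : L ≤ L ^ 3 := by simpa using pow_le_pow_right₀ hL1 (show 1 ≤ 3 by norm_num)
  set X := L ^ 3 * ((1 + N) * A ^ 2 + N ^ 2 * D ^ 2 + N ^ 2 * (A * D)) with hX
  have hL0 : 0 ≤ L := by linarith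
  have t0 : 0 ≤ L ^ 3 * A ^ 2 := by positivity
  have t1 : 0 ≤ L ^ 3 * (N * A ^ 2) := by positivity
  have t2 : 0 ≤ L ^ 3 * (N ^ 2 * D ^ 2) := by positivity
  have t3 : 0 ≤ L ^ 3 * (N ^ 2 * (A * D)) := by positivity
  have hXe : X = L ^ 3 * A ^ 2 + L ^ 3 * (N * A ^ 2) + L ^ 3 * (N ^ 2 * D ^ 2)
      + L ^ 3 * (N ^ 2 * (A * D)) := by rw [hX]; ring
  have u1 : N * A ^ 2 * L ^ 2 ≤ L ^ 3 * (N * A ^ 2) := by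
    rw [mul_comm (L ^ 3)]; exact mul_le_mul_of_nonneg_left hL2 (by positivity)
  have u2 : N ^ 2 * (A * D) * L ^ 2 ≤ L ^ 3 * (N ^ 2 * (A * D)) := by
    rw [mul_comm (L ^ 3)]; exact mul_le_mul_of_nonneg_left hL2 (by positivity)
  have u3 : N * A ^ 2 * L ≤ L ^ 3 * (N * A ^ 2) := by
    rw [mul_comm (L ^ 3)]; exact mul_le_mul_of_nonneg_left hL3 (by positivity)
  have v4 : C ^ 4 * (4 * (N * A ^ 2 * L ^ 2) + 2 * (N ^ 2 * (A * D) * L ^ 2)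
        + 26 * (N * A ^ 2 * L ^ 3)) ≤ C ^ 4 * (32 * X) :=
    mul_le_mul_of_nonneg_left (by linarith) (by positivity)
  have v3 : C ^ 3 * (48 * (N * A ^ 2 * L ^ 2)) ≤ C ^ 3 * (48 * X) :=
    mul_le_mul_of_nonneg_left (by linarith) (by positivity)
  have v2 : C ^ 2 * (4 * (N * A ^ 2 * L)) ≤ C ^ 2 * (4 * X) :=
    mul_le_mul_of_nonneg_left (by linarith) (by positivity)
  have v0 : 2 * C₁ ^ 2 * (2 * A * L + N * D * L) ^ 2 ≤ 2 * C₁ ^ 2 * (8 * X) := by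
    refine mul_le_mul_of_nonneg_left ?_ (by positivity)
    have w1 : (2 * A * L + N * D * L) ^ 2 ≤ 8 * (A ^ 2 * L ^ 2) + 2 * (N ^ 2 * D ^ 2 * L ^ 2) := by
      refine add_sq_le.trans (le_of_eq ?_)
      ring
    have w2 : A ^ 2 * L ^ 2 ≤ L ^ 3 * A ^ 2 := by
      rw [mul_comm (L ^ 3)]; exact mul_le_mul_of_nonneg_left hL2 (by positivity)
    have w3 : N ^ 2 * D ^ 2 * L ^ 2 ≤ L ^ 3 * (N ^ 2 * D ^ 2) := by
      rw [mul_comm (L ^ 3)]; exact mul_le_mul_of_nonneg_left hL2 (by positivity)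
    linarith
  have key := abs_six_le (two.trans v0) (r1.trans v4) (r2.trans v4) (r3.trans v4) (r4.trans v3)
    (r5.trans v2)
  calc _ = |2 * N ^ 2 * V - 4 * N ^ 3 * U + N ^ 4 * (M₁ + M₂) - 2 * N ^ 4 * I₁ - 2 * N ^ 4 * I₂
        - 2 * N ^ 4 * I₃ + 8 * N ^ 3 * J - 2 * N ^ 2 * I₀| := by congr 1; ring
    _ ≤ _ := key
    _ = _ := by ring

end SineBeta

namespace SineBeta

/-! ### The variance of a pair sum of small mean -/

lemma decay_le_two_mul {u v : ℝ} (h : |v| / 2 ≤ |u|) : decay u ≤ 2 * decay v := by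
  have hu := abs_nonneg u
  have hv := abs_nonneg v
  rw [decay, decay, mul_one_div, div_le_div_iff₀ (by linarith) (by linarith)]
  linarith

lemma decay_mul_abs_le (u : ℝ) : decay u * |u| ≤ 1 := by
  have hu := abs_nonneg u
  rw [decay, one_div_mul_eq_div, div_le_one (by linarith)]
  linarith

namespace PairKernel

variable {K : PairKernel} {C : ℝ}

/-- Differences of the lower left entry decay, even when the entry itself does not. -/
lemma BoundedBy.abs_d_mul_e_sub_le (hC : K.BoundedBy C)
    (he : (∀ u, |K.e u| ≤ C * decay u) ∨
      ((∀ u, HasDerivAt K.s (K.d u) u) ∧ (∀ u, HasDerivAt K.e (K.s u) u) ∧ Continuous K.d))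
    (u v : ℝ) : |K.d u * (K.e (v + u) - K.e v)| ≤ 4 * C ^ 2 * decay v := by
  have hC0 := hC.pos
  have hv := decay_pos v
  rcases le_or_gt |u| (|v| / 2) with h | h
  · have hseg : ∀ t, |t - v| ≤ |u| → decay t ≤ 2 * decay v := fun t ht => by
      refine decay_le_two_mul ?_
      have := abs_sub_abs_le_abs_sub v t
      rw [abs_sub_comm v t] at this
      linarith
    rcases he with he | ⟨-, he, -⟩
    · have h1 : |K.e (v + u) - K.e v| ≤ 3 * C * decay v := by
        refine (abs_sub _ _).trans ?_
        have h2 := hseg (v + u) (by simp)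
        have := mul_le_mul_of_nonneg_left h2 hC0.le
        linarith [he (v + u), he v]
      have h2 : |K.d u| ≤ C := (hC.d_le u).trans (mul_le_of_le_one_right hC0.le (decay_le_one u))
      refine (abs_mul_le_mul h2 h1).trans ?_
      have : 0 ≤ C ^ 2 * decay v := by positivity
      linarith
    · have h1 : |K.e (v + u) - K.e v| ≤ 2 * C * decay v * |u| := by
        have := (convex_uIcc v (v + u)).norm_image_sub_le_of_norm_hasDerivWithin_le
          (f := K.e) (f' := K.s) (C := 2 * C * decay v) (fun t _ => (he t).hasDerivWithinAt)
          (fun t ht => by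
            have h3 : |t - v| ≤ |u| := by
              have := abs_sub_left_of_mem_uIcc ht
              simpa using this
            refine (hC.s_le t).trans ?_
            have := mul_le_mul_of_nonneg_left (hseg t h3) hC0.le
            linarith) (left_mem_uIcc) (right_mem_uIcc)
        simpa using this
      refine (abs_mul_le_mul (hC.d_le u) h1).trans ?_
      have h2 := decay_mul_abs_le u
      have h3 : 0 ≤ 2 * C ^ 2 * decay v := by positivity
      calc _ = 2 * C ^ 2 * decay v * (decay u * |u|) := by ring
        _ ≤ 2 * C ^ 2 * decay v * 1 := mul_le_mul_of_nonneg_left h2 h3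
        _ ≤ _ := by linarith
  · have h1 : |K.e (v + u) - K.e v| ≤ C + C :=
      (abs_sub _ _).trans (add_le_add (hC.e_le _) (hC.e_le _))
    have h2 : |K.d u| ≤ C * (2 * decay v) :=
      (hC.d_le u).trans (mul_le_mul_of_nonneg_left (decay_le_two_mul h.le) hC0.le)
    exact (abs_mul_le_mul h2 h1).trans (le_of_eq (by ring))

lemma BoundedBy.abs_R3_le_of_le (hC : K.BoundedBy C) {x y z S : ℝ}
    (h1 : decay (y - z) ≤ S) (h2 : decay (z - x) ≤ S) : |K.R3 x y z| ≤ 6 * C ^ 3 * S := by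
  have hC0 := hC.pos
  have a1 := decay_mul_le_right (x - y) (y - z)
  have a2 := decay_mul_le_left (y - z) (z - x)
  have a3 := decay_mul_le_left (z - x) (x - y)
  refine (hC.R3_le x y z).trans ?_
  calc _ ≤ 2 * C ^ 3 * (S + S + S) := by gcongr <;> linarith
    _ = _ := by ring

lemma BoundedBy.abs_R4dec_le_of_le (hC : K.BoundedBy C) {x y z w S : ℝ}
    (h1 : decay (y - z) ≤ S) (h2 : decay (w - x) ≤ S) : |K.R4dec x y z w| ≤ 12 * C ^ 4 * S := by
  have hC0 := hC.pos
  have h0 := fun u => (decay_pos u).le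
  have a1 : decay (x - y) * decay (y - z) * decay (z - w) ≤ S :=
    (mul_le_of_le_one_right (mul_nonneg (h0 _) (h0 _)) (decay_le_one _)).trans
      ((decay_mul_le_right _ _).trans h1)
  have a2 : decay (y - z) * decay (z - w) * decay (w - x) ≤ S :=
    (mul_le_of_le_one_right (mul_nonneg (h0 _) (h0 _)) (decay_le_one _)).trans
      ((decay_mul_le_left _ _).trans h1)
  have a3 : decay (z - w) * decay (w - x) * decay (x - y) ≤ S :=
    (mul_le_of_le_one_right (mul_nonneg (h0 _) (h0 _)) (decay_le_one _)).trans
      ((decay_mul_le_right _ _).trans h2)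
  have a4 : decay (w - x) * decay (x - y) * decay (y - z) ≤ S :=
    (mul_le_of_le_one_right (mul_nonneg (h0 _) (h0 _)) (decay_le_one _)).trans
      ((decay_mul_le_left _ _).trans h2)
  refine (hC.R4dec_le x y z w).trans ?_
  calc _ ≤ 3 * C ^ 4 * (S + S + S + S) := by gcongr
    _ = _ := by ring

lemma BoundedBy.abs_R4alt_le_of_le (hC : K.BoundedBy C) {x y z w S : ℝ}
    (h1 : decay (x - y) ≤ S) : |K.R4alt x y z w| ≤ C ^ 4 * S := by
  have hC0 := hC.pos
  exact (hC.R4alt_le x y z w).trans (mul_le_mul_of_nonneg_left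
    ((decay_mul_le_left _ _).trans h1) (by positivity))

/-- Two pairs of points decorrelate as the pairs move apart. -/
lemma BoundedBy.abs_r4_sub_le (hC : K.BoundedBy C)
    (he : (∀ u, |K.e u| ≤ C * decay u) ∨
      ((∀ u, HasDerivAt K.s (K.d u) u) ∧ (∀ u, HasDerivAt K.e (K.s u) u) ∧ Continuous K.d))
    (x y z w : ℝ) : |K.r4 x y z w - K.r2 x y * K.r2 z w| ≤ (8 * C ^ 2 + 48 * C ^ 3 + 96 * C ^ 4) *
      (decay (x - z) + decay (x - w) + decay (y - z) + decay (y - w)) := by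
  have hC0 := hC.pos
  have p1 := decay_pos (x - z)
  have p2 := decay_pos (x - w)
  have p3 := decay_pos (y - z)
  have p4 := decay_pos (y - w)
  set S := decay (x - z) + decay (x - w) + decay (y - z) + decay (y - w) with hS
  have w02 : decay (x - z) ≤ S := by linarith
  have w03 : decay (x - w) ≤ S := by linarith
  have w12 : decay (y - z) ≤ S := by linarith
  have w13 : decay (y - w) ≤ S := by linarith
  have w20 : decay (z - x) ≤ S := by rwa [decay_sub_comm]
  have w30 : decay (w - x) ≤ S := by rwa [decay_sub_comm]
  have w21 : decay (z - y) ≤ S := by rwa [decay_sub_comm]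
  have w31 : decay (w - y) ≤ S := by rwa [decay_sub_comm]
  have hS0 : 0 ≤ S := by positivity
  have hT : ∀ {u}, decay u ≤ S → |K.T u| ≤ 2 * C ^ 2 * S := fun {u} h =>
    (hC.T_le u).trans (mul_le_mul_of_nonneg_left h (by positivity))
  have hTT : ∀ {u} (v), decay u ≤ S → |K.T u * K.T v| ≤ 2 * C ^ 2 * S * (2 * C ^ 2) :=
    fun v h => abs_mul_le_mul (hT h) (hC.T_bounded v)
  have t1 := abs_le.1 (hT w02)
  have t2 := abs_le.1 (hT w03)
  have t3 := abs_le.1 (hT w12)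
  have t4 := abs_le.1 (hT w13)
  have t5 := abs_le.1 (hTT (y - w) w02)
  have t6 := abs_le.1 (hTT (y - z) w03)
  have r1 := abs_le.1 (hC.abs_R3_le_of_le w12 w20)
  have r2 := abs_le.1 (hC.abs_R3_le_of_le w13 w30)
  have r3 := abs_le.1 (hC.abs_R3_le_of_le w30 w02)
  have r4 := abs_le.1 (hC.abs_R3_le_of_le w31 w12)
  have d1 := abs_le.1 (hC.abs_R4dec_le_of_le w12 w30)
  have d2 := abs_le.1 (hC.abs_R4dec_le_of_le w13 w20)
  have d3 := abs_le.1 (hC.abs_R4dec_le_of_le w21 w30)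
  have a1 := abs_le.1 (hC.abs_R4alt_le_of_le (x := y) (y := z) (z := w) (w := x) w12)
  have a2 := abs_le.1 (hC.abs_R4alt_le_of_le (x := y) (y := w) (z := z) (w := x) w13)
  have a3 := abs_le.1 (hC.abs_R4alt_le_of_le (x := x) (y := z) (z := y) (w := w) w02)
  have a4 := abs_le.1 (hC.abs_R4alt_le_of_le (x := z) (y := y) (z := w) (w := x) w21)
  have a5 : |K.R4alt x y z w + K.R4alt x y w z| ≤ 8 * C ^ 4 * S := by
    have e1 : K.R4alt x y z w + K.R4alt x y w z =
        K.d (x - y) * (K.e (y - z + (x - y)) - K.e (y - z)) * K.d (z - w) * K.e (y - w)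
        - K.d (x - y) * (K.e (y - w + (x - y)) - K.e (y - w)) * K.d (z - w) * K.e (y - z) := by
      rw [show y - z + (x - y) = x - z by ring, show y - w + (x - y) = x - w by ring, R4alt, R4alt,
        K.d_sub_comm w z, K.e_sub_comm w x, K.e_sub_comm z x]
      ring
    have hd : |K.d (z - w)| ≤ C :=
      (hC.d_le _).trans (mul_le_of_le_one_right hC0.le (decay_le_one _))
    have f1 := abs_mul_le_mul (abs_mul_le_mul (hC.abs_d_mul_e_sub_le he (x - y) (y - z)) hd)
      (hC.e_le (y - w))
    have f2 := abs_mul_le_mul (abs_mul_le_mul (hC.abs_d_mul_e_sub_le he (x - y) (y - w)) hd)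
      (hC.e_le (y - z))
    rw [e1]
    refine (abs_sub _ _).trans ((add_le_add f1 f2).trans ?_)
    have g1 := mul_le_mul_of_nonneg_left w12 (by positivity : 0 ≤ 4 * C ^ 4)
    have g2 := mul_le_mul_of_nonneg_left w13 (by positivity : 0 ≤ 4 * C ^ 4)
    linarith
  have a5 := abs_le.1 a5
  have e : K.r4 x y z w - K.r2 x y * K.r2 z w =
      -K.T (x - z) - K.T (x - w) - K.T (y - z) - K.T (y - w)
      + K.T (x - z) * K.T (y - w) + K.T (x - w) * K.T (y - z)
      + 2 * (K.R3 x y z + K.R3 x y w + K.R3 z w x + K.R3 z w y)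
      - 2 * (K.R4dec x y z w + K.R4dec x y w z + K.R4dec x z y w)
      - (K.R4alt x y z w + K.R4alt x y w z) - K.R4alt y z w x - K.R4alt y w z x
      - K.R4alt x z y w - K.R4alt z y w x := by
    have c : ∀ a b c, K.R3 b c a = K.R3 a b c := fun a b c => by
      rw [R3, R3, scal, scal, Matrix.trace_mul_comm, ← Matrix.mul_assoc]
    rw [PairKernel.r4, PairKernel.r2, PairKernel.r2, R4_eq_add, R4_eq_add, R4_eq_add, c x z w,
      c y z w]
    ring
  rw [e]
  have hX : 0 ≤ C ^ 4 * S := by positivity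
  have hY : 0 ≤ C ^ 3 * S := by positivity
  have hZ : 0 ≤ C ^ 2 * S := by positivity
  clear_value S
  rw [abs_le]
  constructor <;> linarith [t1.1, t1.2]

end PairKernel

section small

variable {N a b : ℝ} {g : ℝ → ℝ} [hN : Fact (0 < N)] {K : PairKernel} {C : ℝ} {k : ℕ}

/-- Integrating out a point that enters through one factor only. -/
lemma integral_abs_mul_le
    (ha : ∀ y, ∫ x, |g (x - y)| ∂unif N ≤ a) {i j : Fin k} (hij : i ≠ j)
    {H : (Fin k → ℝ) → ℝ} (hH : Integrable H (unifPi k N))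
    (hint : Integrable (fun x => |g (x i - x j)| * H x) (unifPi k N)) (h0 : ∀ x, 0 ≤ H x)
    (hi : ∀ x y, H (Function.update x i y) = H x) :
    ∫ x, |g (x i - x j)| * H x ∂unifPi k N ≤ a * ∫ x, H x ∂unifPi k N := by
  rw [integral_update i hint, ← integral_const_mul]
  refine integral_mono (integrable_update i hint) (hH.const_mul _) fun x => ?_
  simp only [Function.update_self, Function.update_of_ne hij.symm, hi]
  rw [integral_mul_const]
  exact mul_le_mul_of_nonneg_right (ha _) (h0 x)

/-- Two factors attached to the ends of a decaying link. -/
lemma integral_abs_mul_abs_mul_decay_le (hg : SquareIntegrableOn N g)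
    (ha : ∀ y, ∫ x, |g (x - y)| ∂unif N ≤ a) {i j l m : Fin k} (hij : i ≠ j) (hil : i ≠ l)
    (him : i ≠ m) (hjl : j ≠ l) (hjm : j ≠ m) (hlm : l ≠ m) :
    ∫ x, |g (x i - x j)| * (|g (x l - x m)| * decay (x j - x m)) ∂unifPi k N ≤
      a ^ 2 * (logBound N / N) := by
  have ha0 : 0 ≤ a := (integral_nonneg fun _ => abs_nonneg _).trans (ha 0)
  have hd : BddMeas fun x : Fin k → ℝ => decay (x j - x m) := BddMeas.decay_sub j m
  have hdm := hd.1
  obtain ⟨B, hB⟩ := hd.2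
  have i2 : Integrable (fun x : Fin k → ℝ => |g (x l - x m)| * decay (x j - x m)) (unifPi k N) := by
    refine (hg.integrable_mul_one hlm hdm hB).abs.congr (ae_of_all _ fun x => ?_)
    simp only
    rw [abs_mul, abs_of_pos (decay_pos _)]
  have i1 : Integrable (fun x : Fin k → ℝ =>
      |g (x i - x j)| * (|g (x l - x m)| * decay (x j - x m))) (unifPi k N) := by
    refine (hg.integrable_mul hij hlm hdm hB).abs.congr (ae_of_all _ fun x => ?_)
    simp only
    rw [abs_mul, abs_mul, abs_of_pos (decay_pos _), mul_assoc]
  refine (integral_abs_mul_le ha hij i2 i1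
    (fun x => mul_nonneg (abs_nonneg _) (decay_pos _).le) fun x y => ?_).trans ?_
  · rw [Function.update_of_ne hil.symm, Function.update_of_ne him.symm,
      Function.update_of_ne hij.symm]
  · rw [sq, mul_assoc]
    refine mul_le_mul_of_nonneg_left ?_ ha0
    refine (integral_abs_mul_le ha hlm hd.integrable i2 (fun x => (decay_pos _).le)
      fun x y => ?_).trans (mul_le_mul_of_nonneg_left (integral_decay_le hjm) ha0)
    rw [Function.update_of_ne hjl, Function.update_of_ne hlm.symm]

end small

/-- The variance of a pair sum of small mean. -/
theorem PairKernel.IsAdmissible.exists_small_bound {K : PairKernel} (hK : K.IsAdmissible) :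
    ∃ C, 0 ≤ C ∧ ∀ {N a b : ℝ} {g : ℝ → ℝ} [Fact (0 < N)], SquareIntegrableOn N g →
      (∀ u, g (-u) = g u) → (∀ y, ∫ x, |g (x - y)| ∂unif N ≤ a) →
      (∫ x, g (x 0 - x 1) * g (x 0 - x 1) ∂unifPi 4 N ≤ b) →
      |pairVariance K N g| ≤ C * (N ^ 3 * logBound N * a ^ 2 + N ^ 2 * b) := by
  obtain ⟨C, hC, he⟩ := hK.exists_boundedBy_decay
  obtain ⟨B, hB, hB2, hB3, hB4⟩ := hC.r_bounded
  have hC0 := hC.pos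
  set M := 8 * C ^ 2 + 48 * C ^ 3 + 96 * C ^ 4 with hM
  have hM0 : 0 ≤ M := by positivity
  refine ⟨4 * M + 4 * B, by positivity, ?_⟩
  intro N a b g hN hg heven ha hb
  have hN0 := hN.out
  have hL1 := one_le_logBound hN0.le
  have ha0 : 0 ≤ a := (integral_nonneg fun _ => abs_nonneg _).trans (ha 0)
  have hb0 : 0 ≤ b := (integral_nonneg fun _ => mul_self_nonneg _).trans hb
  have hs : ∀ x y, |g (x - y)| = |g (y - x)| := fun x y => by rw [← heven, neg_sub]
  have hw : ∀ i j : Fin 4, BddMeas fun x : Fin 4 → ℝ => decay (x i - x j) :=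
    fun i j => BddMeas.decay_sub i j
  have ig : ∀ {r : (Fin 4 → ℝ) → ℝ}, BddMeas r → (∀ x, 0 ≤ r x) →
      Integrable (fun x => |g (x 0 - x 1)| * |g (x 2 - x 3)| * r x) (unifPi 4 N) := by
    intro r hr h0
    obtain ⟨B, hB⟩ := hr.2
    refine (hg.integrable_mul (i := 0) (j := 1) (k := 2) (l := 3) (by decide) (by decide) hr.1
      hB).abs.congr (ae_of_all _ fun x => ?_)
    simp only
    rw [abs_mul, abs_mul, abs_of_nonneg (h0 x)]
  have four : |∫ x, g (x 0 - x 1) * g (x 2 - x 3) * (K.r4 (x 0) (x 1) (x 2) (x 3)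
      - K.r2 (x 0) (x 1) * K.r2 (x 2) (x 3)) ∂unifPi 4 N| ≤ 4 * M * (a ^ 2 * (logBound N / N)) := by
    have hd0 : ∀ (i j : Fin 4) (x : Fin 4 → ℝ), 0 ≤ decay (x i - x j) := fun i j x =>
      (decay_pos _).le
    have j1 := ig (hw 0 2) (hd0 0 2)
    have j2 := ig (hw 0 3) (hd0 0 3)
    have j3 := ig (hw 1 2) (hd0 1 2)
    have j4 := ig (hw 1 3) (hd0 1 3)
    refine (abs_integral_le ((((j1.add j2).add j3).add j4).const_mul M) fun x => ?_).trans ?_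
    · refine (abs_mul_le_mul (abs_mul _ _).le (hC.abs_r4_sub_le he _ _ _ _)).trans (le_of_eq ?_)
      simp only [Pi.add_apply]
      ring
    · rw [integral_const_mul, integral_add' ((j1.add j2).add j3) j4, integral_add' (j1.add j2) j3,
        integral_add' j1 j2]
      have q1 := integral_abs_mul_abs_mul_decay_le hg ha (i := 1) (j := (0 : Fin 4))
        (l := 3) (m := 2) (by decide) (by decide) (by decide) (by decide) (by decide) (by decide)
      have q2 := integral_abs_mul_abs_mul_decay_le hg ha (i := 1) (j := (0 : Fin 4))
        (l := 2) (m := 3) (by decide) (by decide) (by decide) (by decide) (by decide) (by decide)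
      have q3 := integral_abs_mul_abs_mul_decay_le hg ha (i := 0) (j := (1 : Fin 4))
        (l := 3) (m := 2) (by decide) (by decide) (by decide) (by decide) (by decide) (by decide)
      have q4 := integral_abs_mul_abs_mul_decay_le hg ha (i := 0) (j := (1 : Fin 4))
        (l := 2) (m := 3) (by decide) (by decide) (by decide) (by decide) (by decide) (by decide)
      simp only [← mul_assoc, fun x : Fin 4 → ℝ => hs (x 1) (x 0),
        fun x : Fin 4 → ℝ => hs (x 3) (x 2)] at q1 q2 q3 q4
      rw [show 4 * M * (a ^ 2 * (logBound N / N)) = M * (a ^ 2 * (logBound N / N) +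
        a ^ 2 * (logBound N / N) + a ^ 2 * (logBound N / N) + a ^ 2 * (logBound N / N)) by ring]
      exact mul_le_mul_of_nonneg_left (add_le_add (add_le_add (add_le_add q1 q2) q3) q4) hM0
  have three : |∫ x, g (x 0 - x 1) * g (x 0 - x 2) * K.r3 (x 0) (x 1) (x 2) ∂unifPi 4 N| ≤
      B * a ^ 2 := by
    have i2 : Integrable (fun x : Fin 4 → ℝ => |g (x 2 - x 0)|) (unifPi 4 N) :=
      ((hg.memLp (i := 2) (j := 0) (by decide)).integrable (by norm_num)).abs
    have i1 : Integrable (fun x : Fin 4 → ℝ => |g (x 1 - x 0)| * |g (x 2 - x 0)|) (unifPi 4 N) := by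
      refine ((hg.memLp (i := 1) (j := 0) (by decide)).integrable_mul
        (hg.memLp (i := 2) (j := 0) (by decide))).abs.congr (ae_of_all _ fun x => ?_)
      simp only [Pi.mul_apply]
      rw [abs_mul]
    refine (abs_integral_le (i1.const_mul B) fun x => ?_).trans ?_
    · refine (abs_mul_le_mul (abs_mul _ _).le (hB3 _ _ _)).trans (le_of_eq ?_)
      rw [hs (x 0) (x 1), hs (x 0) (x 2)]
      ring
    · rw [integral_const_mul]
      refine mul_le_mul_of_nonneg_left ?_ hB
      refine (integral_abs_mul_le ha (by decide) i2 i1 (fun x => abs_nonneg _)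
        fun x y => ?_).trans ?_
      · rw [Function.update_of_ne (by decide), Function.update_of_ne (by decide)]
      · rw [sq]
        refine mul_le_mul_of_nonneg_left ?_ ha0
        have := integral_abs_mul_le ha (i := 2) (j := (0 : Fin 4)) (by decide)
          (BddMeas.const 1).integrable (i2.mul_const 1) (fun _ => zero_le_one) fun _ _ => rfl
        simpa using this
  have two : |∫ x, g (x 0 - x 1) * g (x 0 - x 1) * K.r2 (x 0) (x 1) ∂unifPi 4 N| ≤ B * b := by
    have i1 : Integrable (fun x : Fin 4 → ℝ => g (x 0 - x 1) * g (x 0 - x 1)) (unifPi 4 N) :=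
      (hg.memLp (i := 0) (j := 1) (by decide)).integrable_mul
        (hg.memLp (i := 0) (j := 1) (by decide))
    refine (abs_integral_le (i1.const_mul B) fun x => ?_).trans ?_
    · refine (abs_mul_le_mul (abs_mul_self _).le (hB2 _ _)).trans (le_of_eq ?_)
      ring
    · rw [integral_const_mul]
      exact mul_le_mul_of_nonneg_left hb hB
  have scale : ∀ {c x b : ℝ}, 0 ≤ c → |x| ≤ b → |c * x| ≤ c * b := fun hc h => by
    rw [abs_mul, abs_of_nonneg hc]; exact mul_le_mul_of_nonneg_left h hc
  rw [pairVariance]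
  refine (abs_add_le _ _).trans ((add_le_add ((abs_add_le _ _).trans (add_le_add
    (scale (by positivity : 0 ≤ N ^ 4) four) (scale (by positivity : 0 ≤ 4 * N ^ 3) three)))
    (scale (by positivity : 0 ≤ 2 * N ^ 2) two)).trans ?_)
  have e1 : N ^ 4 * (4 * M * (a ^ 2 * (logBound N / N))) =
      4 * M * (N ^ 3 * logBound N * a ^ 2) := by field_simp
  have e2 : 4 * N ^ 3 * (B * a ^ 2) ≤ 4 * B * (N ^ 3 * logBound N * a ^ 2) := by
    have : N ^ 3 * a ^ 2 * 1 ≤ N ^ 3 * a ^ 2 * logBound N :=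
      mul_le_mul_of_nonneg_left hL1 (by positivity)
    have := mul_le_mul_of_nonneg_left this (by positivity : 0 ≤ 4 * B)
    linarith
  have e3 : 0 ≤ B * (N ^ 2 * b) := by positivity
  have e4 : 0 ≤ M * (N ^ 2 * b) := by positivity
  rw [e1]
  linarith

end SineBeta

namespace SineBeta

/-! ### Regularization of the logarithmic singularity -/

/-- The logarithm of `|2 sin t|`, regularized at scale `δ`. -/
noncomputable def regLog (δ t : ℝ) : ℝ := 1 / 2 * Real.log (4 * Real.sin t ^ 2 + δ ^ 2)

/-- The effect of the regularization. -/
noncomputable def regGap (δ t : ℝ) : ℝ := regLog δ t - Real.log |2 * Real.sin t|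

/-- An integrable weight with singularities at `0` and `π`. -/
noncomputable def endpointWeight (t : ℝ) : ℝ :=
  t ^ (-(3 / 4) : ℝ) + (Real.pi - t) ^ (-(3 / 4) : ℝ)

section regLog

variable {δ : ℝ}

lemma abs_regLog_le (hδ : 0 < δ) (hδ1 : δ ≤ 1) (t : ℝ) : |regLog δ t| ≤ 2 - Real.log δ := by
  have hs := Real.sin_sq_le_one t
  have hs0 := sq_nonneg (Real.sin t)
  have hl := Real.log_nonpos hδ.le hδ1
  have hp : 0 < 4 * Real.sin t ^ 2 + δ ^ 2 := by positivity
  have h1 := Real.log_le_sub_one_of_pos hp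
  have h2 : Real.log (δ ^ 2) ≤ Real.log (4 * Real.sin t ^ 2 + δ ^ 2) :=
    Real.log_le_log (by positivity) (by linarith)
  rw [Real.log_pow] at h2
  push_cast at h2
  have h3 : δ ^ 2 ≤ 1 := pow_le_one₀ hδ.le hδ1
  rw [regLog, abs_le]
  constructor <;> linarith

lemma hasDerivAt_regLog (hδ : 0 < δ) (t : ℝ) : HasDerivAt (regLog δ)
    (4 * Real.sin t * Real.cos t / (4 * Real.sin t ^ 2 + δ ^ 2)) t := by
  have hp : 4 * Real.sin t ^ 2 + δ ^ 2 ≠ 0 := by positivity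
  have h := ((((((Real.hasDerivAt_sin t).pow 2).const_mul 4).add_const (δ ^ 2)).log hp).const_mul
    (1 / 2))
  refine h.congr_deriv ?_
  simp
  ring

lemma abs_deriv_regLog_le (hδ : 0 < δ) (t : ℝ) :
    |4 * Real.sin t * Real.cos t / (4 * Real.sin t ^ 2 + δ ^ 2)| ≤ 1 / δ := by
  have hp : 0 < 4 * Real.sin t ^ 2 + δ ^ 2 := by positivity
  rw [abs_div, abs_of_pos hp, div_le_div_iff₀ hp hδ, abs_mul, abs_mul, abs_of_pos (by norm_num : (0 : ℝ) < 4)]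
  have hc := Real.abs_cos_le_one t
  have hs := abs_nonneg (Real.sin t)
  have h1 : 4 * |Real.sin t| * |Real.cos t| * δ ≤ 4 * |Real.sin t| * 1 * δ := by gcongr
  have h2 := sq_abs (Real.sin t)
  nlinarith [sq_nonneg (2 * |Real.sin t| - δ)]

lemma log_one_add_pow_le {w : ℝ} (hw : 0 ≤ w) : 1 / 2 * Real.log (1 + w ^ 8) ≤ 4 * w ^ 3 ∧
    (1 / 2 * Real.log (1 + w ^ 8)) ^ 2 ≤ 16 * w ^ 3 := by
  have h0 : 0 ≤ Real.log (1 + w ^ 8) := Real.log_nonneg (by linarith [pow_nonneg hw 8])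
  have hw3 : 0 ≤ w ^ 3 := by positivity
  rcases le_total w 1 with h | h
  · have h1 := Real.log_le_sub_one_of_pos (by positivity : 0 < 1 + w ^ 8)
    have h2 : w ^ 8 ≤ w ^ 3 := pow_le_pow_of_le_one hw h (by norm_num)
    have h3 : w ^ 3 ≤ 1 := pow_le_one₀ hw h
    refine ⟨by linarith, ?_⟩
    have h4 : 1 / 2 * Real.log (1 + w ^ 8) ≤ w ^ 3 := by linarith
    calc _ ≤ (w ^ 3) ^ 2 := pow_le_pow_left₀ (by linarith) h4 2
      _ = w ^ 3 * w ^ 3 := sq _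
      _ ≤ w ^ 3 * 1 := mul_le_mul_of_nonneg_left h3 hw3
      _ ≤ _ := by linarith
  · have h1 : 1 + w ^ 8 ≤ (1 + w) ^ 8 := by
      have := pow_add_pow_le zero_le_one hw (n := 8) (by norm_num)
      simpa using this
    have h2 : Real.log (1 + w ^ 8) ≤ 8 * Real.log (1 + w) := by
      have := Real.log_le_log (by positivity) h1
      rwa [Real.log_pow] at this
    have h3 := Real.log_le_sub_one_of_pos (by positivity : 0 < 1 + w)
    have h4 : w ≤ w ^ 3 := by simpa using pow_le_pow_right₀ h (show 1 ≤ 3 by norm_num)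
    have h5 : w ^ 2 ≤ w ^ 3 := pow_le_pow_right₀ h (by norm_num)
    have h6 : 1 / 2 * Real.log (1 + w ^ 8) ≤ 4 * w := by linarith
    refine ⟨by linarith, ?_⟩
    calc _ ≤ (4 * w) ^ 2 := pow_le_pow_left₀ (by linarith) h6 2
      _ = 16 * w ^ 2 := by ring
      _ ≤ _ := by linarith

lemma rpow_two_mul_sin_le {t : ℝ} (ht : t ∈ Ioo 0 Real.pi) :
    (2 * Real.sin t) ^ (-(3 / 4) : ℝ) ≤ endpointWeight t := by
  have key : ∀ {t : ℝ}, 0 < t → t ≤ Real.pi / 2 →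
      (2 * Real.sin t) ^ (-(3 / 4) : ℝ) ≤ t ^ (-(3 / 4) : ℝ) := by
    intro t h0 h1
    refine Real.rpow_le_rpow_of_nonpos h0 ?_ (by norm_num)
    have h2 := Real.mul_le_sin h0.le h1
    have h3 : 1 ≤ 2 * (2 / Real.pi) := by
      rw [mul_div_assoc', le_div_iff₀ Real.pi_pos]
      linarith [Real.pi_le_four]
    have := mul_le_mul_of_nonneg_right h3 h0.le
    linarith
  have n1 : 0 ≤ t ^ (-(3 / 4) : ℝ) := Real.rpow_nonneg ht.1.le _
  have n2 : 0 ≤ (Real.pi - t) ^ (-(3 / 4) : ℝ) := Real.rpow_nonneg (by linarith [ht.2]) _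
  rw [endpointWeight]
  rcases le_total t (Real.pi / 2) with h | h
  · linarith [key ht.1 h]
  · have := key (t := Real.pi - t) (by linarith [ht.2]) (by linarith)
    rw [Real.sin_pi_sub] at this
    linarith

lemma regGap_bounds (hδ : 0 < δ) {t : ℝ} (ht : t ∈ Ioo 0 Real.pi) : 0 ≤ regGap δ t ∧
    regGap δ t ≤ 4 * (δ ^ (3 / 4 : ℝ) * endpointWeight t) ∧
    regGap δ t ^ 2 ≤ 16 * (δ ^ (3 / 4 : ℝ) * endpointWeight t) := by
  have hs : 0 < Real.sin t := Real.sin_pos_of_mem_Ioo ht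
  set w := (δ / (2 * Real.sin t)) ^ (1 / 4 : ℝ) with hw
  have hz : 0 < δ / (2 * Real.sin t) := by positivity
  have hw0 : 0 ≤ w := Real.rpow_nonneg hz.le _
  have hw8 : w ^ 8 = (δ / (2 * Real.sin t)) ^ 2 := by
    rw [hw, ← Real.rpow_natCast, ← Real.rpow_mul hz.le, ← Real.rpow_natCast]
    norm_num
  have hw3 : w ^ 3 = δ ^ (3 / 4 : ℝ) * (2 * Real.sin t) ^ (-(3 / 4) : ℝ) := by
    rw [hw, ← Real.rpow_natCast, ← Real.rpow_mul hz.le, Real.div_rpow hδ.le (by positivity),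
      Real.rpow_neg (by positivity), div_eq_mul_inv]
    norm_num
  have hgap : regGap δ t = 1 / 2 * Real.log (1 + w ^ 8) := by
    rw [regGap, regLog, hw8, abs_of_pos (by positivity)]
    have e : 4 * Real.sin t ^ 2 + δ ^ 2 =
        (2 * Real.sin t) ^ 2 * (1 + (δ / (2 * Real.sin t)) ^ 2) := by field_simp; ring
    rw [e, Real.log_mul (by positivity) (by positivity), Real.log_pow]
    push_cast
    ring
  have hle : w ^ 3 ≤ δ ^ (3 / 4 : ℝ) * endpointWeight t := by
    rw [hw3]
    exact mul_le_mul_of_nonneg_left (rpow_two_mul_sin_le ht) (Real.rpow_nonneg hδ.le _)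
  have h := log_one_add_pow_le hw0
  rw [hgap]
  refine ⟨mul_nonneg (by norm_num) (Real.log_nonneg (by linarith [pow_nonneg hw0 8])), ?_, ?_⟩
  · linarith [h.1]
  · linarith [h.2]

lemma intervalIntegrable_endpointWeight :
    IntervalIntegrable endpointWeight volume 0 Real.pi := by
  have h : ∀ a b : ℝ, IntervalIntegrable (fun t : ℝ => t ^ (-(3 / 4) : ℝ)) volume a b := fun a b =>
    intervalIntegral.intervalIntegrable_rpow' (by norm_num)
  have h2 := (h Real.pi 0).comp_sub_left (c := Real.pi)
  simp only [sub_self, sub_zero] at h2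
  exact (h _ _).add h2

lemma measurable_regGap (δ : ℝ) : Measurable (regGap δ) := by
  unfold regGap regLog
  have h1 : Measurable fun t => Real.log (4 * Real.sin t ^ 2 + δ ^ 2) :=
    Real.measurable_log.comp (by fun_prop)
  have h2 : Measurable fun t => Real.log |2 * Real.sin t| :=
    Real.measurable_log.comp (by fun_prop)
  exact (measurable_const.mul h1).sub h2

lemma intervalIntegrable_of_le_endpointWeight {f : ℝ → ℝ} (hf : Measurable f) {c : ℝ}
    (h : ∀ t ∈ Ioo 0 Real.pi, |f t| ≤ c * endpointWeight t) :
    IntervalIntegrable f volume 0 Real.pi := by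
  have hw := intervalIntegrable_endpointWeight.const_mul c
  rw [intervalIntegrable_iff_integrableOn_Ioo_of_le Real.pi_pos.le] at hw ⊢
  exact Integrable.mono' hw hf.aestronglyMeasurable
    ((ae_restrict_mem measurableSet_Ioo).mono fun t ht => h t ht)

lemma integral_mono_Ioo_pi {f g : ℝ → ℝ} (hf : IntervalIntegrable f volume 0 Real.pi)
    (hg : IntervalIntegrable g volume 0 Real.pi) (h : ∀ t ∈ Ioo 0 Real.pi, f t ≤ g t) :
    ∫ t in (0 : ℝ)..Real.pi, f t ≤ ∫ t in (0 : ℝ)..Real.pi, g t := by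
  rw [intervalIntegrable_iff_integrableOn_Ioo_of_le Real.pi_pos.le] at hf hg
  rw [intervalIntegral.integral_of_le Real.pi_pos.le, intervalIntegral.integral_of_le
    Real.pi_pos.le, integral_Ioc_eq_integral_Ioo, integral_Ioc_eq_integral_Ioo]
  exact setIntegral_mono_on hf hg measurableSet_Ioo h

lemma intervalIntegrable_regGap (hδ : 0 < δ) :
    IntervalIntegrable (regGap δ) volume 0 Real.pi :=
  intervalIntegrable_of_le_endpointWeight (measurable_regGap δ) (c := 4 * δ ^ (3 / 4 : ℝ))
    fun t ht => by
      have h := regGap_bounds hδ ht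
      rw [abs_of_nonneg h.1]
      linarith [h.2.1]

lemma intervalIntegrable_regGap_sq (hδ : 0 < δ) :
    IntervalIntegrable (fun t => regGap δ t ^ 2) volume 0 Real.pi :=
  intervalIntegrable_of_le_endpointWeight ((measurable_regGap δ).pow_const 2)
    (c := 16 * δ ^ (3 / 4 : ℝ))
    fun t ht => by
      have h := regGap_bounds hδ ht
      rw [abs_of_nonneg (sq_nonneg _)]
      linarith [h.2.2]

/-- The mean of the regularized logarithm over a period. -/
noncomputable def regMean (δ : ℝ) : ℝ := 1 / Real.pi * ∫ t in (0 : ℝ)..Real.pi, regLog δ t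

lemma integral_log_abs_two_mul_sin :
    ∫ t in (0 : ℝ)..Real.pi, Real.log |2 * Real.sin t| = 0 := by
  have h : ∫ t in (0 : ℝ)..Real.pi, Real.log |2 * Real.sin t| =
      ∫ t in (0 : ℝ)..Real.pi, (Real.log 2 + Real.log (Real.sin t)) := by
    rw [intervalIntegral.integral_of_le Real.pi_pos.le, intervalIntegral.integral_of_le
      Real.pi_pos.le, integral_Ioc_eq_integral_Ioo, integral_Ioc_eq_integral_Ioo]
    refine setIntegral_congr_fun measurableSet_Ioo fun t ht => ?_
    have hs : 0 < Real.sin t := Real.sin_pos_of_mem_Ioo ht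
    rw [Real.log_abs, Real.log_mul (by norm_num) hs.ne']
  have hls : IntervalIntegrable (fun t => Real.log (Real.sin t)) volume 0 Real.pi :=
    intervalIntegrable_log_sin
  rw [h, intervalIntegral.integral_add (by simp) hls,
    integral_log_sin_zero_pi]
  simp
  ring

lemma continuous_regLog (hδ : 0 < δ) : Continuous (regLog δ) :=
  continuous_iff_continuousAt.2 fun t => (hasDerivAt_regLog hδ t).continuousAt

lemma regMean_eq (hδ : 0 < δ) :
    regMean δ = 1 / Real.pi * ∫ t in (0 : ℝ)..Real.pi, regGap δ t := by
  have h1 : IntervalIntegrable (fun t => regLog δ t) volume 0 Real.pi :=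
    (continuous_regLog hδ).intervalIntegrable _ _
  have h2 : IntervalIntegrable (fun t => Real.log |2 * Real.sin t|) volume 0 Real.pi := by
    have := h1.sub (intervalIntegrable_regGap hδ)
    refine this.congr_ae (ae_of_all _ fun t => ?_)
    simp [regGap]
  unfold regMean regGap
  rw [intervalIntegral.integral_sub h1 h2, integral_log_abs_two_mul_sin, sub_zero]

lemma abs_regMean_le (hδ : 0 < δ) (hδ1 : δ ≤ 1) : |regMean δ| ≤ 2 - Real.log δ := by
  have h := intervalIntegral.norm_integral_le_of_norm_le_const (a := 0) (b := Real.pi)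
    (f := regLog δ) (C := 2 - Real.log δ) fun t _ => abs_regLog_le hδ hδ1 t
  rw [regMean, abs_mul, abs_of_pos (by positivity : 0 < 1 / Real.pi)]
  rw [sub_zero, abs_of_pos Real.pi_pos, Real.norm_eq_abs] at h
  rw [one_div, inv_mul_le_iff₀ Real.pi_pos]
  linarith

/-- The effect of the regularization is small in mean and in mean square. -/
lemma exists_integral_regGap_le : ∃ c, 0 ≤ c ∧ ∀ δ : ℝ, 0 < δ → δ ≤ 1 →
    (1 / Real.pi * ∫ t in (0 : ℝ)..Real.pi, |regMean δ - regGap δ t|) ≤ c * δ ^ (3 / 4 : ℝ) ∧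
    (1 / Real.pi * ∫ t in (0 : ℝ)..Real.pi, (regMean δ - regGap δ t) ^ 2) ≤
      c * δ ^ (3 / 4 : ℝ) := by
  set c₀ := 1 / Real.pi * ∫ t in (0 : ℝ)..Real.pi, endpointWeight t with hc
  have hpi := Real.pi_pos
  have hip : 0 < 1 / Real.pi := by positivity
  have hc0 : 0 ≤ c₀ := by
    refine mul_nonneg hip.le (intervalIntegral.integral_nonneg hpi.le fun t ht => ?_)
    exact add_nonneg (Real.rpow_nonneg ht.1 _) (Real.rpow_nonneg (by linarith [ht.2]) _)
  refine ⟨8 * c₀ + 32 * c₀ + 32 * c₀ ^ 2, by positivity, fun δ hδ hδ1 => ?_⟩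
  have hi := intervalIntegrable_regGap hδ
  have hi2 := intervalIntegrable_regGap_sq hδ
  have hw := intervalIntegrable_endpointWeight
  set ε := δ ^ (3 / 4 : ℝ) with hε
  have hε0 : 0 ≤ ε := Real.rpow_nonneg hδ.le _
  have hε1 : ε ≤ 1 := Real.rpow_le_one hδ.le hδ1 (by norm_num)
  have b1 : (1 / Real.pi * ∫ t in (0 : ℝ)..Real.pi, regGap δ t) ≤ 4 * c₀ * ε := by
    have := integral_mono_Ioo_pi hi (hw.const_mul (4 * ε)) fun t ht => by
      linarith [(regGap_bounds hδ ht).2.1]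
    rw [intervalIntegral.integral_const_mul] at this
    calc _ ≤ 1 / Real.pi * (4 * ε * ∫ t in (0 : ℝ)..Real.pi, endpointWeight t) :=
          mul_le_mul_of_nonneg_left this hip.le
      _ = _ := by rw [hc]; ring
  have b2 : (1 / Real.pi * ∫ t in (0 : ℝ)..Real.pi, regGap δ t ^ 2) ≤ 16 * c₀ * ε := by
    have := integral_mono_Ioo_pi hi2 (hw.const_mul (16 * ε)) fun t ht => by
      linarith [(regGap_bounds hδ ht).2.2]
    rw [intervalIntegral.integral_const_mul] at this
    calc _ ≤ 1 / Real.pi * (16 * ε * ∫ t in (0 : ℝ)..Real.pi, endpointWeight t) :=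
          mul_le_mul_of_nonneg_left this hip.le
      _ = _ := by rw [hc]; ring
  have hm := regMean_eq hδ
  have hm0 : 0 ≤ regMean δ := by
    have h0 := integral_mono_Ioo_pi (f := fun _ => 0) (by simp) hi fun t ht =>
      (regGap_bounds hδ ht).1
    rw [hm]
    simp only [intervalIntegral.integral_zero] at h0
    positivity
  have hmc : ∀ c : ℝ, 1 / Real.pi * ∫ _ in (0 : ℝ)..Real.pi, c = c := fun c => by
    rw [intervalIntegral.integral_const, smul_eq_mul]; field_simp; ring
  have hci : ∀ c : ℝ, IntervalIntegrable (fun _ => c) volume 0 Real.pi := fun c => by simp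
  constructor
  · have h1 := integral_mono_Ioo_pi (((hci (regMean δ)).sub hi).abs)
      ((hci (regMean δ)).add hi) fun t ht => by
        have := (regGap_bounds hδ ht).1
        refine (abs_sub _ _).trans ?_
        rw [abs_of_nonneg hm0, abs_of_nonneg this]
    have h2 := mul_le_mul_of_nonneg_left h1 hip.le
    rw [intervalIntegral.integral_add (hci _) hi, mul_add, hmc, ← hm] at h2
    rw [← hm] at b1
    have : 0 ≤ c₀ * ε := by positivity
    have : 0 ≤ c₀ ^ 2 * ε := by positivity
    linarith
  · have h1 := integral_mono_Ioo_pi (f := fun t => (regMean δ - regGap δ t) ^ 2)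
      (g := fun t => 2 * regMean δ ^ 2 + 2 * regGap δ t ^ 2)
      (by
        have := (((hci (regMean δ ^ 2)).sub (hi.const_mul (2 * regMean δ))).add hi2)
        refine this.congr_ae (ae_of_all _ fun t => ?_)
        ring)
      ((hci _).add (hi2.const_mul 2)) fun t _ => by
        nlinarith [sq_nonneg (regMean δ + regGap δ t)]
    have h2 := mul_le_mul_of_nonneg_left h1 hip.le
    rw [intervalIntegral.integral_add (hci _) (hi2.const_mul 2), mul_add, hmc,
      intervalIntegral.integral_const_mul] at h2
    rw [← hm] at b1
    have h3 : regMean δ ^ 2 ≤ 16 * c₀ ^ 2 * ε := by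
      calc regMean δ ^ 2 ≤ (4 * c₀ * ε) ^ 2 := pow_le_pow_left₀ hm0 b1 2
        _ = 16 * c₀ ^ 2 * ε * ε := by ring
        _ ≤ 16 * c₀ ^ 2 * ε * 1 := mul_le_mul_of_nonneg_left hε1 (by positivity)
        _ = _ := by ring
    have : 0 ≤ c₀ * ε := by positivity
    linarith

end regLog

end SineBeta

namespace SineBeta

section periodic

variable {N δ : ℝ} [hN : Fact (0 < N)] {F : ℝ → ℝ}

lemma integral_unif_periodic (hF : Function.Periodic F Real.pi) (y : ℝ) :
    ∫ x, F (Real.pi * (x - y) / N) ∂unif N = 1 / Real.pi * ∫ t in (0 : ℝ)..Real.pi, F t := by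
  have hN0 := hN.out
  have hc : Real.pi / N ≠ 0 := by positivity
  have e : ∀ x, Real.pi * (x - y) / N = Real.pi / N * x - Real.pi / N * y := fun x => by ring
  simp only [e]
  rw [integral_unif, intervalIntegral.integral_comp_mul_sub _ hc]
  have e1 : Real.pi / N * 0 - Real.pi / N * y = -(Real.pi / N * y) := by ring
  have e2 : Real.pi / N * N - Real.pi / N * y = -(Real.pi / N * y) + Real.pi := by
    field_simp; ring
  rw [e1, e2, hF.intervalIntegral_add_eq _ 0, zero_add, smul_eq_mul]
  have := Real.pi_pos
  field_simp

lemma integrable_unif_periodic (hF : Function.Periodic F Real.pi)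
    (hi : IntervalIntegrable F volume 0 Real.pi) (y : ℝ) :
    Integrable (fun x => F (Real.pi * (x - y) / N)) (unif N) := by
  have hN0 := hN.out
  have hc : Real.pi / N ≠ 0 := by positivity
  have h1 : ∀ p q : ℝ, IntervalIntegrable (fun x => F (Real.pi / N * x)) volume p q := fun p q => by
    have := (hF.intervalIntegrable₀ Real.pi_ne_zero hi (Real.pi / N * p)
      (Real.pi / N * q)).comp_mul_left (c := Real.pi / N)
    simpa [mul_div_cancel_left₀ _ hc] using this
  have h2 := (h1 (0 - y) (N - y)).comp_sub_right y
  simp only [sub_add_cancel] at h2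
  rw [intervalIntegrable_iff_integrableOn_Icc_of_le hN0.le] at h2
  unfold unif
  refine Integrable.smul_measure ?_ (by simpa using hN0)
  refine Integrable.congr h2 (ae_of_all _ fun x => ?_)
  simp only
  congr 1
  ring

lemma integrable_unifPi_periodic (hF : Function.Periodic F Real.pi) (hFm : Measurable F)
    (hi : IntervalIntegrable F volume 0 Real.pi) :
    Integrable (fun x : Fin 2 → ℝ => F (Real.pi * (x 0 - x 1) / N)) (unifPi 2 N) := by
  have hm : Measurable fun x : Fin 2 → ℝ => F (Real.pi * (x 0 - x 1) / N) :=
    hFm.comp (by fun_prop)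
  have hmp := measurePreserving_update (N := N) (0 : Fin 2)
  rw [← hmp.integrable_comp hm.aestronglyMeasurable, integrable_prod_iff
    (hm.comp hmp.measurable).aestronglyMeasurable]
  simp only [Function.comp, Function.update_self,
    Function.update_of_ne (show (1 : Fin 2) ≠ 0 by decide)]
  refine ⟨ae_of_all _ fun x => integrable_unif_periodic hF hi _, ?_⟩
  have hn : Function.Periodic (fun t => ‖F t‖) Real.pi := fun t => by simp only [hF t]
  simp only [fun x : Fin 2 → ℝ => integral_unif_periodic (N := N) hn (x 1)]
  exact integrable_const _

end periodic

/-- The regularized logarithmic interaction at scale `N`, centred. -/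
noncomputable def smoothPart (N δ u : ℝ) : ℝ := regLog δ (Real.pi * u / N) - regMean δ

/-- What the regularization leaves out. -/
noncomputable def singularPart (N δ u : ℝ) : ℝ := regMean δ - regGap δ (Real.pi * u / N)

lemma smoothPart_add_singularPart (N δ u : ℝ) :
    smoothPart N δ u + singularPart N δ u = Real.log |2 * Real.sin (Real.pi * u / N)| := by
  rw [smoothPart, singularPart, regGap]
  ring

lemma regLog_neg (δ t : ℝ) : regLog δ (-t) = regLog δ t := by simp [regLog]

lemma regGap_neg (δ t : ℝ) : regGap δ (-t) = regGap δ t := by simp [regGap, regLog]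

lemma periodic_regLog (δ : ℝ) : Function.Periodic (regLog δ) Real.pi := fun t => by simp [regLog]

lemma periodic_regGap (δ : ℝ) : Function.Periodic (regGap δ) Real.pi := fun t => by
  simp [regGap, regLog]

lemma measurable_singularPart (N δ : ℝ) : Measurable (singularPart N δ) := by
  unfold singularPart
  exact measurable_const.sub ((measurable_regGap δ).comp (by fun_prop))

lemma singularPart_neg (N δ u : ℝ) : singularPart N δ (-u) = singularPart N δ u := by
  rw [singularPart, singularPart, mul_neg, neg_div, regGap_neg]

section parts

variable {N δ : ℝ} [hN : Fact (0 < N)]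

lemma isSmoothTest_smoothPart (hδ : 0 < δ) (hδ1 : δ ≤ 1) :
    IsSmoothTest N (2 * (2 - Real.log δ)) (Real.pi / (N * δ)) (smoothPart N δ) fun u =>
      4 * Real.sin (Real.pi / N * u) * Real.cos (Real.pi / N * u) /
        (4 * Real.sin (Real.pi / N * u) ^ 2 + δ ^ 2) * (Real.pi / N) where
  even u := by
    rw [smoothPart, smoothPart, mul_neg, neg_div, regLog_neg]
  deriv u := by
    have h1 : HasDerivAt (fun u : ℝ => Real.pi / N * u) (Real.pi / N * 1) u :=
      (hasDerivAt_id u).const_mul _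
    have h2 := ((hasDerivAt_regLog hδ (Real.pi / N * u)).comp u h1).sub_const (regMean δ)
    rw [mul_one] at h2
    refine h2.congr_of_eventuallyEq (Eventually.of_forall fun v => ?_)
    simp only [smoothPart, Function.comp]
    congr 2
    ring
  cont := by
    refine Continuous.mul (Continuous.div (by fun_prop) (by fun_prop) fun u => ?_) continuous_const
    positivity
  le u := by
    refine (abs_sub _ _).trans ?_
    linarith [abs_regLog_le hδ hδ1 (Real.pi * u / N), abs_regMean_le hδ hδ1]
  deriv_le u := by
    have hN0 := hN.out
    have hp : 0 < Real.pi / N := by positivity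
    rw [abs_mul, abs_of_pos hp]
    refine (mul_le_mul_of_nonneg_right (abs_deriv_regLog_le hδ _) hp.le).trans (le_of_eq ?_)
    field_simp
  mean y := by
    have hN0 := hN.out
    have hper : Function.Periodic (fun t => regLog δ t - regMean δ) Real.pi := fun t => by
      simp only [periodic_regLog δ t]
    have h := integral_unif_periodic (N := N) hper y
    rw [integral_unif, intervalIntegral.integral_sub ((continuous_regLog hδ).intervalIntegrable _ _)
      (by simp), mul_sub (1 / Real.pi), ← regMean, intervalIntegral.integral_const] at h
    have h0 : regMean δ - 1 / Real.pi * ((Real.pi - 0) • regMean δ) = 0 := by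
      rw [smul_eq_mul]; field_simp; ring
    rw [h0, mul_eq_zero] at h
    exact h.resolve_left (by positivity)

lemma intervalIntegrable_regMean_sub_sq (hδ : 0 < δ) :
    IntervalIntegrable (fun t => (regMean δ - regGap δ t) ^ 2) volume 0 Real.pi := by
  have hc : ∀ c : ℝ, IntervalIntegrable (fun _ => c) volume 0 Real.pi := fun c => by simp
  refine (((hc (regMean δ ^ 2)).sub ((intervalIntegrable_regGap hδ).const_mul (2 * regMean δ))).add
    (intervalIntegrable_regGap_sq hδ)).congr_ae (ae_of_all _ fun t => ?_)
  ring

lemma squareIntegrableOn_singularPart (hδ : 0 < δ) :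
    SquareIntegrableOn N (singularPart N δ) := by
  refine ⟨measurable_singularPart N δ, ?_⟩
  have hper : Function.Periodic (fun t => (regMean δ - regGap δ t) ^ 2) Real.pi := fun t => by
    simp only [periodic_regGap δ t]
  exact integrable_unifPi_periodic hper ((measurable_const.sub (measurable_regGap δ)).pow_const 2)
    (intervalIntegrable_regMean_sub_sq hδ)

lemma integral_abs_singularPart (y : ℝ) : ∫ x, |singularPart N δ (x - y)| ∂unif N =
    1 / Real.pi * ∫ t in (0 : ℝ)..Real.pi, |regMean δ - regGap δ t| := by
  have hper : Function.Periodic (fun t => |regMean δ - regGap δ t|) Real.pi := fun t => by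
    simp only [periodic_regGap δ t]
  exact integral_unif_periodic hper y

lemma integral_singularPart_sq (hδ : 0 < δ) :
    ∫ x, singularPart N δ (x 0 - x 1) * singularPart N δ (x 0 - x 1) ∂unifPi 4 N =
      1 / Real.pi * ∫ t in (0 : ℝ)..Real.pi, (regMean δ - regGap δ t) ^ 2 := by
  have hper : Function.Periodic (fun t => (regMean δ - regGap δ t) ^ 2) Real.pi := fun t => by
    simp only [periodic_regGap δ t]
  have h := (squareIntegrableOn_singularPart (N := N) hδ).memLp (i := 0) (j := (1 : Fin 4))
    (by decide)
  have hi : Integrable (fun x : Fin 4 → ℝ => singularPart N δ (x 0 - x 1) *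
    singularPart N δ (x 0 - x 1)) (unifPi 4 N) := h.integrable_mul h
  rw [integral_update 0 hi]
  have e : ∀ x : Fin 4 → ℝ, ∫ y, singularPart N δ (y - x 1) * singularPart N δ (y - x 1) ∂unif N =
      1 / Real.pi * ∫ t in (0 : ℝ)..Real.pi, (regMean δ - regGap δ t) ^ 2 := fun x => by
    rw [← integral_unif_periodic (N := N) hper (x 1)]
    simp only [singularPart, sq]
  simp only [Function.update_self, Function.update_of_ne (show (1 : Fin 4) ≠ 0 by decide), e]
  simp

end parts

end SineBeta

namespace SineBeta

section energy

variable {Ω : Type*} [MeasurableSpace Ω] {P : Measure Ω} [IsProbabilityMeasure P] {X : Ω → Set ℝ}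

lemma pairSum_add (N : ℝ) (f g : ℝ → ℝ) (A : Set ℝ) :
    pairSum N (fun u => f u + g u) A = pairSum N f A + pairSum N g A := by
  rw [pairSum, pairSum, pairSum, tupleSum, tupleSum, tupleSum, ← Finset.sum_add_distrib]
  refine Finset.sum_congr rfl fun x _ => ?_
  split_ifs <;> simp

lemma renormalizedEnergy_eq (hX : IsSimplePointProcess X) (N : ℝ) (ω : Ω) :
    renormalizedEnergy N (X ω) = -(1 / N) *
      pairSum N (fun u => Real.log |2 * Real.sin (Real.pi * u / N)|) (X ω) + Real.log N := by
  classical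
  have h : ∀ S : Finset ℝ, S.offDiag = (S ×ˢ S).filter fun p => p.1 ≠ p.2 := fun S => by
    ext p
    simp [Finset.mem_offDiag, and_assoc]
  rw [renormalizedEnergy, ← coe_windowPoints hX, ← Finset.coe_offDiag, finsum_mem_coe_finset,
    pairSum, tupleSum, sum_piFinset_two, h, Finset.sum_filter, Finset.sum_product]
  simp only [injective_two, Matrix.cons_val_zero, Matrix.cons_val_one]

lemma variance_add_le {Y Z : Ω → ℝ} (hY : MemLp Y 2 P) (hZ : MemLp Z 2 P) :
    variance (fun ω => Y ω + Z ω) P ≤ 2 * variance Y P + 2 * variance Z P := by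
  have h1 := variance_fun_add hY hZ
  have h2 := variance_fun_sub hY hZ
  have h3 := variance_nonneg (fun ω => Y ω - Z ω) P
  linarith

/-- The variance of the energy, with the interaction regularized at scale `δ N`. -/
lemma exists_variance_renormalizedEnergy_le {K : PairKernel} (hK : K.IsAdmissible)
    {ρ : (k : ℕ) → (Fin k → ℝ) → ℝ} (hX : IsSimplePointProcess X)
    (hρ : HasCorrelationFunctions P X ρ) (h2 : ∀ x, ρ 2 x = K.r2 (x 0) (x 1))
    (h3 : ∀ x, ρ 3 x = K.r3 (x 0) (x 1) (x 2)) (h4 : ∀ x, ρ 4 x = K.r4 (x 0) (x 1) (x 2) (x 3)) :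
    ∃ C, 0 ≤ C ∧ ∀ N δ : ℝ, 0 < N → 0 < δ → δ ≤ 1 →
      MemLp (fun ω => renormalizedEnergy N (X ω)) 2 P ∧
      variance (fun ω => renormalizedEnergy N (X ω)) P ≤ C / N ^ 2 *
        (logBound N ^ 3 * ((1 + N) * (2 * (2 - Real.log δ)) ^ 2 + N ^ 2 * (Real.pi / (N * δ)) ^ 2
          + N ^ 2 * (2 * (2 - Real.log δ) * (Real.pi / (N * δ))))
        + (N ^ 3 * logBound N * (δ ^ (3 / 4 : ℝ)) ^ 2 + N ^ 2 * δ ^ (3 / 4 : ℝ))) := by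
  obtain ⟨C₁, hC₁, hsmooth⟩ := hK.exists_smooth_bound
  obtain ⟨C₂, hC₂, hsmall⟩ := hK.exists_small_bound
  obtain ⟨c, hc, hgap⟩ := exists_integral_regGap_le
  refine ⟨2 * C₁ + 2 * (C₂ * (c ^ 2 + c)), by positivity, fun N δ hN hδ hδ1 => ?_⟩
  have hNf : Fact (0 < N) := ⟨hN⟩
  have ht := isSmoothTest_smoothPart (N := N) hδ hδ1
  have hs := squareIntegrableOn_singularPart (N := N) hδ
  obtain ⟨m1, v1⟩ := variance_pairSum hX hρ hK h2 h3 h4 ht.squareIntegrableOn ht.even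
  obtain ⟨m2, v2⟩ := variance_pairSum hX hρ hK h2 h3 h4 hs (singularPart_neg N δ)
  rw [← pairVariance] at v1 v2
  have b1 := (le_abs_self _).trans (hsmooth hN ht)
  have b2 := (le_abs_self _).trans (hsmall hs (singularPart_neg N δ)
    (fun y => (integral_abs_singularPart y).trans_le (hgap δ hδ hδ1).1)
    ((integral_singularPart_sq hδ).trans_le (hgap δ hδ hδ1).2))
  rw [← v1] at b1
  rw [← v2] at b2
  have e : ∀ ω, renormalizedEnergy N (X ω) = -(1 / N) * (pairSum N (smoothPart N δ) (X ω) +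
      pairSum N (singularPart N δ) (X ω)) + Real.log N := fun ω => by
    rw [renormalizedEnergy_eq hX, ← pairSum_add]
    simp only [smoothPart_add_singularPart]
  simp only [e]
  have m : MemLp (fun ω => -(1 / N) * (pairSum N (smoothPart N δ) (X ω) +
      pairSum N (singularPart N δ) (X ω))) 2 P := (m1.add m2).const_mul _
  refine ⟨m.add (memLp_const _), ?_⟩
  rw [variance_add_const m.aestronglyMeasurable, variance_const_mul]
  have hv := variance_add_le m1 m2
  have hL := one_le_logBound hN.le
  set a := δ ^ (3 / 4 : ℝ)
  have ha : 0 ≤ a := Real.rpow_nonneg hδ.le _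
  set R₁ := logBound N ^ 3 * ((1 + N) * (2 * (2 - Real.log δ)) ^ 2 + N ^ 2 * (Real.pi / (N * δ)) ^ 2
          + N ^ 2 * (2 * (2 - Real.log δ) * (Real.pi / (N * δ)))) with hR₁
  have hR₁0 : 0 ≤ R₁ := by
    have h5 := Real.log_nonpos hδ.le hδ1
    have h6 : 0 ≤ 2 - Real.log δ := by linarith
    have h7 : 0 < logBound N := by linarith
    have := Real.pi_pos
    positivity
  have hb2 : N ^ 3 * logBound N * (c * a) ^ 2 + N ^ 2 * (c * a) ≤
      (c ^ 2 + c) * (N ^ 3 * logBound N * a ^ 2 + N ^ 2 * a) := by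
    have p1 : 0 ≤ N ^ 3 * logBound N * a ^ 2 := by positivity
    have p2 : 0 ≤ N ^ 2 * a := by positivity
    have := mul_nonneg hc p1
    have := mul_nonneg (sq_nonneg c) p2
    linarith
  have hb3 := mul_le_mul_of_nonneg_left hb2 hC₂
  set R₂ := N ^ 3 * logBound N * a ^ 2 + N ^ 2 * a with hR₂
  have hR₂0 : 0 ≤ R₂ := by
    have h7 : 0 < logBound N := by linarith
    positivity
  have hmain : 2 * variance (fun ω => pairSum N (smoothPart N δ) (X ω)) P +
      2 * variance (fun ω => pairSum N (singularPart N δ) (X ω)) P ≤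
      (2 * C₁ + 2 * (C₂ * (c ^ 2 + c))) * (R₁ + R₂) := by
    have := mul_nonneg hC₁ hR₂0
    have : 0 ≤ C₂ * (c ^ 2 + c) * R₁ := by positivity
    linarith
  calc _ ≤ (-(1 / N)) ^ 2 * ((2 * C₁ + 2 * (C₂ * (c ^ 2 + c))) * (R₁ + R₂)) :=
        mul_le_mul_of_nonneg_left (hv.trans hmain) (sq_nonneg _)
    _ = _ := by ring

end energy

lemma tendsto_logBound_pow_mul_rpow (j : ℕ) {s : ℝ} (hs : 0 < s) :
    Tendsto (fun N => logBound N ^ j * N ^ (-s)) atTop (𝓝 0) := by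
  have h1 : Tendsto (fun N : ℝ => 6 ^ j * (Real.log N ^ (j : ℝ) / N ^ s)) atTop (𝓝 (6 ^ j * 0)) :=
    (isLittleO_log_rpow_rpow_atTop (j : ℝ) hs).tendsto_div_nhds_zero.const_mul _
  rw [mul_zero] at h1
  refine squeeze_zero' ?_ ?_ h1
  · filter_upwards [eventually_ge_atTop 0] with N hN
    have := one_le_logBound hN
    exact mul_nonneg (pow_nonneg (by linarith) _) (Real.rpow_nonneg hN _)
  · filter_upwards [eventually_ge_atTop 2] with N hN
    have hL := one_le_logBound (by linarith : 0 ≤ N)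
    have h2 : Real.log 2 ≤ Real.log N := Real.log_le_log (by norm_num) hN
    have h3 : Real.log (1 + N) ≤ Real.log N + Real.log N := by
      rw [← Real.log_mul (by positivity) (by positivity)]
      exact Real.log_le_log (by positivity) (by nlinarith)
    have h4 : logBound N ≤ 6 * Real.log N := by
      have := Real.log_two_gt_d9
      rw [logBound]
      linarith
    rw [Real.rpow_neg (by linarith), Real.rpow_natCast, ← mul_div_assoc, ← mul_pow, div_eq_mul_inv]
    exact mul_le_mul_of_nonneg_right (pow_le_pow_left₀ (by linarith) h4 j)
      (inv_nonneg.2 (Real.rpow_nonneg (by linarith) _))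

/-- The error terms at scale `N ^ (-3/4)`. -/
lemma error_le {N : ℝ} (hN : 1 ≤ N) {δ : ℝ} (hδ : δ = N ^ (-(3 / 4) : ℝ)) :
    (logBound N ^ 3 * ((1 + N) * (2 * (2 - Real.log δ)) ^ 2 + N ^ 2 * (Real.pi / (N * δ)) ^ 2
          + N ^ 2 * (2 * (2 - Real.log δ) * (Real.pi / (N * δ))))
        + (N ^ 3 * logBound N * (δ ^ (3 / 4 : ℝ)) ^ 2 + N ^ 2 * δ ^ (3 / 4 : ℝ))) / N ^ 2 ≤
      32 * (logBound N ^ 5 * N ^ (-1 : ℝ)) + Real.pi ^ 2 * (logBound N ^ 3 * N ^ (-(1 / 2) : ℝ))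
        + 4 * Real.pi * (logBound N ^ 4 * N ^ (-(1 / 4) : ℝ)) + logBound N ^ 1 * N ^ (-(1 / 8) : ℝ)
        + logBound N ^ 0 * N ^ (-(9 / 16) : ℝ) := by
  have hN0 : 0 < N := by linarith
  have hL := one_le_logBound hN0.le
  have hpi := Real.pi_pos
  have hlog : Real.log δ = -(3 / 4) * Real.log N := by rw [hδ, Real.log_rpow hN0]
  have hlN : Real.log N ≤ Real.log (1 + N) := Real.log_le_log hN0 (by linarith)
  have hlN0 := Real.log_nonneg hN
  have hA : 2 * (2 - Real.log δ) ≤ 4 * logBound N := by rw [hlog, logBound]; linarith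
  have hA0 : 0 ≤ 2 * (2 - Real.log δ) := by rw [hlog]; linarith
  have hD : Real.pi / (N * δ) = Real.pi * N ^ (-(1 / 4) : ℝ) := by
    have : N * δ = N ^ (1 / 4 : ℝ) := by
      rw [hδ]
      nth_rewrite 1 [← Real.rpow_one N]
      rw [← Real.rpow_add hN0]
      norm_num
    rw [this, Real.rpow_neg hN0.le, div_eq_mul_inv]
  have hδ' : δ ^ (3 / 4 : ℝ) = N ^ (-(9 / 16) : ℝ) := by
    rw [hδ, ← Real.rpow_mul hN0.le]; norm_num
  have hD2 : (N ^ (-(1 / 4) : ℝ)) ^ 2 = N ^ (-(1 / 2) : ℝ) := by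
    rw [← Real.rpow_natCast, ← Real.rpow_mul hN0.le]; norm_num
  have ha2 : N * (N ^ (-(9 / 16) : ℝ)) ^ 2 = N ^ (-(1 / 8) : ℝ) := by
    rw [← Real.rpow_natCast, ← Real.rpow_mul hN0.le]
    nth_rewrite 1 [← Real.rpow_one N]
    rw [← Real.rpow_add hN0]
    norm_num
  rw [hD, hδ']
  set A := 2 * (2 - Real.log δ)
  set L := logBound N
  set p := N ^ (-(1 / 4) : ℝ)
  have hp : 0 ≤ p := Real.rpow_nonneg hN0.le _
  have e1 : (L ^ 3 * ((1 + N) * A ^ 2 + N ^ 2 * (Real.pi * p) ^ 2 + N ^ 2 * (A * (Real.pi * p)))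
      + (N ^ 3 * L * (N ^ (-(9 / 16) : ℝ)) ^ 2 + N ^ 2 * N ^ (-(9 / 16) : ℝ))) / N ^ 2 =
      L ^ 3 * ((1 + N) / N ^ 2 * A ^ 2) + Real.pi ^ 2 * (L ^ 3 * p ^ 2)
        + Real.pi * (L ^ 3 * A * p) + L * (N * (N ^ (-(9 / 16) : ℝ)) ^ 2)
        + N ^ (-(9 / 16) : ℝ) := by
    field_simp
    ring
  rw [e1, hD2, ha2, pow_one, pow_zero, one_mul, Real.rpow_neg_one]
  have t1 : L ^ 3 * ((1 + N) / N ^ 2 * A ^ 2) ≤ L ^ 3 * (2 * N⁻¹ * (4 * L) ^ 2) := by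
    have : (1 + N) / N ^ 2 ≤ 2 * N⁻¹ := by
      rw [← div_eq_mul_inv, div_le_div_iff₀ (by positivity) hN0]
      nlinarith
    gcongr
  have t2 : Real.pi * (L ^ 3 * A * p) ≤ Real.pi * (L ^ 3 * (4 * L) * p) := by gcongr
  linarith

end SineBeta

theorem theorem4 {Ω : Type*} [MeasurableSpace Ω] (P : Measure Ω) [IsProbabilityMeasure P]
    (β : ℕ) (hβ : β = 1 ∨ β = 2 ∨ β = 4) (X : Ω → Set ℝ) (hX : SineBeta.IsSineProcess P β X) :
    (∀ N : ℝ, 0 < N → MemLp (fun ω => SineBeta.renormalizedEnergy N (X ω)) 2 P) ∧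
      Tendsto (fun N : ℝ => variance (fun ω => SineBeta.renormalizedEnergy N (X ω)) P)
        atTop (𝓝 0) := by
  obtain ⟨K, hK, h2, h3, h4⟩ := SineBeta.exists_admissible_kernel hβ
  obtain ⟨C, hC, h⟩ := SineBeta.exists_variance_renormalizedEnergy_le hK hX.simple hX.correlation
    h2 h3 h4
  refine ⟨fun N hN => (h N 1 hN one_pos le_rfl).1, ?_⟩
  have hlim := (((((SineBeta.tendsto_logBound_pow_mul_rpow 5 one_pos).const_mul 32).add
    ((SineBeta.tendsto_logBound_pow_mul_rpow 3 (s := 1 / 2) (by norm_num)).const_mul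
      (Real.pi ^ 2))).add
    ((SineBeta.tendsto_logBound_pow_mul_rpow 4 (s := 1 / 4) (by norm_num)).const_mul
      (4 * Real.pi))).add
    (SineBeta.tendsto_logBound_pow_mul_rpow 1 (s := 1 / 8) (by norm_num))).add
    (SineBeta.tendsto_logBound_pow_mul_rpow 0 (s := 9 / 16) (by norm_num))
  have hlim' := hlim.const_mul C
  simp only [mul_zero, add_zero] at hlim'
  refine squeeze_zero' (Eventually.of_forall fun N => variance_nonneg _ _) ?_ hlim'
  filter_upwards [eventually_ge_atTop 1] with N hN
  have hN0 : 0 < N := by linarith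
  refine (h N (N ^ (-(3 / 4) : ℝ)) hN0 (Real.rpow_pos_of_pos hN0 _)
    (Real.rpow_le_one_of_one_le_of_nonpos hN (by norm_num))).2.trans ?_
  rw [div_mul_eq_mul_div, mul_div_assoc]
  exact mul_le_mul_of_nonneg_left (SineBeta.error_le hN rfl) hC
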